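/- Let $N\ge 2$ and let $v:[0,\infty)\to[0,\infty]$ be measurable and of compact support (the value $+\infty$ is allowed on a set of positive measure), such that $x\mapsto v(|x|)$ is not almost everywhere zero on $\mathbb{R}^2$. On $L^2(\mathbb{R}^2)$ let $h=(-\mathrm i\nabla-x^\perp)^2-2$ with $x^\perp=(-x^{(2)},x^{(1)})$. For $a>0$ and $\kappa>0$ consider on $L^2(\mathbb{R}^{2N})$ the operator $$H_a+\kappa\sum_{i=1}^N|x_i|^2,\qquad H_a=\sum_{i=1}^N h_i+\sum_{1\le i<j\le N}v_a(|x_i-x_j|),\qquad v_a(r)=a^{-2}v(r/a),$$ defined as the self-adjoint operator associated with the sum of the quadratic forms, whose form domain consists of all $\Psi\in L^2(\mathbb{R}^{2N})$ with $(-\mathrm i\nabla_i-x_i^\perp)\Psi\in L^2$ (weakly) for all $i$ and $\int\big(\sum_{i<j}v_a(|x_i-x_j|)+\kappa\sum_i|x_i|^2\big)|\Psi|^2<\infty$; the operator acts on the closure of this form domain in $L^2(\mathbb{R}^{2N})$. A ground state is a normalized eigenvector whose eigenvalue is the bottom of the spectrum. For a positive integer $m$ let $$\Psi^{\rm L}_m(x_1,\dots,x_N)=C_{N,m}\prod_{i<j}(z_i-z_j)^m\prod_{i}\mathrm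 e^{-|x_i|^2/2},\qquad z_j=x_j^{(1)}+\mathrm i x_j^{(2)},$$ where $C_{N,m}>0$ is such that $\|\Psi^{\rm L}_m\|_{L^2(\mathbb{R}^{2N})}=1$. 1. For every integer $\ell\ge 1$ there is $\lambda_0>0$ (depending on $N$, $v$ and $\ell$) such that for all $\lambda\in(0,\lambda_0)$ the following holds: for all sufficiently small $a>0$ the operator $H_a+a^{2\ell}\lambda\sum_{i=1}^N|x_i|^2$ has a ground state, which is unique up to a constant phase, and, with a suitable choice of the phase, it converges to $\Psi^{\rm L}_{\ell+1}$ in $L^2(\mathbb{R}^{2N})$ as $a\to 0$. 2. For $\ell=0$ the same holds with $a^{2\ell}$ replaced by $(\ln(1/a^2))^{-1}$: there is $\lambda_0>0$ such that for all $\lambda\in(0,\lambda_0)$ and all sufficiently small $a>0$ the operator $H_a+(\ln(1/a^2))^{-1}\lambda\sum_{i=1}^N|x_i|^2$ has a ground state, which is unique up to a constant phase, and, with a suitable choice of the phase, it converges to $\Psi^{\rm L}_{1}$ in $L^2(\mathbb{R}^{2N})$ as $a\to 0$. -/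

import Mathlib

open MeasureTheory Filter Topology
open scoped ENNReal ContDiff

noncomputable section

namespace Haldane

/-- Configurations of `N` particles in the plane; a point `(x⁽¹⁾, x⁽²⁾)` of `ℝ²` is identified
with `x⁽¹⁾ + i x⁽²⁾`. The volume is Lebesgue measure on `ℝ^{2N}`. -/
abbrev Conf (N : ℕ) : Type := Fin N → ℂ

/-- The Hilbert space `L²(ℝ^{2N})`. -/
abbrev L2 (N : ℕ) : Type := Lp ℂ 2 (volume : Measure (Conf N))

/-- The real coordinate directions of the plane: `1` and `i`. -/
def dir (k : Fin 2) : ℂ := ![1, Complex.I] k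

/-- The components of the vector potential `x^⊥ = (-x⁽²⁾, x⁽¹⁾)`. -/
def vecPot (k : Fin 2) (z : ℂ) : ℝ := ![-z.im, z.re] k

/-- The `k`-th component of the magnetic momentum `-i∇ - x^⊥` of particle `i`, on differentiable
functions. -/
def magMomentum {N : ℕ} (i : Fin N) (k : Fin 2) (φ : Conf N → ℂ) (x : Conf N) : ℂ :=
  -Complex.I * fderiv ℝ φ x (Pi.single i (dir k)) - (vecPot k (x i) : ℂ) * φ x

/-- `G` is the weak (distributional) magnetic derivative `(-i∇_i - x_i^⊥)_k Ψ`. -/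
def IsWeakMagMomentum {N : ℕ} (i : Fin N) (k : Fin 2) (Ψ G : L2 N) : Prop :=
  ∀ φ : Conf N → ℂ, ContDiff ℝ ∞ φ → HasCompactSupport φ →
    ∫ x, star (magMomentum i k φ x) * Ψ x = ∫ x, star (φ x) * G x

open Classical in
/-- The weak magnetic derivative in `L²`, set to `0` if there is none. -/
def weakMagMomentum {N : ℕ} (i : Fin N) (k : Fin 2) (Ψ : L2 N) : L2 N :=
  if h : ∃ G, IsWeakMagMomentum i k Ψ G then h.choose else 0

/-- Membership in the form domain of `∑ᵢ hᵢ + W`, where `h = (-i∇ - x^⊥)² - 2` and `W` is a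
potential with values in `[0, ∞]`. Elements vanish a.e. where `W = ∞`. -/
def InFormDomain {N : ℕ} (W : Conf N → ℝ≥0∞) (Ψ : L2 N) : Prop :=
  (∀ i k, ∃ G, IsWeakMagMomentum i k Ψ G) ∧ ∫⁻ x, W x * ‖Ψ x‖ₑ ^ 2 < ⊤

/-- The sesquilinear form of `∑ᵢ hᵢ + W` on its form domain. The points where `W = ∞` do not
contribute, because elements of the form domain vanish there. -/
def form {N : ℕ} (W : Conf N → ℝ≥0∞) (Φ Ψ : L2 N) : ℂ :=
  (∑ i, ((∑ k, inner ℂ (weakMagMomentum i k Φ) (weakMagMomentum i k Ψ)) - 2 * inner ℂ Φ Ψ))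
    + ∫ x, ((W x).toReal : ℂ) * (star (Φ x) * Ψ x)

/-- `Ψ` is in the domain of the self-adjoint operator `H = ∑ᵢ hᵢ + W` associated with the closed
form, and `H Ψ = η`. The operator acts on the closure of the form domain, which is a proper
subspace of `L²` if `W = ∞` on a set of positive measure. -/
def IsHamiltonianImage {N : ℕ} (W : Conf N → ℝ≥0∞) (Ψ η : L2 N) : Prop :=
  InFormDomain W Ψ ∧ η ∈ closure {Φ | InFormDomain W Φ} ∧
    ∀ Φ, InFormDomain W Φ → form W Φ Ψ = inner ℂ Φ η

/-- `Ψ` is a normalized ground state of `H = ∑ᵢ hᵢ + W`: an eigenvector whose eigenvalue is the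
bottom of the spectrum, that is, the largest lower bound of `H`. -/
def IsGroundState {N : ℕ} (W : Conf N → ℝ≥0∞) (Ψ : L2 N) : Prop :=
  ‖Ψ‖ = 1 ∧ ∃ E : ℝ, IsHamiltonianImage W Ψ ((E : ℂ) • Ψ) ∧
    ∀ Φ η, IsHamiltonianImage W Φ η → E * ‖Φ‖ ^ 2 ≤ (inner ℂ Φ η).re

/-- The scaled potential `v_a(r) = a⁻² v(r/a)`. -/
def scaled (v : ℝ → ℝ≥0∞) (a r : ℝ) : ℝ≥0∞ := ENNReal.ofReal (a ^ 2)⁻¹ * v (r / a)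

/-- The potential part `∑_{i<j} v_a(|x_i - x_j|) + κ ∑ᵢ |x_i|²` of `H_a + κ ∑ᵢ |x_i|²`. -/
def potential (N : ℕ) (v : ℝ → ℝ≥0∞) (a κ : ℝ) (x : Conf N) : ℝ≥0∞ :=
  (∑ i, ∑ j ∈ Finset.Ioi i, scaled v a ‖x i - x j‖) + ENNReal.ofReal (κ * ∑ i, ‖x i‖ ^ 2)

/-- The Laughlin function with exponent `m`, not yet normalized. -/
def laughlinFun (N m : ℕ) (x : Conf N) : ℂ :=
  (∏ i, ∏ j ∈ Finset.Ioi i, (x i - x j) ^ m) * ∏ i, (Real.exp (-‖x i‖ ^ 2 / 2) : ℂ)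

theorem continuous_laughlinFun (N m : ℕ) : Continuous (laughlinFun N m) := by
  unfold laughlinFun
  refine Continuous.mul ?_ ?_
  · refine continuous_finsetProd _ fun i _ => continuous_finsetProd _ fun j _ => ?_
    fun_prop
  · refine continuous_finsetProd _ fun i _ => ?_
    fun_prop

theorem exists_norm_laughlinFun_le (N m : ℕ) :
    ∃ C : ℝ, ∀ x, ‖laughlinFun N m x‖ ≤ ∏ i, (C * Real.exp (-‖x i‖ ^ 2 / 4)) := by
  set K : ℕ := ∑ i : Fin N, (Finset.Ioi i).card * m
  refine ⟨Real.exp ((2 * K) ^ 2), fun x => ?_⟩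
  set S : ℝ := ∑ i, ‖x i‖ with hS
  have h1 : ∀ i j, ‖x i - x j‖ ≤ Real.exp (2 * S) := fun i j => by
    have hi : ‖x i‖ ≤ S :=
      Finset.single_le_sum (f := fun i => ‖x i‖) (fun _ _ => norm_nonneg _) (Finset.mem_univ i)
    have hj : ‖x j‖ ≤ S :=
      Finset.single_le_sum (f := fun i => ‖x i‖) (fun _ _ => norm_nonneg _) (Finset.mem_univ j)
    have := norm_sub_le (x i) (x j)
    have := Real.add_one_le_exp (2 * S)
    linarith
  have h2 : ∏ i, ∏ j ∈ Finset.Ioi i, ‖x i - x j‖ ^ m ≤ Real.exp (2 * S) ^ K := by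
    rw [← Finset.prod_pow_eq_pow_sum]
    refine Finset.prod_le_prod (fun i _ => by positivity) fun i _ => ?_
    calc ∏ j ∈ Finset.Ioi i, ‖x i - x j‖ ^ m
        ≤ ∏ j ∈ Finset.Ioi i, Real.exp (2 * S) ^ m :=
          Finset.prod_le_prod (fun j _ => by positivity) fun j _ =>
            pow_le_pow_left₀ (norm_nonneg _) (h1 i j) m
      _ = Real.exp (2 * S) ^ ((Finset.Ioi i).card * m) := by
          rw [Finset.prod_const, ← pow_mul, mul_comm m]
  have h3 : Real.exp (2 * S) ^ K = ∏ i, Real.exp (2 * K * ‖x i‖) := by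
    rw [← Real.exp_nat_mul, ← Real.exp_sum, ← Finset.mul_sum]
    congr 1
    rw [hS]
    ring
  have h4 : ‖laughlinFun N m x‖
      = (∏ i, ∏ j ∈ Finset.Ioi i, ‖x i - x j‖ ^ m) * ∏ i, Real.exp (-‖x i‖ ^ 2 / 2) := by
    simp only [laughlinFun, norm_mul, norm_prod, norm_pow, Complex.norm_real, Real.norm_eq_abs,
      Real.abs_exp]
  rw [h4]
  refine (mul_le_mul_of_nonneg_right (h2.trans_eq h3) (by positivity)).trans ?_
  rw [← Finset.prod_mul_distrib]
  refine Finset.prod_le_prod (fun i _ => by positivity) fun i _ => ?_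
  rw [← Real.exp_add, ← Real.exp_add]
  apply Real.exp_le_exp.2
  nlinarith [sq_nonneg (2 * (K : ℝ) - ‖x i‖ / 2)]

theorem integrable_exp_neg_norm_sq : Integrable fun z : ℂ => Real.exp (-‖z‖ ^ 2 / 2) := by
  have h := GaussianFourier.integrable_cexp_neg_mul_sq_norm_add (V := ℂ) (b := 1 / 2)
    (by norm_num) 0 0
  refine h.norm.congr (ae_of_all _ fun z => ?_)
  simp only [inner_zero_left, Complex.ofReal_zero, mul_zero, add_zero, Complex.norm_exp]
  congr 1
  have : (-(1 / 2 : ℂ) * (‖z‖ : ℂ) ^ 2) = ((-(1 / 2) * ‖z‖ ^ 2 : ℝ) : ℂ) := by push_cast; ring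
  rw [this, Complex.ofReal_re]
  ring

theorem memLp_laughlinFun (N m : ℕ) : MemLp (laughlinFun N m) 2 volume := by
  obtain ⟨C, hC⟩ := exists_norm_laughlinFun_le N m
  have hm : AEStronglyMeasurable (laughlinFun N m) volume :=
    (continuous_laughlinFun N m).aestronglyMeasurable
  rw [memLp_two_iff_integrable_sq_norm hm]
  have hi : Integrable fun x : Conf N => ∏ i, C ^ 2 * Real.exp (-‖x i‖ ^ 2 / 2) :=
    Integrable.fintype_prod fun _ => integrable_exp_neg_norm_sq.const_mul (C ^ 2)
  refine hi.mono' (hm.norm.pow 2) (ae_of_all _ fun x => ?_)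
  rw [Real.norm_of_nonneg (by positivity)]
  refine (pow_le_pow_left₀ (norm_nonneg _) (hC x) 2).trans_eq ?_
  rw [← Finset.prod_pow]
  refine Finset.prod_congr rfl fun i _ => ?_
  rw [mul_pow, ← Real.exp_nat_mul]
  congr 2
  push_cast
  ring

/-- The normalized Laughlin function `Ψ^L_m` as an element of `L²(ℝ^{2N})`. -/
def laughlin (N m : ℕ) : L2 N :=
  (‖(memLp_laughlinFun N m).toLp‖⁻¹ : ℂ) • (memLp_laughlinFun N m).toLp

/-- As `a → 0⁺`, the normalized ground state of `H_a + κ(a) ∑ᵢ |x_i|²` (exists, is unique up to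
a phase, and), for a suitable choice of the phase, converges to `Ψlim` in `L²(ℝ^{2N})`. -/
def GroundStateTendsto {N : ℕ} (v : ℝ → ℝ≥0∞) (κ : ℝ → ℝ) (Ψlim : L2 N) : Prop :=
  ∃ Ψ : ℝ → L2 N,
    (∀ᶠ a in 𝓝[>] (0 : ℝ), IsGroundState (potential N v a (κ a)) (Ψ a) ∧
      ∀ Φ, IsGroundState (potential N v a (κ a)) Φ → ∃ c : ℂ, ‖c‖ = 1 ∧ Φ = c • Ψ a) ∧
    Tendsto Ψ (𝓝[>] (0 : ℝ)) (𝓝 Ψlim)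

end Haldane

end

open MeasureTheory Filter Topology
open scoped ENNReal ContDiff

noncomputable section

namespace Haldane

open ComplexConjugate

/-! Let `A_i = -2i∂_{z̄} - iz` be the lowering operator of particle `i`. The commutator of the
magnetic momenta gives `(-i∇ - x^⊥)² - 2 = A*A`, with eigenvalues `4n`. The energy is therefore a
sum of nonnegative terms `K + V + sλT`, with `K = ∑‖A_i Ψ‖²`, pair interaction `V`, trap `T = ∑‖x_i
Ψ‖²`, and `s = a^{2ℓ}` or `s = 1/ln(1/a²)`. Where `K` vanishes, `Ψ` is in the lowest Landau level: a
holomorphic function times the Gaussian. On a homogeneous polynomial of degree `d` the trap form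
equals `d + N`.

Lower bound. Up to a constant, the coefficient of `(z_i - z_j)^m` in a holomorphic function can be
read off by integrating against `b(|z|²)/z̄^m` in the relative variable, for any radial profile `b`
of mass one. Profiles at distance one and at distance `a` differ by `∂` of a function
`P(|z|²)/z̄^{m+1}`, so for a general state the two readings differ by at most the norm of that
function times `‖A_i Ψ‖`. The squared norm is of order `∫ t^{-m-1} dt` from `a²` to `1`, that is
`a^{-2m}`, or `ln(1/a²)` for `m = 0`. The reading at distance `a` is controlled by `V`, because `v`
is bounded below on a set of positive measure. Hence all coefficients with `m ≤ ℓ` have square at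
most `C s⁻¹ (K + V)` (`exists_norm_inner_detect_sq_le`).

A polynomial without these coefficients for any pair is divisible by `∏ (z_i - z_j)^{ℓ+1}`. In
degree at most `D = (ℓ+1)·N(N-1)/2` only multiples of this product remain
(`exists_eq_smul_jastrow_pow`). By finite dimensionality, the part of `Ψ` in the lowest Landau level
of degree at most `D` is a multiple of the Laughlin function `L` up to an error of squared norm `C
s⁻¹ (K + V)` (`exists_norm_lowPart_sub_le`). Everything of higher degree has trap energy at least `D
+ N + 1`. For small `λ` the errors, multiplied by `sλ`, are absorbed by `K + V`, and the energy is
at least `sλ((D + N + 1)(1 - δ)‖Ψ‖² - |⟨L, Ψ⟩|²)` (`exists_energy_lower_bound`).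

Upper bound. Cutting `L` off at distances of order `a` between particles removes the interaction and
costs kinetic energy of order `a^{2ℓ+2} = o(s)`, so the infimum is at most `sλ(D + N + ε)`
(`exists_trial`).

Conclusion. The form lies strictly above the trial energy on the orthogonal complement of the single
vector `L`. This gives a minimizer, unique up to phase, without any compactness
(`exists_minimizer_of_gap`). Comparing the two bounds at the minimizer forces `|⟨L, Ψ⟩|² → 1`. -/

/-! ### Complex Hermite functions of one particle -/

/-- The real-linear map `w ↦ A w + B w̄`; its coefficients are the Wirtinger derivatives. -/
def wirtinger (A B : ℂ) : ℂ →L[ℝ] ℂ :=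
  A • ContinuousLinearMap.id ℝ ℂ + B • (Complex.conjCLE : ℂ →L[ℝ] ℂ)

@[simp]
theorem wirtinger_apply (A B w : ℂ) : wirtinger A B w = A * w + B * conj w := by
  simp [wirtinger]

theorem hasFDerivAt_id_wirtinger (z : ℂ) : HasFDerivAt (fun z : ℂ => z) (wirtinger 1 0) z := by
  refine (hasFDerivAt_id (𝕜 := ℝ) z).congr_fderiv (ContinuousLinearMap.ext fun w => ?_)
  simp

theorem hasFDerivAt_conj_wirtinger (z : ℂ) :
    HasFDerivAt (fun z : ℂ => conj z) (wirtinger 0 1) z := by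
  refine (Complex.conjCLE : ℂ →L[ℝ] ℂ).hasFDerivAt.congr_fderiv
    (ContinuousLinearMap.ext fun w => ?_)
  simp

theorem HasFDerivAt.mul_wirtinger {f g : ℂ → ℂ} {A B A' B' z : ℂ}
    (hf : HasFDerivAt f (wirtinger A B) z) (hg : HasFDerivAt g (wirtinger A' B') z) :
    HasFDerivAt (fun z => f z * g z) (wirtinger (A * g z + f z * A') (B * g z + f z * B')) z := by
  refine (hf.mul hg).congr_fderiv (ContinuousLinearMap.ext fun w => ?_)
  simp
  ring

theorem HasFDerivAt.sub_wirtinger {f g : ℂ → ℂ} {A B A' B' z : ℂ}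
    (hf : HasFDerivAt f (wirtinger A B) z) (hg : HasFDerivAt g (wirtinger A' B') z) :
    HasFDerivAt (fun z => f z - g z) (wirtinger (A - A') (B - B')) z := by
  refine (hf.sub hg).congr_fderiv (ContinuousLinearMap.ext fun w => ?_)
  simp
  ring

theorem HasFDerivAt.const_mul_wirtinger {f : ℂ → ℂ} {A B z : ℂ} (c : ℂ)
    (hf : HasFDerivAt f (wirtinger A B) z) :
    HasFDerivAt (fun z => c * f z) (wirtinger (c * A) (c * B)) z := by
  refine (hf.const_mul c).congr_fderiv (ContinuousLinearMap.ext fun w => ?_)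
  simp
  ring

theorem HasFDerivAt.star_wirtinger {f : ℂ → ℂ} {A B z : ℂ}
    (hf : HasFDerivAt f (wirtinger A B) z) :
    HasFDerivAt (fun z => conj (f z)) (wirtinger (conj B) (conj A)) z := by
  refine ((Complex.conjCLE : ℂ →L[ℝ] ℂ).hasFDerivAt.comp z hf).congr_fderiv (ContinuousLinearMap.ext fun w => ?_)
  simp
  ring

/-- The Gaussian `e^{-|z|²/2}`. -/
def gauss (z : ℂ) : ℂ := (Real.exp (-‖z‖ ^ 2 / 2) : ℂ)

theorem gauss_eq (z : ℂ) : gauss z = Complex.exp (-(1 / 2) * (z * conj z)) := by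
  rw [gauss, Complex.mul_conj, Complex.ofReal_exp]
  congr 1
  rw [Complex.normSq_eq_norm_sq]
  push_cast
  ring

theorem hasFDerivAt_gauss (z : ℂ) :
    HasFDerivAt gauss (wirtinger (-(1 / 2) * conj z * gauss z) (-(1 / 2) * z * gauss z)) z := by
  have h := ((HasFDerivAt.const_mul_wirtinger (-(1 / 2))
    (HasFDerivAt.mul_wirtinger (hasFDerivAt_id_wirtinger z) (hasFDerivAt_conj_wirtinger z))).cexp)
  rw [funext gauss_eq]
  refine h.congr_fderiv (ContinuousLinearMap.ext fun w => ?_)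
  simp
  ring

theorem gauss_ne_zero (z : ℂ) : gauss z ≠ 0 := by
  rw [gauss_eq]; exact Complex.exp_ne_zero _

@[simp]
theorem conj_gauss (z : ℂ) : conj (gauss z) = gauss z := Complex.conj_ofReal _

theorem norm_gauss (z : ℂ) : ‖gauss z‖ = Real.exp (-‖z‖ ^ 2 / 2) := by
  rw [gauss, Complex.norm_real, Real.norm_of_nonneg (Real.exp_pos _).le]

theorem contDiff_gauss : ContDiff ℝ ∞ gauss := by
  rw [funext gauss_eq]
  have : ContDiff ℝ ∞ fun z : ℂ => conj z := Complex.conjCLE.contDiff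
  fun_prop

/-- The complex Hermite polynomials: `(z̄ - ∂)ⁿ zᵐ`. -/
def hermiteC : ℕ → ℕ → ℂ → ℂ
  | m, 0, z => z ^ m
  | m, n + 1, z => conj z * hermiteC m n z - m * hermiteC (m - 1) n z

theorem hermiteC_zero (m : ℕ) (z : ℂ) : hermiteC m 0 z = z ^ m := by simp [hermiteC]

theorem hermiteC_succ (m n : ℕ) (z : ℂ) :
    hermiteC m (n + 1) z = conj z * hermiteC m n z - m * hermiteC (m - 1) n z := by
  simp [hermiteC]

/-- Each commutation of `z` past `z̄ - ∂` produces one extra term, since `z (z̄ - ∂) = (z̄ - ∂) z +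
1`. Together with the recursion this makes the span of these polynomials stable under multiplication
by `z` and `z̄`. -/
theorem mul_hermiteC (m n : ℕ) (z : ℂ) :
    z * hermiteC m n z = hermiteC (m + 1) n z + n * hermiteC m (n - 1) z := by
  induction n generalizing m with
  | zero => simp [hermiteC_zero, pow_succ']
  | succ n ih =>
    rw [hermiteC_succ, mul_sub, mul_left_comm, ih, mul_left_comm, hermiteC_succ]
    rcases m with _ | m
    · rcases n with _ | n
      · simp
      · simp [hermiteC_succ]; ring
    · rw [Nat.add_sub_cancel, ih m]
      rcases n with _ | n
      · simp; ring
      · simp [hermiteC_succ]; ring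

/-- `∂` commutes with `z̄ - ∂` and `∂_{z̄}` does so up to `1`, so the two Wirtinger derivatives
lower `m` and `n` respectively. The truncated subtractions at zero are harmless because their
coefficient is zero. -/
theorem hasFDerivAt_hermiteC (m n : ℕ) (z : ℂ) :
    HasFDerivAt (hermiteC m n)
      (wirtinger (m * hermiteC (m - 1) n z) (n * hermiteC m (n - 1) z)) z := by
  induction n generalizing m with
  | zero =>
    have h := ((hasDerivAt_pow m z).hasFDerivAt.restrictScalars ℝ)
    have e : hermiteC m 0 = fun z => z ^ m := funext (hermiteC_zero m)
    rw [e]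
    refine h.congr_fderiv (ContinuousLinearMap.ext fun w => ?_)
    simp [hermiteC_zero, mul_comm]
  | succ n ih =>
    have e : hermiteC m (n + 1) = fun z => conj z * hermiteC m n z - m * hermiteC (m - 1) n z :=
      funext (hermiteC_succ m n)
    rw [e]
    convert HasFDerivAt.sub_wirtinger
      (HasFDerivAt.mul_wirtinger (hasFDerivAt_conj_wirtinger z) (ih m))
      (HasFDerivAt.const_mul_wirtinger (m : ℂ) (ih (m - 1))) using 2
    · rw [hermiteC_succ]; ring
    · rcases n with _ | n
      · simp
      · simp [hermiteC_succ]; ring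

theorem contDiff_hermiteC (m n : ℕ) : ContDiff ℝ ∞ (hermiteC m n) := by
  induction n generalizing m with
  | zero =>
    rw [funext (hermiteC_zero m)]
    fun_prop
  | succ n ih =>
    rw [funext (hermiteC_succ m n)]
    have : ContDiff ℝ ∞ fun z : ℂ => conj z := Complex.conjCLE.contDiff
    exact (this.mul (ih m)).sub (contDiff_const.mul (ih (m - 1)))

theorem exists_norm_hermiteC_le (m n : ℕ) :
    ∃ C c : ℝ, 0 ≤ C ∧ 0 ≤ c ∧ ∀ z, ‖hermiteC m n z‖ ≤ C * Real.exp (c * ‖z‖) := by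
  induction n generalizing m with
  | zero =>
    refine ⟨1, m, by norm_num, by positivity, fun z => ?_⟩
    rw [hermiteC_zero, norm_pow, one_mul, Real.exp_nat_mul]
    exact pow_le_pow_left₀ (norm_nonneg _) ((Real.add_one_le_exp _).trans' (by linarith)) _
  | succ n ih =>
    obtain ⟨C, c, hC, hc, h⟩ := ih m
    obtain ⟨C', c', hC', hc', h'⟩ := ih (m - 1)
    refine ⟨C + m * C', c + c' + 1, by positivity, by positivity, fun z => ?_⟩
    rw [hermiteC_succ]
    have hz := norm_nonneg z
    have h1 : ‖z‖ ≤ Real.exp ‖z‖ := (Real.add_one_le_exp _).trans' (by linarith)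
    calc ‖conj z * hermiteC m n z - m * hermiteC (m - 1) n z‖
        ≤ ‖z‖ * ‖hermiteC m n z‖ + m * ‖hermiteC (m - 1) n z‖ := by
          refine (norm_sub_le _ _).trans ?_
          simp
      _ ≤ Real.exp ‖z‖ * (C * Real.exp (c * ‖z‖)) + m * (C' * Real.exp (c' * ‖z‖)) := by
          gcongr
          exacts [h z, h' z]
      _ = C * Real.exp ((c + 1) * ‖z‖) + m * C' * Real.exp (c' * ‖z‖) := by
          rw [add_mul, one_mul, Real.exp_add]; ring
      _ ≤ C * Real.exp ((c + c' + 1) * ‖z‖) + m * C' * Real.exp ((c + c' + 1) * ‖z‖) := by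
          gcongr <;> linarith
      _ = _ := by ring

theorem mul_exp_linear_le (c : ℝ) (z : ℂ) :
    Real.exp (c * ‖z‖) * Real.exp (-‖z‖ ^ 2 / 2) ≤ Real.exp (c ^ 2) * Real.exp (-‖z‖ ^ 2 / 4) := by
  rw [← Real.exp_add, ← Real.exp_add]
  apply Real.exp_le_exp.2
  nlinarith [sq_nonneg (c - ‖z‖ / 2)]

theorem exists_norm_hermiteC_mul_gauss_le (m n : ℕ) :
    ∃ C : ℝ, ∀ z, ‖hermiteC m n z * gauss z‖ ≤ C * Real.exp (-‖z‖ ^ 2 / 4) := by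
  obtain ⟨C, c, hC, hc, h⟩ := exists_norm_hermiteC_le m n
  refine ⟨C * Real.exp (c ^ 2), fun z => ?_⟩
  rw [norm_mul, norm_gauss, mul_assoc]
  refine (mul_le_mul_of_nonneg_right (h z) (by positivity)).trans ?_
  rw [mul_assoc]
  exact mul_le_mul_of_nonneg_left (mul_exp_linear_le c z) hC

/-- A product of two continuous functions dominated by `e^{-|z|²/4}` is integrable. -/
theorem integrable_mul_of_norm_le {f g : ℂ → ℂ} (hf : Continuous f) (hg : Continuous g) {C C' : ℝ}
    (h : ∀ z, ‖f z‖ ≤ C * Real.exp (-‖z‖ ^ 2 / 4))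
    (h' : ∀ z, ‖g z‖ ≤ C' * Real.exp (-‖z‖ ^ 2 / 4)) : Integrable fun z => f z * g z := by
  refine (integrable_exp_neg_norm_sq.const_mul (C * C')).mono' (by fun_prop)
    (ae_of_all _ fun z => ?_)
  rw [norm_mul]
  refine (mul_le_mul (h z) (h' z) (norm_nonneg _) ((norm_nonneg _).trans (h z))).trans_eq ?_
  rw [mul_mul_mul_comm, ← Real.exp_add]
  congr 2
  ring

theorem integrable_conj_hermiteC_mul (m n m' n' : ℕ) :
    Integrable fun z => conj (hermiteC m n z * gauss z) * (hermiteC m' n' z * gauss z) := by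
  obtain ⟨C, hC⟩ := exists_norm_hermiteC_mul_gauss_le m n
  obtain ⟨C', hC'⟩ := exists_norm_hermiteC_mul_gauss_le m' n'
  have h1 := (contDiff_hermiteC m n).continuous
  have h2 := (contDiff_hermiteC m' n').continuous
  have h3 := contDiff_gauss.continuous
  have h4 : Continuous fun z : ℂ => conj z := Complex.continuous_conj
  exact integrable_mul_of_norm_le (h4.comp (h1.mul h3)) (h2.mul h3)
    (fun z => by simpa only [Function.comp, Complex.norm_conj] using hC z) hC'

/-- Lowering a complex Hermite function against raising another one. -/
theorem integral_conj_hermiteC_succ_mul (m n m' n' : ℕ) :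
    ∫ z, conj (hermiteC m (n + 1) z * gauss z) * (hermiteC m' n' z * gauss z) =
      n' * ∫ z, conj (hermiteC m n z * gauss z) * (hermiteC m' (n' - 1) z * gauss z) := by
  set F : ℂ → ℂ := fun z => conj (hermiteC m n z * gauss z) * (hermiteC m' n' z * gauss z) with hF
  have hd : ∀ z, HasFDerivAt F (wirtinger _ _) z := fun z => HasFDerivAt.mul_wirtinger
    (HasFDerivAt.star_wirtinger (HasFDerivAt.mul_wirtinger (hasFDerivAt_hermiteC m n z)
      (hasFDerivAt_gauss z)))
    (HasFDerivAt.mul_wirtinger (hasFDerivAt_hermiteC m' n' z) (hasFDerivAt_gauss z))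
  have hfd := fun z => (hd z).fderiv
  have hdiff : Differentiable ℝ F := fun z => (hd z).differentiableAt
  have I := integrable_conj_hermiteC_mul
  -- Integration by parts against the constant function `1`: an integrable directional derivative of
  -- an integrable function has integral zero.
  have key : ∀ w : ℂ, Integrable (fun z => fderiv ℝ F z w) → ∫ z, fderiv ℝ F z w = 0 := by
    intro w hw
    have := integral_mul_fderiv_eq_neg_fderiv_mul_of_integrable (μ := (volume : Measure ℂ))
      (f := fun _ : ℂ => (1 : ℂ)) (g := F) (v := w) (by simp) (by simpa using hw)
      (by simpa only [one_mul] using I m n m' n') (fun _ _ => by fun_prop) (fun z _ => hdiff z)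
    simpa using this
  have expand : ∀ z w, fderiv ℝ F z w =
      w * (n * (conj (hermiteC m (n - 1) z * gauss z) * (hermiteC m' n' z * gauss z))
        - conj (hermiteC m n z * gauss z) * (hermiteC m' (n' + 1) z * gauss z))
      + conj w * (n' * (conj (hermiteC m n z * gauss z) * (hermiteC m' (n' - 1) z * gauss z))
        - conj (hermiteC m (n + 1) z * gauss z) * (hermiteC m' n' z * gauss z)) := by
    intro z w
    rw [hfd z, wirtinger_apply, hermiteC_succ, hermiteC_succ]
    simp only [map_mul, map_sub, map_add, map_natCast, conj_gauss, Complex.conj_conj, map_neg,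
      map_div₀, map_one, map_ofNat]
    ring
  have hint : ∀ w, Integrable (fun z => fderiv ℝ F z w) := fun w => by
    simp_rw [expand]
    exact ((((I m (n - 1) m' n').const_mul _).sub (I m n m' (n' + 1))).const_mul _).add
      ((((I m n m' (n' - 1)).const_mul _).sub (I m (n + 1) m' n')).const_mul _)
  have h1 := key 1 (hint 1)
  have h2 := key Complex.I (hint Complex.I)
  -- `∂₁ + i∂₂ = 2∂_{z̄}`, so only the coefficient of `conj w` in `expand` survives, which is the
  -- asserted identity.
  have h3 : ∫ z, (fderiv ℝ F z 1 + Complex.I * fderiv ℝ F z Complex.I) = 0 := by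
    rw [integral_add (hint 1) ((hint Complex.I).const_mul _), integral_const_mul, h1, h2]
    simp
  have h4 : ∀ z, fderiv ℝ F z 1 + Complex.I * fderiv ℝ F z Complex.I =
      2 * (n' * (conj (hermiteC m n z * gauss z) * (hermiteC m' (n' - 1) z * gauss z))
        - conj (hermiteC m (n + 1) z * gauss z) * (hermiteC m' n' z * gauss z)) := by
    intro z
    rw [expand, expand]
    simp only [map_one, Complex.conj_I]
    linear_combination (((n : ℂ) * (conj (hermiteC m (n - 1) z * gauss z) *
      (hermiteC m' n' z * gauss z)) - conj (hermiteC m n z * gauss z) *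
      (hermiteC m' (n' + 1) z * gauss z)) -
      ((n' : ℂ) * (conj (hermiteC m n z * gauss z) * (hermiteC m' (n' - 1) z * gauss z))
        - conj (hermiteC m (n + 1) z * gauss z) * (hermiteC m' n' z * gauss z))) *
      Complex.I_mul_I
  simp_rw [h4] at h3
  rw [integral_const_mul, integral_sub ((I m n m' (n' - 1)).const_mul _) (I m (n + 1) m' n'),
    integral_const_mul] at h3
  rcases mul_eq_zero.1 h3 with h | h
  · norm_num at h
  · exact (sub_eq_zero.1 h).symm

/-- Monomials of different degree are orthogonal for every radial weight. -/
theorem integral_conj_pow_mul_pow_radial {p q : ℕ} (hpq : p ≠ q) (ρ : ℝ → ℂ) :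
    ∫ z : ℂ, conj (z ^ p) * z ^ q * ρ ‖z‖ = 0 := by
  -- A rotation by one radian separates all degrees at once: `u ^ p = u ^ q` with `p ≠ q` would make
  -- `π` rational. The integral then equals itself times a constant different from one, an argument
  -- that needs no integrability.
  set u : Circle := Circle.exp 1
  have hu : ∀ z : ℂ, conj (((u : ℂ) * z) ^ p) * ((u : ℂ) * z) ^ q * ρ ‖(u : ℂ) * z‖ =
      (conj ((u : ℂ) ^ p) * (u : ℂ) ^ q) * (conj (z ^ p) * z ^ q * ρ ‖z‖) := by
    intro z
    rw [norm_mul, Circle.norm_coe, one_mul]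
    simp only [mul_pow, map_mul]
    ring
  have hrot : ∫ z : ℂ, conj (((u : ℂ) * z) ^ p) * ((u : ℂ) * z) ^ q * ρ ‖(u : ℂ) * z‖ =
      ∫ z : ℂ, conj (z ^ p) * z ^ q * ρ ‖z‖ := by
    have := (rotation u).measurePreserving.integral_comp
      (rotation u).toHomeomorph.measurableEmbedding
      (fun z : ℂ => conj (z ^ p) * z ^ q * ρ ‖z‖)
    simpa [rotation_apply] using this
  simp_rw [hu] at hrot
  rw [integral_const_mul] at hrot
  have hne : conj ((u : ℂ) ^ p) * (u : ℂ) ^ q ≠ 1 := by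
    intro h
    have h1 : (u : ℂ) ^ q = (u : ℂ) ^ p := by
      have h2 : (u : ℂ) ^ p * conj ((u : ℂ) ^ p) = 1 := by
        rw [Complex.mul_conj, Complex.normSq_eq_norm_sq, norm_pow, Circle.norm_coe]; simp
      calc (u : ℂ) ^ q = ((u : ℂ) ^ p * conj ((u : ℂ) ^ p)) * (u : ℂ) ^ q := by rw [h2, one_mul]
        _ = (u : ℂ) ^ p * (conj ((u : ℂ) ^ p) * (u : ℂ) ^ q) := by ring
        _ = _ := by rw [h, mul_one]
    have h2 : (u : ℂ) = Complex.exp Complex.I := by simp [u, Circle.coe_exp]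
    rw [h2, ← Complex.exp_nat_mul, ← Complex.exp_nat_mul, Complex.exp_eq_exp_iff_exists_int] at h1
    obtain ⟨n, hn⟩ := h1
    have h3 : (q : ℝ) = p + n * (2 * Real.pi) := by
      have : ((q : ℂ)) = p + n * (2 * Real.pi) := by
        apply mul_right_cancel₀ Complex.I_ne_zero
        rw [hn]; ring
      exact_mod_cast this
    rcases eq_or_ne n 0 with rfl | hn0
    · exact hpq (by exact_mod_cast (by simpa using h3.symm : (p : ℝ) = q))
    · apply irrational_pi
      refine ⟨(q - p : ℚ) / (2 * n), ?_⟩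
      push_cast
      rw [h3]
      have : (n : ℝ) ≠ 0 := by exact_mod_cast hn0
      field_simp
      ring
  by_contra hz
  exact hne (mul_right_cancel₀ hz (by rw [hrot, one_mul]))

theorem integral_norm_pow_mul_exp (p : ℕ) {b : ℝ} (hb : 0 < b) :
    ∫ z : ℂ, (‖z‖ ^ 2) ^ p * Real.exp (-b * ‖z‖ ^ 2) =
      Real.pi * p.factorial * (b ^ (p + 1))⁻¹ := by
  have h := Complex.integral_rpow_mul_exp_neg_mul_rpow (p := 2) (q := 2 * p) (b := b) (by norm_num)
    (by linarith [(by positivity : (0 : ℝ) ≤ 2 * p)]) hb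
  have h1 : ((2 * p + 2 : ℝ) / 2) = (p : ℝ) + 1 := by ring
  have h2 : -(2 * p + 2 : ℝ) / 2 = -((p + 1 : ℕ) : ℝ) := by push_cast; ring
  rw [h2, h1, Real.Gamma_nat_eq_factorial, Real.rpow_neg hb.le, Real.rpow_natCast] at h
  rw [show Real.pi * p.factorial * (b ^ (p + 1))⁻¹ =
    2 * Real.pi / 2 * (b ^ (p + 1))⁻¹ * p.factorial by ring, ← h]
  refine integral_congr_ae (ae_of_all _ fun z => ?_)
  simp only
  rw [← pow_mul, ← Real.rpow_natCast, ← Real.rpow_natCast]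
  norm_num

/-- Lowering reduces `n` and `n'` together. At `n = n' = 0` the angular integral decides; if only
one of them is zero, lowering the other function (after conjugation if necessary) produces the
factor zero. -/
theorem integral_conj_hermiteC_mul (m n m' n' : ℕ) :
    ∫ z, conj (hermiteC m n z * gauss z) * (hermiteC m' n' z * gauss z) =
      if m = m' ∧ n = n' then (Real.pi * m.factorial * n.factorial : ℂ) else 0 := by
  induction n generalizing n' with
  | zero =>
    rcases n' with _ | n'
    · have e : ∀ z, conj (hermiteC m 0 z * gauss z) * (hermiteC m' 0 z * gauss z) =
          conj (z ^ m) * z ^ m' * (Real.exp (-1 * ‖z‖ ^ 2) : ℂ) := by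
        intro z
        rw [hermiteC_zero, hermiteC_zero, map_mul, conj_gauss, gauss]
        rw [show -1 * ‖z‖ ^ 2 = -‖z‖ ^ 2 / 2 + -‖z‖ ^ 2 / 2 by ring, Real.exp_add]
        push_cast
        ring
      simp_rw [e]
      split_ifs with h
      · obtain ⟨rfl, -⟩ := h
        have e2 : ∀ z : ℂ, conj (z ^ m) * z ^ m * (Real.exp (-1 * ‖z‖ ^ 2) : ℂ) =
            (((‖z‖ ^ 2) ^ m * Real.exp (-1 * ‖z‖ ^ 2) : ℝ) : ℂ) := by
          intro z
          rw [mul_comm (conj _), Complex.mul_conj, Complex.normSq_eq_norm_sq, norm_pow]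
          push_cast
          ring
        simp_rw [e2]
        rw [integral_complex_ofReal, integral_norm_pow_mul_exp m one_pos]
        simp
      · exact integral_conj_pow_mul_pow_radial (by simpa using h)
          (fun r => (Real.exp (-1 * r ^ 2) : ℂ))
    · have h := integral_conj_hermiteC_succ_mul m' n' m 0
      have e : ∀ z, conj (hermiteC m 0 z * gauss z) * (hermiteC m' (n' + 1) z * gauss z) =
          conj (conj (hermiteC m' (n' + 1) z * gauss z) * (hermiteC m 0 z * gauss z)) := by
        intro z
        simp only [map_mul, Complex.conj_conj]
        ring
      simp_rw [e]
      rw [integral_conj, h]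
      simp
  | succ n ih =>
    rw [integral_conj_hermiteC_succ_mul, ih]
    rcases n' with _ | n'
    · simp
    · simp only [Nat.add_sub_cancel, Nat.add_right_cancel_iff]
      split_ifs with h
      · obtain ⟨rfl, rfl⟩ := h
        rw [Nat.factorial_succ]
        push_cast
        ring
      · simp

/-- The normalized complex Hermite functions. -/
def orbital (p : ℕ × ℕ) (z : ℂ) : ℂ :=
  ((√(Real.pi * p.1.factorial * p.2.factorial))⁻¹ : ℝ) * (hermiteC p.1 p.2 z * gauss z)

theorem contDiff_orbital (p : ℕ × ℕ) : ContDiff ℝ ∞ (orbital p) :=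
  contDiff_const.mul ((contDiff_hermiteC _ _).mul contDiff_gauss)

theorem exists_norm_orbital_le (p : ℕ × ℕ) :
    ∃ C : ℝ, ∀ z, ‖orbital p z‖ ≤ C * Real.exp (-‖z‖ ^ 2 / 4) := by
  obtain ⟨C, h⟩ := exists_norm_hermiteC_mul_gauss_le p.1 p.2
  refine ⟨‖((√(Real.pi * p.1.factorial * p.2.factorial))⁻¹ : ℝ)‖ * C, fun z => ?_⟩
  rw [orbital, norm_mul, Complex.norm_real]
  exact (mul_le_mul_of_nonneg_left (h z) (norm_nonneg _)).trans_eq (by ring)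

theorem integral_conj_orbital_mul (p q : ℕ × ℕ) :
    ∫ z, conj (orbital p z) * orbital q z = if p = q then 1 else 0 := by
  have e : ∀ z, conj (orbital p z) * orbital q z =
      (((√(Real.pi * p.1.factorial * p.2.factorial))⁻¹ : ℝ) *
      ((√(Real.pi * q.1.factorial * q.2.factorial))⁻¹ : ℝ)) *
      (conj (hermiteC p.1 p.2 z * gauss z) * (hermiteC q.1 q.2 z * gauss z)) := by
    intro z
    simp only [orbital, map_mul, Complex.conj_ofReal]
    ring
  simp_rw [e]
  rw [integral_const_mul, integral_conj_hermiteC_mul]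
  by_cases h : p = q
  · subst h
    have hpos : 0 < Real.pi * p.1.factorial * p.2.factorial := by positivity
    simp only [and_self, if_true]
    rw [← Complex.ofReal_mul, ← mul_inv, Real.mul_self_sqrt hpos.le]
    norm_cast
    exact inv_mul_cancel₀ hpos.ne'
  · rw [if_neg h, if_neg (fun h' => h (Prod.ext h'.1 h'.2)), mul_zero]

/-! ### Uniqueness of Fourier transforms -/

section Fourier

variable {E : Type*} [NormedAddCommGroup E] [NormedSpace ℝ E] [MeasurableSpace E] [BorelSpace E] {μ : Measure E}

theorem norm_cexp_ofReal_mul_I_mul (t : ℝ) (c : ℂ) : ‖Complex.exp (t * Complex.I) * c‖ = ‖c‖ := by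
  rw [norm_mul, Complex.norm_exp_ofReal_mul_I, one_mul]

theorem integrable_cexp_mul {f : E → ℂ} (hf : Integrable f μ) (L : StrongDual ℝ E) :
    Integrable (fun x => Complex.exp (L x * Complex.I) * f x) μ := by
  have hm : AEStronglyMeasurable (fun x => Complex.exp (L x * Complex.I)) μ :=
    Continuous.aestronglyMeasurable (by fun_prop)
  exact hf.norm.mono' (hm.mul hf.aestronglyMeasurable)
    (ae_of_all _ fun x => (norm_cexp_ofReal_mul_I_mul _ _).le)

/-- The positive and the negative part are densities of two finite measures with the same
characteristic function, so these measures agree. -/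
theorem ae_eq_zero_of_integral_cexp_mul_real [SecondCountableTopology E] [CompleteSpace E]
    [SigmaFinite μ] {f : E → ℝ} (hf : Integrable f μ)
    (h : ∀ L : StrongDual ℝ E, ∫ x, Complex.exp (L x * Complex.I) * (f x : ℂ) ∂μ = 0) :
    f =ᵐ[μ] 0 := by
  have hm : AEMeasurable f μ := hf.aemeasurable
  have hp : AEMeasurable (fun x => ENNReal.ofReal (f x)) μ := hm.ennreal_ofReal
  have hn : AEMeasurable (fun x => ENNReal.ofReal (-f x)) μ := hm.neg.ennreal_ofReal
  have h1 : IsFiniteMeasure (μ.withDensity fun x => ENNReal.ofReal (f x)) :=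
    isFiniteMeasure_withDensity_ofReal hf.2
  have h2 : IsFiniteMeasure (μ.withDensity fun x => ENNReal.ofReal (-f x)) :=
    isFiniteMeasure_withDensity_ofReal hf.neg.2
  have h3 : (μ.withDensity fun x => ENNReal.ofReal (f x)) =
      μ.withDensity fun x => ENNReal.ofReal (-f x) := by
    refine Measure.ext_of_charFunDual (funext fun L => ?_)
    rw [charFunDual_apply, charFunDual_apply,
      integral_withDensity_eq_integral_toReal_smul₀ hp (ae_of_all _ fun _ => ENNReal.ofReal_lt_top),
      integral_withDensity_eq_integral_toReal_smul₀ hn (ae_of_all _ fun _ => ENNReal.ofReal_lt_top),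
      ← sub_eq_zero, ← integral_sub, ← h L]
    · refine integral_congr_ae (ae_of_all _ fun x => ?_)
      simp only [ENNReal.toReal_ofReal', Complex.real_smul]
      rw [← sub_mul, ← Complex.ofReal_sub, max_zero_sub_eq_self, mul_comm]
    · refine (integrable_cexp_mul hf.pos_part.ofReal L).congr (ae_of_all _ fun x => ?_)
      simp only [ENNReal.toReal_ofReal', Complex.real_smul]
      exact mul_comm _ _
    · refine (integrable_cexp_mul hf.neg_part.ofReal L).congr (ae_of_all _ fun x => ?_)
      simp only [ENNReal.toReal_ofReal', Complex.real_smul]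
      exact mul_comm _ _
  rw [withDensity_eq_iff_of_sigmaFinite hp hn] at h3
  filter_upwards [h3] with x hx
  simp only [Pi.zero_apply]
  rcases le_total 0 (f x) with h0 | h0
  · rw [ENNReal.ofReal_of_nonpos (neg_nonpos.2 h0), ENNReal.ofReal_eq_zero] at hx
    exact le_antisymm hx h0
  · rw [ENNReal.ofReal_of_nonpos h0, eq_comm, ENNReal.ofReal_eq_zero] at hx
    linarith

/-- An integrable function whose Fourier transform vanishes is zero almost everywhere. -/
theorem ae_eq_zero_of_integral_cexp_mul [SecondCountableTopology E] [CompleteSpace E]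
    [SigmaFinite μ] {f : E → ℂ} (hf : Integrable f μ)
    (h : ∀ L : StrongDual ℝ E, ∫ x, Complex.exp (L x * Complex.I) * f x ∂μ = 0) :
    f =ᵐ[μ] 0 := by
  -- Replacing `L` by `-L` and conjugating shows that `conj f` has vanishing Fourier transform too;
  -- the real case then applies to the real and the imaginary part.
  have h' : ∀ L : StrongDual ℝ E, ∫ x, Complex.exp (L x * Complex.I) * conj (f x) ∂μ = 0 := by
    intro L
    have h1 := congrArg conj (h (-L))
    rw [← integral_conj, map_zero] at h1
    rw [← h1]
    refine integral_congr_ae (ae_of_all _ fun x => ?_)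
    simp [← Complex.exp_conj]
  have hc : Integrable (fun x => conj (f x)) μ :=
    (Complex.conjCLE : ℂ →L[ℝ] ℂ).integrable_comp hf
  have hre : (fun x => (f x).re) =ᵐ[μ] 0 := by
    refine ae_eq_zero_of_integral_cexp_mul_real hf.re fun L => ?_
    have e : ∀ x, Complex.exp (L x * Complex.I) * ((f x).re : ℂ) = (1 / 2) *
        (Complex.exp (L x * Complex.I) * f x + Complex.exp (L x * Complex.I) * conj (f x)) := by
      intro x
      rw [Complex.re_eq_add_conj]
      ring
    simp_rw [e]
    rw [integral_const_mul, integral_add (integrable_cexp_mul hf L) (integrable_cexp_mul hc L),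
      h, h']
    simp
  have him : (fun x => (f x).im) =ᵐ[μ] 0 := by
    refine ae_eq_zero_of_integral_cexp_mul_real hf.im fun L => ?_
    have e : ∀ x, Complex.exp (L x * Complex.I) * ((f x).im : ℂ) = (1 / (2 * Complex.I)) *
        (Complex.exp (L x * Complex.I) * f x - Complex.exp (L x * Complex.I) * conj (f x)) := by
      intro x
      rw [Complex.im_eq_sub_conj]
      ring
    simp_rw [e]
    rw [integral_const_mul, integral_sub (integrable_cexp_mul hf L) (integrable_cexp_mul hc L),
      h, h']
    simp
  filter_upwards [hre, him] with x h1 h2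
  exact Complex.ext h1 h2

end Fourier

/-! ### The Hilbert basis of products of complex Hermite functions -/

theorem inner_toLp_left {N : ℕ} {f : Conf N → ℂ} (hf : MemLp f 2) (Ψ : L2 N) :
    inner ℂ (hf.toLp f) Ψ = ∫ x, conj (f x) * Ψ x := by
  rw [L2.inner_def]
  refine integral_congr_ae ?_
  filter_upwards [hf.coeFn_toLp] with x hx
  rw [hx, RCLike.inner_apply, mul_comm]

theorem inner_toLp_toLp {N : ℕ} {f g : Conf N → ℂ} (hf : MemLp f 2) (hg : MemLp g 2) :
    inner ℂ (hf.toLp f) (hg.toLp g) = ∫ x, conj (f x) * g x := by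
  rw [inner_toLp_left]
  refine integral_congr_ae ?_
  filter_upwards [hg.coeFn_toLp] with x hx
  rw [hx]

theorem integrable_conj_mul {N : ℕ} {f g : Conf N → ℂ} (hf : MemLp f 2) (hg : MemLp g 2) :
    Integrable fun x => conj (f x) * g x := by
  have h := hf.star.integrable_mul hg
  exact h

/-- A function dominated by a product of Gaussians is square integrable. -/
theorem memLp_of_norm_le_prod {N : ℕ} {f : Conf N → ℂ} (hm : AEStronglyMeasurable f volume)
    (C : Fin N → ℝ) (hC : ∀ x, ‖f x‖ ≤ ∏ i, (C i * Real.exp (-‖x i‖ ^ 2 / 4))) :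
    MemLp f 2 volume := by
  rw [memLp_two_iff_integrable_sq_norm hm]
  have hi : Integrable fun x : Conf N => ∏ i, C i ^ 2 * Real.exp (-‖x i‖ ^ 2 / 2) :=
    Integrable.fintype_prod fun i => integrable_exp_neg_norm_sq.const_mul (C i ^ 2)
  refine hi.mono' (hm.norm.pow 2) (ae_of_all _ fun x => ?_)
  rw [Real.norm_of_nonneg (by positivity)]
  refine (pow_le_pow_left₀ (norm_nonneg _) (hC x) 2).trans_eq ?_
  rw [← Finset.prod_pow]
  refine Finset.prod_congr rfl fun i _ => ?_
  rw [mul_pow, ← Real.exp_nat_mul]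
  congr 2
  push_cast
  ring

/-- Products of complex Hermite functions of the single particles. -/
def orbitalProd {N : ℕ} (ν : Fin N → ℕ × ℕ) (x : Conf N) : ℂ := ∏ i, orbital (ν i) (x i)

theorem contDiff_orbitalProd {N : ℕ} (ν : Fin N → ℕ × ℕ) : ContDiff ℝ ∞ (orbitalProd ν) := by
  unfold orbitalProd
  exact contDiff_prod fun i _ => (contDiff_orbital (ν i)).comp (contDiff_apply ℝ ℂ i)

theorem memLp_orbitalProd {N : ℕ} (ν : Fin N → ℕ × ℕ) : MemLp (orbitalProd ν) 2 volume := by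
  choose C hC using fun i => exists_norm_orbital_le (ν i)
  refine memLp_of_norm_le_prod (contDiff_orbitalProd ν).continuous.aestronglyMeasurable C fun x => ?_
  rw [orbitalProd, norm_prod]
  exact Finset.prod_le_prod (fun _ _ => norm_nonneg _) fun i _ => hC i (x i)

/-- Products of complex Hermite functions as elements of `L²`. -/
def orbitalLp {N : ℕ} (ν : Fin N → ℕ × ℕ) : L2 N := (memLp_orbitalProd ν).toLp

theorem orthonormal_orbitalLp (N : ℕ) : Orthonormal ℂ (orbitalLp (N := N)) := by
  classical
  rw [orthonormal_iff_ite]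
  intro ν ν'
  rw [orbitalLp, orbitalLp, inner_toLp_toLp]
  have e : ∀ x : Conf N, conj (orbitalProd ν x) * orbitalProd ν' x =
      ∏ i, conj (orbital (ν i) (x i)) * orbital (ν' i) (x i) := by
    intro x
    rw [orbitalProd, orbitalProd, map_prod, ← Finset.prod_mul_distrib]
  simp_rw [e]
  rw [integral_fintype_prod_volume_eq_prod
    (fun i (z : ℂ) => conj (orbital (ν i) z) * orbital (ν' i) z)]
  simp_rw [integral_conj_orbital_mul]
  split_ifs with h
  · subst h; simp
  · obtain ⟨i, hi⟩ := Function.ne_iff.1 h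
    exact Finset.prod_eq_zero (Finset.mem_univ i) (if_neg hi)

/-- The Gaussian of all particles. -/
def gaussProd {N : ℕ} (x : Conf N) : ℂ := ∏ i, gauss (x i)

theorem continuous_gaussProd {N : ℕ} : Continuous (gaussProd (N := N)) := by
  unfold gaussProd
  exact continuous_finsetProd _ fun i _ => contDiff_gauss.continuous.comp (continuous_apply i)

theorem gaussProd_ne_zero {N : ℕ} (x : Conf N) : gaussProd x ≠ 0 :=
  Finset.prod_ne_zero_iff.2 fun i _ => gauss_ne_zero (x i)

@[simp]
theorem conj_gaussProd {N : ℕ} (x : Conf N) : conj (gaussProd x) = gaussProd x := by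
  simp [gaussProd, map_prod]

/-- Products of complex Hermite polynomials. -/
def hermiteProd {N : ℕ} (ν : Fin N → ℕ × ℕ) (x : Conf N) : ℂ :=
  ∏ i, hermiteC (ν i).1 (ν i).2 (x i)

theorem hermiteProd_update {N : ℕ} (ν : Fin N → ℕ × ℕ) (k : Fin N) (p : ℕ × ℕ) (x : Conf N) :
    hermiteProd (Function.update ν k p) x = hermiteC p.1 p.2 (x k) *
      ∏ i ∈ Finset.univ.erase k, hermiteC (ν i).1 (ν i).2 (x i) := by
  rw [hermiteProd, ← Finset.mul_prod_erase _ _ (Finset.mem_univ k), Function.update_self]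
  congr 1
  refine Finset.prod_congr rfl fun i hi => ?_
  rw [Function.update_of_ne (Finset.ne_of_mem_erase hi)]

theorem hermiteProd_eq {N : ℕ} (ν : Fin N → ℕ × ℕ) (k : Fin N) (x : Conf N) :
    hermiteProd ν x = hermiteC (ν k).1 (ν k).2 (x k) *
      ∏ i ∈ Finset.univ.erase k, hermiteC (ν i).1 (ν i).2 (x i) := by
  rw [hermiteProd, ← Finset.mul_prod_erase _ _ (Finset.mem_univ k)]

theorem orbitalProd_eq {N : ℕ} (ν : Fin N → ℕ × ℕ) : ∃ c : ℂ, c ≠ 0 ∧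
    ∀ x, orbitalProd ν x = c * (hermiteProd ν x * gaussProd x) := by
  refine ⟨∏ i, ((√(Real.pi * (ν i).1.factorial * (ν i).2.factorial))⁻¹ : ℝ), ?_, fun x => ?_⟩
  · refine Finset.prod_ne_zero_iff.2 fun i _ => ?_
    exact Complex.ofReal_ne_zero.2 (by positivity)
  · simp only [orbitalProd, orbital, hermiteProd, gaussProd, Finset.prod_mul_distrib]

/-- The space of polynomials in the coordinates and their conjugates. -/
def polyFun (N : ℕ) : Submodule ℂ (Conf N → ℂ) := Submodule.span ℂ (Set.range hermiteProd)

theorem coord_mul_mem_polyFun {N : ℕ} (k : Fin N) {f : Conf N → ℂ} (hf : f ∈ polyFun N) :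
    (fun x => x k * f x) ∈ polyFun N := by
  induction hf using Submodule.span_induction with
  | mem f h =>
    obtain ⟨ν, rfl⟩ := h
    have e : (fun x => x k * hermiteProd ν x) =
        hermiteProd (Function.update ν k ((ν k).1 + 1, (ν k).2)) +
        ((ν k).2 : ℂ) • hermiteProd (Function.update ν k ((ν k).1, (ν k).2 - 1)) := by
      funext x
      simp only [Pi.add_apply, Pi.smul_apply, smul_eq_mul]
      rw [hermiteProd_update, hermiteProd_update, hermiteProd_eq ν k, ← mul_assoc, mul_hermiteC]
      ring
    rw [e]
    exact add_mem (Submodule.subset_span ⟨_, rfl⟩)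
      (Submodule.smul_mem _ _ (Submodule.subset_span ⟨_, rfl⟩))
  | zero =>
    convert (polyFun N).zero_mem using 1
    funext x
    simp
  | add f g _ _ hf hg =>
    have e : (fun x => x k * (f + g) x) = (fun x => x k * f x) + fun x => x k * g x := by
      funext x; simp [mul_add]
    rw [e]; exact add_mem hf hg
  | smul c f _ hf =>
    have e : (fun x => x k * (c • f) x) = c • fun x => x k * f x := by
      funext x; simp; ring
    rw [e]; exact Submodule.smul_mem _ _ hf

theorem conj_coord_mul_mem_polyFun {N : ℕ} (k : Fin N) {f : Conf N → ℂ} (hf : f ∈ polyFun N) :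
    (fun x => conj (x k) * f x) ∈ polyFun N := by
  induction hf using Submodule.span_induction with
  | mem f h =>
    obtain ⟨ν, rfl⟩ := h
    have e : (fun x => conj (x k) * hermiteProd ν x) =
        hermiteProd (Function.update ν k ((ν k).1, (ν k).2 + 1)) +
        ((ν k).1 : ℂ) • hermiteProd (Function.update ν k ((ν k).1 - 1, (ν k).2)) := by
      funext x
      simp only [Pi.add_apply, Pi.smul_apply, smul_eq_mul]
      rw [hermiteProd_update, hermiteProd_update, hermiteProd_eq ν k, hermiteC_succ]
      ring
    rw [e]
    exact add_mem (Submodule.subset_span ⟨_, rfl⟩)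
      (Submodule.smul_mem _ _ (Submodule.subset_span ⟨_, rfl⟩))
  | zero =>
    convert (polyFun N).zero_mem using 1
    funext x
    simp
  | add f g _ _ hf hg =>
    have e : (fun x => conj (x k) * (f + g) x) =
        (fun x => conj (x k) * f x) + fun x => conj (x k) * g x := by
      funext x; simp [mul_add]
    rw [e]; exact add_mem hf hg
  | smul c f _ hf =>
    have e : (fun x => conj (x k) * (c • f) x) = c • fun x => conj (x k) * f x := by
      funext x; simp; ring
    rw [e]; exact Submodule.smul_mem _ _ hf

theorem exists_dual_eq_sum {N : ℕ} (L : StrongDual ℝ (Conf N)) : ∃ A B : Fin N → ℂ,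
    ∀ x, (L x : ℂ) = ∑ k, (A k * x k + B k * conj (x k)) := by
  refine ⟨fun k => ((L (Pi.single k 1) : ℂ) - Complex.I * L (Pi.single k Complex.I)) / 2,
    fun k => ((L (Pi.single k 1) : ℂ) + Complex.I * L (Pi.single k Complex.I)) / 2, fun x => ?_⟩
  have h1 : L x = ∑ k, ((x k).re * L (Pi.single k 1) + (x k).im * L (Pi.single k Complex.I)) := by
    conv_lhs => rw [← Finset.univ_sum_single x]
    rw [map_sum]
    refine Finset.sum_congr rfl fun k _ => ?_
    have : (Pi.single k (x k) : Conf N) =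
        (x k).re • (Pi.single k 1 : Conf N) + (x k).im • (Pi.single k Complex.I : Conf N) := by
      rw [← Pi.single_smul, ← Pi.single_smul, ← Pi.single_add]
      congr 1
      simp [Complex.re_add_im]
    rw [this, map_add, map_smul, map_smul]
    simp
  rw [h1]
  push_cast
  refine Finset.sum_congr rfl fun k _ => ?_
  rw [Complex.re_eq_add_conj, Complex.im_eq_sub_conj]
  field_simp
  linear_combination (x k - conj (x k)) * (L (Pi.single k Complex.I) : ℂ) * Complex.I_sq

/-- These powers are the Taylor terms of the characters `exp(i L x)`, through which completeness of
the Hermite functions is reduced to uniqueness of Fourier transforms. -/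
theorem dual_pow_mem_polyFun {N : ℕ} (L : StrongDual ℝ (Conf N)) (n : ℕ) :
    (fun x => (L x : ℂ) ^ n) ∈ polyFun N := by
  obtain ⟨A, B, hAB⟩ := exists_dual_eq_sum L
  induction n with
  | zero =>
    refine Submodule.subset_span ⟨fun _ => (0, 0), funext fun x => ?_⟩
    simp [hermiteProd, hermiteC_zero]
  | succ n ih =>
    have e : (fun x => (L x : ℂ) ^ (n + 1)) = ∑ k, (A k • (fun x : Conf N => x k * (L x : ℂ) ^ n) +
        B k • fun x : Conf N => conj (x k) * (L x : ℂ) ^ n) := by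
      funext x
      rw [pow_succ, Finset.sum_apply]
      conv_lhs => rw [hAB x, Finset.mul_sum]
      rw [← hAB x]
      refine Finset.sum_congr rfl fun k _ => ?_
      simp only [Pi.add_apply, Pi.smul_apply, smul_eq_mul]
      ring
    rw [e]
    exact Submodule.sum_mem _ fun k _ => add_mem
      (Submodule.smul_mem _ _ (coord_mul_mem_polyFun k ih))
      (Submodule.smul_mem _ _ (conj_coord_mul_mem_polyFun k ih))

theorem memLp_hermiteProd_mul_gaussProd {N : ℕ} (ν : Fin N → ℕ × ℕ) :
    MemLp (fun x => hermiteProd ν x * gaussProd x) 2 volume := by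
  obtain ⟨c, hc, h⟩ := orbitalProd_eq ν
  refine ((memLp_orbitalProd ν).const_mul c⁻¹).ae_eq (ae_of_all _ fun x => ?_)
  simp only
  rw [h, inv_mul_cancel_left₀ hc]

theorem polyFun_orthogonal {N : ℕ} {Ψ : L2 N} (hΨ : ∀ ν, inner ℂ (orbitalLp ν) Ψ = 0)
    {f : Conf N → ℂ} (hf : f ∈ polyFun N) :
    MemLp (fun x => f x * gaussProd x) 2 volume ∧ ∫ x, conj (f x * gaussProd x) * Ψ x = 0 := by
  induction hf using Submodule.span_induction with
  | mem f h =>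
    obtain ⟨ν, rfl⟩ := h
    refine ⟨memLp_hermiteProd_mul_gaussProd ν, ?_⟩
    obtain ⟨c, hc, h⟩ := orbitalProd_eq ν
    have h1 := hΨ ν
    rw [orbitalLp, inner_toLp_left] at h1
    simp_rw [h, map_mul (starRingEnd ℂ) c, mul_assoc (conj c)] at h1
    rw [integral_const_mul] at h1
    exact (mul_eq_zero.1 h1).resolve_left ((map_ne_zero _).2 hc)
  | zero => simp
  | add f g _ _ hf hg =>
    have e : (fun x => (f + g) x * gaussProd x) =
        (fun x => f x * gaussProd x) + fun x => g x * gaussProd x := by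
      funext x; simp [add_mul]
    refine ⟨by rw [e]; exact hf.1.add hg.1, ?_⟩
    simp_rw [Pi.add_apply, add_mul, map_add, add_mul]
    rw [integral_add (integrable_conj_mul hf.1 (Lp.memLp Ψ))
      (integrable_conj_mul hg.1 (Lp.memLp Ψ)), hf.2, hg.2, add_zero]
  | smul c f _ hf =>
    have e : (fun x => (c • f) x * gaussProd x) = fun x => c * (f x * gaussProd x) := by
      funext x; simp [mul_assoc]
    refine ⟨by rw [e]; exact hf.1.const_mul c, ?_⟩
    simp_rw [Pi.smul_apply, smul_eq_mul, mul_assoc c, map_mul (starRingEnd ℂ) c,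
      mul_assoc (conj c)]
    rw [integral_const_mul, hf.2, mul_zero]

theorem memLp_exp_mul_gaussProd {N : ℕ} (c : ℝ) (hc : 0 ≤ c) :
    MemLp (fun x : Conf N => (Real.exp (c * ‖x‖) : ℂ) * gaussProd x) 2 volume := by
  refine memLp_of_norm_le_prod (Continuous.aestronglyMeasurable ?_)
    (fun _ => Real.exp (c ^ 2)) fun x => ?_
  · have := continuous_gaussProd (N := N)
    fun_prop
  · have h1 : ‖x‖ ≤ ∑ i, ‖x i‖ := pi_norm_le_iff_of_nonneg (Finset.sum_nonneg fun _ _ =>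
      norm_nonneg _) |>.2 fun i => Finset.single_le_sum (f := fun i => ‖x i‖)
      (fun _ _ => norm_nonneg _) (Finset.mem_univ i)
    have h2 : Real.exp (c * ‖x‖) ≤ ∏ i, Real.exp (c * ‖x i‖) := by
      rw [← Real.exp_sum, ← Finset.mul_sum]
      exact Real.exp_le_exp.2 (mul_le_mul_of_nonneg_left h1 hc)
    rw [norm_mul, Complex.norm_real, Real.norm_of_nonneg (Real.exp_pos _).le, gaussProd, norm_prod]
    refine (mul_le_mul_of_nonneg_right h2 (by positivity)).trans ?_
    rw [← Finset.prod_mul_distrib]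
    refine Finset.prod_le_prod (fun _ _ => by positivity) fun i _ => ?_
    rw [norm_gauss]
    exact mul_exp_linear_le c (x i)

/-- Completeness: the Gaussian times `Ψ` has all exponential moments, so its Fourier transform is
the sum of its moment series. Orthogonality to all orbitals makes every moment vanish, and the
Gaussian has no zeros. -/
theorem eq_zero_of_orthogonal_orbitalLp {N : ℕ} {Ψ : L2 N}
    (hΨ : ∀ ν, inner ℂ (orbitalLp ν) Ψ = 0) : Ψ = 0 := by
  have hm := (Lp.memLp Ψ)
  have hexp : ∀ c : ℝ, 0 ≤ c →
      Integrable fun x : Conf N => Real.exp (c * ‖x‖) * ‖gaussProd x * Ψ x‖ := by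
    intro c hc
    refine (integrable_conj_mul (memLp_exp_mul_gaussProd c hc) hm).norm.congr
      (ae_of_all _ fun x => ?_)
    simp only [norm_mul, Complex.norm_conj, Complex.norm_real, Real.norm_eq_abs, Real.abs_exp]
    ring
  have hmeas : AEStronglyMeasurable (fun x => gaussProd x * Ψ x) volume :=
    continuous_gaussProd.aestronglyMeasurable.mul hm.1
  have hint : Integrable fun x => gaussProd x * Ψ x := by
    refine (hexp 0 le_rfl).mono' hmeas (ae_of_all _ fun x => ?_)
    simp
  have hzero : (fun x => gaussProd x * Ψ x) =ᵐ[volume] 0 := by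
    refine ae_eq_zero_of_integral_cexp_mul hint fun L => ?_
    have hs : HasSum (fun n : ℕ => ∫ x, ((L x * Complex.I) ^ n / n.factorial) *
        (gaussProd x * Ψ x)) (∫ x, Complex.exp (L x * Complex.I) * (gaussProd x * Ψ x)) := by
      refine hasSum_integral_of_dominated_convergence
        (fun n x => |L x| ^ n / n.factorial * ‖gaussProd x * Ψ x‖) (fun n => ?_)
        (fun n => ae_of_all _ fun x => ?_) (ae_of_all _ fun x => ?_) ?_ (ae_of_all _ fun x => ?_)
      · exact (Continuous.aestronglyMeasurable (by fun_prop)).mul hmeas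
      · rw [norm_mul]
        simp
      · exact (Real.summable_pow_div_factorial |L x|).mul_right _
      · have e : ∀ x, ∑' n : ℕ, |L x| ^ n / n.factorial * ‖gaussProd x * Ψ x‖ =
            Real.exp |L x| * ‖gaussProd x * Ψ x‖ := fun x => by
          rw [tsum_mul_right, Real.exp_eq_exp_ℝ, NormedSpace.exp_eq_tsum_div]
        simp_rw [e]
        refine (hexp ‖L‖ (norm_nonneg _)).mono' ?_ (ae_of_all _ fun x => ?_)
        · exact (Continuous.aestronglyMeasurable (by fun_prop)).mul hmeas.norm
        · rw [Real.norm_of_nonneg (by positivity)]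
          gcongr
          exact L.le_opNorm x
      · refine HasSum.mul_right _ ?_
        rw [Complex.exp_eq_exp_ℂ]
        exact NormedSpace.expSeries_div_hasSum_exp _
    have h0 : ∀ n : ℕ, ∫ x, ((L x * Complex.I) ^ n / n.factorial) * (gaussProd x * Ψ x) = 0 := by
      intro n
      have h1 := (polyFun_orthogonal hΨ (dual_pow_mem_polyFun L n)).2
      have e : ∀ x, ((L x * Complex.I) ^ n / n.factorial) * (gaussProd x * Ψ x) =
          (Complex.I ^ n / n.factorial) * (conj ((L x : ℂ) ^ n * gaussProd x) * Ψ x) := by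
        intro x
        simp only [map_mul, map_pow, Complex.conj_ofReal, conj_gaussProd]
        ring
      simp_rw [e]
      rw [integral_const_mul, h1, mul_zero]
    simp_rw [h0] at hs
    exact hs.unique hasSum_zero
  rw [Lp.eq_zero_iff_ae_eq_zero]
  filter_upwards [hzero] with x hx
  exact (mul_eq_zero.1 hx).resolve_left (gaussProd_ne_zero x)

/-- The Hilbert basis of `L²(ℝ^{2N})` that consists of products of complex Hermite functions. -/
def orbitalBasis (N : ℕ) : HilbertBasis (Fin N → ℕ × ℕ) ℂ (L2 N) :=
  HilbertBasis.mkOfOrthogonalEqBot (orthonormal_orbitalLp N) <| by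
    rw [Submodule.eq_bot_iff]
    intro Ψ hΨ
    refine eq_zero_of_orthogonal_orbitalLp fun ν => ?_
    exact (Submodule.mem_orthogonal _ _).1 hΨ _ (Submodule.subset_span ⟨ν, rfl⟩)

theorem orbitalBasis_apply {N : ℕ} (ν : Fin N → ℕ × ℕ) : orbitalBasis N ν = orbitalLp ν := by
  rw [orbitalBasis, HilbertBasis.coe_mkOfOrthogonalEqBot]

/-! ### Magnetic momenta of the basis functions -/

theorem fderiv_prod_single {N : ℕ} {f : Fin N → ℂ → ℂ} {i : Fin N} {x : Conf N}
    (hf : ∀ k, DifferentiableAt ℝ (f k) (x k)) (w : ℂ) :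
    fderiv ℝ (fun x : Conf N => ∏ k, f k (x k)) x (Pi.single i w) =
      fderiv ℝ (f i) (x i) w * ∏ k ∈ Finset.univ.erase i, f k (x k) := by
  have h : ∀ k ∈ Finset.univ, HasFDerivAt (fun x : Conf N => f k (x k))
      ((fderiv ℝ (f k) (x k)).comp (ContinuousLinearMap.proj k)) x := fun k _ =>
    (hf k).hasFDerivAt.comp x (ContinuousLinearMap.proj (R := ℝ) (φ := fun _ : Fin N => ℂ) k).hasFDerivAt
  rw [(HasFDerivAt.finsetProd h).fderiv, _root_.sum_apply,
    Finset.sum_eq_single i]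
  · simp [mul_comm]
  · intro k _ hk
    simp [Pi.single_eq_of_ne hk]
  · simp

theorem sqrt_succ_mul_inv (m n : ℕ) :
    √((n : ℝ) + 1) * (√(Real.pi * m.factorial * (n + 1).factorial))⁻¹ =
      (√(Real.pi * m.factorial * n.factorial))⁻¹ := by
  rw [Nat.factorial_succ]
  push_cast
  rw [show Real.pi * m.factorial * ((n + 1) * n.factorial) =
    ((n : ℝ) + 1) * (Real.pi * m.factorial * n.factorial) by ring,
    Real.sqrt_mul (by positivity), mul_inv, ← mul_assoc, mul_inv_cancel₀ (by positivity), one_mul]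

theorem orbital_raise (m n : ℕ) (z : ℂ) :
    (√((n : ℝ) + 1) : ℂ) * orbital (m, n + 1) z =
      ((√(Real.pi * m.factorial * n.factorial))⁻¹ : ℝ) * (hermiteC m (n + 1) z * gauss z) := by
  rw [orbital, ← mul_assoc, ← Complex.ofReal_mul, sqrt_succ_mul_inv]

theorem orbital_lower (m n : ℕ) (z : ℂ) :
    (√(n : ℝ) : ℂ) * orbital (m, n - 1) z =
      ((√(Real.pi * m.factorial * n.factorial))⁻¹ : ℝ) *
        ((n : ℂ) * hermiteC m (n - 1) z * gauss z) := by
  rcases n with _ | n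
  · simp
  · rw [orbital]
    have h : ((n + 1 : ℕ) : ℂ) = (√((n : ℝ) + 1) : ℂ) * (√((n : ℝ) + 1) : ℂ) := by
      rw [← Complex.ofReal_mul, Real.mul_self_sqrt (by positivity)]
      simp
    simp only [Nat.add_sub_cancel]
    rw [← sqrt_succ_mul_inv m n, h, Nat.cast_add, Nat.cast_one, Complex.ofReal_mul]
    ring

/-- The derivative is split so that the terms `z̄/2` and `-z/2` are exactly those cancelled by the
vector potential. What remains in the magnetic momentum is a pure raising and a pure lowering term.
-/
theorem hasFDerivAt_orbital (p : ℕ × ℕ) (z : ℂ) : HasFDerivAt (orbital p)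
    (wirtinger (1 / 2 * conj z * orbital p z - √((p.2 : ℝ) + 1) * orbital (p.1, p.2 + 1) z)
      (-(1 / 2) * z * orbital p z + √(p.2 : ℝ) * orbital (p.1, p.2 - 1) z)) z := by
  have h := HasFDerivAt.const_mul_wirtinger
    ((√(Real.pi * p.1.factorial * p.2.factorial))⁻¹ : ℝ)
    (HasFDerivAt.mul_wirtinger (hasFDerivAt_hermiteC p.1 p.2 z) (hasFDerivAt_gauss z))
  rw [orbital_raise, orbital_lower, orbital]
  refine h.congr_fderiv ?_
  congr 1
  · rw [hermiteC_succ]; ring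
  · ring

/-- Raise the Landau level of particle `i`. -/
def raise {N : ℕ} (ν : Fin N → ℕ × ℕ) (i : Fin N) : Fin N → ℕ × ℕ :=
  Function.update ν i ((ν i).1, (ν i).2 + 1)

/-- Lower the Landau level of particle `i`. -/
def lower {N : ℕ} (ν : Fin N → ℕ × ℕ) (i : Fin N) : Fin N → ℕ × ℕ :=
  Function.update ν i ((ν i).1, (ν i).2 - 1)

theorem orbitalProd_update {N : ℕ} (ν : Fin N → ℕ × ℕ) (k : Fin N) (p : ℕ × ℕ) (x : Conf N) :
    orbitalProd (Function.update ν k p) x = orbital p (x k) *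
      ∏ i ∈ Finset.univ.erase k, orbital (ν i) (x i) := by
  rw [orbitalProd, ← Finset.mul_prod_erase _ _ (Finset.mem_univ k), Function.update_self]
  congr 1
  refine Finset.prod_congr rfl fun i hi => ?_
  rw [Function.update_of_ne (Finset.ne_of_mem_erase hi)]

theorem orbitalProd_eq_mul {N : ℕ} (ν : Fin N → ℕ × ℕ) (k : Fin N) (x : Conf N) :
    orbitalProd ν x = orbital (ν k) (x k) *
      ∏ i ∈ Finset.univ.erase k, orbital (ν i) (x i) := by
  rw [orbitalProd, ← Finset.mul_prod_erase _ _ (Finset.mem_univ k)]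

theorem fderiv_orbitalProd {N : ℕ} (ν : Fin N → ℕ × ℕ) (i : Fin N) (x : Conf N) (w : ℂ) :
    fderiv ℝ (orbitalProd ν) x (Pi.single i w) =
      (1 / 2 * conj (x i) * orbitalProd ν x -
        √(((ν i).2 : ℝ) + 1) * orbitalProd (raise ν i) x) * w +
      (-(1 / 2) * x i * orbitalProd ν x + √((ν i).2 : ℝ) * orbitalProd (lower ν i) x) * conj w := by
  have h := fderiv_prod_single (i := i) (x := x) (f := fun k => orbital (ν k))
    (fun k => (contDiff_orbital (ν k)).differentiable (by simp) _) w
  rw [(hasFDerivAt_orbital (ν i) (x i)).fderiv] at h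
  rw [raise, lower, orbitalProd_update, orbitalProd_update, orbitalProd_eq_mul ν i]
  rw [wirtinger_apply] at h
  refine h.trans ?_
  ring

theorem magMomentum_zero_orbitalProd {N : ℕ} (ν : Fin N → ℕ × ℕ) (i : Fin N) (x : Conf N) :
    magMomentum i 0 (orbitalProd ν) x =
      Complex.I * √(((ν i).2 : ℝ) + 1) * orbitalProd (raise ν i) x
        - Complex.I * √((ν i).2 : ℝ) * orbitalProd (lower ν i) x := by
  have h : ((x i).im : ℂ) = -Complex.I * (x i - conj (x i)) / 2 := by
    rw [Complex.im_eq_sub_conj, div_eq_div_iff (by simp) (by norm_num)]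
    linear_combination 2 * (x i - conj (x i)) * Complex.I_mul_I
  simp only [magMomentum, dir, vecPot, Matrix.cons_val_zero, fderiv_orbitalProd, map_one,
    Complex.ofReal_neg]
  rw [h]
  ring

theorem magMomentum_one_orbitalProd {N : ℕ} (ν : Fin N → ℕ × ℕ) (i : Fin N) (x : Conf N) :
    magMomentum i 1 (orbitalProd ν) x =
      -(√(((ν i).2 : ℝ) + 1) * orbitalProd (raise ν i) x)
        - √((ν i).2 : ℝ) * orbitalProd (lower ν i) x := by
  simp only [magMomentum, dir, vecPot, Matrix.cons_val_one, Matrix.cons_val_fin_one,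
    fderiv_orbitalProd, Complex.conj_I]
  rw [Complex.re_eq_add_conj]
  linear_combination (-(1 / 2 * conj (x i) * orbitalProd ν x -
        √(((ν i).2 : ℝ) + 1) * orbitalProd (raise ν i) x) +
      (-(1 / 2) * x i * orbitalProd ν x + √((ν i).2 : ℝ) * orbitalProd (lower ν i) x)) *
      Complex.I_mul_I

/-! ### Weak magnetic momenta -/

theorem magMomentum_mul {N : ℕ} (i : Fin N) (k : Fin 2) {f g : Conf N → ℂ} {x : Conf N}
    (hf : DifferentiableAt ℝ f x) (hg : DifferentiableAt ℝ g x) :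
    magMomentum i k (fun x => f x * g x) x = f x * magMomentum i k g x
      - Complex.I * fderiv ℝ f x (Pi.single i (dir k)) * g x := by
  simp only [magMomentum]
  rw [fderiv_fun_mul hf hg]
  simp only [_root_.add_apply, _root_.smul_apply, smul_eq_mul]
  ring

theorem continuous_magMomentum {N : ℕ} (i : Fin N) (k : Fin 2) {φ : Conf N → ℂ}
    (hφ : ContDiff ℝ 1 φ) : Continuous (magMomentum i k φ) := by
  have h1 : Continuous fun x => fderiv ℝ φ x (Pi.single i (dir k)) :=
    (hφ.continuous_fderiv (by simp)).clm_apply continuous_const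
  have h2 : Continuous fun x : Conf N => ((vecPot k (x i) : ℝ) : ℂ) := by
    fin_cases k <;> simp only [vecPot] <;> simp <;> fun_prop
  have h3 := hφ.continuous
  unfold magMomentum
  fun_prop

theorem hasCompactSupport_magMomentum {N : ℕ} (i : Fin N) (k : Fin 2) {φ : Conf N → ℂ}
    (hφ : HasCompactSupport φ) : HasCompactSupport (magMomentum i k φ) := by
  have h1 : HasCompactSupport fun x => fderiv ℝ φ x (Pi.single i (dir k)) :=
    hφ.fderiv_apply (𝕜 := ℝ) _
  exact (h1.mul_left (f := fun _ => -Complex.I)).sub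
    (hφ.mul_left (f := fun x : Conf N => ((vecPot k (x i) : ℝ) : ℂ)))

theorem IsWeakMagMomentum.unique {N : ℕ} {i : Fin N} {k : Fin 2} {Ψ G G' : L2 N}
    (h : IsWeakMagMomentum i k Ψ G) (h' : IsWeakMagMomentum i k Ψ G') : G = G' := by
  have hloc : LocallyIntegrable (fun x => (G - G') x) volume :=
    (Lp.memLp (G - G')).locallyIntegrable (by norm_num)
  have hz : ∀ᵐ x, (G - G') x = 0 := by
    refine ae_eq_zero_of_integral_contDiff_smul_eq_zero hloc fun g hg hgs => ?_
    have hφ : ContDiff ℝ ∞ fun x => (g x : ℂ) := Complex.ofRealCLM.contDiff.comp hg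
    have hφs : HasCompactSupport fun x => (g x : ℂ) := hgs.comp_left (g := fun t : ℝ => (t : ℂ)) (by simp)
    have hφL : MemLp (fun x => (g x : ℂ)) 2 volume :=
      hφ.continuous.memLp_of_hasCompactSupport hφs
    have h1 := (h _ hφ hφs).symm.trans (h' _ hφ hφs)
    have h2 : inner ℂ (hφL.toLp _) (G - G') = 0 := by
      rw [inner_sub_right, inner_toLp_left, inner_toLp_left, sub_eq_zero]
      exact h1
    rw [inner_toLp_left] at h2
    rw [← h2]
    refine integral_congr_ae (ae_of_all _ fun x => ?_)
    simp
  exact sub_eq_zero.1 ((Lp.eq_zero_iff_ae_eq_zero).2 hz)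

/-- As an identity between inner products in `L²`, the definition visibly passes to sums, multiples
and limits. -/
theorem isWeakMagMomentum_iff {N : ℕ} {i : Fin N} {k : Fin 2} {Ψ G : L2 N} :
    IsWeakMagMomentum i k Ψ G ↔ ∀ (φ : Conf N → ℂ) (hφ : ContDiff ℝ ∞ φ)
      (hs : HasCompactSupport φ),
      inner ℂ (((continuous_magMomentum i k (hφ.of_le (by simp))).memLp_of_hasCompactSupport
        (hasCompactSupport_magMomentum i k hs)).toLp (magMomentum i k φ)) Ψ =
      inner ℂ ((hφ.continuous.memLp_of_hasCompactSupport hs).toLp φ) G := by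
  simp_rw [inner_toLp_left]
  rfl

theorem IsWeakMagMomentum.add {N : ℕ} {i : Fin N} {k : Fin 2} {Ψ G Ψ' G' : L2 N}
    (h : IsWeakMagMomentum i k Ψ G) (h' : IsWeakMagMomentum i k Ψ' G') :
    IsWeakMagMomentum i k (Ψ + Ψ') (G + G') := by
  rw [isWeakMagMomentum_iff] at *
  intro φ hφ hs
  rw [inner_add_right, inner_add_right, h φ hφ hs, h' φ hφ hs]

theorem IsWeakMagMomentum.smul {N : ℕ} {i : Fin N} {k : Fin 2} {Ψ G : L2 N} (c : ℂ)
    (h : IsWeakMagMomentum i k Ψ G) : IsWeakMagMomentum i k (c • Ψ) (c • G) := by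
  rw [isWeakMagMomentum_iff] at *
  intro φ hφ hs
  rw [inner_smul_right, inner_smul_right, h φ hφ hs]

theorem IsWeakMagMomentum.of_tendsto {N : ℕ} {i : Fin N} {k : Fin 2} {Ψ G : ℕ → L2 N}
    {Ψ' G' : L2 N} (h : ∀ n, IsWeakMagMomentum i k (Ψ n) (G n)) (hΨ : Tendsto Ψ atTop (𝓝 Ψ'))
    (hG : Tendsto G atTop (𝓝 G')) : IsWeakMagMomentum i k Ψ' G' := by
  simp_rw [isWeakMagMomentum_iff] at *
  intro φ hφ hs
  refine tendsto_nhds_unique (tendsto_const_nhds.inner hΨ) ?_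
  simp_rw [h _ φ hφ hs]
  exact tendsto_const_nhds.inner hG

/-- Square integrable smooth functions are admissible test functions if their magnetic momentum is
square integrable. -/
theorem IsWeakMagMomentum.integral_eq {N : ℕ} {i : Fin N} {k : Fin 2} {Ψ G : L2 N}
    (h : IsWeakMagMomentum i k Ψ G) {φ : Conf N → ℂ} (hφ : ContDiff ℝ ∞ φ)
    (hφL : MemLp φ 2 volume) (hφL' : MemLp (magMomentum i k φ) 2 volume) :
    ∫ x, conj (magMomentum i k φ x) * Ψ x = ∫ x, conj (φ x) * G x := by
  -- The test function is cut off by `χ (r n • x)`, which is one on the ball of radius `n + 1`.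
  -- Differentiating the cutoff contributes a term of size `r n`, which disappears in the limit.
  let b : ContDiffBump (0 : Conf N) := ⟨1, 2, one_pos, one_lt_two⟩
  set χ : Conf N → ℂ := fun x => (b x : ℂ) with hχ
  have hb : ContDiff ℝ ∞ b := b.contDiff
  have hχd : ContDiff ℝ ∞ χ := Complex.ofRealCLM.contDiff.comp hb
  have hχs : HasCompactSupport χ :=
    b.hasCompactSupport.comp_left (g := fun t : ℝ => (t : ℂ)) (by simp)
  have hχ1 : ∀ x, ‖χ x‖ ≤ 1 := fun x => by
    rw [hχ, Complex.norm_real, Real.norm_of_nonneg b.nonneg]; exact b.le_one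
  set r : ℕ → ℝ := fun n => ((n : ℝ) + 1)⁻¹ with hr
  have hr0 : ∀ n, 0 < r n := fun n => by simp only [hr]; positivity
  have hr1 : ∀ n, r n ≤ 1 := fun n => inv_le_one_of_one_le₀ (by linarith [Nat.cast_nonneg (α := ℝ) n])
  have hrlim : Tendsto r atTop (𝓝 0) := tendsto_inv_atTop_zero.comp
    (tendsto_atTop_add_const_right _ _ tendsto_natCast_atTop_atTop)
  obtain ⟨C, hC⟩ : ∃ C, ∀ x, ‖fderiv ℝ χ x (Pi.single i (dir k))‖ ≤ C :=
    ((hχs.fderiv_apply (𝕜 := ℝ) _).exists_bound_of_continuous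
      ((hχd.continuous_fderiv (by simp)).clm_apply continuous_const))
  set χn : ℕ → Conf N → ℂ := fun n x => χ (r n • x) with hχn
  have hχnd : ∀ n, ContDiff ℝ ∞ (χn n) := fun n => hχd.comp (contDiff_const_smul _)
  have hχnf : ∀ n x, fderiv ℝ (χn n) x (Pi.single i (dir k)) =
      r n * fderiv ℝ χ (r n • x) (Pi.single i (dir k)) := by
    intro n x
    have h1 : HasFDerivAt (fun x : Conf N => r n • x)
      (r n • ContinuousLinearMap.id ℝ (Conf N)) x := (hasFDerivAt_id x).const_smul (r n)
    have h2 := ((hχd.differentiable (by simp)) (r n • x)).hasFDerivAt.comp x h1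
    rw [show χn n = χ ∘ fun x => r n • x from rfl]
    refine (congrArg (fun T : Conf N →L[ℝ] ℂ => T (Pi.single i (dir k))) h2.fderiv).trans ?_
    simp
  have hχlim : ∀ x, Tendsto (fun n => χn n x) atTop (𝓝 1) := by
    intro x
    have h1 : Tendsto (fun n => r n • x) atTop (𝓝 0) := by
      simpa using hrlim.smul_const x
    have h2 : χ 0 = 1 := by
      simp only [hχ]
      rw [b.one_of_mem_closedBall (by simp [b])]
      simp
    rw [← h2]
    exact (hχd.continuous.tendsto 0).comp h1
  have htest : ∀ n, ∫ x, conj (magMomentum i k (fun x => χn n x * φ x) x) * Ψ x =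
      ∫ x, conj (χn n x * φ x) * G x := by
    intro n
    refine h _ ((hχnd n).mul hφ) ?_
    have h1 : HasCompactSupport (χn n) :=
      hχs.comp_homeomorph (Homeomorph.smulOfNeZero (r n) (hr0 n).ne')
    exact h1.mul_right
  have hmag : ∀ n x, magMomentum i k (fun x => χn n x * φ x) x = χn n x * magMomentum i k φ x
      - Complex.I * (r n * fderiv ℝ χ (r n • x) (Pi.single i (dir k))) * φ x := by
    intro n x
    rw [magMomentum_mul i k ((hχnd n).differentiable (by simp) x) (hφ.differentiable (by simp) x),
      hχnf]
  have hΨ := Lp.memLp Ψ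
  have hG := Lp.memLp G
  have hL : Tendsto (fun n => ∫ x, conj (magMomentum i k (fun x => χn n x * φ x) x) * Ψ x) atTop
      (𝓝 (∫ x, conj (magMomentum i k φ x) * Ψ x)) := by
    refine tendsto_integral_of_dominated_convergence
      (fun x => ‖conj (magMomentum i k φ x) * Ψ x‖ + C * ‖conj (φ x) * Ψ x‖) (fun n => ?_)
      ((integrable_conj_mul hφL' hΨ).norm.add ((integrable_conj_mul hφL hΨ).norm.const_mul C))
      (fun n => ae_of_all _ fun x => ?_) (ae_of_all _ fun x => ?_)
    · refine AEStronglyMeasurable.mul ?_ hΨ.1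
      refine (Complex.continuous_conj.comp (continuous_magMomentum i k ?_)).aestronglyMeasurable
      exact ((hχnd n).mul hφ).of_le (by simp)
    · rw [hmag]
      rw [norm_mul, norm_mul, norm_mul, Complex.norm_conj, Complex.norm_conj, Complex.norm_conj,
        ← mul_assoc C, ← add_mul]
      refine mul_le_mul_of_nonneg_right ?_ (norm_nonneg _)
      refine (norm_sub_le _ _).trans (add_le_add ?_ ?_)
      · rw [norm_mul]
        exact mul_le_of_le_one_left (norm_nonneg _) (hχ1 _)
      · rw [norm_mul, norm_mul, norm_mul, Complex.norm_I, one_mul, Complex.norm_real,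
          Real.norm_of_nonneg (hr0 n).le]
        refine mul_le_mul_of_nonneg_right ?_ (norm_nonneg _)
        calc r n * ‖fderiv ℝ χ (r n • x) (Pi.single i (dir k))‖
            ≤ 1 * ‖fderiv ℝ χ (r n • x) (Pi.single i (dir k))‖ :=
              mul_le_mul_of_nonneg_right (hr1 n) (norm_nonneg _)
          _ ≤ C := by rw [one_mul]; exact hC _
    · refine Tendsto.mul ?_ tendsto_const_nhds
      refine (Complex.continuous_conj.tendsto _).comp ?_
      simp_rw [hmag]
      have h1 : Tendsto (fun n => (r n : ℂ) * fderiv ℝ χ (r n • x) (Pi.single i (dir k))) atTop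
          (𝓝 0) := by
        refine squeeze_zero_norm (a := fun n => r n * C) (fun n => ?_) (by
          simpa using hrlim.mul_const C)
        rw [norm_mul, Complex.norm_real, Real.norm_of_nonneg (hr0 n).le]
        exact mul_le_mul_of_nonneg_left (hC _) (hr0 n).le
      simpa using ((hχlim x).mul_const (magMomentum i k φ x)).sub
        ((h1.const_mul Complex.I).mul_const (φ x))
  have hR : Tendsto (fun n => ∫ x, conj (χn n x * φ x) * G x) atTop
      (𝓝 (∫ x, conj (φ x) * G x)) := by
    refine tendsto_integral_of_dominated_convergence (fun x => ‖conj (φ x) * G x‖) (fun n => ?_)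
      (integrable_conj_mul hφL hG).norm
      (fun n => ae_of_all _ fun x => ?_) (ae_of_all _ fun x => ?_)
    · refine AEStronglyMeasurable.mul ?_ hG.1
      exact (Complex.continuous_conj.comp
        ((hχnd n).continuous.mul hφ.continuous)).aestronglyMeasurable
    · simp only [norm_mul, Complex.norm_conj]
      refine mul_le_mul_of_nonneg_right ?_ (norm_nonneg _)
      exact mul_le_of_le_one_left (norm_nonneg _) (hχ1 _)
    · refine Tendsto.mul ?_ tendsto_const_nhds
      refine (Complex.continuous_conj.tendsto _).comp ?_
      simpa using (hχlim x).mul_const (φ x)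
  simp_rw [htest] at hL
  exact tendsto_nhds_unique hL hR

/-! ### Weak momenta in the Hermite basis and their commutation relation -/

theorem memLp_magMomentum_orbitalProd {N : ℕ} (ν : Fin N → ℕ × ℕ) (i : Fin N) (k : Fin 2) :
    MemLp (magMomentum i k (orbitalProd ν)) 2 volume := by
  have h1 := (memLp_orbitalProd (raise ν i))
  have h2 := (memLp_orbitalProd (lower ν i))
  fin_cases k
  · exact ((h1.const_mul _).sub (h2.const_mul _)).ae_eq
      (ae_of_all _ fun x => (magMomentum_zero_orbitalProd ν i x).symm)
  · exact ((h1.const_mul _).neg.sub (h2.const_mul _)).ae_eq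
      (ae_of_all _ fun x => (magMomentum_one_orbitalProd ν i x).symm)

theorem inner_orbitalLp_zero {N : ℕ} {i : Fin N} {Ψ G : L2 N} (h : IsWeakMagMomentum i 0 Ψ G)
    (ν : Fin N → ℕ × ℕ) : inner ℂ (orbitalLp ν) G =
      -(Complex.I * √(((ν i).2 : ℝ) + 1) * inner ℂ (orbitalLp (raise ν i)) Ψ)
        + Complex.I * √((ν i).2 : ℝ) * inner ℂ (orbitalLp (lower ν i)) Ψ := by
  rw [orbitalLp, inner_toLp_left, ← h.integral_eq (contDiff_orbitalProd ν) (memLp_orbitalProd ν)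
    (memLp_magMomentum_orbitalProd ν i 0), orbitalLp, inner_toLp_left, orbitalLp, inner_toLp_left,
    ← integral_const_mul, ← integral_const_mul, ← integral_neg, ← integral_add]
  · refine integral_congr_ae (ae_of_all _ fun x => ?_)
    simp only [magMomentum_zero_orbitalProd, map_sub, map_mul, Complex.conj_I, Complex.conj_ofReal]
    ring
  · exact ((integrable_conj_mul (memLp_orbitalProd _) (Lp.memLp Ψ)).const_mul _).neg
  · exact (integrable_conj_mul (memLp_orbitalProd _) (Lp.memLp Ψ)).const_mul _

theorem inner_orbitalLp_one {N : ℕ} {i : Fin N} {Ψ G : L2 N} (h : IsWeakMagMomentum i 1 Ψ G)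
    (ν : Fin N → ℕ × ℕ) : inner ℂ (orbitalLp ν) G =
      -(√(((ν i).2 : ℝ) + 1) * inner ℂ (orbitalLp (raise ν i)) Ψ)
        + -(√((ν i).2 : ℝ) * inner ℂ (orbitalLp (lower ν i)) Ψ) := by
  rw [orbitalLp, inner_toLp_left, ← h.integral_eq (contDiff_orbitalProd ν) (memLp_orbitalProd ν)
    (memLp_magMomentum_orbitalProd ν i 1), orbitalLp, inner_toLp_left, orbitalLp, inner_toLp_left,
    ← integral_const_mul, ← integral_const_mul, ← integral_neg, ← integral_neg, ← integral_add]
  · refine integral_congr_ae (ae_of_all _ fun x => ?_)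
    simp only [magMomentum_one_orbitalProd, map_sub, map_neg, map_mul, Complex.conj_ofReal]
    ring
  · exact ((integrable_conj_mul (memLp_orbitalProd _) (Lp.memLp Ψ)).const_mul _).neg
  · exact ((integrable_conj_mul (memLp_orbitalProd _) (Lp.memLp Ψ)).const_mul _).neg

theorem raise_injective {N : ℕ} (i : Fin N) :
    Function.Injective fun ν : Fin N → ℕ × ℕ => raise ν i := by
  intro ν ν' h
  funext j
  have h1 := congrFun h j
  rcases eq_or_ne j i with rfl | hj
  · simp only [raise, Function.update_self, Prod.mk.injEq, Nat.add_right_cancel_iff] at h1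
    exact Prod.ext h1.1 h1.2
  · simpa [raise, Function.update_of_ne hj] using h1

theorem raise_lower {N : ℕ} {ν : Fin N → ℕ × ℕ} {i : Fin N} (h : (ν i).2 ≠ 0) :
    raise (lower ν i) i = ν := by
  funext j
  rcases eq_or_ne j i with rfl | hj
  · simp only [raise, lower, Function.update_self]
    exact Prod.ext rfl (by simp; omega)
  · simp [raise, lower, Function.update_of_ne hj]

theorem lower_raise {N : ℕ} (ν : Fin N → ℕ × ℕ) (i : Fin N) : lower (raise ν i) i = ν := by
  funext j
  rcases eq_or_ne j i with rfl | hj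
  · simp [raise, lower]
  · simp [raise, lower, Function.update_of_ne hj]

theorem mem_range_raise {N : ℕ} {ν : Fin N → ℕ × ℕ} {i : Fin N} (h : (ν i).2 ≠ 0) :
    ν ∈ Set.range fun ν : Fin N → ℕ × ℕ => raise ν i := ⟨lower ν i, raise_lower h⟩

theorem sqrt_mul_sqrt_ofReal {r : ℝ} (hr : 0 ≤ r) : (√r : ℂ) * (√r : ℂ) = r := by
  rw [← Complex.ofReal_mul, Real.mul_self_sqrt hr]

/-- On coefficients, `P₀ + iP₁` is a shift: the coefficient at `ν` is `-2i√(n+1)` times the one of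
the state at `raise ν i`. Parseval turns this into the weight `4n`; indices outside the range of
`raise` have `n = 0` and do not matter. -/
theorem hasSum_inner_lowering {N : ℕ} {i : Fin N} {Φ Ψ : L2 N} {F G : Fin 2 → L2 N}
    (hF : ∀ k, IsWeakMagMomentum i k Φ (F k)) (hG : ∀ k, IsWeakMagMomentum i k Ψ (G k)) :
    HasSum (fun ν : Fin N → ℕ × ℕ => 4 * ((ν i).2 : ℂ) *
        (inner ℂ Φ (orbitalLp ν) * inner ℂ (orbitalLp ν) Ψ))
      (inner ℂ (F 0 + Complex.I • F 1) (G 0 + Complex.I • G 1)) := by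
  have key : ∀ {Ψ : L2 N} {G : Fin 2 → L2 N}, (∀ k, IsWeakMagMomentum i k Ψ (G k)) → ∀ ν,
      inner ℂ (orbitalLp ν) (G 0 + Complex.I • G 1) =
        -(2 * Complex.I * √(((ν i).2 : ℝ) + 1)) * inner ℂ (orbitalLp (raise ν i)) Ψ := by
    intro Ψ G hG ν
    rw [inner_add_right, inner_smul_right, inner_orbitalLp_zero (hG 0), inner_orbitalLp_one (hG 1)]
    ring
  have h := (orbitalBasis N).hasSum_inner_mul_inner (F 0 + Complex.I • F 1)
    (G 0 + Complex.I • G 1)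
  rw [← (raise_injective i).hasSum_iff]
  · refine h.congr_fun fun ν => ?_
    simp only [Function.comp, orbitalBasis_apply]
    rw [key hG, ← inner_conj_symm (F 0 + Complex.I • F 1), key hF, ← inner_conj_symm Φ]
    simp only [raise, Function.update_self, map_mul, map_neg, map_ofNat, Complex.conj_I,
      Complex.conj_ofReal]
    have h2 := sqrt_mul_sqrt_ofReal (r := ((ν i).2 : ℝ) + 1) (by positivity)
    push_cast at h2 ⊢
    linear_combination (-4 * conj
      (inner ℂ (orbitalLp (Function.update ν i ((ν i).1, (ν i).2 + 1))) Φ) *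
      inner ℂ (orbitalLp (Function.update ν i ((ν i).1, (ν i).2 + 1))) Ψ) *
      (h2 - (√(((ν i).2 : ℝ) + 1) : ℂ) * (√(((ν i).2 : ℝ) + 1) : ℂ) * Complex.I_mul_I)
  · intro ν hν
    have : (ν i).2 = 0 := by
      by_contra h0
      exact hν (mem_range_raise h0)
    simp [this]

/-- The combination `P₀ - iP₁` shifts in the opposite direction and yields the weight `4n + 4`. The
difference of the two weights is a constant, which is the commutator of the momenta without any
second derivative. -/
theorem hasSum_inner_raising {N : ℕ} {i : Fin N} {Φ Ψ : L2 N} {F G : Fin 2 → L2 N}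
    (hF : ∀ k, IsWeakMagMomentum i k Φ (F k)) (hG : ∀ k, IsWeakMagMomentum i k Ψ (G k)) :
    HasSum (fun ν : Fin N → ℕ × ℕ => (4 * ((ν i).2 : ℂ) + 4) *
        (inner ℂ Φ (orbitalLp ν) * inner ℂ (orbitalLp ν) Ψ))
      (inner ℂ (F 0 - Complex.I • F 1) (G 0 - Complex.I • G 1)) := by
  have key : ∀ {Ψ : L2 N} {G : Fin 2 → L2 N}, (∀ k, IsWeakMagMomentum i k Ψ (G k)) → ∀ ν,
      inner ℂ (orbitalLp ν) (G 0 - Complex.I • G 1) =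
        (2 * Complex.I * √((ν i).2 : ℝ)) * inner ℂ (orbitalLp (lower ν i)) Ψ := by
    intro Ψ G hG ν
    rw [inner_sub_right, inner_smul_right, inner_orbitalLp_zero (hG 0), inner_orbitalLp_one (hG 1)]
    ring
  have h := (orbitalBasis N).hasSum_inner_mul_inner (F 0 - Complex.I • F 1)
    (G 0 - Complex.I • G 1)
  rw [← (raise_injective i).hasSum_iff] at h
  · refine h.congr_fun fun ν => ?_
    simp only [Function.comp, orbitalBasis_apply]
    rw [key hG, ← inner_conj_symm (F 0 - Complex.I • F 1), key hF, ← inner_conj_symm Φ, lower_raise]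
    simp only [raise, Function.update_self, map_mul, map_ofNat, Complex.conj_I,
      Complex.conj_ofReal]
    have h2 := sqrt_mul_sqrt_ofReal (r := (((ν i).2 + 1 : ℕ) : ℝ)) (by positivity)
    push_cast at h2 ⊢
    linear_combination (-4) * (conj (inner ℂ (orbitalLp ν) Φ) * inner ℂ (orbitalLp ν) Ψ) *
      (h2 - (√(((ν i).2 : ℝ) + 1) : ℂ) * (√(((ν i).2 : ℝ) + 1) : ℂ) * Complex.I_mul_I)
  · intro ν hν
    have h0 : (ν i).2 = 0 := by
      by_contra h0
      exact hν (mem_range_raise h0)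
    rw [orbitalBasis_apply, key hG, h0]
    simp

/-- The commutation relation of the magnetic momenta in weak form. -/
theorem sum_inner_weakMagMomentum {N : ℕ} {i : Fin N} {Φ Ψ : L2 N} {F G : Fin 2 → L2 N}
    (hF : ∀ k, IsWeakMagMomentum i k Φ (F k)) (hG : ∀ k, IsWeakMagMomentum i k Ψ (G k)) :
    (∑ k, inner ℂ (F k) (G k)) - 2 * inner ℂ Φ Ψ =
      inner ℂ (F 0 + Complex.I • F 1) (G 0 + Complex.I • G 1) := by
  have h1 := hasSum_inner_lowering hF hG
  have h2 := hasSum_inner_raising hF hG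
  have h3 := (orbitalBasis N).hasSum_inner_mul_inner Φ Ψ
  simp_rw [orbitalBasis_apply] at h3
  have h4 : inner ℂ (F 0 - Complex.I • F 1) (G 0 - Complex.I • G 1) =
      inner ℂ (F 0 + Complex.I • F 1) (G 0 + Complex.I • G 1) + 4 * inner ℂ Φ Ψ := by
    refine h2.unique ((h1.add (h3.mul_left 4)).congr_fun fun ν => ?_)
    ring
  have h5 : inner ℂ (F 0 - Complex.I • F 1) (G 0 - Complex.I • G 1) +
      inner ℂ (F 0 + Complex.I • F 1) (G 0 + Complex.I • G 1) =
      2 * (inner ℂ (F 0) (G 0) + inner ℂ (F 1) (G 1)) := by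
    simp only [inner_add_left, inner_add_right, inner_sub_left, inner_sub_right, inner_smul_left,
      inner_smul_right, Complex.conj_I]
    linear_combination (-2) * inner ℂ (F 1) (G 1) * Complex.I_mul_I
  rw [Fin.sum_univ_two]
  linear_combination (-1 / 2) * h5 + (1 / 2) * h4

/-- Continuously differentiable functions have their classical magnetic momentum as weak one. -/
theorem isWeakMagMomentum_toLp {N : ℕ} (i : Fin N) (k : Fin 2) {u : Conf N → ℂ}
    (hu : ContDiff ℝ 1 u) (huL : MemLp u 2 volume) (huL' : MemLp (magMomentum i k u) 2 volume) :
    IsWeakMagMomentum i k (huL.toLp u) (huL'.toLp _) := by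
  intro φ hφ hs
  have hL : ∫ x, star (magMomentum i k φ x) * (huL.toLp u) x =
      ∫ x, conj (magMomentum i k φ x) * u x := by
    refine integral_congr_ae ?_
    filter_upwards [huL.coeFn_toLp] with x hx
    rw [hx]; rfl
  have hR : ∫ x, star (φ x) * (huL'.toLp _) x = ∫ x, conj (φ x) * magMomentum i k u x := by
    refine integral_congr_ae ?_
    filter_upwards [huL'.coeFn_toLp] with x hx
    rw [hx]; rfl
  rw [hL, hR]
  set w : Conf N := Pi.single i (dir k) with hw
  have hφd : Differentiable ℝ φ := hφ.differentiable (by simp)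
  have hud : Differentiable ℝ u := hu.differentiable (by simp)
  set φc : Conf N → ℂ := fun x => conj (φ x) with hφc
  have hφcd : ContDiff ℝ ∞ φc := Complex.conjCLE.contDiff.comp hφ
  have hφcs : HasCompactSupport φc := hs.comp_left (g := fun z : ℂ => conj z) (by simp)
  have hφcf : ∀ x, fderiv ℝ φc x w = conj (fderiv ℝ φ x w) := by
    intro x
    have := ((Complex.conjCLE : ℂ →L[ℝ] ℂ).hasFDerivAt (x := φ x)).comp x (hφd x).hasFDerivAt
    rw [show φc = (Complex.conjCLE : ℂ →L[ℝ] ℂ) ∘ φ from rfl, this.fderiv]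
    simp
  have c1 : Continuous fun x => fderiv ℝ φc x w :=
    (hφcd.continuous_fderiv (by simp)).clm_apply continuous_const
  have c2 : Continuous fun x => fderiv ℝ u x w :=
    (hu.continuous_fderiv (by simp)).clm_apply continuous_const
  have c3 : Continuous fun x : Conf N => ((vecPot k (x i) : ℝ) : ℂ) := by
    fin_cases k <;> simp only [vecPot] <;> simp <;> fun_prop
  have i1 : Integrable fun x => fderiv ℝ φc x w * u x :=
    (c1.mul hu.continuous).integrable_of_hasCompactSupport
      ((hφcs.fderiv_apply (𝕜 := ℝ) w).mul_right)
  have i2 : Integrable fun x => φc x * fderiv ℝ u x w :=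
    (hφcd.continuous.mul c2).integrable_of_hasCompactSupport hφcs.mul_right
  have i3 : Integrable fun x => φc x * u x :=
    (hφcd.continuous.mul hu.continuous).integrable_of_hasCompactSupport hφcs.mul_right
  have i4 : Integrable fun x => φc x * (((vecPot k (x i) : ℝ) : ℂ) * u x) :=
    (hφcd.continuous.mul (c3.mul hu.continuous)).integrable_of_hasCompactSupport hφcs.mul_right
  have parts := integral_mul_fderiv_eq_neg_fderiv_mul_of_integrable i1 i2 i3
    (fun x _ => hφcd.differentiable (by simp) x) (fun x _ => hud x)
  have e1 : ∀ x, conj (magMomentum i k φ x) * u x =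
      Complex.I * (fderiv ℝ φc x w * u x) - φc x * (((vecPot k (x i) : ℝ) : ℂ) * u x) := by
    intro x
    rw [hφcf]
    simp only [magMomentum, map_sub, map_mul, map_neg, Complex.conj_I, Complex.conj_ofReal, hφc,
      hw]
    ring
  have e2 : ∀ x, conj (φ x) * magMomentum i k u x =
      -Complex.I * (φc x * fderiv ℝ u x w) - φc x * (((vecPot k (x i) : ℝ) : ℂ) * u x) := by
    intro x
    simp only [magMomentum, hφc, hw]
    ring
  simp_rw [e1, e2]
  rw [integral_sub (i1.const_mul _) i4, integral_sub (i2.const_mul _) i4, integral_const_mul,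
    integral_const_mul, parts]
  ring

/-! ### Existence and uniqueness of minimizers from a spectral gap -/

section Abstract

variable {H K : Type*} [NormedAddCommGroup H] [InnerProductSpace ℂ H]
  [NormedAddCommGroup K] [InnerProductSpace ℂ K]

/-- A nonnegative quadratic form of the type `‖S Φ‖² - E ‖Φ‖²` that vanishes at `Ψ`
has `Ψ` in the kernel of its polarization. -/
theorem inner_eq_of_minimizer {D : Submodule ℂ H} (S : D →ₗ[ℂ] K) {E : ℝ}
    (hE : ∀ Φ : D, E * ‖Φ‖ ^ 2 ≤ ‖S Φ‖ ^ 2) {Ψ : D} (hΨ : ‖S Ψ‖ ^ 2 = E * ‖Ψ‖ ^ 2) (Φ : D) :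
    inner ℂ (S Φ) (S Ψ) = E * inner ℂ (Φ : H) (Ψ : H) := by
  have key : ∀ Φ : D, (inner ℂ (S Φ) (S Ψ)).re = E * (inner ℂ (Φ : H) (Ψ : H)).re := by
    intro Φ
    -- The nonnegative form at `tΦ + Ψ` is a quadratic polynomial in `t` without constant term, so
    -- its discriminant forces the linear coefficient to vanish.
    have h : ∀ t : ℝ, 0 ≤ (‖S Φ‖ ^ 2 - E * ‖Φ‖ ^ 2) * (t * t) +
        2 * ((inner ℂ (S Φ) (S Ψ)).re - E * (inner ℂ (Φ : H) (Ψ : H)).re) * t + 0 := by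
      intro t
      have h1 := hE ((t : ℂ) • Φ + Ψ)
      rw [map_add, map_smul] at h1
      have e1 := norm_add_sq (𝕜 := ℂ) ((t : ℂ) • S Φ) (S Ψ)
      have e2 := norm_add_sq (𝕜 := ℂ) ((t : ℂ) • (Φ : H)) (Ψ : H)
      rw [inner_smul_left, norm_smul] at e1 e2
      have e3 : ‖(t : ℂ) • Φ + Ψ‖ = ‖(t : ℂ) • (Φ : H) + (Ψ : H)‖ := rfl
      rw [e3, e2, e1] at h1
      simp only [Complex.conj_ofReal, RCLike.re_to_complex, Complex.re_ofReal_mul,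
        Complex.norm_real, Real.norm_eq_abs, mul_pow, sq_abs] at h1
      have e4 : ‖(Φ : H)‖ = ‖Φ‖ := rfl
      have e5 : ‖(Ψ : H)‖ = ‖Ψ‖ := rfl
      rw [e4, e5] at h1
      nlinarith
    have := discrim_le_zero h
    rw [discrim] at this
    nlinarith [sq_nonneg ((inner ℂ (S Φ) (S Ψ)).re - E * (inner ℂ (Φ : H) (Ψ : H)).re)]
  apply Complex.ext
  · rw [key, Complex.re_ofReal_mul]
  -- The imaginary part is the real part with `iΦ` in place of `Φ`.
  · have h := key (Complex.I • Φ)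
    rw [map_smul, inner_smul_left, Submodule.coe_smul, inner_smul_left] at h
    simpa using h

/-- Let `E` be the infimum of `‖SΨ‖²` over unit vectors and `Q = ‖S·‖² - E‖·‖²`. Because of the
trial vector `T`, `E < g`, so `Q ≥ (g - E)‖·‖²` on the orthogonal complement of `L`. Normalizing a
minimizing sequence by `⟨L, p⟩ = 1` puts all differences into this complement, while `Q` of a
difference is small by the parallelogram law. The sequence is therefore Cauchy in the graph norm and
its limit is a minimizer. The same argument with two minimizers gives uniqueness. No compact
embedding enters. -/
theorem exists_minimizer_of_gap [CompleteSpace H] [CompleteSpace K] {D : Submodule ℂ H} (S : D →ₗ[ℂ] K)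
    (hclosed : ∀ (u : ℕ → D) (Ψ : H) (ξ : K), Tendsto (fun n => (u n : H)) atTop (𝓝 Ψ) →
      Tendsto (fun n => S (u n)) atTop (𝓝 ξ) → ∃ h : Ψ ∈ D, S ⟨Ψ, h⟩ = ξ)
    (L : H) {g C : ℝ}
    (hgap : ∀ Ψ : D, g * ‖Ψ‖ ^ 2 - C * ‖(inner ℂ L (Ψ : H) : ℂ)‖ ^ 2 ≤ ‖S Ψ‖ ^ 2)
    (T : D) (hT : ‖S T‖ ^ 2 < g * ‖T‖ ^ 2) :
    ∃ (Ψ : D) (E : ℝ), ‖Ψ‖ = 1 ∧ ‖S Ψ‖ ^ 2 = E ∧ (∀ Φ : D, E * ‖Φ‖ ^ 2 ≤ ‖S Φ‖ ^ 2) ∧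
      ∀ Φ : D, ‖S Φ‖ ^ 2 = E * ‖Φ‖ ^ 2 → ∃ c : ℂ, Φ = c • Ψ := by
  set A : Set ℝ := {e | ∃ Ψ : D, ‖Ψ‖ = 1 ∧ ‖S Ψ‖ ^ 2 = e} with hA
  have hT0 : T ≠ 0 := by rintro rfl; simp at hT
  have hTn : 0 < ‖T‖ := norm_pos_iff.2 hT0
  have hunit : ∀ Φ : D, Φ ≠ 0 → ‖((‖Φ‖⁻¹ : ℝ) : ℂ) • Φ‖ = 1 ∧
      ‖S (((‖Φ‖⁻¹ : ℝ) : ℂ) • Φ)‖ ^ 2 = ‖S Φ‖ ^ 2 / ‖Φ‖ ^ 2 := by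
    intro Φ h0
    have hn : 0 < ‖Φ‖ := norm_pos_iff.2 h0
    constructor
    · rw [norm_smul, Complex.norm_real, Real.norm_of_nonneg (by positivity),
        inv_mul_cancel₀ hn.ne']
    · rw [map_smul, norm_smul, Complex.norm_real, Real.norm_of_nonneg (by positivity)]
      field_simp
  have hbdd : BddBelow A := ⟨0, by rintro e ⟨Ψ, -, rfl⟩; positivity⟩
  have hTA : ‖S T‖ ^ 2 / ‖T‖ ^ 2 ∈ A := ⟨_, (hunit T hT0).1, (hunit T hT0).2⟩
  set E := sInf A with hEdef
  have hEg : E < g := (csInf_le hbdd hTA).trans_lt (by rwa [div_lt_iff₀ (by positivity)])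
  have hE : ∀ Φ : D, E * ‖Φ‖ ^ 2 ≤ ‖S Φ‖ ^ 2 := by
    intro Φ
    rcases eq_or_ne Φ 0 with rfl | h0
    · simp
    · have hn : 0 < ‖Φ‖ := norm_pos_iff.2 h0
      have := csInf_le hbdd ⟨_, (hunit Φ h0).1, (hunit Φ h0).2⟩
      rwa [le_div_iff₀ (by positivity)] at this
  set Q : D → ℝ := fun Φ => ‖S Φ‖ ^ 2 - E * ‖Φ‖ ^ 2 with hQ
  have hQ0 : ∀ Φ, 0 ≤ Q Φ := fun Φ => sub_nonneg.2 (hE Φ)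
  have hQsub : ∀ Φ Φ', Q (Φ - Φ') ≤ 2 * Q Φ + 2 * Q Φ' := by
    intro Φ Φ'
    have h1 := hQ0 (Φ + Φ')
    have h2 := parallelogram_law_with_norm ℂ (S Φ) (S Φ')
    have h3 := parallelogram_law_with_norm ℂ Φ Φ'
    have h4 : E * ‖Φ + Φ'‖ ^ 2 + E * ‖Φ - Φ'‖ ^ 2 = 2 * (E * ‖Φ‖ ^ 2 + E * ‖Φ'‖ ^ 2) := by
      linear_combination E * h3
    simp only [hQ, map_sub, map_add] at h1 ⊢
    linarith
  have hQsmul : ∀ (c : ℂ) Φ, Q (c • Φ) = ‖c‖ ^ 2 * Q Φ := by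
    intro c Φ
    simp only [hQ, map_smul, norm_smul]
    ring
  have horth : ∀ Φ : D, inner ℂ L (Φ : H) = 0 → (g - E) * ‖Φ‖ ^ 2 ≤ Q Φ := by
    intro Φ h
    have := hgap Φ
    rw [h] at this
    simp only [norm_zero] at this
    simp only [hQ]
    nlinarith
  -- Half the gap: a unit vector of energy below `E + δ` must satisfy `C |⟨L, u⟩|² ≥ δ`, so it can
  -- be normalized by its overlap with `L` with control on the resulting `Q`.
  set δ := (g - E) / 2 with hδ
  have hδ0 : 0 < δ := by rw [hδ]; linarith
  have hseq : ∀ n : ℕ, ∃ p : D, inner ℂ L (p : H) = 1 ∧ Q p ≤ C / (n + 1) := by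
    intro n
    have hn1 : (0 : ℝ) < (n : ℝ) + 1 := by positivity
    obtain ⟨e, ⟨u, hu1, rfl⟩, hue⟩ := exists_lt_of_csInf_lt ⟨_, hTA⟩
      (show sInf A < E + δ / (n + 1) by rw [← hEdef]; linarith [div_pos hδ0 hn1])
    have h1 := hgap u
    rw [hu1] at h1
    have h2 : δ / (n + 1) ≤ δ := div_le_self hδ0.le (by linarith [Nat.cast_nonneg (α := ℝ) n])
    have h3 : δ ≤ C * ‖(inner ℂ L (u : H) : ℂ)‖ ^ 2 := by linarith
    have hne : (inner ℂ L (u : H) : ℂ) ≠ 0 := by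
      intro h; rw [h] at h3; simp at h3; linarith
    have hpos : 0 < ‖(inner ℂ L (u : H) : ℂ)‖ ^ 2 := by positivity
    refine ⟨(inner ℂ L (u : H) : ℂ)⁻¹ • u, ?_, ?_⟩
    · rw [Submodule.coe_smul, inner_smul_right, inv_mul_cancel₀ hne]
    · rw [hQsmul, norm_inv, inv_pow]
      have h4 : Q u ≤ δ / (n + 1) := by simp only [hQ, hu1]; linarith
      rw [inv_mul_le_iff₀ hpos]
      calc Q u ≤ δ / (n + 1) := h4
        _ ≤ C * ‖(inner ℂ L (u : H) : ℂ)‖ ^ 2 / (n + 1) := by gcongr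
        _ = _ := by ring
  choose p hp1 hp2 using hseq
  have hC0 : 0 ≤ C := by simpa using (hQ0 _).trans (hp2 0)
  have hdiff : ∀ n m k : ℕ, k ≤ n → k ≤ m → Q (p n - p m) ≤ 4 * C / (k + 1) := by
    intro n m k hn hm
    have a1 : C / (n + 1) ≤ C / (k + 1 : ℝ) := by gcongr
    have a2 : C / (m + 1) ≤ C / (k + 1 : ℝ) := by gcongr
    have := hQsub (p n) (p m)
    have b1 := hp2 n
    have b2 := hp2 m
    calc Q (p n - p m) ≤ 2 * (C / (k + 1)) + 2 * (C / (k + 1)) := by linarith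
      _ = _ := by ring
  have hdist : ∀ n m k : ℕ, k ≤ n → k ≤ m → ‖p n - p m‖ ^ 2 ≤ 4 * C / (g - E) / (k + 1) := by
    intro n m k hn hm
    have h1 := horth (p n - p m) (by
      rw [Submodule.coe_sub, inner_sub_right, hp1, hp1, sub_self])
    have h2 := hdiff n m k hn hm
    rw [div_right_comm, le_div_iff₀ (by linarith), mul_comm]
    linarith
  have hSdist : ∀ n m k : ℕ, k ≤ n → k ≤ m →
      ‖S (p n) - S (p m)‖ ^ 2 ≤ (4 * C + |E| * (4 * C / (g - E))) / (k + 1) := by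
    intro n m k hn hm
    have h1 := hdiff n m k hn hm
    have h2 := hdist n m k hn hm
    simp only [hQ] at h1
    rw [← map_sub]
    have h3 : E * ‖p n - p m‖ ^ 2 ≤ |E| * (4 * C / (g - E) / (k + 1)) :=
      (mul_le_mul_of_nonneg_right (le_abs_self E) (by positivity)).trans (by gcongr)
    calc ‖S (p n - p m)‖ ^ 2 ≤ 4 * C / (k + 1) + |E| * (4 * C / (g - E) / (k + 1)) := by linarith
      _ = _ := by ring
  have hlim : ∀ B : ℝ, Tendsto (fun k : ℕ => √(B / ((k : ℝ) + 1))) atTop (𝓝 0) := by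
    intro B
    have h1 : Tendsto (fun k : ℕ => B / ((k : ℝ) + 1)) atTop (𝓝 0) :=
      tendsto_const_nhds.div_atTop
        (tendsto_atTop_add_const_right _ _ tendsto_natCast_atTop_atTop)
    have h2 := (Real.continuous_sqrt.tendsto 0).comp h1
    rwa [Real.sqrt_zero] at h2
  have hc1 : CauchySeq fun n => (p n : H) := by
    refine cauchySeq_of_le_tendsto_0 _ (fun n m k hn hm => ?_) (hlim (4 * C / (g - E)))
    rw [dist_eq_norm]
    exact Real.le_sqrt_of_sq_le (hdist n m k hn hm)
  have hc2 : CauchySeq fun n => S (p n) := by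
    refine cauchySeq_of_le_tendsto_0 _ (fun n m k hn hm => ?_)
      (hlim (4 * C + |E| * (4 * C / (g - E))))
    rw [dist_eq_norm]
    exact Real.le_sqrt_of_sq_le (hSdist n m k hn hm)
  obtain ⟨Ψ, hΨ⟩ := cauchySeq_tendsto_of_complete hc1
  obtain ⟨ξ, hξ⟩ := cauchySeq_tendsto_of_complete hc2
  obtain ⟨hD, hS⟩ := hclosed p Ψ ξ hΨ hξ
  set Ψ' : D := ⟨Ψ, hD⟩ with hΨ'
  have hLΨ : inner ℂ L Ψ = (1 : ℂ) := by
    refine tendsto_nhds_unique (tendsto_const_nhds.inner hΨ) ?_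
    simp_rw [hp1]
    exact tendsto_const_nhds
  have hQlim : Tendsto (fun n => Q (p n)) atTop (𝓝 (Q Ψ')) := by
    simp only [hQ, hS]
    exact (hξ.norm.pow 2).sub ((hΨ.norm.pow 2).const_mul E)
  have hQΨ : Q Ψ' = 0 := by
    refine le_antisymm (le_of_tendsto_of_tendsto' hQlim ?_ hp2) (hQ0 _)
    exact tendsto_const_nhds.div_atTop
      (tendsto_atTop_add_const_right _ _ tendsto_natCast_atTop_atTop)
  have hne : Ψ' ≠ 0 := by
    intro h
    have : Ψ = 0 := congrArg Subtype.val h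
    rw [this] at hLΨ
    simp at hLΨ
  have hn : 0 < ‖Ψ'‖ := norm_pos_iff.2 hne
  refine ⟨((‖Ψ'‖⁻¹ : ℝ) : ℂ) • Ψ', E, (hunit _ hne).1, ?_, hE, ?_⟩
  · rw [(hunit _ hne).2, div_eq_iff (by positivity)]
    exact sub_eq_zero.1 hQΨ
  · intro Φ hΦ
    have hQΦ : Q Φ = 0 := sub_eq_zero.2 hΦ
    set c : ℂ := inner ℂ L (Φ : H)
    -- Subtracting the multiple with the same overlap gives a vector orthogonal to `L` on which `Q`
    -- vanishes, hence zero.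
    have h1 : Q (Φ - c • Ψ') ≤ 0 := by
      have := hQsub Φ (c • Ψ')
      rw [hQsmul, hQΦ, hQΨ] at this
      linarith
    have h2 := horth (Φ - c • Ψ') (by
      rw [Submodule.coe_sub, Submodule.coe_smul, inner_sub_right, inner_smul_right, hLΨ, mul_one,
        sub_self])
    have h3 : ‖Φ - c • Ψ'‖ ^ 2 ≤ 0 := by
      by_contra h
      push Not at h
      have := mul_pos (sub_pos.2 hEg) h
      linarith
    have h4 : Φ - c • Ψ' = 0 := by
      rw [← norm_eq_zero]
      exact pow_eq_zero_iff two_ne_zero |>.1 (le_antisymm h3 (by positivity))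
    refine ⟨c * ‖Ψ'‖, ?_⟩
    rw [sub_eq_zero.1 h4, smul_smul]
    congr 1
    push_cast
    rw [mul_assoc, mul_inv_cancel₀ (by exact_mod_cast hn.ne'), mul_one]

end Abstract

/-! ### The form domain -/

theorem isWeakMagMomentum_weakMagMomentum {N : ℕ} {i : Fin N} {k : Fin 2} {Ψ : L2 N}
    (h : ∃ G, IsWeakMagMomentum i k Ψ G) : IsWeakMagMomentum i k Ψ (weakMagMomentum i k Ψ) := by
  rw [weakMagMomentum, dif_pos h]
  exact h.choose_spec

theorem IsWeakMagMomentum.weakMagMomentum_eq {N : ℕ} {i : Fin N} {k : Fin 2} {Ψ G : L2 N}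
    (h : IsWeakMagMomentum i k Ψ G) : weakMagMomentum i k Ψ = G :=
  (isWeakMagMomentum_weakMagMomentum ⟨G, h⟩).unique h

/-- The lowering operator `-2i ∂_{z̄} - i z` of particle `i`, in weak form. -/
def lowering {N : ℕ} (i : Fin N) (Ψ : L2 N) : L2 N :=
  weakMagMomentum i 0 Ψ + Complex.I • weakMagMomentum i 1 Ψ

/-- Multiplication by the square root of the potential. -/
def sqrtPot {N : ℕ} (W : Conf N → ℝ≥0∞) (Ψ : L2 N) (x : Conf N) : ℂ := (√(W x).toReal : ℂ) * Ψ x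

/-- The value of the quadratic form. -/
def energy {N : ℕ} (W : Conf N → ℝ≥0∞) (Ψ : L2 N) : ℝ :=
  ∑ i, ‖lowering i Ψ‖ ^ 2 + (∫⁻ x, W x * ‖Ψ x‖ₑ ^ 2).toReal

theorem enorm_sqrt_mul_sq {w : ℝ≥0∞} (hw : w ≠ ⊤) (z : ℂ) :
    ‖(√w.toReal : ℂ) * z‖ₑ ^ 2 = w * ‖z‖ₑ ^ 2 := by
  have h : ‖(√w.toReal : ℂ)‖ₑ ^ 2 = w := by
    rw [← ofReal_norm, Complex.norm_real, Real.norm_of_nonneg (Real.sqrt_nonneg _),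
      ← ENNReal.ofReal_pow (Real.sqrt_nonneg _), Real.sq_sqrt ENNReal.toReal_nonneg,
      ENNReal.ofReal_toReal hw]
  rw [enorm_mul, mul_pow, h]

theorem aestronglyMeasurable_sqrtPot {N : ℕ} {W : Conf N → ℝ≥0∞} (hW : Measurable W) (Ψ : L2 N) :
    AEStronglyMeasurable (sqrtPot W Ψ) volume := by
  have h : Measurable fun x => (√(W x).toReal : ℂ) :=
    Complex.measurable_ofReal.comp hW.ennreal_toReal.sqrt
  exact h.aestronglyMeasurable.mul (Lp.aestronglyMeasurable Ψ)

theorem memLp_two_iff_lintegral {N : ℕ} {f : Conf N → ℂ} (hf : AEStronglyMeasurable f volume) :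
    MemLp f 2 volume ↔ ∫⁻ x, ‖f x‖ₑ ^ 2 < ⊤ := by
  rw [MemLp, eLpNorm_lt_top_iff_lintegral_rpow_enorm_lt_top (by norm_num) (by norm_num)]
  simp [hf]

theorem norm_toLp_sq {N : ℕ} {f : Conf N → ℂ} (hf : MemLp f 2 volume) :
    ‖hf.toLp f‖ ^ 2 = (∫⁻ x, ‖f x‖ₑ ^ 2).toReal := by
  rw [Lp.norm_toLp, ← ENNReal.toReal_pow, eLpNorm_eq_lintegral_rpow_enorm_toReal (by norm_num) (by norm_num)]
  congr 1
  rw [← ENNReal.rpow_natCast, ← ENNReal.rpow_mul]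
  simp

/-- Since `toReal` sends `∞` to `0`, the function `sqrtPot` does not see the region `W = ∞`;
vanishing there is recorded as a separate condition. The remaining condition is then linear in `Ψ`
and survives limits. -/
theorem inFormDomain_iff {N : ℕ} {W : Conf N → ℝ≥0∞} (hW : Measurable W) {Ψ : L2 N} :
    InFormDomain W Ψ ↔ (∀ i k, ∃ G, IsWeakMagMomentum i k Ψ G) ∧
      (∀ᵐ x, W x = ⊤ → Ψ x = 0) ∧ MemLp (sqrtPot W Ψ) 2 volume := by
  have hm := aestronglyMeasurable_sqrtPot hW Ψ
  have hae : (∀ᵐ x, W x = ⊤ → Ψ x = 0) →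
      ∫⁻ x, ‖sqrtPot W Ψ x‖ₑ ^ 2 = ∫⁻ x, W x * ‖Ψ x‖ₑ ^ 2 := by
    intro h
    refine lintegral_congr_ae ?_
    filter_upwards [h] with x hx
    by_cases hw : W x = ⊤
    · rw [sqrtPot, hx hw]; simp
    · exact enorm_sqrt_mul_sq hw _
  unfold InFormDomain
  refine and_congr_right fun _ => ⟨fun h => ?_, fun h => ?_⟩
  · have h1 : ∀ᵐ x, W x = ⊤ → Ψ x = 0 := by
      have hmm : AEMeasurable (fun x => W x * ‖Ψ x‖ₑ ^ 2) volume :=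
        hW.aemeasurable.mul ((Lp.aestronglyMeasurable Ψ).enorm.pow_const 2)
      filter_upwards [ae_lt_top' hmm h.ne] with x hx hw
      by_contra h0
      rw [hw, ENNReal.top_mul (by simpa using h0)] at hx
      exact lt_irrefl _ hx
    refine ⟨h1, (memLp_two_iff_lintegral hm).2 ?_⟩
    rwa [hae h1]
  · rw [← hae h.1]
    exact (memLp_two_iff_lintegral hm).1 h.2

theorem norm_sqrtPot_sq {N : ℕ} {W : Conf N → ℝ≥0∞} (hW : Measurable W) {Ψ : L2 N}
    (h : InFormDomain W Ψ) (hm : MemLp (sqrtPot W Ψ) 2 volume) :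
    ‖hm.toLp _‖ ^ 2 = (∫⁻ x, W x * ‖Ψ x‖ₑ ^ 2).toReal := by
  rw [norm_toLp_sq]
  congr 1
  refine lintegral_congr_ae ?_
  filter_upwards [((inFormDomain_iff hW).1 h).2.1] with x hx
  by_cases hw : W x = ⊤
  · rw [sqrtPot, hx hw]; simp
  · exact enorm_sqrt_mul_sq hw _

theorem sqrtPot_add {N : ℕ} (W : Conf N → ℝ≥0∞) (Φ Ψ : L2 N) :
    sqrtPot W (Φ + Ψ) =ᵐ[volume] sqrtPot W Φ + sqrtPot W Ψ := by
  filter_upwards [Lp.coeFn_add Φ Ψ] with x hx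
  simp only [sqrtPot, Pi.add_apply, hx, mul_add]

theorem sqrtPot_smul {N : ℕ} (W : Conf N → ℝ≥0∞) (c : ℂ) (Ψ : L2 N) :
    sqrtPot W (c • Ψ) =ᵐ[volume] c • sqrtPot W Ψ := by
  filter_upwards [Lp.coeFn_smul c Ψ] with x hx
  simp only [sqrtPot, Pi.smul_apply, hx, smul_eq_mul]
  ring

/-- The form domain as a subspace. -/
def formDomain {N : ℕ} {W : Conf N → ℝ≥0∞} (hW : Measurable W) : Submodule ℂ (L2 N) where
  carrier := {Ψ | InFormDomain W Ψ}
  zero_mem' := by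
    rw [Set.mem_ofPred_eq, inFormDomain_iff hW]
    refine ⟨fun i k => ⟨0, fun φ _ _ => ?_⟩, ?_, ?_⟩
    · rw [integral_eq_zero_of_ae, integral_eq_zero_of_ae]
      · exact ae_of_all _ fun x => by simp
      · exact ae_of_all _ fun x => by simp
    · exact ae_of_all _ fun x _ => by simp
    · refine (MemLp.zero (ε := ℂ)).ae_eq ?_
      exact ae_of_all _ fun x => by simp [sqrtPot]
  add_mem' := by
    intro Φ Ψ hΦ hΨ
    rw [Set.mem_ofPred_eq, inFormDomain_iff hW] at *
    refine ⟨fun i k => ?_, ?_, (hΦ.2.2.add hΨ.2.2).ae_eq (sqrtPot_add W Φ Ψ).symm⟩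
    · obtain ⟨F, hF⟩ := hΦ.1 i k
      obtain ⟨G, hG⟩ := hΨ.1 i k
      exact ⟨_, hF.add hG⟩
    · filter_upwards [hΦ.2.1, hΨ.2.1, Lp.coeFn_add Φ Ψ] with x h1 h2 h3 hw
      rw [h3, Pi.add_apply, h1 hw, h2 hw, add_zero]
  smul_mem' := by
    intro c Ψ hΨ
    rw [Set.mem_ofPred_eq, inFormDomain_iff hW] at *
    refine ⟨fun i k => ?_, ?_, (hΨ.2.2.const_smul c).ae_eq (sqrtPot_smul W c Ψ).symm⟩
    · obtain ⟨G, hG⟩ := hΨ.1 i k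
      exact ⟨_, hG.smul c⟩
    · filter_upwards [hΨ.2.1, Lp.coeFn_smul c Ψ] with x h1 h3 hw
      rw [h3, Pi.smul_apply, h1 hw, smul_zero]

theorem InFormDomain.isWeak {N : ℕ} {W : Conf N → ℝ≥0∞} {Ψ : L2 N} (h : InFormDomain W Ψ)
    (i : Fin N) (k : Fin 2) : IsWeakMagMomentum i k Ψ (weakMagMomentum i k Ψ) :=
  isWeakMagMomentum_weakMagMomentum (h.1 i k)

theorem InFormDomain.memLp {N : ℕ} {W : Conf N → ℝ≥0∞} (hW : Measurable W) {Ψ : L2 N}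
    (h : InFormDomain W Ψ) : MemLp (sqrtPot W Ψ) 2 volume := ((inFormDomain_iff hW).1 h).2.2

/-- The square root of the quadratic form: lowering operators and root of the potential. -/
def rootForm {N : ℕ} {W : Conf N → ℝ≥0∞} (hW : Measurable W) :
    formDomain hW →ₗ[ℂ] PiLp 2 (fun _ : Option (Fin N) => L2 N) where
  toFun Ψ := WithLp.toLp 2 fun o => o.elim ((Ψ.2.memLp hW).toLp _) fun i => lowering i Ψ
  map_add' Φ Ψ := by
    ext1 o
    rcases o with _ | i
    · simp only [Option.elim, PiLp.add_apply]
      rw [← MemLp.toLp_add]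
      exact MemLp.toLp_congr _ _ (sqrtPot_add W Φ Ψ)
    · simp only [Option.elim, PiLp.add_apply, lowering, Submodule.coe_add]
      rw [((Φ.2.isWeak i 0).add (Ψ.2.isWeak i 0)).weakMagMomentum_eq,
        ((Φ.2.isWeak i 1).add (Ψ.2.isWeak i 1)).weakMagMomentum_eq, smul_add]
      abel
  map_smul' c Ψ := by
    ext1 o
    rcases o with _ | i
    · simp only [Option.elim, PiLp.smul_apply, RingHom.id_apply]
      rw [← MemLp.toLp_const_smul]
      exact MemLp.toLp_congr _ _ (sqrtPot_smul W c Ψ)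
    · simp only [Option.elim, PiLp.smul_apply, RingHom.id_apply, lowering, Submodule.coe_smul]
      rw [((Ψ.2.isWeak i 0).smul c).weakMagMomentum_eq,
        ((Ψ.2.isWeak i 1).smul c).weakMagMomentum_eq, smul_add, smul_comm]

theorem rootForm_some {N : ℕ} {W : Conf N → ℝ≥0∞} (hW : Measurable W) (Ψ : formDomain hW)
    (i : Fin N) : rootForm hW Ψ (some i) = lowering i Ψ := rfl

theorem rootForm_none {N : ℕ} {W : Conf N → ℝ≥0∞} (hW : Measurable W) (Ψ : formDomain hW) :
    rootForm hW Ψ none = (Ψ.2.memLp hW).toLp _ := rfl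

theorem norm_rootForm_sq {N : ℕ} {W : Conf N → ℝ≥0∞} (hW : Measurable W) (Ψ : formDomain hW) :
    ‖rootForm hW Ψ‖ ^ 2 = energy W Ψ := by
  rw [PiLp.norm_sq_eq_of_L2, Fintype.sum_option, rootForm_none, norm_sqrtPot_sq hW Ψ.2, energy,
    add_comm]
  rfl

/-- The subtracted `2` per particle is exactly the commutator that turns the sum of squared momenta
into a square of `lowering`. The form is thus manifestly nonnegative and of the type treated
abstractly above. -/
theorem form_eq_inner {N : ℕ} {W : Conf N → ℝ≥0∞} (hW : Measurable W) (Φ Ψ : formDomain hW) :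
    form W Φ Ψ = inner ℂ (rootForm hW Φ) (rootForm hW Ψ) := by
  rw [PiLp.inner_apply, Fintype.sum_option, rootForm_none, rootForm_none, inner_toLp_toLp, form,
    add_comm]
  congr 1
  · refine integral_congr_ae (ae_of_all _ fun x => ?_)
    simp only [sqrtPot, map_mul, Complex.conj_ofReal, Complex.star_def]
    have := sqrt_mul_sqrt_ofReal (r := (W x).toReal) ENNReal.toReal_nonneg
    linear_combination (-(conj ((Φ : L2 N) x) * (Ψ : L2 N) x)) * this
  · refine Finset.sum_congr rfl fun i _ => ?_
    rw [rootForm_some, rootForm_some, lowering, lowering]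
    exact sum_inner_weakMagMomentum (F := fun k => weakMagMomentum i k Φ)
      (G := fun k => weakMagMomentum i k Ψ) (fun k => Φ.2.isWeak i k) (fun k => Ψ.2.isWeak i k)

theorem InFormDomain.sum_norm_weakMagMomentum_sq {N : ℕ} {W : Conf N → ℝ≥0∞} {Ψ : L2 N}
    (h : InFormDomain W Ψ) (i : Fin N) : ∑ k, ‖weakMagMomentum i k Ψ‖ ^ 2 =
      ‖lowering i Ψ‖ ^ 2 + 2 * ‖Ψ‖ ^ 2 := by
  have h1 := sum_inner_weakMagMomentum (F := fun k => weakMagMomentum i k Ψ)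
      (G := fun k => weakMagMomentum i k Ψ) (fun k => h.isWeak i k) (fun k => h.isWeak i k)
  simp only [inner_self_eq_norm_sq_to_K] at h1
  have h2 : ((∑ k, ‖weakMagMomentum i k Ψ‖ ^ 2 - 2 * ‖Ψ‖ ^ 2 : ℝ) : ℂ) =
      ((‖lowering i Ψ‖ ^ 2 : ℝ) : ℂ) := by
    push_cast
    exact h1
  have h3 := Complex.ofReal_injective h2
  linarith

/-- By the commutation relation the two momenta together have squared norm `‖lowering‖² + 2‖·‖²`.
Graph convergence of `rootForm` therefore forces convergence of each weak derivative, which is what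
closedness requires. -/
theorem norm_weakMagMomentum_sub_le {N : ℕ} {W : Conf N → ℝ≥0∞} (hW : Measurable W)
    (Φ Ψ : formDomain hW) (i : Fin N) (k : Fin 2) :
    ‖weakMagMomentum i k (Φ : L2 N) - weakMagMomentum i k (Ψ : L2 N)‖ ≤
      ‖rootForm hW Φ - rootForm hW Ψ‖ + 2 * ‖Φ - Ψ‖ := by
  have hd : weakMagMomentum i k ((Φ - Ψ : formDomain hW) : L2 N) =
      weakMagMomentum i k (Φ : L2 N) - weakMagMomentum i k (Ψ : L2 N) := by
    have := ((Φ.2.isWeak i k).add ((Ψ.2.isWeak i k).smul (-1))).weakMagMomentum_eq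
    rw [neg_one_smul, neg_one_smul, ← sub_eq_add_neg, ← sub_eq_add_neg] at this
    exact this
  rw [← hd, ← map_sub]
  set Θ := Φ - Ψ
  have h1 := Θ.2.sum_norm_weakMagMomentum_sq i
  have h2 : ‖weakMagMomentum i k (Θ : L2 N)‖ ^ 2 ≤ ∑ k, ‖weakMagMomentum i k (Θ : L2 N)‖ ^ 2 :=
    Finset.single_le_sum (f := fun k => ‖weakMagMomentum i k (Θ : L2 N)‖ ^ 2)
      (fun _ _ => by positivity) (Finset.mem_univ k)
  have h3 : ‖lowering i (Θ : L2 N)‖ ≤ ‖rootForm hW Θ‖ := by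
    rw [← rootForm_some hW]
    exact PiLp.norm_apply_le _ _
  have h4 : ‖(Θ : L2 N)‖ = ‖Θ‖ := rfl
  rw [h4] at h1
  have h5 := norm_nonneg (rootForm hW Θ)
  have h6 := norm_nonneg Θ
  have h7 := norm_nonneg (lowering i (Θ : L2 N))
  refine abs_le_of_sq_le_sq' ?_ (by positivity) |>.2
  nlinarith

theorem rootForm_closed {N : ℕ} {W : Conf N → ℝ≥0∞} (hW : Measurable W) (u : ℕ → formDomain hW)
    (Ψ : L2 N) (ξ : PiLp 2 (fun _ : Option (Fin N) => L2 N))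
    (hu : Tendsto (fun n => (u n : L2 N)) atTop (𝓝 Ψ))
    (hξ : Tendsto (fun n => rootForm hW (u n)) atTop (𝓝 ξ)) :
    ∃ h : Ψ ∈ formDomain hW, rootForm hW ⟨Ψ, h⟩ = ξ := by
  have hG : ∀ i k, ∃ G, Tendsto (fun n => weakMagMomentum i k (u n : L2 N)) atTop (𝓝 G) := by
    intro i k
    refine cauchySeq_tendsto_of_complete (cauchySeq_iff_tendsto_dist_atTop_0.2 ?_)
    have h1 := cauchySeq_iff_tendsto_dist_atTop_0.1 hu.cauchySeq
    have h2 := cauchySeq_iff_tendsto_dist_atTop_0.1 hξ.cauchySeq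
    refine squeeze_zero (fun _ => dist_nonneg) (fun n => ?_)
      (by simpa using h2.add (h1.const_mul 2))
    simp only [dist_eq_norm]
    exact norm_weakMagMomentum_sub_le hW _ _ i k
  choose G hG using hG
  have hweak : ∀ i k, IsWeakMagMomentum i k Ψ (G i k) := fun i k =>
    IsWeakMagMomentum.of_tendsto (fun n => (u n).2.isWeak i k) hu (hG i k)
  have hnone : Tendsto (fun n => rootForm hW (u n) none) atTop (𝓝 (ξ none)) :=
    ((PiLp.continuous_apply 2 _ none).tendsto ξ).comp hξ
  have hsome : ∀ i, Tendsto (fun n => lowering i (u n : L2 N)) atTop (𝓝 (ξ (some i))) := fun i =>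
    ((PiLp.continuous_apply 2 _ (some i)).tendsto ξ).comp hξ
  -- Two successive subsequences converge almost everywhere, one for the states and one for their
  -- images under the root of the potential. Pointwise limits identify the limiting potential part
  -- and preserve vanishing on `W = ∞`.
  obtain ⟨ns, hns, hae⟩ := (tendstoInMeasure_of_tendsto_Lp hu).exists_seq_tendsto_ae
  obtain ⟨ms, hms, hae'⟩ := (tendstoInMeasure_of_tendsto_Lp
    (hnone.comp hns.tendsto_atTop)).exists_seq_tendsto_ae
  have hall : ∀ᵐ x, ∀ n, W x = ⊤ → (u n : L2 N) x = 0 :=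
    ae_all_iff.2 fun n => ((inFormDomain_iff hW).1 (u n).2).2.1
  have hcoe : ∀ᵐ x, ∀ n, rootForm hW (u n) none x = sqrtPot W (u n) x :=
    ae_all_iff.2 fun n => ((u n).2.memLp hW).coeFn_toLp
  have hpot : sqrtPot W Ψ =ᵐ[volume] ξ none := by
    filter_upwards [hae, hae', hcoe] with x h1 h2 h3
    refine tendsto_nhds_unique ((h1.comp hms.tendsto_atTop).const_mul _) ?_
    refine h2.congr fun n => ?_
    simp only [Function.comp, h3]
    rfl
  have hdom : InFormDomain W Ψ := by
    rw [inFormDomain_iff hW]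
    refine ⟨fun i k => ⟨_, hweak i k⟩, ?_, (Lp.memLp (ξ none)).ae_eq hpot.symm⟩
    filter_upwards [hae, hall] with x h1 h2 hw
    refine tendsto_nhds_unique h1 ?_
    simp_rw [h2 _ hw]
    exact tendsto_const_nhds
  refine ⟨hdom, ?_⟩
  ext1 o
  rcases o with _ | i
  · rw [rootForm_none]
    refine Lp.ext ?_
    exact (MemLp.coeFn_toLp _).trans hpot
  · rw [rootForm_some]
    refine tendsto_nhds_unique ?_ (hsome i)
    simp only [lowering]
    rw [(hweak i 0).weakMagMomentum_eq, (hweak i 1).weakMagMomentum_eq]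
    exact (hG i 0).add ((hG i 1).const_smul _)

theorem InFormDomain.energy_eq_of_isHamiltonianImage {N : ℕ} {W : Conf N → ℝ≥0∞}
    (hW : Measurable W) {Ψ η : L2 N} (h : IsHamiltonianImage W Ψ η) :
    (inner ℂ Ψ η).re = energy W Ψ := by
  rw [← h.2.2 Ψ h.1]
  have h1 := form_eq_inner hW ⟨Ψ, h.1⟩ ⟨Ψ, h.1⟩
  have h2 := norm_rootForm_sq hW ⟨Ψ, h.1⟩
  simp only at h1 h2
  rw [h1, inner_self_eq_norm_sq_to_K, ← h2]
  norm_cast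

/-- A gap of the quadratic form above a one-dimensional space yields a ground state, which is
unique up to a phase. -/
theorem exists_isGroundState_of_gap {N : ℕ} {W : Conf N → ℝ≥0∞} (hW : Measurable W) (L : L2 N)
    {g C : ℝ} (hgap : ∀ Ψ, InFormDomain W Ψ →
      g * ‖Ψ‖ ^ 2 - C * ‖(inner ℂ L Ψ : ℂ)‖ ^ 2 ≤ energy W Ψ)
    {T : L2 N} (hTd : InFormDomain W T) (hT : energy W T < g * ‖T‖ ^ 2) :
    ∃ Ψ, InFormDomain W Ψ ∧ IsGroundState W Ψ ∧
      (∀ Φ, InFormDomain W Φ → energy W Ψ * ‖Φ‖ ^ 2 ≤ energy W Φ) ∧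
      ∀ Φ, IsGroundState W Φ → ∃ c : ℂ, ‖c‖ = 1 ∧ Φ = c • Ψ := by
  obtain ⟨Ψ, E, hΨ1, hΨE, hlow, huniq⟩ := exists_minimizer_of_gap (rootForm hW)
    (rootForm_closed hW) L (g := g) (C := C)
    (fun Ψ => by rw [norm_rootForm_sq]; exact hgap Ψ Ψ.2) ⟨T, hTd⟩
    (by rw [norm_rootForm_sq]; exact hT)
  have hEL := inner_eq_of_minimizer (rootForm hW) hlow (Ψ := Ψ) (by rw [hΨE, hΨ1]; ring)
  have hlow' : ∀ Φ, InFormDomain W Φ → E * ‖Φ‖ ^ 2 ≤ energy W Φ := fun Φ hΦ => by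
    have := hlow ⟨Φ, hΦ⟩
    rwa [norm_rootForm_sq] at this
  rw [norm_rootForm_sq] at hΨE
  have hΨ1' : ‖(Ψ : L2 N)‖ = 1 := hΨ1
  have himg : IsHamiltonianImage W Ψ ((E : ℂ) • (Ψ : L2 N)) := by
    refine ⟨Ψ.2, subset_closure ((formDomain hW).smul_mem _ Ψ.2), fun Φ hΦ => ?_⟩
    rw [inner_smul_right]
    exact (form_eq_inner hW ⟨Φ, hΦ⟩ Ψ).trans (hEL ⟨Φ, hΦ⟩)
  refine ⟨Ψ, Ψ.2, ⟨hΨ1', E, himg, fun Φ η h => ?_⟩, fun Φ hΦ => ?_, fun Φ hΦ => ?_⟩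
  · rw [InFormDomain.energy_eq_of_isHamiltonianImage hW h]
    exact hlow' Φ h.1
  · rw [hΨE]; exact hlow' Φ hΦ
  · obtain ⟨hΦ1, E', hΦ, hΦlow⟩ := hΦ
    have hself : ∀ (e : ℝ) (Θ : L2 N), ‖Θ‖ = 1 → (inner ℂ Θ ((e : ℂ) • Θ)).re = e := by
      intro e Θ h
      rw [inner_smul_right, inner_self_eq_norm_sq_to_K, h]
      simp
    -- The eigenvalue of any ground state is squeezed: it is at most `E` because it bounds the
    -- operator below at `Ψ`, and at least `E` because `E` bounds the form below.
    have h1 : E' ≤ E := by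
      have := hΦlow _ _ himg
      rwa [hself E _ hΨ1', hΨ1', one_pow, mul_one] at this
    have h2 : energy W Φ = E' := by
      rw [← InFormDomain.energy_eq_of_isHamiltonianImage hW hΦ, hself E' _ hΦ1]
    have h3 := hlow' Φ hΦ.1
    rw [hΦ1, one_pow, mul_one] at h3
    have h4 : E' = E := le_antisymm h1 (h2 ▸ h3)
    obtain ⟨c, hc⟩ := huniq ⟨Φ, hΦ.1⟩ (by
      rw [norm_rootForm_sq]
      change energy W Φ = E * ‖Φ‖ ^ 2
      rw [h2, hΦ1, h4]; ring)
    have hc' : Φ = c • (Ψ : L2 N) := congrArg Subtype.val hc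
    refine ⟨c, ?_, hc'⟩
    rw [hc', norm_smul, hΨ1', mul_one] at hΦ1
    exact hΦ1

/-! ### Polynomials that vanish on the diagonals -/

section Algebra

open MvPolynomial

variable {N : ℕ}

/-- The substitution `X i ↦ X i + c X j`. -/
def shearHom (i j : Fin N) (c : ℂ) : MvPolynomial (Fin N) ℂ →ₐ[ℂ] MvPolynomial (Fin N) ℂ :=
  aeval fun k => if k = i then X i + C c * X j else X k

theorem shearHom_X_self (i j : Fin N) (c : ℂ) : shearHom i j c (X i) = X i + C c * X j := by
  simp [shearHom]

theorem shearHom_X_of_ne {i j k : Fin N} (h : k ≠ i) (c : ℂ) : shearHom i j c (X k) = X k := by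
  simp [shearHom, h]

theorem shearHom_comp_neg {i j : Fin N} (h : j ≠ i) (c : ℂ) (Q : MvPolynomial (Fin N) ℂ) :
    shearHom i j c (shearHom i j (-c) Q) = Q := by
  have e : (shearHom i j c).comp (shearHom i j (-c)) = AlgHom.id ℂ _ := by
    ext1 k
    rcases eq_or_ne k i with rfl | hk
    · rw [AlgHom.comp_apply, shearHom_X_self, map_add, map_mul, shearHom_X_self,
        shearHom_X_of_ne h, ← algebraMap_eq, AlgHom.commutes, map_neg]
      simp
    · rw [AlgHom.comp_apply, shearHom_X_of_ne hk, shearHom_X_of_ne hk]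
      rfl
  exact congrArg (fun f : MvPolynomial (Fin N) ℂ →ₐ[ℂ] MvPolynomial (Fin N) ℂ => f Q) e

theorem shearHom_neg_comp {i j : Fin N} (h : j ≠ i) (c : ℂ) (Q : MvPolynomial (Fin N) ℂ) :
    shearHom i j (-c) (shearHom i j c Q) = Q := by
  have := shearHom_comp_neg h (-c) Q
  rwa [neg_neg] at this

/-- The substitution `X i ↦ X i + X j` as an automorphism. -/
def shearEquiv {i j : Fin N} (h : j ≠ i) : MvPolynomial (Fin N) ℂ ≃ₐ[ℂ] MvPolynomial (Fin N) ℂ :=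
  { shearHom i j 1 with
    invFun := shearHom i j (-1)
    left_inv := shearHom_neg_comp h 1
    right_inv := shearHom_comp_neg h 1 }

theorem shearEquiv_apply {i j : Fin N} (h : j ≠ i) (Q : MvPolynomial (Fin N) ℂ) :
    shearEquiv h Q = shearHom i j 1 Q := rfl

theorem shearEquiv_sub {i j : Fin N} (h : j ≠ i) :
    shearEquiv h (X i - X j) = X i := by
  rw [shearEquiv_apply, map_sub, shearHom_X_self, shearHom_X_of_ne h]
  simp

/-- The shear is an automorphism taking the difference to a variable, and variables are prime. -/
theorem prime_X_sub_X {i j : Fin N} (h : j ≠ i) : Prime (X i - X j : MvPolynomial (Fin N) ℂ) := by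
  rw [← MulEquiv.prime_iff (shearEquiv h).toMulEquiv]
  change Prime (shearEquiv h (X i - X j))
  rw [shearEquiv_sub]
  exact X_prime

theorem X_pow_dvd_of_coeff_eq_zero {i : Fin N} {n : ℕ} {Q : MvPolynomial (Fin N) ℂ}
    (h : ∀ α : Fin N →₀ ℕ, α i < n → coeff α Q = 0) : X i ^ n ∣ Q := by
  rw [← support_sum_monomial_coeff Q]
  refine Finset.dvd_sum fun α hα => ?_
  rw [X_pow_eq_monomial, monomial_dvd_monomial]
  refine ⟨Or.inr ?_, one_dvd _⟩
  rw [Finsupp.single_le_iff]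
  by_contra hlt
  exact (mem_support_iff.1 hα) (h α (not_le.1 hlt))

theorem X_sub_X_pow_dvd {i j : Fin N} (hij : j ≠ i) {n : ℕ} {Q : MvPolynomial (Fin N) ℂ}
    (h : ∀ α : Fin N →₀ ℕ, α i < n → coeff α (shearHom i j 1 Q) = 0) : (X i - X j) ^ n ∣ Q := by
  have h1 := X_pow_dvd_of_coeff_eq_zero h
  rw [← map_dvd_iff (shearEquiv hij), map_pow, shearEquiv_sub]
  exact h1

/-- Divisibility would make `x k = x l` a consequence of `x i = x j`. The indicator point of an
index in `{k, l}` but not in `{i, j}` contradicts this. -/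
theorem not_X_sub_X_dvd {i j k l : Fin N} (hij : i < j) (hkl : k < l) (hne : (i, j) ≠ (k, l)) :
    ¬ (X i - X j : MvPolynomial (Fin N) ℂ) ∣ X k - X l := by
  intro hd
  have key : ∀ x : Fin N → ℂ, x i = x j → x k = x l := by
    intro x hx
    obtain ⟨R, hR⟩ := hd
    have := congrArg (eval x) hR
    simp only [map_sub, map_mul, eval_X, hx, sub_self, zero_mul] at this
    exact sub_eq_zero.1 this
  by_cases hk : k ≠ i ∧ k ≠ j
  · have := key (Pi.single k 1) (by
      rw [Pi.single_eq_of_ne hk.1.symm, Pi.single_eq_of_ne hk.2.symm])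
    rw [Pi.single_eq_same, Pi.single_eq_of_ne hkl.ne'] at this
    exact one_ne_zero this
  by_cases hl : l ≠ i ∧ l ≠ j
  · have := key (Pi.single l 1) (by
      rw [Pi.single_eq_of_ne hl.1.symm, Pi.single_eq_of_ne hl.2.symm])
    rw [Pi.single_eq_same, Pi.single_eq_of_ne hkl.ne] at this
    exact zero_ne_one this
  · apply hne
    have h1 : k = i ∨ k = j := by tauto
    have h2 : l = i ∨ l = j := by tauto
    rw [Prod.mk.injEq]
    rcases h1 with rfl | rfl <;> rcases h2 with rfl | rfl <;> simp_all
    all_goals first | exact absurd hkl (lt_irrefl _) | exact absurd (hij.trans hkl) (lt_irrefl _)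

/-- The product of all differences of the coordinates. -/
def jastrow (N : ℕ) : MvPolynomial (Fin N) ℂ := ∏ i, ∏ j ∈ Finset.Ioi i, (X i - X j)

/-- The number of pairs of particles. -/
def numPairs (N : ℕ) : ℕ := ∑ i : Fin N, (Finset.Ioi i).card

theorem jastrow_isHomogeneous (N : ℕ) : (jastrow N).IsHomogeneous (numPairs N) := by
  unfold jastrow numPairs
  refine IsHomogeneous.prod _ _ _ fun i _ => ?_
  rw [Finset.card_eq_sum_ones]
  exact IsHomogeneous.prod _ _ _ fun j _ => (isHomogeneous_X ℂ i).sub (isHomogeneous_X ℂ j)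

theorem jastrow_ne_zero (N : ℕ) : jastrow N ≠ 0 := by
  refine Finset.prod_ne_zero_iff.2 fun i _ => Finset.prod_ne_zero_iff.2 fun j hj => ?_
  exact (prime_X_sub_X (Finset.mem_Ioi.1 hj).ne').ne_zero

/-- The differences belonging to distinct pairs are non-associated primes, so divisibility by each
power gives divisibility by the product. -/
theorem jastrow_pow_dvd {n : ℕ} {Q : MvPolynomial (Fin N) ℂ}
    (h : ∀ i j : Fin N, i < j → (X i - X j) ^ n ∣ Q) : jastrow N ^ n ∣ Q := by
  have e : jastrow N ^ n =
      ∏ p ∈ Finset.univ.sigma (fun i : Fin N => Finset.Ioi i), (X p.1 - X p.2) ^ n := by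
    rw [jastrow, ← Finset.prod_pow, Finset.prod_sigma]
    exact Finset.prod_congr rfl fun i _ => (Finset.prod_pow _ _ _).symm
  rw [e]
  refine Finset.prod_dvd_of_isRelPrime ?_ fun p hp => ?_
  · rintro ⟨i, j⟩ hp ⟨k, l⟩ hq hne
    simp only [Finset.coe_sigma, Set.mem_sigma_iff, Finset.coe_Ioi, Set.mem_Ioi] at hp hq
    refine IsRelPrime.pow ?_
    rw [(prime_X_sub_X hp.2.ne').irreducible.isRelPrime_iff_not_dvd]
    refine not_X_sub_X_dvd hp.2 hq.2 fun h => hne ?_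
    simp only [Prod.mk.injEq] at h
    obtain ⟨rfl, rfl⟩ := h
    rfl
  · simp only [Finset.mem_sigma, Finset.mem_Ioi] at hp
    exact h _ _ hp.2

/-- Powers of the Jastrow factor are the polynomials of lowest degree vanishing to the given order
on all diagonals. -/
theorem exists_eq_smul_jastrow_pow {n : ℕ} {Q : MvPolynomial (Fin N) ℂ}
    (hdeg : Q.totalDegree ≤ numPairs N * n)
    (h : ∀ i j : Fin N, i < j → ∀ α : Fin N →₀ ℕ, α i < n → coeff α (shearHom i j 1 Q) = 0) :
    ∃ c : ℂ, Q = C c * jastrow N ^ n := by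
  obtain ⟨R, hR⟩ := jastrow_pow_dvd fun i j hij => X_sub_X_pow_dvd hij.ne' (h i j hij)
  rcases eq_or_ne R 0 with rfl | hR0
  · exact ⟨0, by simp [hR]⟩
  have hJ : jastrow N ^ n ≠ 0 := pow_ne_zero _ (jastrow_ne_zero N)
  -- The degree bound is exactly the degree of the Jastrow power, so the quotient has degree zero.
  have h1 := totalDegree_mul_of_isDomain hJ hR0
  rw [← hR, ((jastrow_isHomogeneous N).pow n).totalDegree hJ] at h1
  have h2 : R.totalDegree = 0 := by omega
  rw [totalDegree_eq_zero_iff_eq_C] at h2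
  exact ⟨coeff 0 R, by rw [hR]; conv_lhs => rw [h2, mul_comm]⟩

theorem shearHom_isHomogeneous {i j : Fin N} (c : ℂ) {Q : MvPolynomial (Fin N) ℂ} {d : ℕ}
    (h : Q.IsHomogeneous d) : (shearHom i j c Q).IsHomogeneous d := by
  have := h.aeval (fun k => if k = i then X i + C c * X j else X k) (n := 1) fun k => by
    split_ifs
    · exact (isHomogeneous_X ℂ i).add (isHomogeneous_C_mul_X c j)
    · exact isHomogeneous_X ℂ k
  simpa [shearHom] using this

theorem eval_shearHom (i j : Fin N) (Q : MvPolynomial (Fin N) ℂ) (y : Fin N → ℂ) :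
    eval y (shearHom i j 1 Q) = eval (Function.update y i (y i + y j)) Q := by
  have e : (aeval y).comp (shearHom i j 1) = aeval (Function.update y i (y i + y j)) := by
    ext1 k
    rcases eq_or_ne k i with rfl | hk
    · simp [shearHom_X_self]
    · simp [shearHom_X_of_ne hk, hk]
  have := congrArg (fun f : MvPolynomial (Fin N) ℂ →ₐ[ℂ] ℂ => f Q) e
  simpa [coe_aeval_eq_eval] using this

end Algebra

/-! ### The relative coordinate of a pair -/

/-- The linear change of coordinates `x i ↦ x i + x j`. -/
def shear {N : ℕ} (i j : Fin N) (c : ℂ) : Conf N →ₗ[ℂ] Conf N :=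
  LinearMap.transvection (c • LinearMap.proj j) (Pi.single i 1)

theorem shear_apply {N : ℕ} (i j : Fin N) (c : ℂ) (x : Conf N) :
    shear i j c x = Function.update x i (x i + c * x j) := by
  funext k
  rw [shear, LinearMap.transvection.apply]
  rcases eq_or_ne k i with rfl | hk
  · simp
  · simp [hk]

theorem measurePreserving_shear {N : ℕ} {i j : Fin N} (h : j ≠ i) (c : ℂ) :
    MeasurePreserving (shear i j c) volume volume := by
  have hdet : LinearMap.det ((shear i j c).restrictScalars ℝ) = 1 := by
    rw [LinearMap.det_restrictScalars, shear, LinearMap.transvection.det]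
    simp [Pi.single_eq_of_ne h]
  refine ⟨((shear i j c).restrictScalars ℝ).continuous_of_finiteDimensional.measurable, ?_⟩
  have := Measure.map_linearMap_addHaar_eq_smul_addHaar (volume : Measure (Conf N))
    (f := (shear i j c).restrictScalars ℝ) (by rw [hdet]; exact one_ne_zero)
  rw [hdet] at this
  simpa using this

/-- The volume preserving change of coordinates `x i ↦ x i - x j`. -/
def shearHomeo {N : ℕ} {i j : Fin N} (h : j ≠ i) : Conf N ≃ₜ Conf N where
  toFun := shear i j (-1)
  invFun := shear i j 1
  left_inv x := by
    rw [shear_apply, shear_apply]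
    simp [Function.update_of_ne h]
  right_inv x := by
    rw [shear_apply, shear_apply]
    simp [Function.update_of_ne h]
  continuous_toFun := (shear i j (-1)).continuous_of_finiteDimensional
  continuous_invFun := (shear i j 1).continuous_of_finiteDimensional

theorem shearHomeo_apply {N : ℕ} {i j : Fin N} (h : j ≠ i) (x : Conf N) :
    shearHomeo h x = Function.update x i (x i - x j) := by
  change shear i j (-1) x = _
  rw [shear_apply, neg_one_mul, sub_eq_add_neg]

theorem shearHomeo_symm_apply {N : ℕ} {i j : Fin N} (h : j ≠ i) (y : Conf N) :
    (shearHomeo h).symm y = Function.update y i (y i + y j) := by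
  change shear i j 1 y = _
  rw [shear_apply, one_mul]

theorem measurePreserving_shearHomeo {N : ℕ} {i j : Fin N} (h : j ≠ i) :
    MeasurePreserving (shearHomeo h) volume volume := measurePreserving_shear h (-1)

theorem contDiff_shearHomeo {N : ℕ} {i j : Fin N} (h : j ≠ i) :
    ContDiff ℝ ∞ (shearHomeo h) :=
  (LinearMap.toContinuousLinearMap ((shear i j (-1)).restrictScalars ℝ)).contDiff

/-! ### Polynomials times the Gaussian -/

section Poly

open MvPolynomial

variable {N : ℕ}

/-- A polynomial times the Gaussian. -/
def polyFn (Q : MvPolynomial (Fin N) ℂ) (x : Conf N) : ℂ := eval x Q * gaussProd x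

theorem eval_monomial_one (α : Fin N →₀ ℕ) (x : Conf N) :
    eval x (monomial α (1 : ℂ)) = ∏ i, x i ^ α i := by
  rw [eval_monomial, one_mul, Finsupp.prod_fintype _ _ fun _ => pow_zero _]

/-- The orbital quantum numbers of a product of lowest Landau level orbitals. -/
def lllIndex (α : Fin N →₀ ℕ) (i : Fin N) : ℕ × ℕ := (α i, 0)

theorem lllIndex_injective : Function.Injective (lllIndex (N := N)) := fun _ _ h =>
  Finsupp.ext fun i => congrArg Prod.fst (congrFun h i)

theorem hermiteProd_lllIndex (α : Fin N →₀ ℕ) (x : Conf N) :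
    hermiteProd (lllIndex α) x = eval x (monomial α (1 : ℂ)) := by
  rw [eval_monomial_one]
  simp only [hermiteProd, lllIndex, hermiteC_zero]

theorem memLp_polyFn (Q : MvPolynomial (Fin N) ℂ) : MemLp (polyFn Q) 2 volume := by
  induction Q using MvPolynomial.induction_on' with
  | monomial α c =>
    refine ((memLp_hermiteProd_mul_gaussProd (lllIndex α)).const_mul c).ae_eq
      (ae_of_all _ fun x => ?_)
    simp only [polyFn, hermiteProd_lllIndex]
    rw [eval_monomial, eval_monomial]
    ring
  | add P Q hP hQ =>
    refine (hP.add hQ).ae_eq (ae_of_all _ fun x => ?_)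
    simp only [polyFn, Pi.add_apply, map_add, add_mul]

/-- Polynomials times the Gaussian, as elements of `L²`. -/
def polyLp : MvPolynomial (Fin N) ℂ →ₗ[ℂ] L2 N where
  toFun Q := (memLp_polyFn Q).toLp _
  map_add' P Q := by
    rw [← MemLp.toLp_add]
    exact MemLp.toLp_congr _ _ (ae_of_all _ fun x => by simp [polyFn, add_mul])
  map_smul' c Q := by
    rw [RingHom.id_apply, ← MemLp.toLp_const_smul]
    exact MemLp.toLp_congr _ _ (ae_of_all _ fun x => by simp [polyFn, mul_assoc, smul_eval])

theorem polyLp_apply (Q : MvPolynomial (Fin N) ℂ) : polyLp Q = (memLp_polyFn Q).toLp _ := rfl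

/-- The lowest Landau level orbitals. -/
def lllLp (α : Fin N →₀ ℕ) : L2 N := orbitalLp (lllIndex α)

theorem orthonormal_lllLp : Orthonormal ℂ (lllLp (N := N)) :=
  (orthonormal_orbitalLp N).comp _ lllIndex_injective

theorem lllLp_eq (α : Fin N →₀ ℕ) :
    ∃ c : ℂ, c ≠ 0 ∧ lllLp α = c • polyLp (monomial α (1 : ℂ)) := by
  obtain ⟨c, hc, h⟩ := orbitalProd_eq (lllIndex α)
  refine ⟨c, hc, ?_⟩
  rw [lllLp, orbitalLp, polyLp_apply, ← MemLp.toLp_const_smul]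
  refine MemLp.toLp_congr _ _ (ae_of_all _ fun x => ?_)
  rw [h, hermiteProd_lllIndex]
  rfl

theorem polyLp_monomial_mem {α : Fin N →₀ ℕ} (c : ℂ) :
    ∃ c' : ℂ, polyLp (monomial α c) = c' • lllLp α := by
  obtain ⟨b, hb, h⟩ := lllLp_eq α
  refine ⟨c * b⁻¹, ?_⟩
  rw [h, smul_smul, mul_assoc, inv_mul_cancel₀ hb, mul_one, ← map_smul, smul_monomial, smul_eq_mul,
    mul_one]

theorem polyFn_jastrow_pow (m : ℕ) (x : Conf N) : polyFn (jastrow N ^ m) x = laughlinFun N m x := by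
  simp only [polyFn, jastrow, laughlinFun, gaussProd, gauss, map_pow, map_prod, map_sub, eval_X,
    Finset.prod_pow]

theorem toLp_laughlinFun (m : ℕ) : (memLp_laughlinFun N m).toLp = polyLp (jastrow N ^ m) :=
  MemLp.toLp_congr _ (memLp_polyFn _) (ae_of_all _ fun x => (polyFn_jastrow_pow m x).symm)

theorem polyLp_eq_zero {Q : MvPolynomial (Fin N) ℂ} (h : polyLp Q = 0) : Q = 0 := by
  rw [polyLp_apply] at h
  have h1 : polyFn Q =ᵐ[volume] 0 := by
    have := (memLp_polyFn Q).coeFn_toLp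
    rw [h] at this
    exact this.symm.trans (Lp.coeFn_zero _ _ _)
  have hc : Continuous (polyFn Q) := (MvPolynomial.continuous_eval Q).mul continuous_gaussProd
  have h2 : polyFn Q = 0 := (hc.ae_eq_iff_eq volume continuous_const).1 h1
  refine MvPolynomial.funext fun x => ?_
  have := congrFun h2 x
  simp only [polyFn, Pi.zero_apply, mul_eq_zero, gaussProd_ne_zero, or_false] at this
  rw [this, map_zero]

theorem norm_laughlinFun_ne_zero (m : ℕ) : ‖(memLp_laughlinFun N m).toLp‖ ≠ 0 := by
  rw [toLp_laughlinFun, norm_ne_zero_iff]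
  exact fun h => pow_ne_zero m (jastrow_ne_zero N) (polyLp_eq_zero h)

theorem norm_laughlin (m : ℕ) : ‖laughlin N m‖ = 1 := by
  rw [laughlin, norm_smul, ← Complex.ofReal_inv, Complex.norm_real, norm_inv, norm_norm,
    inv_mul_cancel₀ (norm_laughlinFun_ne_zero m)]

/-- Polynomials of bounded degree times the Gaussian. -/
def lllSpan (N d : ℕ) : Submodule ℂ (L2 N) :=
  Submodule.span ℂ (lllLp '' {α : Fin N →₀ ℕ | α.degree ≤ d})

theorem finite_degree_le (d : ℕ) : {α : Fin N →₀ ℕ | α.degree ≤ d}.Finite := by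
  refine (Set.finite_Iic (Finsupp.equivFunOnFinite.symm fun _ : Fin N => d)).subset fun α hα i => ?_
  exact (Finsupp.le_degree i α).trans hα

instance (d : ℕ) : FiniteDimensional ℂ (lllSpan N d) :=
  FiniteDimensional.span_of_finite ℂ ((finite_degree_le d).image _)

theorem polyLp_mem_lllSpan {Q : MvPolynomial (Fin N) ℂ} {d : ℕ} (hQ : Q.totalDegree ≤ d) :
    polyLp Q ∈ lllSpan N d := by
  rw [Q.as_sum, map_sum]
  refine Submodule.sum_mem _ fun α hα => ?_
  obtain ⟨c, hc⟩ := polyLp_monomial_mem (α := α) (coeff α Q)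
  rw [hc]
  refine Submodule.smul_mem _ _ (Submodule.subset_span ⟨α, ?_, rfl⟩)
  rw [Set.mem_ofPred_eq]
  refine le_trans ?_ hQ
  exact le_totalDegree hα

theorem exists_polyLp_eq {d : ℕ} {u : L2 N} (hu : u ∈ lllSpan N d) :
    ∃ Q : MvPolynomial (Fin N) ℂ, Q.totalDegree ≤ d ∧ polyLp Q = u := by
  induction hu using Submodule.span_induction with
  | mem u h =>
    obtain ⟨α, hα, rfl⟩ := h
    obtain ⟨c, -, h⟩ := lllLp_eq α
    refine ⟨monomial α c, ?_, ?_⟩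
    · refine (totalDegree_monomial_le _ _).trans ?_
      exact hα
    · rw [h, ← map_smul, smul_monomial, smul_eq_mul, mul_one]
  | zero => exact ⟨0, by simp, map_zero _⟩
  | add u v _ _ h1 h2 =>
    obtain ⟨P, hP, rfl⟩ := h1
    obtain ⟨Q, hQ, rfl⟩ := h2
    exact ⟨P + Q, (totalDegree_add _ _).trans (max_le hP hQ), map_add _ _ _⟩
  | smul c u _ h =>
    obtain ⟨P, hP, rfl⟩ := h
    exact ⟨c • P, (totalDegree_smul_le _ _).trans hP, map_smul _ _ _⟩

/-- Radial weights pick out coefficients of a polynomial. -/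
theorem integral_radial_mul_eval (p : Fin N →₀ ℕ) (ρ : Fin N → ℝ → ℂ)
    (hρ : ∀ k q, Integrable fun z : ℂ => conj (z ^ p k) * z ^ q * ρ k ‖z‖)
    (Q : MvPolynomial (Fin N) ℂ) :
    ∫ x : Conf N, (∏ k, conj (x k ^ p k) * ρ k ‖x k‖) * eval x Q =
      coeff p Q * ∏ k, ∫ z : ℂ, conj (z ^ p k) * z ^ p k * ρ k ‖z‖ := by
  have e : ∀ x : Conf N, (∏ k, conj (x k ^ p k) * ρ k ‖x k‖) * eval x Q =
      ∑ α ∈ Q.support, coeff α Q * ∏ k, (conj (x k ^ p k) * x k ^ α k * ρ k ‖x k‖) := by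
    intro x
    rw [eval_eq', Finset.mul_sum]
    refine Finset.sum_congr rfl fun α _ => ?_
    rw [mul_left_comm, ← Finset.prod_mul_distrib]
    congr 1
    exact Finset.prod_congr rfl fun k _ => by ring
  simp_rw [e]
  rw [integral_finsetSum]
  · simp_rw [integral_const_mul]
    have h1 : ∀ α : Fin N →₀ ℕ, ∫ x : Conf N, ∏ k, (conj (x k ^ p k) * x k ^ α k * ρ k ‖x k‖) =
        ∏ k, ∫ z : ℂ, conj (z ^ p k) * z ^ α k * ρ k ‖z‖ := fun α =>
      integral_fintype_prod_volume_eq_prod fun k z => conj (z ^ p k) * z ^ α k * ρ k ‖z‖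
    simp_rw [h1]
    refine (Finset.sum_eq_single p (fun α _ hα => ?_) fun hp => ?_)
    · obtain ⟨k, hk⟩ : ∃ k, p k ≠ α k := by
        by_contra! hcon
        exact hα (Finsupp.ext fun k => (hcon k).symm)
      rw [Finset.prod_eq_zero (Finset.mem_univ k) (integral_conj_pow_mul_pow_radial hk (ρ k)),
        mul_zero]
    · rw [notMem_support_iff.1 hp, zero_mul]
  · intro α _
    exact (Integrable.fintype_prod fun k => hρ k (α k)).const_mul _

end Poly

/-! ### Radial functions in the plane -/

/-- Polar coordinates with `s = |z|²` as variable, for which the area element is `½ ds dθ`. All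
radial profiles below are functions of `s`, so no Jacobian appears later. -/
theorem lintegral_radial {h : ℝ → ℝ≥0∞} (hh : Measurable h) :
    ∫⁻ z : ℂ, h (‖z‖ ^ 2) = ENNReal.ofReal Real.pi * ∫⁻ s in Set.Ioi 0, h s := by
  rw [← Complex.lintegral_comp_polarCoord_symm]
  have e : ∀ p ∈ polarCoord.target, ENNReal.ofReal p.1 • h (‖Complex.polarCoord.symm p‖ ^ 2) =
      (ENNReal.ofReal p.1 * h (p.1 ^ 2)) * 1 := by
    intro p hp
    rw [Complex.norm_polarCoord_symm, sq_abs, mul_one, smul_eq_mul]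
  rw [setLIntegral_congr_fun polarCoord.open_target.measurableSet e, polarCoord_target,
    Measure.volume_eq_prod, ← Measure.prod_restrict,
    lintegral_prod_mul (f := fun r : ℝ => ENNReal.ofReal r * h (r ^ 2)) (g := fun _ : ℝ => 1)
      (by fun_prop) aemeasurable_const]
  have himg : (fun r : ℝ => r ^ 2) '' Set.Ioi 0 = Set.Ioi 0 := by
    ext s
    constructor
    · rintro ⟨r, hr, rfl⟩
      exact pow_pos (Set.mem_Ioi.1 hr) 2
    · intro hs
      exact ⟨√s, Real.sqrt_pos.2 hs, Real.sq_sqrt (le_of_lt hs)⟩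
  have h1 := lintegral_image_eq_lintegral_abs_deriv_mul (s := Set.Ioi (0 : ℝ)) measurableSet_Ioi
    (f := fun r => r ^ 2) (f' := fun r => 2 * r)
    (fun r _ => by simpa using (hasDerivAt_pow 2 r).hasDerivWithinAt)
    (fun r hr t ht hrt => (pow_left_inj₀ (le_of_lt hr) (le_of_lt ht) two_ne_zero).1 hrt) h
  rw [himg] at h1
  rw [h1]
  have h2 : ∫⁻ r in Set.Ioi (0 : ℝ), ENNReal.ofReal |2 * r| * h (r ^ 2) =
      2 * ∫⁻ r in Set.Ioi (0 : ℝ), ENNReal.ofReal r * h (r ^ 2) := by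
    rw [← lintegral_const_mul _ (by fun_prop)]
    refine setLIntegral_congr_fun measurableSet_Ioi fun r hr => ?_
    have hr' : (0 : ℝ) < r := hr
    rw [abs_of_pos (by positivity), ENNReal.ofReal_mul (by norm_num), mul_assoc]
    simp
  rw [h2, lintegral_one, Measure.restrict_apply MeasurableSet.univ, Set.univ_inter, Real.volume_Ioo,
    show Real.pi - -Real.pi = 2 * Real.pi by ring, ENNReal.ofReal_mul (by norm_num)]
  simp only [ENNReal.ofReal_ofNat]
  ring

/-- The function `b(|z|²) / z̄ᵐ`. -/
def radialFn (b : ℝ → ℝ) (m : ℕ) (z : ℂ) : ℂ := (b (‖z‖ ^ 2) : ℂ) * (conj z ^ m)⁻¹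

theorem radialFn_eq_zero {b : ℝ → ℝ} {m : ℕ} {z : ℂ} (h : b (‖z‖ ^ 2) = 0) : radialFn b m z = 0 := by
  rw [radialFn, h, Complex.ofReal_zero, zero_mul]

theorem measurable_radialFn {b : ℝ → ℝ} (hb : Measurable b) (m : ℕ) : Measurable (radialFn b m) := by
  have : Measurable fun z : ℂ => conj z := Complex.continuous_conj.measurable
  unfold radialFn
  fun_prop

theorem radialFn_eventuallyEq_zero {b : ℝ → ℝ} {c : ℝ} (hc : 0 < c) (h : ∀ s < c, b s = 0) (m : ℕ) :
    radialFn b m =ᶠ[𝓝 0] fun _ => 0 := by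
  have hcont : Continuous fun z : ℂ => ‖z‖ ^ 2 := by fun_prop
  have : ∀ᶠ z : ℂ in 𝓝 0, ‖z‖ ^ 2 < c :=
    hcont.continuousAt.eventually_lt continuousAt_const (by simpa using hc)
  filter_upwards [this] with z hz
  exact radialFn_eq_zero (h _ hz)

theorem contDiff_radialFn {b : ℝ → ℝ} (hb : ContDiff ℝ ∞ b) {c : ℝ} (hc : 0 < c)
    (h : ∀ s < c, b s = 0) (m : ℕ) : ContDiff ℝ ∞ (radialFn b m) := by
  rw [contDiff_iff_contDiffAt]
  intro z
  rcases eq_or_ne z 0 with rfl | hz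
  · exact contDiffAt_const.congr_of_eventuallyEq (radialFn_eventuallyEq_zero hc h m)
  · have h1 : ContDiff ℝ ∞ fun z : ℂ => conj z := Complex.conjCLE.contDiff
    have h2 : ContDiff ℝ ∞ fun z : ℂ => ((b (‖z‖ ^ 2) : ℝ) : ℂ) :=
      Complex.ofRealCLM.contDiff.comp (hb.comp (contDiff_norm_sq ℝ))
    exact h2.contDiffAt.mul ((h1.pow m).contDiffAt.inv
      (pow_ne_zero _ ((map_ne_zero (starRingEnd ℂ)).2 hz)))

theorem hasFDerivAt_ofReal_comp_norm_sq {P : ℝ → ℝ} {b : ℝ} {z : ℂ} (h : HasDerivAt P b (‖z‖ ^ 2)) :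
    HasFDerivAt (fun z : ℂ => ((P (‖z‖ ^ 2) : ℝ) : ℂ)) (wirtinger (b * conj z) (b * z)) z := by
  have h1 : HasFDerivAt (fun z : ℂ => ‖z‖ ^ 2) (2 • innerSL ℝ z) z :=
    (hasStrictFDerivAt_norm_sq z).hasFDerivAt
  have h2 := Complex.ofRealCLM.hasFDerivAt.comp z (h.hasFDerivAt.comp z h1)
  refine h2.congr_fderiv (ContinuousLinearMap.ext fun w => ?_)
  have e : (2 * (inner ℝ z w : ℝ) : ℂ) = conj z * w + z * conj w := by
    rw [Complex.inner]
    have := Complex.add_conj (conj z * w)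
    rw [map_mul, Complex.conj_conj] at this
    rw [this]
    push_cast
    ring_nf
  have e' : (Complex.ofRealCLM ∘SL ContinuousLinearMap.toSpanSingleton ℝ b ∘SL (2 • innerSL ℝ z)) w
      = ((2 * inner ℝ z w * b : ℝ) : ℂ) := by
    simp only [ContinuousLinearMap.comp_apply, Complex.ofRealCLM_apply, _root_.smul_apply,
      innerSL_apply_apply, ContinuousLinearMap.toSpanSingleton_apply, smul_eq_mul, nsmul_eq_mul,
      Nat.cast_ofNat]
  rw [e', wirtinger_apply]
  push_cast
  linear_combination (b : ℂ) * e

/-- Away from zero, `z̄^{-(m+1)}` is antiholomorphic, so `∂` falls only on `P(|z|²)` and produces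
`P'(|z|²) z̄`, cancelling one power. Near zero the function vanishes. The `∂_{z̄}` part is left
unspecified because the raising operator does not see it. -/
theorem hasFDerivAt_radialFn {P b : ℝ → ℝ} (hP : ∀ s, HasDerivAt P (b s) s) {c : ℝ} (hc : 0 < c)
    (h : ∀ s < c, P s = 0) (m : ℕ) (z : ℂ) :
    ∃ B, HasFDerivAt (radialFn P (m + 1)) (wirtinger (radialFn b m z) B) z := by
  rcases eq_or_ne z 0 with rfl | hz
  · refine ⟨0, ?_⟩
    have hb : b 0 = 0 := by
      have h1 : P =ᶠ[𝓝 0] fun _ => 0 := by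
        filter_upwards [gt_mem_nhds hc] with s hs using h s hs
      exact ((hP 0).congr_of_eventuallyEq h1.symm).unique (hasDerivAt_const _ _)
    rw [radialFn_eq_zero (by simpa using hb)]
    refine ((hasFDerivAt_const (0 : ℂ) (0 : ℂ)).congr_of_eventuallyEq
      (radialFn_eventuallyEq_zero hc h (m + 1))).congr_fderiv
      (ContinuousLinearMap.ext fun w => ?_)
    simp
  · have hz' : conj z ≠ 0 := (map_ne_zero (starRingEnd ℂ)).2 hz
    have h1 : HasDerivAt (fun w : ℂ => (w ^ (m + 1))⁻¹)
        (-((m + 1 : ℕ) * conj z ^ m) / (conj z ^ (m + 1)) ^ 2) (conj z) := by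
      have := (hasDerivAt_pow (m + 1) (conj z)).fun_inv (pow_ne_zero _ hz')
      simpa using this
    set q : ℂ := -((m + 1 : ℕ) * conj z ^ m) / (conj z ^ (m + 1)) ^ 2
    have h2 : HasFDerivAt (fun z : ℂ => (conj z ^ (m + 1))⁻¹) (wirtinger 0 q) z := by
      have := (h1.hasFDerivAt.restrictScalars ℝ).comp z (hasFDerivAt_conj_wirtinger z)
      refine this.congr_fderiv (ContinuousLinearMap.ext fun w => ?_)
      simp
      ring
    have h3 := HasFDerivAt.mul_wirtinger (hasFDerivAt_ofReal_comp_norm_sq (hP (‖z‖ ^ 2))) h2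
    have e : (b (‖z‖ ^ 2) : ℂ) * conj z * (conj z ^ (m + 1))⁻¹ + (P (‖z‖ ^ 2) : ℂ) * 0 =
        radialFn b m z := by
      rw [radialFn, mul_zero, add_zero, pow_succ (conj z), mul_inv, mul_assoc, mul_left_comm (conj z),
        mul_inv_cancel₀ hz', mul_one]
    rw [e] at h3
    exact ⟨_, h3⟩

theorem norm_radialFn_sq (b : ℝ → ℝ) (m : ℕ) (z : ℂ) :
    ‖radialFn b m z‖ ^ 2 = b (‖z‖ ^ 2) ^ 2 / (‖z‖ ^ 2) ^ m := by
  rw [radialFn, norm_mul, norm_inv, norm_pow, RCLike.norm_conj, Complex.norm_real, mul_pow, inv_pow,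
    Real.norm_eq_abs, sq_abs, ← pow_mul, ← pow_mul, mul_comm m 2, div_eq_mul_inv]

theorem memLp_radialFn {b : ℝ → ℝ} (hb : Measurable b) {m : ℕ} {B : ℝ}
    (h : ∫⁻ s in Set.Ioi 0, ENNReal.ofReal (b s ^ 2 / s ^ m) ≤ ENNReal.ofReal B) :
    Integrable (fun z => ‖radialFn b m z‖ ^ 2) ∧
      ∫ z, ‖radialFn b m z‖ ^ 2 ≤ Real.pi * max B 0 := by
  have hm : Measurable fun z => ‖radialFn b m z‖ ^ 2 := (measurable_radialFn hb m).norm.pow_const 2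
  have h1 : ∫⁻ z, ENNReal.ofReal (‖radialFn b m z‖ ^ 2) ≤ ENNReal.ofReal (Real.pi * max B 0) := by
    simp_rw [norm_radialFn_sq]
    rw [lintegral_radial (h := fun s => ENNReal.ofReal (b s ^ 2 / s ^ m)) (by fun_prop),
      ENNReal.ofReal_mul Real.pi_pos.le]
    gcongr
    refine h.trans (ENNReal.ofReal_le_ofReal (le_max_left _ _))
  constructor
  · refine ⟨hm.aestronglyMeasurable, ?_⟩
    rw [hasFiniteIntegral_iff_ofReal (ae_of_all _ fun z => by positivity)]
    exact h1.trans_lt ENNReal.ofReal_lt_top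
  · rw [integral_eq_lintegral_of_nonneg_ae (ae_of_all _ fun z => by positivity)
      hm.aestronglyMeasurable]
    exact ENNReal.toReal_le_of_le_ofReal (by positivity) h1

/-! ### Product functions of the relative coordinate -/

section ShearFun

variable {N : ℕ} {i j : Fin N}

/-- A product function in the sheared coordinates, divided by the Gaussian. -/
def shearFn (h : j ≠ i) (G : Fin N → ℂ → ℂ) (x : Conf N) : ℂ :=
  (gaussProd x)⁻¹ * ∏ k, G k (shearHomeo h x k)

theorem contDiff_gaussProd : ContDiff ℝ ∞ (gaussProd (N := N)) := by
  unfold gaussProd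
  exact contDiff_prod fun i _ => contDiff_gauss.comp (contDiff_apply ℝ ℂ i)

theorem contDiff_gaussProd_inv : ContDiff ℝ ∞ fun x : Conf N => (gaussProd x)⁻¹ :=
  contDiff_gaussProd.inv gaussProd_ne_zero

theorem contDiff_shearFn (h : j ≠ i) {G : Fin N → ℂ → ℂ} (hG : ∀ k, ContDiff ℝ ∞ (G k)) :
    ContDiff ℝ ∞ (shearFn h G) := by
  refine contDiff_gaussProd_inv.mul (contDiff_prod fun k _ => ?_)
  exact (hG k).comp ((contDiff_apply ℝ ℂ k).comp (contDiff_shearHomeo h))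

theorem measurable_shearFn (h : j ≠ i) {G : Fin N → ℂ → ℂ} (hG : ∀ k, Measurable (G k)) :
    Measurable (shearFn h G) := by
  have h1 : Measurable fun x : Conf N => (gaussProd x)⁻¹ := contDiff_gaussProd_inv.continuous.measurable
  refine h1.mul (Finset.measurable_fun_prod _ fun k _ => ?_)
  exact (hG k).comp ((measurable_pi_apply k).comp (shearHomeo h).continuous.measurable)

theorem hasCompactSupport_shearFn (h : j ≠ i) {G : Fin N → ℂ → ℂ}
    (hG : ∀ k z, 2 < ‖z‖ ^ 2 → G k z = 0) : HasCompactSupport (shearFn h G) := by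
  refine HasCompactSupport.intro
    (((isCompact_closedBall (0 : Conf N) 2).image (shearHomeo h).symm.continuous)) fun x hx => ?_
  have hx' : shearHomeo h x ∉ Metric.closedBall (0 : Conf N) 2 := fun hmem =>
    hx ⟨_, hmem, (shearHomeo h).symm_apply_apply x⟩
  rw [mem_closedBall_zero_iff, pi_norm_le_iff_of_nonneg (by norm_num)] at hx'
  push Not at hx'
  obtain ⟨k, hk⟩ := hx'
  rw [shearFn, Finset.prod_eq_zero (Finset.mem_univ k) (hG k _ (by nlinarith)), mul_zero]

theorem norm_gaussProd_inv (x : Conf N) :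
    ‖(gaussProd x)⁻¹‖ ^ 2 = Real.exp (∑ k, ‖x k‖ ^ 2) := by
  rw [norm_inv, gaussProd, norm_prod]
  simp_rw [norm_gauss]
  rw [← Real.exp_sum, ← Real.exp_neg, ← Real.exp_nat_mul]
  congr 1
  rw [← Finset.sum_neg_distrib, Finset.mul_sum]
  refine Finset.sum_congr rfl fun k _ => ?_
  push_cast
  ring

theorem norm_shearFn_sq_le (h : j ≠ i) {G : Fin N → ℂ → ℂ}
    (hG : ∀ k z, 2 < ‖z‖ ^ 2 → G k z = 0) (x : Conf N) :
    ‖shearFn h G x‖ ^ 2 ≤ Real.exp (8 * N) * ∏ k, ‖G k (shearHomeo h x k)‖ ^ 2 := by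
  rw [shearFn, norm_mul, mul_pow, norm_prod, Finset.prod_pow]
  by_cases hx : ∃ k, 2 < ‖shearHomeo h x k‖ ^ 2
  · obtain ⟨k, hk⟩ := hx
    have : ∏ k, ‖G k (shearHomeo h x k)‖ = 0 :=
      Finset.prod_eq_zero (Finset.mem_univ k) (by rw [hG k _ hk, norm_zero])
    simp [this]
  push Not at hx
  refine mul_le_mul_of_nonneg_right ?_ (by positivity)
  rw [norm_gaussProd_inv]
  apply Real.exp_le_exp.2
  -- On the support each sheared coordinate has modulus at most `√2`, and the shear adds at most two
  -- of them: `(√2 + √2)² = 8`.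
  have hk : ∀ k, ‖x k‖ ^ 2 ≤ 8 := by
    have hne : ∀ k, k ≠ i → ‖x k‖ ^ 2 ≤ 2 := fun k hki => by
      have := hx k
      rwa [shearHomeo_apply, Function.update_of_ne hki] at this
    intro k
    rcases eq_or_ne k i with rfl | hki
    · have h1 := hx k
      rw [shearHomeo_apply, Function.update_self] at h1
      have h2 := hne j h
      have h3 : ‖x k‖ ≤ ‖x k - x j‖ + ‖x j‖ := by simpa using norm_add_le (x k - x j) (x j)
      have h4 := norm_nonneg (x k)
      nlinarith [sq_nonneg (‖x k - x j‖ - ‖x j‖)]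
    · linarith [hne k hki]
  calc ∑ k, ‖x k‖ ^ 2 ≤ ∑ _k : Fin N, (8 : ℝ) := Finset.sum_le_sum fun k _ => hk k
    _ = 8 * N := by simp [mul_comm]

theorem memLp_shearFn (h : j ≠ i) {G : Fin N → ℂ → ℂ} (hm : ∀ k, Measurable (G k))
    (hG : ∀ k z, 2 < ‖z‖ ^ 2 → G k z = 0) (hi : ∀ k, Integrable fun z => ‖G k z‖ ^ 2) :
    MemLp (shearFn h G) 2 volume ∧
      ∫ x, ‖shearFn h G x‖ ^ 2 ≤ Real.exp (8 * N) * ∏ k, ∫ z, ‖G k z‖ ^ 2 := by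
  have hmeas := (measurable_shearFn h hm).aestronglyMeasurable (μ := volume)
  have h1 : Integrable fun y : Conf N => Real.exp (8 * N) * ∏ k, ‖G k (y k)‖ ^ 2 :=
    (Integrable.fintype_prod hi).const_mul _
  have h2 : Integrable fun x : Conf N => Real.exp (8 * N) * ∏ k, ‖G k (shearHomeo h x k)‖ ^ 2 :=
    (measurePreserving_shearHomeo h).integrable_comp_of_integrable h1
  have h3 : Integrable fun x => ‖shearFn h G x‖ ^ 2 :=
    h2.mono' (hmeas.norm.pow 2) (ae_of_all _ fun x => by
      rw [Real.norm_of_nonneg (by positivity)]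
      exact norm_shearFn_sq_le h hG x)
  refine ⟨(memLp_two_iff_integrable_sq_norm hmeas).2 h3, ?_⟩
  refine (integral_mono h3 h2 fun x => norm_shearFn_sq_le h hG x).trans_eq ?_
  rw [(measurePreserving_shearHomeo h).integral_comp (shearHomeo h).measurableEmbedding
    (fun y : Conf N => Real.exp (8 * N) * ∏ k, ‖G k (y k)‖ ^ 2), integral_const_mul,
    integral_fintype_prod_volume_eq_prod fun k z => ‖G k z‖ ^ 2]

theorem fderiv_gaussProd_inv (i : Fin N) (x : Conf N) (w : ℂ) :
    fderiv ℝ (fun x : Conf N => (gaussProd x)⁻¹) x (Pi.single i w) =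
      (1 / 2) * (conj (x i) * w + x i * conj w) * (gaussProd x)⁻¹ := by
  have hd : ∀ k, DifferentiableAt ℝ (fun z => (gauss z)⁻¹) (x k) := fun k =>
    ((contDiff_gauss.differentiable (by simp)) _).inv (gauss_ne_zero _)
  have h1 := fderiv_prod_single (i := i) (x := x) (f := fun _ z => (gauss z)⁻¹) hd w
  have h2 : HasFDerivAt (fun z => (gauss z)⁻¹)
      (wirtinger ((1 / 2) * conj (x i) * (gauss (x i))⁻¹) ((1 / 2) * x i * (gauss (x i))⁻¹)) (x i) := by
    have := (hasDerivAt_inv (gauss_ne_zero (x i))).hasFDerivAt.restrictScalars ℝ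
    refine (this.comp (x i) (hasFDerivAt_gauss (x i))).congr_fderiv
      (ContinuousLinearMap.ext fun w => ?_)
    simp
    field_simp [gauss_ne_zero (x i)]
    ring
  rw [h2.fderiv] at h1
  have e : (fun x : Conf N => (gaussProd x)⁻¹) = fun x => ∏ k, (gauss (x k))⁻¹ := by
    funext x
    rw [gaussProd, Finset.prod_inv_distrib]
  rw [congrFun e x, e, h1, ← Finset.mul_prod_erase _ _ (Finset.mem_univ i), wirtinger_apply]
  ring

/-- The inverse Gaussian is annihilated by the raising operator, the formal adjoint of `lowering`.
On multiples of it, that operator is therefore plain `-2i∂`. In inner products with polynomials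
times the Gaussian, the same factor removes the Gaussian altogether. -/
theorem magMomentum_gaussProd_inv (i : Fin N) (x : Conf N) :
    magMomentum i 0 (fun x : Conf N => (gaussProd x)⁻¹) x -
      Complex.I * magMomentum i 1 (fun x : Conf N => (gaussProd x)⁻¹) x = 0 := by
  have e1 : conj (x i) = (x i).re - (x i).im * Complex.I := by
    apply Complex.ext <;> simp
  have e2 : x i = (x i).re + (x i).im * Complex.I := (Complex.re_add_im (x i)).symm
  simp only [magMomentum, dir, vecPot, Matrix.cons_val_zero, Matrix.cons_val_one,
    Matrix.cons_val_fin_one, fderiv_gaussProd_inv, map_one, Complex.conj_I, Complex.ofReal_neg]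
  linear_combination ((gaussProd x)⁻¹ * Complex.I * (-1)) * e1 +
    ((gaussProd x)⁻¹ * (x i).im + 1 / 2 * conj (x i) * Complex.I * (gaussProd x)⁻¹
      - 1 / 2 * x i * Complex.I * (gaussProd x)⁻¹) * Complex.I_mul_I

/-- The raising operator on product functions of the relative coordinate. -/
theorem magMomentum_shearFn (h : j ≠ i) {G : Fin N → ℂ → ℂ}
    (hG : ∀ k, ContDiff ℝ ∞ (G k)) {A : ℂ → ℂ}
    (hA : ∀ z, ∃ B, HasFDerivAt (G i) (wirtinger (A z) B) z) (x : Conf N) :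
    magMomentum i 0 (shearFn h G) x - Complex.I * magMomentum i 1 (shearFn h G) x =
      -(2 * Complex.I) * shearFn h (Function.update G i A) x := by
  have hPd : ContDiff ℝ ∞ fun y : Conf N => ∏ k, G k (y k) :=
    contDiff_prod fun k _ => (hG k).comp (contDiff_apply ℝ ℂ k)
  set P : Conf N → ℂ := fun x => ∏ k, G k (shearHomeo h x k) with hP
  have hPc : ContDiff ℝ ∞ P := hPd.comp (contDiff_shearHomeo h)
  have e : shearFn h G = fun x => P x * (gaussProd x)⁻¹ := by
    funext x
    rw [shearFn, mul_comm]
  obtain ⟨B, hB⟩ := hA (shearHomeo h x i)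
  have hder : ∀ w, fderiv ℝ P x (Pi.single i w) =
      (A (shearHomeo h x i) * w + B * conj w) *
        ∏ k ∈ Finset.univ.erase i, G k (shearHomeo h x k) := by
    intro w
    have hl : HasFDerivAt (shearHomeo h)
        (LinearMap.toContinuousLinearMap ((shear i j (-1)).restrictScalars ℝ)) x :=
      (LinearMap.toContinuousLinearMap ((shear i j (-1)).restrictScalars ℝ)).hasFDerivAt
    have h1 := ((hPd.differentiable (by simp) (shearHomeo h x)).hasFDerivAt.comp x hl).fderiv
    have h2 : P = (fun y : Conf N => ∏ k, G k (y k)) ∘ shearHomeo h := rfl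
    rw [h2, h1, ContinuousLinearMap.comp_apply]
    have h3 : (LinearMap.toContinuousLinearMap ((shear i j (-1)).restrictScalars ℝ))
        (Pi.single i w) = Pi.single i w := by
      change shear i j (-1) (Pi.single i w) = _
      rw [shear_apply]
      funext k
      rcases eq_or_ne k i with rfl | hk
      · simp [Pi.single_eq_of_ne h]
      · simp [hk]
    rw [h3, fderiv_prod_single (fun k => (hG k).differentiable (by simp) _), hB.fderiv,
      wirtinger_apply]
  have hd1 : DifferentiableAt ℝ P x := hPc.differentiable (by simp) x
  have hd2 : DifferentiableAt ℝ (fun x : Conf N => (gaussProd x)⁻¹) x :=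
    contDiff_gaussProd_inv.differentiable (by simp) x
  have h0 := magMomentum_gaussProd_inv i x
  have h4 : shearFn h (Function.update G i A) x = (gaussProd x)⁻¹ * (A (shearHomeo h x i) *
      ∏ k ∈ Finset.univ.erase i, G k (shearHomeo h x k)) := by
    rw [shearFn, ← Finset.mul_prod_erase _ _ (Finset.mem_univ i), Function.update_self]
    congr 2
    exact Finset.prod_congr rfl fun k hk => by
      rw [Function.update_of_ne (Finset.ne_of_mem_erase hk)]
  rw [h4, e, magMomentum_mul i 0 hd1 hd2, magMomentum_mul i 1 hd1 hd2, hder, hder]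
  simp only [dir, Matrix.cons_val_zero, Matrix.cons_val_one, Matrix.cons_val_fin_one, map_one,
    Complex.conj_I]
  linear_combination P x * h0 + (gaussProd x)⁻¹ *
    (∏ k ∈ Finset.univ.erase i, G k (shearHomeo h x k)) * Complex.I *
      (A (shearHomeo h x i) - B) * Complex.I_mul_I

/-- The definition of the weak momenta, applied to a smooth compactly supported test function, moves
the lowering operator from the state to the test function. -/
theorem inner_shearFn_lowering (h : j ≠ i) {G : Fin N → ℂ → ℂ}
    (hG : ∀ k, ContDiff ℝ ∞ (G k)) (hGs : ∀ k z, 2 < ‖z‖ ^ 2 → G k z = 0) {A : ℂ → ℂ}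
    (hA : ∀ z, ∃ B, HasFDerivAt (G i) (wirtinger (A z) B) z) {Ψ : L2 N}
    (hΨ : ∀ k, IsWeakMagMomentum i k Ψ (weakMagMomentum i k Ψ)) :
    ∫ x, conj (shearFn h G x) * lowering i Ψ x =
      2 * Complex.I * ∫ x, conj (shearFn h (Function.update G i A) x) * Ψ x := by
  have hφ := contDiff_shearFn h hG
  have hs := hasCompactSupport_shearFn h hGs
  have hL : MemLp (shearFn h G) 2 volume := hφ.continuous.memLp_of_hasCompactSupport hs
  have hL' : ∀ k, MemLp (magMomentum i k (shearFn h G)) 2 volume := fun k =>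
    (continuous_magMomentum i k (hφ.of_le (by simp))).memLp_of_hasCompactSupport
      (hasCompactSupport_magMomentum i k hs)
  have e : ∀ k, ∫ x, conj (shearFn h G x) * weakMagMomentum i k Ψ x =
      ∫ x, star (magMomentum i k (shearFn h G) x) * Ψ x := fun k => (hΨ k _ hφ hs).symm
  rw [← inner_toLp_left hL, lowering, inner_add_right, inner_smul_right, inner_toLp_left,
    inner_toLp_left, e, e, ← integral_const_mul, ← integral_const_mul,
    ← integral_add]
  · refine integral_congr_ae (ae_of_all _ fun x => ?_)
    have := congrArg conj (magMomentum_shearFn h hG hA x)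
    simp only [map_sub, map_mul, map_neg, Complex.conj_I, map_ofNat] at this
    simp only [Complex.star_def]
    linear_combination Ψ x * this
  · exact integrable_conj_mul (hL' 0) (Lp.memLp Ψ)
  · exact (integrable_conj_mul (hL' 1) (Lp.memLp Ψ)).const_mul _

end ShearFun

/-! ### Vectors detecting the coefficients of a polynomial -/

/-- A smooth bump on `[1, 2]` with integral one. -/
def bump : ℝ → ℝ := (⟨1 / 4, 1 / 2, by norm_num, by norm_num⟩ : ContDiffBump (3 / 2 : ℝ)).normed volume

theorem contDiff_bump : ContDiff ℝ ∞ bump := ContDiffBump.contDiff_normed _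

theorem bump_nonneg (s : ℝ) : 0 ≤ bump s := ContDiffBump.nonneg_normed _ _

theorem integral_bump : ∫ s, bump s = 1 := ContDiffBump.integral_normed _

theorem mem_of_bump_ne_zero {s : ℝ} (h : bump s ≠ 0) : 1 < s ∧ s < 2 := by
  have h1 : s ∈ Function.support bump := h
  rw [bump, ContDiffBump.support_normed_eq, Metric.mem_ball, Real.dist_eq, abs_lt] at h1
  simp only at h1
  constructor <;> linarith [h1.1, h1.2]

theorem bump_eq_zero_of_lt {s : ℝ} (h : s < 1) : bump s = 0 := by
  by_contra hne
  linarith [(mem_of_bump_ne_zero hne).1]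

theorem bump_eq_zero_of_gt {s : ℝ} (h : 2 < s) : bump s = 0 := by
  by_contra hne
  linarith [(mem_of_bump_ne_zero hne).2]

theorem bump_pos : bump (3 / 2) ≠ 0 := by
  have : (3 / 2 : ℝ) ∈ Function.support bump := by
    rw [bump, ContDiffBump.support_normed_eq]
    exact Metric.mem_ball_self (by norm_num)
  exact this

theorem contDiff_radialFn_bump (m : ℕ) : ContDiff ℝ ∞ (radialFn bump m) :=
  contDiff_radialFn contDiff_bump one_pos (fun _ h => bump_eq_zero_of_lt h) m

theorem hasCompactSupport_of_norm_sq {f : ℂ → ℂ} (h : ∀ z, 2 < ‖z‖ ^ 2 → f z = 0) :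
    HasCompactSupport f := by
  refine HasCompactSupport.intro (isCompact_closedBall (0 : ℂ) 2) fun z hz => h z ?_
  rw [mem_closedBall_zero_iff, not_le] at hz
  nlinarith

theorem radialFn_bump_eq_zero (m : ℕ) (z : ℂ) (h : 2 < ‖z‖ ^ 2) : radialFn bump m z = 0 :=
  radialFn_eq_zero (bump_eq_zero_of_gt h)

theorem integrable_norm_radialFn_bump (m : ℕ) : Integrable fun z => ‖radialFn bump m z‖ ^ 2 := by
  have h1 := (contDiff_radialFn_bump m).continuous
  refine Continuous.integrable_of_hasCompactSupport (by fun_prop) ?_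
  exact (hasCompactSupport_of_norm_sq (radialFn_bump_eq_zero m)).comp_left (g := fun z => ‖z‖ ^ 2)
    (by simp)

theorem conj_radialFn_bump (p : ℕ) (z : ℂ) :
    conj (radialFn bump p z) = conj (z ^ p) * ((bump (‖z‖ ^ 2) / (‖z‖ ^ 2) ^ p : ℝ) : ℂ) := by
  rcases eq_or_ne z 0 with rfl | hz
  · have : bump 0 = 0 := bump_eq_zero_of_lt one_pos
    simp [radialFn, this]
  · have h1 : z ^ p ≠ 0 := pow_ne_zero _ hz
    have h2 : conj (z ^ p) ≠ 0 := (map_ne_zero _).2 h1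
    have h3 : ((‖z‖ ^ 2 : ℝ) : ℂ) ^ p = z ^ p * conj (z ^ p) := by
      rw [map_pow, ← mul_pow, Complex.mul_conj, Complex.normSq_eq_norm_sq]
    rw [radialFn, map_mul, Complex.conj_ofReal, map_inv₀, map_pow, Complex.conj_conj,
      Complex.ofReal_div, Complex.ofReal_pow _ p, h3]
    field_simp

theorem integral_bump_norm_sq_ne_zero : ∫ z : ℂ, (bump (‖z‖ ^ 2) : ℂ) ≠ 0 := by
  rw [integral_complex_ofReal]
  refine Complex.ofReal_ne_zero.2 (ne_of_gt ?_)
  have h1 := contDiff_bump.continuous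
  refine Continuous.integral_pos_of_hasCompactSupport_nonneg_nonzero (x := (√(3 / 2) : ℂ))
    (by fun_prop) ?_ (fun z => bump_nonneg _) ?_
  · refine HasCompactSupport.intro (isCompact_closedBall (0 : ℂ) 2) fun z hz => ?_
    rw [mem_closedBall_zero_iff, not_le] at hz
    exact bump_eq_zero_of_gt (by nlinarith)
  · rw [Complex.norm_real, Real.norm_eq_abs, sq_abs, Real.sq_sqrt (by norm_num)]
    exact bump_pos

section Detect

open MvPolynomial

variable {N : ℕ} {i j : Fin N}

theorem memLp_detect (h : j ≠ i) (α : Fin N →₀ ℕ) :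
    MemLp (shearFn h fun k => radialFn bump (α k)) 2 volume :=
  (memLp_shearFn h (fun k => (contDiff_radialFn_bump (α k)).continuous.measurable)
    (fun k => radialFn_bump_eq_zero (α k)) fun k => integrable_norm_radialFn_bump (α k)).1

/-- The vector whose inner product with a polynomial times the Gaussian is, up to a constant, a
coefficient of the polynomial in the relative coordinate of a pair. -/
def detect (h : j ≠ i) (α : Fin N →₀ ℕ) : L2 N := (memLp_detect h α).toLp _

/-- The Gaussian cancels and the change to relative coordinates turns `Q` into its sheared version.
The angular integrals then select the monomial `α`, and each factor `|z^p|²` cancels against the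
weight, so the constant does not depend on `α`. -/
theorem inner_detect_polyLp (h : j ≠ i) (α : Fin N →₀ ℕ) (Q : MvPolynomial (Fin N) ℂ) :
    inner ℂ (detect h α) (polyLp Q) =
      coeff α (shearHom i j 1 Q) * (∫ z : ℂ, (bump (‖z‖ ^ 2) : ℂ)) ^ N := by
  rw [detect, polyLp_apply, inner_toLp_toLp]
  set ρ : Fin N → ℝ → ℂ := fun k t => ((bump (t ^ 2) / (t ^ 2) ^ α k : ℝ) : ℂ) with hρ
  have e : ∀ x : Conf N, conj (shearFn h (fun k => radialFn bump (α k)) x) * polyFn Q x =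
      (fun y : Conf N => (∏ k, conj (y k ^ α k) * ρ k ‖y k‖) * eval y (shearHom i j 1 Q))
        (shearHomeo h x) := by
    intro x
    simp only [shearFn, polyFn, map_mul, map_inv₀, conj_gaussProd, map_prod, conj_radialFn_bump]
    rw [eval_shearHom, ← shearHomeo_symm_apply h, Homeomorph.symm_apply_apply]
    have := gaussProd_ne_zero x
    field_simp
    exact mul_comm _ _
  rw [integral_congr_ae (ae_of_all _ e),
    (measurePreserving_shearHomeo h).integral_comp (shearHomeo h).measurableEmbedding
      (fun y : Conf N => (∏ k, conj (y k ^ α k) * ρ k ‖y k‖) * eval y (shearHom i j 1 Q)),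
    integral_radial_mul_eval]
  · congr 1
    rw [Finset.prod_congr rfl fun k _ => ?_, Finset.prod_const, Finset.card_univ, Fintype.card_fin]
    refine integral_congr_ae (ae_of_all _ fun z => ?_)
    simp only [hρ]
    rcases eq_or_ne z 0 with rfl | hz
    · have : bump 0 = 0 := bump_eq_zero_of_lt one_pos
      simp [this]
    · have h1 : z ^ α k ≠ 0 := pow_ne_zero _ hz
      have h2 : conj (z ^ α k) ≠ 0 := (map_ne_zero _).2 h1
      have h3 : ((‖z‖ ^ 2 : ℝ) : ℂ) ^ α k = z ^ α k * conj (z ^ α k) := by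
        rw [map_pow, ← mul_pow, Complex.mul_conj, Complex.normSq_eq_norm_sq]
      rw [Complex.ofReal_div, Complex.ofReal_pow _ (α k), h3]
      field_simp
  · intro k q
    have h1 := (contDiff_radialFn_bump (α k)).continuous
    have h2 : Continuous fun z => conj (radialFn bump (α k) z) * z ^ q := by fun_prop
    have h3 : HasCompactSupport fun z => conj (radialFn bump (α k) z) * z ^ q :=
      hasCompactSupport_of_norm_sq fun z hz => by
        rw [radialFn_bump_eq_zero _ z hz, map_zero, zero_mul]
    refine (h2.integrable_of_hasCompactSupport h3).congr (ae_of_all _ fun z => ?_)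
    simp only [conj_radialFn_bump, hρ]
    ring

theorem inner_detect_eq_zero_of_isHomogeneous (h : j ≠ i) {α : Fin N →₀ ℕ}
    {Q : MvPolynomial (Fin N) ℂ} {d : ℕ} (hQ : Q.IsHomogeneous d) (hd : α.degree ≠ d) :
    inner ℂ (detect h α) (polyLp Q) = 0 := by
  rw [inner_detect_polyLp, (shearHom_isHomogeneous 1 hQ).coeff_eq_zero hd, zero_mul]

theorem coeff_shearHom_eq_zero {Q : MvPolynomial (Fin N) ℂ} {d : ℕ} (hQ : Q.totalDegree ≤ d)
    {α : Fin N →₀ ℕ} (hα : d < α.degree) (c : ℂ) : coeff α (shearHom i j c Q) = 0 := by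
  rw [← sum_homogeneousComponent Q, map_sum, coeff_sum]
  refine Finset.sum_eq_zero fun n hn => ?_
  refine (shearHom_isHomogeneous c (homogeneousComponent_isHomogeneous n Q)).coeff_eq_zero ?_
  have := Finset.mem_range.1 hn
  omega

/-- Vanishing of these inner products says that the sheared polynomial contains no power of the
relative coordinate below `n`. Monomials above the degree bound are absent anyway, so finitely many
vectors suffice. -/
theorem exists_eq_smul_of_inner_detect_eq_zero {n : ℕ} {u : L2 N} (hu : u ∈ lllSpan N (numPairs N * n))
    (h : ∀ (i j : Fin N) (hij : i < j) (α : Fin N →₀ ℕ), α i < n → α.degree ≤ numPairs N * n →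
      inner ℂ (detect hij.ne' α) u = 0) : ∃ c : ℂ, u = c • polyLp (jastrow N ^ n) := by
  obtain ⟨Q, hQ, rfl⟩ := exists_polyLp_eq hu
  obtain ⟨c, hc⟩ := exists_eq_smul_jastrow_pow hQ fun i j hij α hα => by
    rcases le_or_gt α.degree (numPairs N * n) with hd | hd
    · have := h i j hij α hα hd
      rw [inner_detect_polyLp] at this
      exact (mul_eq_zero.1 this).resolve_right (pow_ne_zero _ integral_bump_norm_sq_ne_zero)
    · exact coeff_shearHom_eq_zero hQ hd 1
  exact ⟨c, by rw [hc, ← map_smul, smul_eq_C_mul]⟩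

theorem inner_detect_jastrow_pow (i j : Fin N) (hij : i < j) {n : ℕ} {α : Fin N →₀ ℕ} (hα : α i < n) :
    inner ℂ (detect hij.ne' α) (polyLp (jastrow N ^ n)) = 0 := by
  rw [inner_detect_polyLp]
  have h1 : (X i - X j : MvPolynomial (Fin N) ℂ) ∣ jastrow N := by
    refine (Finset.dvd_prod_of_mem (fun j => (X i - X j : MvPolynomial (Fin N) ℂ))
      (Finset.mem_Ioi.2 hij)).trans ?_
    exact Finset.dvd_prod_of_mem (fun i => ∏ j ∈ Finset.Ioi i, (X i - X j : MvPolynomial (Fin N) ℂ))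
      (Finset.mem_univ i)
  obtain ⟨R, hR⟩ := map_dvd (shearHom i j 1) (pow_dvd_pow_of_dvd h1 n)
  have h2 : shearHom i j 1 (X i - X j) = X i := by
    rw [← shearEquiv_apply hij.ne', shearEquiv_sub]
  rw [map_pow _ (X i - X j), h2] at hR
  rw [hR, X_pow_eq_monomial, coeff_monomial_mul', if_neg, zero_mul]
  rw [Finsupp.single_le_iff]
  omega

end Detect

/-! ### Smooth approximation of a normalized indicator function -/

/-- Test functions must be smooth, whereas the lower bound on `v` is available only on a measurable
set `U`. The `L²` closeness controls the error in the test function. The mass and the bound on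
primitives come from `L¹` closeness, which follows because everything lives in a fixed bounded
interval. -/
theorem exists_smooth_approx {c d : ℝ} (hc : 0 < c) (hcd : c ≤ d) {U : Set ℝ} (hU : MeasurableSet U)
    (hUs : U ⊆ Set.Icc c d) (h0 : 0 < volume U) {ε : ℝ} (hε : 0 < ε) (hε1 : ε ≤ 1) :
    ∃ g : ℝ → ℝ, ContDiff ℝ ∞ g ∧ (∀ s, g s ≠ 0 → s ∈ Set.Icc (c / 2) (2 * d)) ∧
      ∫⁻ s, ENNReal.ofReal ((g s - U.indicator (fun _ => (volume.real U)⁻¹) s) ^ 2) ≤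
        ENNReal.ofReal (ε ^ 2) ∧
      |(∫ s, g s) - 1| ≤ ε ∧ ∀ t, |∫ s in (0 : ℝ)..t, g s| ≤ 2 := by
  set w : ℝ → ℝ := U.indicator fun _ => (volume.real U)⁻¹ with hw
  have hUfin : volume U ≠ ⊤ :=
    ((measure_mono hUs).trans_lt (by rw [Real.volume_Icc]; exact ENNReal.ofReal_lt_top)).ne
  have hUr : volume.real U ≠ 0 := (ENNReal.toReal_pos h0.ne' hUfin).ne'
  have hwL : MemLp w 2 volume := memLp_indicator_const 2 hU _ (Or.inr hUfin)
  have hwi : Integrable w := (integrable_indicator_iff hU).2 (integrableOn_const hUfin)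
  have hw1 : ∫ s, w s = 1 := by
    rw [hw, integral_indicator_const _ hU, smul_eq_mul, mul_inv_cancel₀ hUr]
  have hw0 : ∀ s, 0 ≤ w s := Set.indicator_nonneg fun _ _ => by positivity
  have hd : 0 < d := hc.trans_le hcd
  -- Chosen so that `d * η ≤ ε / 2`; below, `ε'` is chosen to satisfy both `ε' ≤ ε` and `ε' ^ 2 ≤ ε
  -- * η`.
  set η : ℝ := ε / (2 * (d + 1)) with hη
  have hη0 : 0 < η := by positivity
  set ε' : ℝ := ε * min 1 (√η) with hε'
  have hε'0 : 0 < ε' := by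
    have : 0 < min 1 (√η) := lt_min one_pos (Real.sqrt_pos.2 hη0)
    positivity
  have hε'ε : ε' ≤ ε := mul_le_of_le_one_right hε.le (min_le_left _ _)
  have hε'2 : ε' ^ 2 ≤ ε * η := by
    rw [hε', mul_pow]
    have h1 : min 1 (√η) ^ 2 ≤ η := by
      calc min 1 (√η) ^ 2 ≤ √η ^ 2 := by
            have : 0 ≤ min 1 (√η) := le_min zero_le_one (Real.sqrt_nonneg _)
            exact pow_le_pow_left₀ this (min_le_right _ _) 2
        _ = η := Real.sq_sqrt hη0.le
    have h2 : ε ^ 2 ≤ ε := by nlinarith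
    exact mul_le_mul h2 h1 (sq_nonneg _) hε.le
  obtain ⟨g₀, -, hg₀, hg₀a⟩ := hwL.exist_eLpNorm_sub_le (by norm_num) (by norm_num) hε'0
  -- One on `[c, d]` and supported in `[c/2, d + c/2]`. The additional `c / 4` keeps the inner
  -- radius positive if `c = d`.
  let χ : ContDiffBump ((c + d) / 2) :=
    ⟨(d - c) / 2 + c / 4, (d - c) / 2 + c / 2, by linarith, by linarith⟩
  set g : ℝ → ℝ := fun s => χ s * g₀ s with hg
  have hgd : ContDiff ℝ ∞ g := χ.contDiff.mul hg₀
  have hgs : ∀ s, g s ≠ 0 → s ∈ Set.Icc (c / 2) (2 * d) := by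
    intro s hs
    have h1 : s ∈ Function.support χ := left_ne_zero_of_mul hs
    rw [χ.support_eq, Metric.mem_ball, Real.dist_eq, abs_lt] at h1
    simp only [χ] at h1
    exact ⟨by linarith [h1.1], by linarith [h1.2]⟩
  have hgw : ∀ s, (g s - w s) ^ 2 ≤ (w s - g₀ s) ^ 2 := by
    intro s
    have h1 : w s = χ s * w s := by
      by_cases hs : s ∈ U
      · have : χ s = 1 := χ.one_of_mem_closedBall (by
          rw [Metric.mem_closedBall, Real.dist_eq, abs_le]
          have := hUs hs
          simp only [χ]
          constructor <;> linarith [this.1, this.2])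
        rw [this, one_mul]
      · simp [hw, hs]
    have h2 : (g s - w s) ^ 2 = χ s ^ 2 * (w s - g₀ s) ^ 2 := by
      have : g s - w s = χ s * (g₀ s - w s) := by rw [mul_sub, ← h1]
      rw [this]; ring
    rw [h2]
    have h3 : χ s ^ 2 ≤ 1 := pow_le_one₀ χ.nonneg χ.le_one
    exact mul_le_of_le_one_left (sq_nonneg _) h3
  have hL2 : ∫⁻ s, ENNReal.ofReal ((g s - w s) ^ 2) ≤ ENNReal.ofReal (ε' ^ 2) := by
    calc ∫⁻ s, ENNReal.ofReal ((g s - w s) ^ 2) ≤ ∫⁻ s, ‖(w - g₀) s‖ₑ ^ 2 := by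
          refine lintegral_mono fun s => ?_
          rw [← ofReal_norm, ← ENNReal.ofReal_pow (norm_nonneg _), Real.norm_eq_abs, sq_abs]
          exact ENNReal.ofReal_le_ofReal (hgw s)
      _ = eLpNorm (w - g₀) 2 volume ^ 2 := by
          rw [eLpNorm_eq_lintegral_rpow_enorm_toReal (by norm_num) (by norm_num),
            ← ENNReal.rpow_natCast, ← ENNReal.rpow_mul]
          simp
      _ ≤ ENNReal.ofReal ε' ^ 2 := by gcongr
      _ = ENNReal.ofReal (ε' ^ 2) := (ENNReal.ofReal_pow hε'0.le 2).symm
  have hgi : Integrable g := by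
    refine hgd.continuous.integrable_of_hasCompactSupport
      (HasCompactSupport.intro (isCompact_Icc (a := c / 2) (b := 2 * d)) fun s hs => ?_)
    by_contra hne
    exact hs (hgs s hne)
  have hm : Measurable fun s => (g s - w s) ^ 2 :=
    ((hgd.continuous.measurable).sub (measurable_const.indicator hU)).pow_const 2
  have hsq : Integrable fun s => (g s - w s) ^ 2 := by
    refine ⟨hm.aestronglyMeasurable, ?_⟩
    rw [hasFiniteIntegral_iff_ofReal (ae_of_all _ fun z => by positivity)]
    exact hL2.trans_lt ENNReal.ofReal_lt_top
  have hsqi : ∫ s, (g s - w s) ^ 2 ≤ ε' ^ 2 := by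
    rw [integral_eq_lintegral_of_nonneg_ae (ae_of_all _ fun z => by positivity)
      hm.aestronglyMeasurable]
    exact ENNReal.toReal_le_of_le_ofReal (by positivity) hL2
  have hdi : Integrable fun s => |g s - w s| := (hgi.sub hwi).abs
  have hL1 : ∫ s, |g s - w s| ≤ ε := by
    have hind : Integrable ((Set.Icc (c / 2) (2 * d)).indicator fun _ : ℝ => η / 2) :=
      (integrable_indicator_iff measurableSet_Icc).2 (integrableOn_const (by
        rw [Real.volume_Icc]; exact ENNReal.ofReal_ne_top))
    -- `|t| ≤ t²/(2η) + η/2` converts the `L²` bound into an `L¹` bound on the bounded support.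
    have hle : ∀ s, |g s - w s| ≤ (2 * η)⁻¹ * (g s - w s) ^ 2 +
        (Set.Icc (c / 2) (2 * d)).indicator (fun _ : ℝ => η / 2) s := by
      intro s
      by_cases hs : s ∈ Set.Icc (c / 2) (2 * d)
      · rw [Set.indicator_of_mem hs]
        have : (2 * η)⁻¹ * (g s - w s) ^ 2 + η / 2 - |g s - w s| =
            (2 * η)⁻¹ * (|g s - w s| - η) ^ 2 := by
          rw [← sq_abs (g s - w s)]
          field_simp
          ring
        have h2 : 0 ≤ (2 * η)⁻¹ * (|g s - w s| - η) ^ 2 := by positivity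
        linarith
      · have h1 : g s = 0 := by
          by_contra hne
          exact hs (hgs s hne)
        have h2 : w s = 0 := Set.indicator_of_notMem (fun hsU => hs
          ⟨by linarith [(hUs hsU).1], by linarith [(hUs hsU).2]⟩) _
        rw [h1, h2, Set.indicator_of_notMem hs]
        simp
    calc ∫ s, |g s - w s| ≤ ∫ s, ((2 * η)⁻¹ * (g s - w s) ^ 2 +
          (Set.Icc (c / 2) (2 * d)).indicator (fun _ : ℝ => η / 2) s) :=
        integral_mono hdi ((hsq.const_mul _).add hind) hle
      _ = (2 * η)⁻¹ * (∫ s, (g s - w s) ^ 2) + (2 * d - c / 2) * (η / 2) := by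
        rw [integral_add (hsq.const_mul _) hind, integral_const_mul,
          integral_indicator_const _ measurableSet_Icc, smul_eq_mul, Real.volume_real_Icc_of_le
            (by linarith)]
      _ ≤ (2 * η)⁻¹ * (ε * η) + (2 * d) * (η / 2) := by
        have := hsqi.trans hε'2
        gcongr
        linarith
      _ = ε / 2 + d * η := by field_simp
      _ ≤ ε := by
        have : d * η ≤ ε / 2 := by
          rw [hη, mul_div_assoc', div_le_div_iff₀ (by positivity) (by positivity)]
          nlinarith
        linarith
  refine ⟨g, hgd, hgs, hL2.trans (ENNReal.ofReal_le_ofReal (by gcongr)), ?_, fun t => ?_⟩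
  · rw [← hw1, ← integral_sub hgi hwi]
    exact (abs_integral_le_integral_abs).trans hL1
  · have h1 : |∫ s in (0 : ℝ)..t, g s| ≤ ∫ s, |g s| := by
      refine (intervalIntegral.norm_integral_le_integral_norm_uIoc (f := g) (μ := volume)).trans ?_
      exact setIntegral_le_integral hgi.abs (ae_of_all _ fun s => abs_nonneg _)
    refine h1.trans ?_
    calc ∫ s, |g s| ≤ ∫ s, (w s + |g s - w s|) := by
          refine integral_mono hgi.abs (hwi.add hdi) fun s => ?_
          have := abs_add_le (w s) (g s - w s)
          rw [add_sub_cancel, abs_of_nonneg (hw0 s)] at this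
          exact this
      _ = 1 + ∫ s, |g s - w s| := by rw [integral_add hwi hdi, hw1]
      _ ≤ 2 := by linarith

/-! ### The interaction energy of a pair -/

theorem lintegral_comp_div {e : ℝ → ℝ≥0∞} {b : ℝ} (hb : 0 < b) :
    ∫⁻ s, e (s / b) = ENNReal.ofReal b * ∫⁻ s, e s := by
  have h1 := lintegral_image_eq_lintegral_abs_deriv_mul (s := Set.univ) MeasurableSet.univ
    (f := fun t => t / b) (f' := fun _ => 1 / b)
    (fun r _ => by simpa using (hasDerivAt_id r).div_const b)
    (fun r _ t _ hrt => (div_left_inj' hb.ne').1 hrt) e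
  have himg : (fun t : ℝ => t / b) '' Set.univ = Set.univ :=
    Set.image_univ_of_surjective fun s => ⟨s * b, by field_simp⟩
  rw [himg, Measure.restrict_univ, lintegral_const_mul' _ _ ENNReal.ofReal_ne_top] at h1
  rw [h1, ← mul_assoc, ← ENNReal.ofReal_mul hb.le, abs_of_pos (by positivity),
    mul_one_div_cancel hb.ne', ENNReal.ofReal_one, one_mul]

theorem lintegral_scaled_le {e : ℝ → ℝ} {c a B : ℝ} (hc : 0 < c) (ha : 0 < a)
    (he : ∀ s < c / 2, e s = 0) (m : ℕ)
    (hB : ∫⁻ s, ENNReal.ofReal (e s ^ 2) ≤ ENNReal.ofReal B) :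
    ∫⁻ s in Set.Ioi 0, ENNReal.ofReal (((a ^ 2)⁻¹ * e (s / a ^ 2)) ^ 2 / s ^ m) ≤
      ENNReal.ofReal ((a ^ 2)⁻¹ * ((c * a ^ 2 / 2) ^ m)⁻¹ * B) := by
  have ha2 : 0 < a ^ 2 := by positivity
  calc ∫⁻ s in Set.Ioi 0, ENNReal.ofReal (((a ^ 2)⁻¹ * e (s / a ^ 2)) ^ 2 / s ^ m)
      ≤ ∫⁻ s in Set.Ioi 0, ENNReal.ofReal ((a ^ 2)⁻¹ ^ 2 * ((c * a ^ 2 / 2) ^ m)⁻¹) *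
          ENNReal.ofReal (e (s / a ^ 2) ^ 2) := by
        refine setLIntegral_mono' measurableSet_Ioi fun s hs => ?_
        rw [← ENNReal.ofReal_mul (by positivity)]
        apply ENNReal.ofReal_le_ofReal
        rcases lt_or_ge (s / a ^ 2) (c / 2) with hlt | hge
        · rw [he _ hlt]
          simp
        · have h1 : c * a ^ 2 / 2 ≤ s := by
            rw [le_div_iff₀ ha2] at hge
            linarith
          have h2 : (s ^ m)⁻¹ ≤ ((c * a ^ 2 / 2) ^ m)⁻¹ := by gcongr
          rw [mul_pow, div_eq_mul_inv]
          calc (a ^ 2)⁻¹ ^ 2 * e (s / a ^ 2) ^ 2 * (s ^ m)⁻¹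
              ≤ (a ^ 2)⁻¹ ^ 2 * e (s / a ^ 2) ^ 2 * ((c * a ^ 2 / 2) ^ m)⁻¹ := by gcongr
            _ = _ := by ring
    _ ≤ ∫⁻ s, ENNReal.ofReal ((a ^ 2)⁻¹ ^ 2 * ((c * a ^ 2 / 2) ^ m)⁻¹) *
          ENNReal.ofReal (e (s / a ^ 2) ^ 2) := setLIntegral_le_lintegral _ _
    _ = ENNReal.ofReal ((a ^ 2)⁻¹ ^ 2 * ((c * a ^ 2 / 2) ^ m)⁻¹) *
          (ENNReal.ofReal (a ^ 2) * ∫⁻ s, ENNReal.ofReal (e s ^ 2)) := by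
        rw [lintegral_const_mul' _ _ ENNReal.ofReal_ne_top,
          lintegral_comp_div (e := fun s => ENNReal.ofReal (e s ^ 2)) ha2]
    _ ≤ ENNReal.ofReal ((a ^ 2)⁻¹ ^ 2 * ((c * a ^ 2 / 2) ^ m)⁻¹) *
          (ENNReal.ofReal (a ^ 2) * ENNReal.ofReal B) := by gcongr
    _ = ENNReal.ofReal ((a ^ 2)⁻¹ * ((c * a ^ 2 / 2) ^ m)⁻¹ * B) := by
        rw [← ENNReal.ofReal_mul (by positivity), ← ENNReal.ofReal_mul (by positivity)]
        congr 1
        field_simp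

theorem norm_toLp_sq_eq_integral {N : ℕ} {f : Conf N → ℂ} (hf : MemLp f 2 volume) :
    ‖hf.toLp f‖ ^ 2 = ∫ x, ‖f x‖ ^ 2 := by
  rw [norm_toLp_sq, integral_eq_lintegral_of_nonneg_ae (f := fun x => ‖f x‖ ^ 2)
    (ae_of_all _ fun x => by positivity)
    (hf.1.norm.pow 2)]
  congr 1
  refine lintegral_congr fun x => ?_
  rw [ENNReal.ofReal_pow (norm_nonneg _), ofReal_norm]

section PairBound

variable {N : ℕ} {i j : Fin N}

/-- The product function of the relative coordinate with given factor in the relative variable and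
the standard bumps in the others. -/
def slotFn (h : j ≠ i) (α : Fin N →₀ ℕ) (G : ℂ → ℂ) : Conf N → ℂ :=
  shearFn h (Function.update (fun k => radialFn bump (α k)) i G)

theorem slotFn_eq (h : j ≠ i) (α : Fin N →₀ ℕ) (G : ℂ → ℂ) (x : Conf N) :
    slotFn h α G x = G (x i - x j) * ((gaussProd x)⁻¹ *
      ∏ k ∈ Finset.univ.erase i, radialFn bump (α k) (x k)) := by
  rw [slotFn, shearFn, ← Finset.mul_prod_erase _ _ (Finset.mem_univ i), Function.update_self,
    Finset.prod_congr rfl fun k hk => ?_, shearHomeo_apply, Function.update_self]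
  · ring
  · rw [Function.update_of_ne (Finset.ne_of_mem_erase hk), shearHomeo_apply,
      Function.update_of_ne (Finset.ne_of_mem_erase hk)]

/-- The constant depends on the pair, on `α` and on the fixed bumps only. All dependence on the
length scale `a` will sit in the profile `b` of the relative coordinate. -/
theorem exists_norm_slotFn_le (h : j ≠ i) (α : Fin N →₀ ℕ) : ∃ E : ℝ, 0 ≤ E ∧
    ∀ (b : ℝ → ℝ) (m : ℕ) (B : ℝ), Measurable b → (∀ s, 2 < s → b s = 0) → 0 ≤ B →
      ∫⁻ s in Set.Ioi 0, ENNReal.ofReal (b s ^ 2 / s ^ m) ≤ ENNReal.ofReal B →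
      ∃ hL : MemLp (slotFn h α (radialFn b m)) 2 volume, ‖hL.toLp _‖ ^ 2 ≤ E * B := by
  refine ⟨Real.exp (8 * N) *
    (∏ k ∈ Finset.univ.erase i, ∫ z, ‖radialFn bump (α k) z‖ ^ 2) * Real.pi, ?_, ?_⟩
  · have : 0 ≤ ∏ k ∈ Finset.univ.erase i, ∫ z, ‖radialFn bump (α k) z‖ ^ 2 :=
      Finset.prod_nonneg fun k _ => integral_nonneg fun z => by positivity
    have := Real.pi_pos
    positivity
  · intro b m B hb hbs hB hint
    obtain ⟨h1, h2⟩ := memLp_radialFn hb hint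
    rw [max_eq_left hB] at h2
    obtain ⟨h3, h4⟩ := memLp_shearFn h
      (G := Function.update (fun k => radialFn bump (α k)) i (radialFn b m))
      (fun k => by
        rcases eq_or_ne k i with rfl | hk
        · rw [Function.update_self]
          exact measurable_radialFn hb m
        · rw [Function.update_of_ne hk]
          exact (contDiff_radialFn_bump (α k)).continuous.measurable)
      (fun k z hz => by
        rcases eq_or_ne k i with rfl | hk
        · rw [Function.update_self]
          exact radialFn_eq_zero (hbs _ hz)
        · rw [Function.update_of_ne hk]
          exact radialFn_bump_eq_zero (α k) z hz)
      (fun k => by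
        rcases eq_or_ne k i with rfl | hk
        · rw [Function.update_self]
          exact h1
        · rw [Function.update_of_ne hk]
          exact integrable_norm_radialFn_bump (α k))
    refine ⟨h3, ?_⟩
    change ‖h3.toLp _‖ ^ 2 ≤ _
    rw [norm_toLp_sq_eq_integral]
    refine h4.trans ?_
    rw [← Finset.mul_prod_erase _ _ (Finset.mem_univ i), Function.update_self]
    have h8 : ∏ k ∈ Finset.univ.erase i, ∫ z, ‖Function.update (fun k => radialFn bump (α k)) i
        (radialFn b m) k z‖ ^ 2 = ∏ k ∈ Finset.univ.erase i, ∫ z, ‖radialFn bump (α k) z‖ ^ 2 :=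
      Finset.prod_congr rfl fun k hk => by
        rw [Function.update_of_ne (Finset.ne_of_mem_erase hk)]
    rw [h8]
    set Γ := ∏ k ∈ Finset.univ.erase i, ∫ z, ‖radialFn bump (α k) z‖ ^ 2
    have hΓ : 0 ≤ Γ := Finset.prod_nonneg fun k _ => integral_nonneg fun z => by positivity
    calc Real.exp (8 * N) * ((∫ z, ‖radialFn b m z‖ ^ 2) * Γ)
        ≤ Real.exp (8 * N) * ((Real.pi * B) * Γ) := by gcongr
      _ = _ := by ring

theorem slotFn_bump (h : j ≠ i) (α : Fin N →₀ ℕ) :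
    slotFn h α (radialFn bump (α i)) = shearFn h fun k => radialFn bump (α k) := by
  rw [slotFn, Function.update_eq_self_iff.2 rfl]

/-- A test function in the relative coordinate bounds the component of a state along `detect`. -/
theorem norm_inner_detect_le_of_test (h : j ≠ i) (α : Fin N →₀ ℕ) {P b : ℝ → ℝ}
    (hPd : ContDiff ℝ ∞ P) (hP : ∀ s, HasDerivAt P (b s) s) {c : ℝ} (hc : 0 < c)
    (hP0 : ∀ s < c, P s = 0) (hP2 : ∀ s, 2 < s → P s = 0) {Ψ : L2 N}
    (hΨ : ∀ k, IsWeakMagMomentum i k Ψ (weakMagMomentum i k Ψ))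
    (hL : MemLp (slotFn h α (radialFn P (α i + 1))) 2 volume) :
    2 * ‖∫ x, conj (slotFn h α (radialFn b (α i)) x) * Ψ x‖ ≤ ‖hL.toLp _‖ * ‖lowering i Ψ‖ := by
  have h1 := inner_shearFn_lowering h
    (G := Function.update (fun k => radialFn bump (α k)) i (radialFn P (α i + 1)))
    (fun k => by
      rcases eq_or_ne k i with rfl | hk
      · rw [Function.update_self]
        exact contDiff_radialFn hPd hc hP0 _
      · rw [Function.update_of_ne hk]
        exact contDiff_radialFn_bump (α k))
    (fun k z hz => by
      rcases eq_or_ne k i with rfl | hk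
      · rw [Function.update_self]
        exact radialFn_eq_zero (hP2 _ hz)
      · rw [Function.update_of_ne hk]
        exact radialFn_bump_eq_zero (α k) z hz)
    (A := radialFn b (α i))
    (fun z => by
      rw [Function.update_self]
      exact hasFDerivAt_radialFn hP hc hP0 (α i) z) hΨ
  rw [Function.update_idem] at h1
  have h2 := congrArg norm h1
  rw [norm_mul, norm_mul, Complex.norm_I, mul_one, Complex.norm_ofNat] at h2
  change ‖∫ x, conj (slotFn h α (radialFn P (α i + 1)) x) * lowering i Ψ x‖ =
    2 * ‖∫ x, conj (slotFn h α (radialFn b (α i)) x) * Ψ x‖ at h2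
  rw [← h2, ← inner_toLp_left hL]
  exact norm_inner_le_norm _ _

/-- The profile lives where `|x_i - x_j|²/a²` lies in `U`, and there the scaled potential is at
least `δ/a²`. Cauchy–Schwarz against the restriction of `Ψ` to this region then costs `a²/δ` times
the interaction energy. Only a lower bound on `v` enters, so infinite values do no harm. -/
theorem norm_integral_slotFn_le_pair (h : j ≠ i) (α : Fin N →₀ ℕ) {v : ℝ → ℝ≥0∞} {U : Set ℝ}
    (hU : MeasurableSet U) {δ : ℝ} (hδ : 0 < δ) (hUv : ∀ s ∈ U, ENNReal.ofReal δ ≤ v (√s))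
    {a : ℝ} (ha : 0 < a) {b : ℝ → ℝ} (hb : ∀ s, s / a ^ 2 ∉ U → b s = 0) {m : ℕ}
    (hL : MemLp (slotFn h α (radialFn b m)) 2 volume) {Ψ : L2 N}
    (hV : ∫⁻ x, scaled v a ‖x i - x j‖ * ‖Ψ x‖ₑ ^ 2 < ⊤) :
    ‖∫ x, conj (slotFn h α (radialFn b m) x) * Ψ x‖ ^ 2 ≤ ‖hL.toLp _‖ ^ 2 *
      (a ^ 2 / δ * (∫⁻ x, scaled v a ‖x i - x j‖ * ‖Ψ x‖ₑ ^ 2).toReal) := by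
  set S : Set (Conf N) := {x | ‖x i - x j‖ ^ 2 / a ^ 2 ∈ U} with hS
  have hSm : MeasurableSet S := by
    have : Measurable fun x : Conf N => ‖x i - x j‖ ^ 2 / a ^ 2 := by fun_prop
    exact this hU
  have hI : MemLp (S.indicator Ψ) 2 volume := (Lp.memLp Ψ).indicator hSm
  have e : ∫ x, conj (slotFn h α (radialFn b m) x) * Ψ x =
      inner ℂ (hL.toLp _) (hI.toLp _) := by
    rw [inner_toLp_toLp]
    refine integral_congr_ae (ae_of_all _ fun x => ?_)
    by_cases hx : x ∈ S
    · simp only [Set.indicator_of_mem hx]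
    · have : slotFn h α (radialFn b m) x = 0 := by
        rw [slotFn_eq, radialFn_eq_zero (hb _ hx), zero_mul]
      simp [this]
  rw [e]
  have h1 : ‖hI.toLp _‖ ^ 2 ≤
      a ^ 2 / δ * (∫⁻ x, scaled v a ‖x i - x j‖ * ‖Ψ x‖ₑ ^ 2).toReal := by
    rw [norm_toLp_sq]
    refine ENNReal.toReal_le_of_le_ofReal (by positivity) ?_
    rw [ENNReal.ofReal_mul (by positivity), ENNReal.ofReal_toReal hV.ne,
      ← lintegral_const_mul' _ _ ENNReal.ofReal_ne_top]
    refine lintegral_mono fun x => ?_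
    by_cases hx : x ∈ S
    · rw [Set.indicator_of_mem hx, ← mul_assoc]
      refine le_mul_of_one_le_left zero_le ?_
      have h2 : √(‖x i - x j‖ ^ 2 / a ^ 2) = ‖x i - x j‖ / a := by
        rw [← div_pow, Real.sqrt_sq (by positivity)]
      have h3 := hUv _ hx
      rw [h2] at h3
      calc (1 : ℝ≥0∞) = ENNReal.ofReal (a ^ 2 / δ) * (ENNReal.ofReal (a ^ 2)⁻¹ * ENNReal.ofReal δ) := by
            rw [← ENNReal.ofReal_mul (by positivity), ← ENNReal.ofReal_mul (by positivity),
              ← ENNReal.ofReal_one]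
            congr 1
            field_simp
        _ ≤ _ := by
            rw [scaled]
            gcongr
    · rw [Set.indicator_of_notMem hx]
      simp
  calc ‖inner ℂ (hL.toLp _) (hI.toLp _)‖ ^ 2 ≤ (‖hL.toLp _‖ * ‖hI.toLp _‖) ^ 2 := by
        gcongr
        exact norm_inner_le_norm _ _
    _ = ‖hL.toLp _‖ ^ 2 * ‖hI.toLp _‖ ^ 2 := mul_pow _ _ _
    _ ≤ _ := by gcongr

end PairBound

/-! ### Comparing the readings at distance one and at the range of the interaction -/

section PairBound

variable {N : ℕ} {i j : Fin N}

theorem hasDerivAt_primitive {g : ℝ → ℝ} (hg : Continuous g) (s : ℝ) :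
    HasDerivAt (fun t => ∫ r in (0 : ℝ)..t, g r) (g s) s :=
  intervalIntegral.integral_hasDerivAt_right (hg.intervalIntegrable _ _)
    (hg.stronglyMeasurableAtFilter _ _) hg.continuousAt

theorem contDiff_of_hasDerivAt {P b : ℝ → ℝ} (hb : ContDiff ℝ ∞ b)
    (hP : ∀ s, HasDerivAt P (b s) s) : ContDiff ℝ ∞ P := by
  rw [contDiff_infty_iff_deriv]
  refine ⟨fun s => (hP s).differentiableAt, ?_⟩
  rwa [funext fun s => (hP s).deriv]

theorem primitive_eq_zero {g : ℝ → ℝ} {c d : ℝ} (hc : 0 < c)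
    (hs : ∀ s, g s ≠ 0 → s ∈ Set.Icc c d) {t : ℝ} (ht : t < c) : ∫ r in (0 : ℝ)..t, g r = 0 := by
  refine intervalIntegral.integral_zero_ae (ae_of_all _ fun s hs' => ?_)
  by_contra hne
  have h1 := (hs s hne).1
  rw [Set.mem_uIoc] at hs'
  rcases hs' with h2 | h2 <;> linarith [h2.2]

theorem primitive_eq_integral {g : ℝ → ℝ} {c d : ℝ} (hc : 0 < c)
    (hs : ∀ s, g s ≠ 0 → s ∈ Set.Icc c d) {t : ℝ} (ht : d < t) (ht0 : 0 ≤ t) :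
    ∫ r in (0 : ℝ)..t, g r = ∫ r, g r := by
  rw [intervalIntegral.integral_of_le ht0]
  refine setIntegral_eq_integral_of_forall_compl_eq_zero fun s hs' => ?_
  by_contra hne
  have h1 := hs s hne
  exact hs' ⟨by linarith [h1.1], by linarith [h1.2]⟩

theorem abs_primitive_bump_le (t : ℝ) : |∫ r in (0 : ℝ)..t, bump r| ≤ 1 := by
  have hi : Integrable bump := ContDiffBump.integrable_normed _
  have h1 := intervalIntegral.norm_integral_le_integral_norm_uIoc (f := bump) (a := 0) (b := t)
    (μ := volume)
  refine h1.trans ((setIntegral_le_integral hi.norm (ae_of_all _ fun s => norm_nonneg _)).trans ?_)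
  simp_rw [Real.norm_of_nonneg (bump_nonneg _)]
  rw [integral_bump]

/-- The raising operator maps the test function with profile `P` to `κ` times the `detect` vector
minus a profile concentrated at distance of order `a`, up to a constant factor. Pairing with `Ψ`,
the image itself costs `‖lowering i Ψ‖` times the norm of the test function. The profile at scale
`a` is split into the normalized indicator of the rescaled `U`, controlled by the interaction, and a
smoothing error proportional to `ε`. -/
theorem norm_inner_detect_le_approx (h : j ≠ i) (α : Fin N →₀ ℕ) {E : ℝ} (hE : 0 ≤ E)
    (hslot : ∀ (b : ℝ → ℝ) (m : ℕ) (B : ℝ), Measurable b → (∀ s, 2 < s → b s = 0) → 0 ≤ B →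
      ∫⁻ s in Set.Ioi 0, ENNReal.ofReal (b s ^ 2 / s ^ m) ≤ ENNReal.ofReal B →
      ∃ hL : MemLp (slotFn h α (radialFn b m)) 2 volume, ‖hL.toLp _‖ ^ 2 ≤ E * B)
    {v : ℝ → ℝ≥0∞} {c d δ : ℝ} (hc : 0 < c) (hcd : c ≤ d) (hδ : 0 < δ) {U : Set ℝ}
    (hU : MeasurableSet U) (hUs : U ⊆ Set.Icc c d) (h0 : 0 < volume U)
    (hUv : ∀ s ∈ U, ENNReal.ofReal δ ≤ v (√s)) {a : ℝ} (ha : 0 < a) (had : 2 * d * a ^ 2 ≤ 2)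
    {J : ℝ} (hJ0 : 0 ≤ J)
    (hJ : ∫⁻ s in Set.Icc (c * a ^ 2 / 2) 2, ENNReal.ofReal (s ^ (α i + 1))⁻¹ ≤ ENNReal.ofReal J)
    {Ψ : L2 N} (hΨ : ∀ k, IsWeakMagMomentum i k Ψ (weakMagMomentum i k Ψ))
    (hV : ∫⁻ x, scaled v a ‖x i - x j‖ * ‖Ψ x‖ₑ ^ 2 < ⊤) {ε : ℝ} (hε : 0 < ε) (hε1 : ε ≤ 1) :
    (1 - ε) * ‖(inner ℂ (detect h α) Ψ : ℂ)‖ ≤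
      2 * √(E * J) * ‖lowering i Ψ‖ +
      √(E * ((c / 2) ^ α i * volume.real U * δ)⁻¹ * (a ^ 2)⁻¹ ^ α i *
          (∫⁻ x, scaled v a ‖x i - x j‖ * ‖Ψ x‖ₑ ^ 2).toReal) +
      √(E * ((a ^ 2)⁻¹ * ((c * a ^ 2 / 2) ^ α i)⁻¹)) * ‖Ψ‖ * ε := by
  obtain ⟨g, hgd, hgs, hgw, hgi, hgp⟩ := exists_smooth_approx hc hcd hU hUs h0 hε hε1
  set w : ℝ → ℝ := U.indicator fun _ => (volume.real U)⁻¹ with hw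
  set κ : ℝ := ∫ s, g s with hκ
  set m : ℕ := α i with hm
  set V : ℝ := (∫⁻ x, scaled v a ‖x i - x j‖ * ‖Ψ x‖ₑ ^ 2).toReal with hVdef
  have ha2 : 0 < a ^ 2 := by positivity
  have hUfin : volume U ≠ ⊤ :=
    ((measure_mono hUs).trans_lt (by rw [Real.volume_Icc]; exact ENNReal.ofReal_lt_top)).ne
  have hUr : 0 < volume.real U := ENNReal.toReal_pos h0.ne' hUfin
  have hdiv : ∀ s, 2 < s → 2 * d < s / a ^ 2 := fun s hs => by
    rw [lt_div_iff₀ ha2]; linarith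
  have hg0 : ∀ s, 2 * d < s → g s = 0 := fun s hs => by
    by_contra hne
    linarith [(hgs s hne).2]
  have hg0' : ∀ s < c / 2, g s = 0 := fun s hs => by
    by_contra hne
    linarith [(hgs s hne).1]
  have hw0 : ∀ s, 2 * d < s → w s = 0 := fun s hs =>
    Set.indicator_of_notMem (fun hsU => by linarith [(hUs hsU).2, hc, (hUs hsU).1]) _
  have hw0' : ∀ s < c / 2, w s = 0 := fun s hs =>
    Set.indicator_of_notMem (fun hsU => by linarith [(hUs hsU).1]) _
  have hwm : Measurable w := measurable_const.indicator hU
  have hgm : Measurable g := hgd.continuous.measurable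
  -- the test function
  set b : ℝ → ℝ := fun s => κ * bump s - (a ^ 2)⁻¹ * g (s / a ^ 2) with hb
  set P : ℝ → ℝ := fun s => κ * (∫ r in (0 : ℝ)..s, bump r) - ∫ r in (0 : ℝ)..(s / a ^ 2), g r with hP
  have hbd : ContDiff ℝ ∞ b :=
    (contDiff_const.mul contDiff_bump).sub (contDiff_const.mul (hgd.comp (contDiff_id.div_const _)))
  have hPb : ∀ s, HasDerivAt P (b s) s := by
    intro s
    have h1 := (hasDerivAt_primitive contDiff_bump.continuous s).const_mul κ
    have h2 := (hasDerivAt_primitive hgd.continuous (s / a ^ 2)).comp s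
      ((hasDerivAt_id s).div_const (a ^ 2))
    refine (h1.sub h2).congr_deriv ?_
    simp only [hb]
    ring
  have hPd := contDiff_of_hasDerivAt hbd hPb
  have hbs : ∀ s, bump s ≠ 0 → s ∈ Set.Icc (1 : ℝ) 2 := fun s hs =>
    ⟨(mem_of_bump_ne_zero hs).1.le, (mem_of_bump_ne_zero hs).2.le⟩
  have hca : c * a ^ 2 / 2 ≤ 1 := by nlinarith
  have hP0 : ∀ s < c * a ^ 2 / 2, P s = 0 := by
    intro s hs
    simp only [hP]
    rw [primitive_eq_zero one_pos hbs (hs.trans_le hca),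
      primitive_eq_zero (by positivity) hgs (by rw [div_lt_iff₀ ha2]; linarith)]
    ring
  -- Beyond `2` both primitives have reached their full mass `κ` and cancel; this is why the bump
  -- carries the factor `κ` and why `P` is admissible as a compactly supported profile.
  have hP2 : ∀ s, 2 < s → P s = 0 := by
    intro s hs
    simp only [hP]
    rw [primitive_eq_integral one_pos hbs hs (by linarith), integral_bump,
      primitive_eq_integral (by positivity) hgs (hdiv s hs) (by positivity)]
    ring
  have hκ2 : |κ| ≤ 2 := by
    have := abs_le.1 hgi
    rw [abs_le]
    constructor <;> linarith [this.1, this.2]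
  -- `|κ| ≤ 2` times the mass one of the bump, plus the bound `2` on the primitive of `g`. Its
  -- square is the `16` in the next estimate.
  have hPle : ∀ s, |P s| ≤ 4 := by
    intro s
    simp only [hP]
    refine (abs_sub _ _).trans ?_
    rw [abs_mul]
    have h1 := abs_primitive_bump_le s
    have h2 := hgp (s / a ^ 2)
    have h3 := abs_nonneg (∫ r in (0 : ℝ)..s, bump r)
    nlinarith [abs_nonneg κ]
  have hPint : ∫⁻ s in Set.Ioi 0, ENNReal.ofReal (P s ^ 2 / s ^ (m + 1)) ≤
      ENNReal.ofReal (16 * J) := by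
    have hsub : Set.Icc (c * a ^ 2 / 2) 2 ⊆ Set.Ioi 0 := fun s hs =>
      lt_of_lt_of_le (by positivity : (0 : ℝ) < c * a ^ 2 / 2) hs.1
    calc ∫⁻ s in Set.Ioi 0, ENNReal.ofReal (P s ^ 2 / s ^ (m + 1))
        ≤ ∫⁻ s in Set.Ioi 0, (Set.Icc (c * a ^ 2 / 2) 2).indicator
            (fun s => ENNReal.ofReal 16 * ENNReal.ofReal (s ^ (m + 1))⁻¹) s := by
          refine setLIntegral_mono' measurableSet_Ioi fun s hs => ?_
          have hs0 : (0 : ℝ) < s := hs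
          by_cases hmem : s ∈ Set.Icc (c * a ^ 2 / 2) 2
          · rw [Set.indicator_of_mem hmem, ← ENNReal.ofReal_mul (by norm_num), div_eq_mul_inv]
            apply ENNReal.ofReal_le_ofReal
            have h1 : P s ^ 2 ≤ 16 := by
              rw [← sq_abs]
              nlinarith [hPle s, abs_nonneg (P s)]
            gcongr
          · have h1 : P s = 0 := by
              rw [Set.mem_Icc, not_and_or, not_le, not_le] at hmem
              exact hmem.elim (hP0 s) (hP2 s)
            simp [h1]
      _ = ENNReal.ofReal 16 * ∫⁻ s in Set.Icc (c * a ^ 2 / 2) 2, ENNReal.ofReal (s ^ (m + 1))⁻¹ := by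
          rw [lintegral_indicator measurableSet_Icc, Measure.restrict_restrict measurableSet_Icc,
            Set.inter_eq_left.2 hsub, lintegral_const_mul' _ _ ENNReal.ofReal_ne_top]
      _ ≤ ENNReal.ofReal (16 * J) := by
          rw [ENNReal.ofReal_mul (by norm_num)]
          gcongr
  obtain ⟨hφL, hφn⟩ := hslot P (m + 1) (16 * J) hPd.continuous.measurable hP2 (by positivity) hPint
  -- the three parts of its image under the raising operator
  have hbwint := lintegral_scaled_le (e := w) (B := (volume.real U)⁻¹) hc ha hw0' m (by
    have e : ∀ s, ENNReal.ofReal (w s ^ 2) =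
        U.indicator (fun _ => ENNReal.ofReal ((volume.real U)⁻¹ ^ 2)) s := fun s => by
      by_cases hs : s ∈ U <;> simp [hw, hs]
    simp_rw [e]
    rw [lintegral_indicator_const hU, ← ENNReal.ofReal_toReal hUfin, ← ENNReal.ofReal_mul (by positivity)]
    refine ENNReal.ofReal_le_ofReal (le_of_eq ?_)
    change (volume.real U)⁻¹ ^ 2 * volume.real U = _
    field_simp)
  have hbeint := lintegral_scaled_le (e := fun s => g s - w s) (B := ε ^ 2) hc ha
    (fun s hs => by rw [hg0' s hs, hw0' s hs, sub_zero]) m hgw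
  obtain ⟨hwL, hwn⟩ := hslot (fun s => (a ^ 2)⁻¹ * w (s / a ^ 2)) m _ (by fun_prop)
    (fun s hs => by rw [hw0 _ (hdiv s hs), mul_zero]) (by positivity) hbwint
  obtain ⟨heL, hen⟩ := hslot (fun s => (a ^ 2)⁻¹ * (g (s / a ^ 2) - w (s / a ^ 2))) m _ (by fun_prop)
    (fun s hs => by rw [hw0 _ (hdiv s hs), hg0 _ (hdiv s hs), sub_zero, mul_zero])
    (by positivity) hbeint
  have htest := norm_inner_detect_le_of_test h α hPd hPb (c := c * a ^ 2 / 2) (by positivity) hP0 hP2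
    hΨ hφL
  have hdet : inner ℂ (detect h α) Ψ = ∫ x, conj (slotFn h α (radialFn bump m) x) * Ψ x := by
    rw [detect, inner_toLp_left, hm, slotFn_bump]
  have hbL : MemLp (slotFn h α (radialFn bump m)) 2 volume := by
    rw [hm, slotFn_bump]
    exact memLp_detect h α
  -- The profile `b` is `κ` times the bump, minus the rescaled indicator, minus the rescaled
  -- smoothing error; `slotFn` is linear in the profile.
  have hsplit : ∫ x, conj (slotFn h α (radialFn b m) x) * Ψ x =
      κ * inner ℂ (detect h α) Ψ
        - (∫ x, conj (slotFn h α (radialFn (fun s => (a ^ 2)⁻¹ * w (s / a ^ 2)) m) x) * Ψ x)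
        - ∫ x, conj (slotFn h α
            (radialFn (fun s => (a ^ 2)⁻¹ * (g (s / a ^ 2) - w (s / a ^ 2))) m) x) * Ψ x := by
    have i1 := integrable_conj_mul hbL (Lp.memLp Ψ)
    have i2 := integrable_conj_mul hwL (Lp.memLp Ψ)
    have i3 := integrable_conj_mul heL (Lp.memLp Ψ)
    have i4 : Integrable (fun x => (κ : ℂ) * (conj (slotFn h α (radialFn bump m) x) * Ψ x) -
        conj (slotFn h α (radialFn (fun s => (a ^ 2)⁻¹ * w (s / a ^ 2)) m) x) * Ψ x) :=
      (i1.const_mul _).sub i2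
    rw [hdet, ← integral_const_mul, ← integral_sub (i1.const_mul _) i2, ← integral_sub i4 i3]
    refine integral_congr_ae (ae_of_all _ fun x => ?_)
    simp only [slotFn_eq, radialFn, hb]
    simp only [map_mul, Complex.conj_ofReal]
    push_cast
    ring
  set Λ : ℂ := inner ℂ (detect h α) Ψ
  set Sb : ℂ := ∫ x, conj (slotFn h α (radialFn b m) x) * Ψ x
  set Sw : ℂ := ∫ x, conj (slotFn h α (radialFn (fun s => (a ^ 2)⁻¹ * w (s / a ^ 2)) m) x) * Ψ x
    with hSw
  set Se : ℂ := ∫ x, conj (slotFn h α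
    (radialFn (fun s => (a ^ 2)⁻¹ * (g (s / a ^ 2) - w (s / a ^ 2))) m) x) * Ψ x with hSe
  have b1 : ‖Sb‖ ≤ 2 * √(E * J) * ‖lowering i Ψ‖ := by
    have h1 : ‖hφL.toLp _‖ ≤ 4 * √(E * J) := by
      refine abs_le_of_sq_le_sq' ?_ (by positivity) |>.2
      rw [mul_pow, Real.sq_sqrt (by positivity)]
      linarith
    have h2 := mul_le_mul_of_nonneg_right h1 (norm_nonneg (lowering i Ψ))
    have h3 : 2 * ‖Sb‖ ≤ ‖hφL.toLp _‖ * ‖lowering i Ψ‖ := htest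
    linarith
  have b2 : ‖Sw‖ ≤ √(E * ((c / 2) ^ m * volume.real U * δ)⁻¹ * (a ^ 2)⁻¹ ^ m * V) := by
    refine Real.le_sqrt_of_sq_le ?_
    have h1 := norm_integral_slotFn_le_pair h α hU hδ hUv ha
      (b := fun s => (a ^ 2)⁻¹ * w (s / a ^ 2)) (fun s hs => by simp [hw, hs]) hwL hV
    rw [← hSw] at h1
    refine h1.trans ((mul_le_mul_of_nonneg_right hwn (by positivity)).trans_eq ?_)
    rw [show c * a ^ 2 / 2 = c / 2 * a ^ 2 by ring, mul_pow, inv_pow, ← hVdef]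
    field_simp
  have b3 : ‖Se‖ ≤ √(E * ((a ^ 2)⁻¹ * ((c * a ^ 2 / 2) ^ m)⁻¹)) * ‖Ψ‖ * ε := by
    have h1 : ‖heL.toLp _‖ ≤ √(E * ((a ^ 2)⁻¹ * ((c * a ^ 2 / 2) ^ m)⁻¹)) * ε := by
      refine abs_le_of_sq_le_sq' ?_ (by positivity) |>.2
      rw [mul_pow, Real.sq_sqrt (by positivity)]
      linarith
    rw [hSe, ← inner_toLp_left heL]
    refine (norm_inner_le_norm _ _).trans ?_
    calc _ ≤ √(E * ((a ^ 2)⁻¹ * ((c * a ^ 2 / 2) ^ m)⁻¹)) * ε * ‖Ψ‖ := by gcongr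
      _ = _ := by ring
  have hkey : κ * ‖Λ‖ ≤ ‖Sb‖ + ‖Sw‖ + ‖Se‖ := by
    have h1 : (κ : ℂ) * Λ = Sb + Sw + Se := by rw [hsplit]; ring
    calc κ * ‖Λ‖ ≤ ‖(κ : ℂ) * Λ‖ := by
          rw [norm_mul, Complex.norm_real]
          gcongr
          exact Real.le_norm_self _
      _ ≤ _ := by rw [h1]; exact norm_add₃_le
  have hκ1 : 1 - ε ≤ κ := by linarith [(abs_le.1 hgi).1]
  have := mul_le_mul_of_nonneg_right hκ1 (norm_nonneg Λ)
  linarith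

/-- The kinetic and interaction energy of a pair control the components of a state along `detect`. -/
theorem exists_norm_inner_detect_sq_le (h : j ≠ i) (α : Fin N →₀ ℕ)
    {v : ℝ → ℝ≥0∞} {c d δ : ℝ} (hc : 0 < c) (hcd : c ≤ d) (hδ : 0 < δ) {U : Set ℝ}
    (hU : MeasurableSet U) (hUs : U ⊆ Set.Icc c d) (h0 : 0 < volume U)
    (hUv : ∀ s ∈ U, ENNReal.ofReal δ ≤ v (√s)) : ∃ C : ℝ, 0 ≤ C ∧
    ∀ a : ℝ, 0 < a → 2 * d * a ^ 2 ≤ 2 → ∀ J : ℝ, 0 ≤ J →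
    ∫⁻ s in Set.Icc (c * a ^ 2 / 2) 2, ENNReal.ofReal (s ^ (α i + 1))⁻¹ ≤ ENNReal.ofReal J →
    ∀ Ψ : L2 N, (∀ k, IsWeakMagMomentum i k Ψ (weakMagMomentum i k Ψ)) →
    ∫⁻ x, scaled v a ‖x i - x j‖ * ‖Ψ x‖ₑ ^ 2 < ⊤ →
    ‖(inner ℂ (detect h α) Ψ : ℂ)‖ ^ 2 ≤ C * (J * ‖lowering i Ψ‖ ^ 2 + (a ^ 2)⁻¹ ^ α i *
          (∫⁻ x, scaled v a ‖x i - x j‖ * ‖Ψ x‖ₑ ^ 2).toReal) := by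
  obtain ⟨E, hE, hslot⟩ := exists_norm_slotFn_le h α
  set D : ℝ := ((c / 2) ^ α i * volume.real U * δ)⁻¹ with hD
  have hD0 : 0 ≤ D := by positivity
  refine ⟨8 * E + 2 * E * D, by positivity, fun a ha had J hJ0 hJ Ψ hΨ hV => ?_⟩
  have hap := fun ε (hε : 0 < ε) (hε1 : ε ≤ 1) =>
    norm_inner_detect_le_approx h α hE hslot hc hcd hδ hU hUs h0 hUv ha had hJ0 hJ hΨ hV hε hε1
  set V : ℝ := (∫⁻ x, scaled v a ‖x i - x j‖ * ‖Ψ x‖ₑ ^ 2).toReal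
  have hV0 : 0 ≤ V := ENNReal.toReal_nonneg
  set Λ : ℂ := inner ℂ (detect h α) Ψ
  set A : ℝ := √(E * ((a ^ 2)⁻¹ * ((c * a ^ 2 / 2) ^ α i)⁻¹)) * ‖Ψ‖
  rw [← hD] at hap
  set X : ℝ := 2 * √(E * J) * ‖lowering i Ψ‖ with hX
  set Y : ℝ := √(E * D * (a ^ 2)⁻¹ ^ α i * V) with hY
  -- The coefficient `A` of the smoothing error depends on `a` but not on `ε`, so `ε → 0` at fixed
  -- `a` removes the error completely.
  have hlim : ‖Λ‖ ≤ X + Y := by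
    have t1 : Tendsto (fun ε : ℝ => (1 - ε) * ‖Λ‖) (𝓝[>] 0) (𝓝 ((1 - 0) * ‖Λ‖)) :=
      ((tendsto_const_nhds.sub tendsto_id).mul_const _).mono_left nhdsWithin_le_nhds
    have t2 : Tendsto (fun ε : ℝ => X + Y + A * ε) (𝓝[>] 0) (𝓝 (X + Y + A * 0)) :=
      (tendsto_const_nhds.add (tendsto_id.const_mul A)).mono_left nhdsWithin_le_nhds
    have := le_of_tendsto_of_tendsto t1 t2 (by
      filter_upwards [Ioc_mem_nhdsGT (zero_lt_one' ℝ)] with ε hε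
      exact hap ε hε.1 hε.2)
    simpa using this
  have hX2 : X ^ 2 = 4 * E * J * ‖lowering i Ψ‖ ^ 2 := by
    rw [hX, mul_pow, mul_pow, Real.sq_sqrt (by positivity)]
    ring
  have hY2 : Y ^ 2 = E * D * ((a ^ 2)⁻¹ ^ α i * V) := by
    rw [hY, Real.sq_sqrt (by positivity)]
    ring
  have hXY : ‖Λ‖ ^ 2 ≤ 2 * X ^ 2 + 2 * Y ^ 2 := by
    nlinarith [norm_nonneg Λ, sq_nonneg (X - Y)]
  rw [hX2, hY2] at hXY
  set K := J * ‖lowering i Ψ‖ ^ 2 with hK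
  set M := (a ^ 2)⁻¹ ^ α i * V
  have hK0 : 0 ≤ K := by positivity
  have hM0 : 0 ≤ M := by positivity
  have e1 : 0 ≤ 8 * E * M := by positivity
  have e2 : 0 ≤ 2 * E * D * K := by positivity
  nlinarith

end PairBound

/-- If `v(√s)` were below `1/(n+1)` almost everywhere on `[1/(n+1), n+1]` for every `n`, it would
vanish almost everywhere on `(0, ∞)`, and `v(|x|)` almost everywhere in the plane. -/
theorem exists_lower_bound_on_set {v : ℝ → ℝ≥0∞} (hv : Measurable v)
    (hne : ¬ ∀ᵐ x : ℂ, v ‖x‖ = 0) : ∃ (c d δ : ℝ) (U : Set ℝ), 0 < c ∧ c ≤ d ∧ 0 < δ ∧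
      MeasurableSet U ∧ U ⊆ Set.Icc c d ∧ 0 < volume U ∧ ∀ s ∈ U, ENNReal.ofReal δ ≤ v (√s) := by
  by_contra hcon
  push Not at hcon
  have hvs : Measurable fun s : ℝ => v (√s) := hv.comp Real.continuous_sqrt.measurable
  set U : ℕ → Set ℝ := fun n => Set.Icc (1 / ((n : ℝ) + 1)) (n + 1) ∩
    {s | ENNReal.ofReal (1 / ((n : ℝ) + 1)) ≤ v (√s)} with hU
  have hnull : ∀ n, volume (U n) = 0 := by
    intro n
    by_contra h0
    have hle : 1 / ((n : ℝ) + 1) ≤ n + 1 := by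
      rw [div_le_iff₀ (by positivity)]
      nlinarith [(Nat.cast_nonneg n : (0 : ℝ) ≤ n)]
    obtain ⟨s, hs, hlt⟩ := hcon (1 / ((n : ℝ) + 1)) (n + 1) (1 / ((n : ℝ) + 1)) (U n) (by positivity)
      hle (by positivity) (measurableSet_Icc.inter (measurableSet_le measurable_const hvs))
      Set.inter_subset_left (pos_iff_ne_zero.2 h0)
    exact absurd hs.2 (not_le.2 hlt)
  have hun : volume (⋃ n, U n) = 0 := measure_iUnion_null hnull
  have hint : ∫⁻ s in Set.Ioi 0, v (√s) = 0 := by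
    rw [lintegral_eq_zero_iff hvs, EventuallyEq, ae_restrict_iff' measurableSet_Ioi]
    filter_upwards [compl_mem_ae_iff.2 hun] with s hs hs0
    by_contra hpos
    apply hs
    rw [Pi.zero_apply] at hpos
    have hs0' : (0 : ℝ) < s := hs0
    obtain ⟨n1, hn1⟩ := exists_nat_one_div_lt hs0'
    obtain ⟨n2, hn2⟩ := exists_nat_gt s
    obtain ⟨δ, hδ0, hδ⟩ : ∃ δ : ℝ, 0 < δ ∧ ENNReal.ofReal δ ≤ v (√s) := by
      obtain ⟨q, hq0, hq⟩ := ENNReal.lt_iff_exists_nnreal_btwn.1 (pos_iff_ne_zero.2 hpos)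
      exact ⟨q, by exact_mod_cast hq0, by rw [ENNReal.ofReal_coe_nnreal]; exact hq.le⟩
    obtain ⟨n3, hn3⟩ := exists_nat_one_div_lt hδ0
    set n := n1 + n2 + n3
    have a1 : 1 / ((n : ℝ) + 1) ≤ 1 / ((n1 : ℝ) + 1) := by
      apply one_div_le_one_div_of_le (by positivity)
      have : (n1 : ℝ) ≤ n := by exact_mod_cast (by omega : n1 ≤ n)
      linarith
    have a3 : 1 / ((n : ℝ) + 1) ≤ 1 / ((n3 : ℝ) + 1) := by
      apply one_div_le_one_div_of_le (by positivity)
      have : (n3 : ℝ) ≤ n := by exact_mod_cast (by omega : n3 ≤ n)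
      linarith
    have a2 : (n2 : ℝ) ≤ n := by exact_mod_cast (by omega : n2 ≤ n)
    refine Set.mem_iUnion.2 ⟨n, ⟨by linarith, by linarith⟩, ?_⟩
    exact (ENNReal.ofReal_le_ofReal (by linarith)).trans hδ
  have h1 := lintegral_radial hvs
  rw [hint, mul_zero, lintegral_eq_zero_iff (by fun_prop)] at h1
  apply hne
  filter_upwards [h1] with z hz
  simpa [Real.sqrt_sq (norm_nonneg z)] using hz

/-! ### The lowest Landau level component -/

section LLL

variable {N : ℕ}

/-- The kinetic energy of particle `i` is four times its Landau level. -/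
theorem hasSum_norm_lowering_sq {i : Fin N} {Ψ : L2 N}
    (hΨ : ∀ k, IsWeakMagMomentum i k Ψ (weakMagMomentum i k Ψ)) :
    HasSum (fun ν : Fin N → ℕ × ℕ => ((ν i).2 : ℝ) * ‖(inner ℂ (orbitalLp ν) Ψ : ℂ)‖ ^ 2)
      (‖lowering i Ψ‖ ^ 2 / 4) := by
  have h1 := hasSum_inner_lowering hΨ hΨ
  have h2 := (Complex.hasSum_re h1).div_const 4
  have e : (inner ℂ (weakMagMomentum i 0 Ψ + Complex.I • weakMagMomentum i 1 Ψ)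
      (weakMagMomentum i 0 Ψ + Complex.I • weakMagMomentum i 1 Ψ) : ℂ).re = ‖lowering i Ψ‖ ^ 2 := by
    change (inner ℂ (lowering i Ψ) (lowering i Ψ) : ℂ).re = _
    exact inner_self_eq_norm_sq (𝕜 := ℂ) _
  rw [e] at h2
  refine h2.congr_fun fun ν => ?_
  have e2 : (inner ℂ Ψ (orbitalLp ν) : ℂ) * inner ℂ (orbitalLp ν) Ψ =
      ((‖(inner ℂ (orbitalLp ν) Ψ : ℂ)‖ ^ 2 : ℝ) : ℂ) := by
    rw [← inner_conj_symm Ψ, mul_comm, Complex.mul_conj, Complex.normSq_eq_norm_sq]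
  rw [e2, show (4 * ((ν i).2 : ℂ) * ((‖(inner ℂ (orbitalLp ν) Ψ : ℂ)‖ ^ 2 : ℝ) : ℂ)) =
    ((4 * (ν i).2 * ‖(inner ℂ (orbitalLp ν) Ψ : ℂ)‖ ^ 2 : ℝ) : ℂ) by push_cast; ring,
    Complex.ofReal_re]
  ring

theorem hasSum_norm_inner_orbitalLp_sq (Ψ : L2 N) :
    HasSum (fun ν => ‖(inner ℂ (orbitalLp ν) Ψ : ℂ)‖ ^ 2) (‖Ψ‖ ^ 2) := by
  have h1 := Complex.hasSum_re ((orbitalBasis N).hasSum_inner_mul_inner Ψ Ψ)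
  have e : (inner ℂ Ψ Ψ : ℂ).re = ‖Ψ‖ ^ 2 := inner_self_eq_norm_sq (𝕜 := ℂ) _
  rw [e] at h1
  refine h1.congr_fun fun ν => ?_
  rw [orbitalBasis_apply, ← inner_conj_symm Ψ, mul_comm, Complex.mul_conj,
    Complex.normSq_eq_norm_sq, Complex.ofReal_re]

theorem eq_lllIndex {ν : Fin N → ℕ × ℕ} (h : ∀ i, (ν i).2 = 0) :
    ν = lllIndex (Finsupp.equivFunOnFinite.symm fun i => (ν i).1) := by
  funext i
  exact Prod.ext rfl (h i)

/-- Decomposition into the lowest Landau level and the rest. -/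
theorem exists_lll_decomposition (Ψ : L2 N) : ∃ Θ η : L2 N, Ψ = Θ + η ∧
    (∀ α, inner ℂ (lllLp α) η = 0) ∧
    (∀ ν : Fin N → ℕ × ℕ, (∃ i, (ν i).2 ≠ 0) → inner ℂ (orbitalLp ν) Θ = 0) ∧
    ‖Ψ‖ ^ 2 = ‖Θ‖ ^ 2 + ‖η‖ ^ 2 := by
  set K : Submodule ℂ (L2 N) := (Submodule.span ℂ (Set.range (lllLp (N := N)))).topologicalClosure
  have hKc : IsClosed (K : Set (L2 N)) := Submodule.isClosed_topologicalClosure _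
  have : CompleteSpace K := hKc.completeSpace_coe
  obtain ⟨Θ, hΘ, η, hη, hsum⟩ := K.exists_add_mem_mem_orthogonal Ψ
  refine ⟨Θ, η, hsum, fun α => ?_, fun ν hν => ?_, ?_⟩
  · exact (Submodule.mem_orthogonal _ _).1 hη _
      (Submodule.le_topologicalClosure _ (Submodule.subset_span ⟨α, rfl⟩))
  · have hle : K ≤ (Submodule.span ℂ {orbitalLp ν})ᗮ := by
      refine Submodule.topologicalClosure_minimal _ (Submodule.span_le.2 ?_)
        (Submodule.isClosed_orthogonal _)
      rintro _ ⟨α, rfl⟩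
      rw [SetLike.mem_coe, Submodule.mem_orthogonal_singleton_iff_inner_right]
      refine (orthonormal_orbitalLp N).2 fun h => ?_
      obtain ⟨i, hi⟩ := hν
      exact hi (by rw [h]; rfl)
    exact (Submodule.mem_orthogonal_singleton_iff_inner_right).1 (hle hΘ)
  · have h0 : inner ℂ Θ η = 0 := (Submodule.mem_orthogonal _ _).1 hη Θ hΘ
    rw [hsum, sq, sq, sq]
    exact norm_add_sq_eq_norm_sq_add_norm_sq_of_inner_eq_zero Θ η h0

/-- A basis function outside the lowest Landau level has at least one excited particle and so
kinetic energy at least four. -/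
theorem norm_sq_le_of_lll_orthogonal {Ψ Θ η : L2 N} (hsum : Ψ = Θ + η)
    (hη : ∀ α, inner ℂ (lllLp α) η = 0)
    (hΘ : ∀ ν : Fin N → ℕ × ℕ, (∃ i, (ν i).2 ≠ 0) → inner ℂ (orbitalLp ν) Θ = 0)
    (hΨ : ∀ i k, IsWeakMagMomentum i k Ψ (weakMagMomentum i k Ψ)) :
    ‖η‖ ^ 2 ≤ (∑ i, ‖lowering i Ψ‖ ^ 2) / 4 := by
  have h1 := hasSum_norm_inner_orbitalLp_sq η
  have h2 := hasSum_sum fun i (_ : i ∈ Finset.univ) => hasSum_norm_lowering_sq (hΨ i)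
  rw [← Finset.sum_div] at h2
  refine hasSum_le (fun ν => ?_) h1 h2
  by_cases hν : ∃ i, (ν i).2 ≠ 0
  · obtain ⟨i, hi⟩ := hν
    have e : inner ℂ (orbitalLp ν) η = inner ℂ (orbitalLp ν) Ψ := by
      rw [hsum, inner_add_right, hΘ ν ⟨i, hi⟩, zero_add]
    rw [e]
    refine le_trans ?_ (Finset.single_le_sum
      (f := fun i => ((ν i).2 : ℝ) * ‖(inner ℂ (orbitalLp ν) Ψ : ℂ)‖ ^ 2)
      (fun i _ => by positivity) (Finset.mem_univ i))
    have : (1 : ℝ) ≤ (ν i).2 := by exact_mod_cast Nat.one_le_iff_ne_zero.2 hi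
    exact le_mul_of_one_le_left (by positivity) this
  · push Not at hν
    have : inner ℂ (orbitalLp ν) η = 0 := by
      rw [eq_lllIndex hν]
      exact hη _
    rw [this]
    simp only [norm_zero, ne_eq, OfNat.ofNat_ne_zero, not_false_eq_true, zero_pow]
    exact Finset.sum_nonneg fun i _ => by positivity

theorem hasSum_norm_inner_lllLp_sq {Θ : L2 N}
    (hΘ : ∀ ν : Fin N → ℕ × ℕ, (∃ i, (ν i).2 ≠ 0) → inner ℂ (orbitalLp ν) Θ = 0) :
    HasSum (fun α => ‖(inner ℂ (lllLp α) Θ : ℂ)‖ ^ 2) (‖Θ‖ ^ 2) := by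
  refine (lllIndex_injective.hasSum_iff
    (f := fun ν => ‖(inner ℂ (orbitalLp ν) Θ : ℂ)‖ ^ 2) fun ν hν => ?_).2
    (hasSum_norm_inner_orbitalLp_sq Θ)
  have : ∃ i, (ν i).2 ≠ 0 := by
    by_contra! hcon
    exact hν ⟨_, (eq_lllIndex hcon).symm⟩
  rw [hΘ ν this]
  simp

/-! ### The trapping potential -/

/-- Multiplication by `z̄` leads from the lowest Landau level only into itself and the first one.
The second coefficient carries the trap energy `m + 1` of `z^m`; the first component is paid for by
kinetic energy. -/
theorem conj_mul_orbital (m : ℕ) (z : ℂ) :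
    conj z * orbital (m + 1, 0) z = orbital (m + 1, 1) z + √((m : ℝ) + 1) * orbital (m, 0) z := by
  have h1 : ((√(Real.pi * (m + 1).factorial * Nat.factorial 0))⁻¹ : ℝ) * ((m : ℝ) + 1) =
      √((m : ℝ) + 1) * (√(Real.pi * m.factorial * Nat.factorial 0))⁻¹ := by
    rw [Nat.factorial_succ]
    push_cast
    rw [show Real.pi * (((m : ℝ) + 1) * m.factorial) * (Nat.factorial 0 : ℝ) =
      ((m : ℝ) + 1) * (Real.pi * m.factorial * Nat.factorial 0) by ring,
      Real.sqrt_mul (by positivity), mul_inv]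
    have h2 : √((m : ℝ) + 1) * √((m : ℝ) + 1) = (m : ℝ) + 1 := Real.mul_self_sqrt (by positivity)
    have h3 : √((m : ℝ) + 1) ≠ 0 := by positivity
    field_simp
    rw [sq, h2]
  have h1' := congrArg (fun r : ℝ => (r : ℂ)) h1
  push_cast at h1'
  simp only [orbital, hermiteC_succ, hermiteC_zero, Nat.factorial_zero, Nat.factorial_one,
    Nat.add_sub_cancel]
  push_cast
  simp only [Nat.factorial_zero, Nat.cast_one] at h1'
  linear_combination (z ^ m * gauss z) * h1'

theorem conj_mul_orbitalProd (α : Fin N →₀ ℕ) (i : Fin N) (x : Conf N) :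
    conj (x i) * orbitalProd (lllIndex (α + Finsupp.single i 1)) x =
      orbitalProd (raise (lllIndex (α + Finsupp.single i 1)) i) x +
        √((α i : ℝ) + 1) * orbitalProd (lllIndex α) x := by
  have e : ∏ k ∈ Finset.univ.erase i, orbital (lllIndex (α + Finsupp.single i 1) k) (x k) =
      ∏ k ∈ Finset.univ.erase i, orbital (lllIndex α k) (x k) :=
    Finset.prod_congr rfl fun k hk => by
      simp [lllIndex, Finsupp.single_eq_of_ne (Finset.ne_of_mem_erase hk)]
  rw [raise, orbitalProd_update, orbitalProd_eq_mul _ i, orbitalProd_eq_mul (lllIndex α) i, e]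
  have h1 := conj_mul_orbital (α i) (x i)
  simp only [lllIndex, Finsupp.add_apply, Finsupp.single_eq_same, zero_add]
  linear_combination (∏ k ∈ Finset.univ.erase i, orbital (α k, 0) (x k)) * h1

theorem memLp_coord_mul {Ψ : L2 N} (h : ∫⁻ x, ENNReal.ofReal (∑ i, ‖x i‖ ^ 2) * ‖Ψ x‖ₑ ^ 2 < ⊤)
    (i : Fin N) : MemLp (fun x => x i * Ψ x) 2 volume := by
  have hm : AEStronglyMeasurable (fun x => x i * Ψ x) volume :=
    (measurable_pi_apply i).aestronglyMeasurable.mul (Lp.aestronglyMeasurable Ψ)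
  rw [memLp_two_iff_lintegral hm]
  refine lt_of_le_of_lt (lintegral_mono fun x => ?_) h
  rw [enorm_mul, mul_pow, ← ofReal_norm, ← ENNReal.ofReal_pow (norm_nonneg _)]
  gcongr
  exact Finset.single_le_sum (f := fun i => ‖x i‖ ^ 2) (fun _ _ => by positivity) (Finset.mem_univ i)

theorem sum_norm_coord_mul_sq {Ψ : L2 N}
    (h : ∫⁻ x, ENNReal.ofReal (∑ i, ‖x i‖ ^ 2) * ‖Ψ x‖ₑ ^ 2 < ⊤) :
    ∑ i, ‖(memLp_coord_mul h i).toLp _‖ ^ 2 =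
      (∫⁻ x, ENNReal.ofReal (∑ i, ‖x i‖ ^ 2) * ‖Ψ x‖ₑ ^ 2).toReal := by
  simp_rw [norm_toLp_sq]
  rw [← ENNReal.toReal_sum fun i _ => ((memLp_two_iff_lintegral (memLp_coord_mul h i).1).1
    (memLp_coord_mul h i)).ne]
  congr 1
  rw [← lintegral_finsetSum' _ fun i _ => (memLp_coord_mul h i).1.enorm.pow_const 2]
  refine lintegral_congr fun x => ?_
  rw [ENNReal.ofReal_sum_of_nonneg fun _ _ => by positivity, Finset.sum_mul]
  refine Finset.sum_congr rfl fun i _ => ?_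
  rw [enorm_mul, mul_pow, ← ofReal_norm (x i), ← ENNReal.ofReal_pow (norm_nonneg _)]

theorem inner_lllLp_coord_mul {Ψ : L2 N}
    (h : ∫⁻ x, ENNReal.ofReal (∑ i, ‖x i‖ ^ 2) * ‖Ψ x‖ₑ ^ 2 < ⊤) (i : Fin N) (α : Fin N →₀ ℕ) :
    inner ℂ (lllLp (α + Finsupp.single i 1)) ((memLp_coord_mul h i).toLp _) =
      inner ℂ (orbitalLp (raise (lllIndex (α + Finsupp.single i 1)) i)) Ψ +
        √((α i : ℝ) + 1) * inner ℂ (lllLp α) Ψ := by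
  rw [lllLp, lllLp, orbitalLp, orbitalLp, orbitalLp, inner_toLp_toLp, inner_toLp_left,
    inner_toLp_left, ← integral_const_mul, ← integral_add
      (integrable_conj_mul (memLp_orbitalProd _) (Lp.memLp Ψ))
      ((integrable_conj_mul (memLp_orbitalProd _) (Lp.memLp Ψ)).const_mul _)]
  refine integral_congr_ae (ae_of_all _ fun x => ?_)
  have := congrArg conj (conj_mul_orbitalProd α i x)
  simp only [map_mul, map_add, Complex.conj_conj, Complex.conj_ofReal] at this
  linear_combination Ψ x * this

/-- A weighted triangle inequality: almost all of `‖b‖ ^ 2` is kept, and the perturbation `p` pays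
the price `1 / δ`. -/
theorem sq_norm_le_of_add {p b : ℂ} {δ : ℝ} (hδ : 0 < δ) (hδ1 : δ ≤ 1) :
    (1 - δ) * ‖b‖ ^ 2 ≤ ‖p + b‖ ^ 2 + ‖p‖ ^ 2 / δ := by
  have h1 : ‖b‖ ≤ ‖p + b‖ + ‖p‖ := by
    have := norm_sub_le (p + b) p
    rwa [add_sub_cancel_left] at this
  set X := ‖p + b‖
  set Y := ‖p‖
  have h2 : ‖b‖ ^ 2 ≤ (X + Y) ^ 2 := pow_le_pow_left₀ (norm_nonneg _) h1 2
  have h3 : (1 - δ) * ‖b‖ ^ 2 ≤ (1 - δ) * (X + Y) ^ 2 :=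
    mul_le_mul_of_nonneg_left h2 (by linarith)
  refine h3.trans ?_
  have h4 : X ^ 2 + Y ^ 2 / δ - (1 - δ) * (X + Y) ^ 2 =
      ((δ * X - (1 - δ) * Y) ^ 2 + δ * Y ^ 2) / δ := by
    field_simp
    ring
  have h5 : 0 ≤ ((δ * X - (1 - δ) * Y) ^ 2 + δ * Y ^ 2) / δ := by positivity
  linarith

/-- Bessel's inequality for `x_i Ψ` against lowest Landau level orbitals raised by one in the
coordinate `i` produces the weight `α_i + 1`; summed over `i` this is the degree plus `N`. The cross
terms with the first Landau level cannot be dropped, but their squares are bounded by kinetic energy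
over `δ`. -/
theorem sum_degree_mul_le {Ψ : L2 N} (hΨ : ∀ i k, IsWeakMagMomentum i k Ψ (weakMagMomentum i k Ψ))
    (h : ∫⁻ x, ENNReal.ofReal (∑ i, ‖x i‖ ^ 2) * ‖Ψ x‖ₑ ^ 2 < ⊤) {δ : ℝ} (hδ : 0 < δ) (hδ1 : δ ≤ 1)
    (F : Finset (Fin N →₀ ℕ)) :
    (1 - δ) * ∑ α ∈ F, ((α.degree : ℝ) + N) * ‖(inner ℂ (lllLp α) Ψ : ℂ)‖ ^ 2 ≤
      (∫⁻ x, ENNReal.ofReal (∑ i, ‖x i‖ ^ 2) * ‖Ψ x‖ₑ ^ 2).toReal +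
        (∑ i, ‖lowering i Ψ‖ ^ 2) / δ := by
  classical
  have key : ∀ i, (1 - δ) * ∑ α ∈ F, ((α i : ℝ) + 1) * ‖(inner ℂ (lllLp α) Ψ : ℂ)‖ ^ 2 ≤
      ‖(memLp_coord_mul h i).toLp _‖ ^ 2 + ‖lowering i Ψ‖ ^ 2 / δ := by
    intro i
    have hinj : Function.Injective fun α : Fin N →₀ ℕ => α + Finsupp.single i 1 :=
      add_left_injective _
    have h1 := ((orthonormal_lllLp (N := N)).comp _ hinj).sum_inner_products_le
      ((memLp_coord_mul h i).toLp _) (s := F)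
    have h2 : ∑ α ∈ F, ‖(inner ℂ (orbitalLp (raise (lllIndex (α + Finsupp.single i 1)) i)) Ψ : ℂ)‖ ^ 2
        ≤ ‖lowering i Ψ‖ ^ 2 / 4 := by
      have hinj2 : Function.Injective
          fun α : Fin N →₀ ℕ => raise (lllIndex (α + Finsupp.single i 1)) i :=
        (raise_injective i).comp (lllIndex_injective.comp hinj)
      have h3 := sum_le_hasSum (F.image fun α => raise (lllIndex (α + Finsupp.single i 1)) i)
        (fun ν _ => by positivity) (hasSum_norm_lowering_sq (hΨ i))
      rw [Finset.sum_image fun _ _ _ _ e => hinj2 e] at h3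
      refine le_trans (le_of_eq (Finset.sum_congr rfl fun α _ => ?_)) h3
      simp [raise, lllIndex]
    calc (1 - δ) * ∑ α ∈ F, ((α i : ℝ) + 1) * ‖(inner ℂ (lllLp α) Ψ : ℂ)‖ ^ 2
        = ∑ α ∈ F, (1 - δ) * ‖(√((α i : ℝ) + 1) : ℂ) * inner ℂ (lllLp α) Ψ‖ ^ 2 := by
          rw [Finset.mul_sum]
          refine Finset.sum_congr rfl fun α _ => ?_
          rw [norm_mul, mul_pow, Complex.norm_real, Real.norm_eq_abs, sq_abs,
            Real.sq_sqrt (by positivity)]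
      _ ≤ ∑ α ∈ F, (‖(inner ℂ (lllLp (α + Finsupp.single i 1))
            ((memLp_coord_mul h i).toLp _) : ℂ)‖ ^ 2 +
          ‖(inner ℂ (orbitalLp (raise (lllIndex (α + Finsupp.single i 1)) i)) Ψ : ℂ)‖ ^ 2 / δ) := by
          refine Finset.sum_le_sum fun α _ => ?_
          rw [inner_lllLp_coord_mul h i α]
          exact sq_norm_le_of_add hδ hδ1
      _ ≤ _ := by
          rw [Finset.sum_add_distrib, ← Finset.sum_div]
          refine add_le_add h1 ?_
          gcongr
          have := sq_nonneg ‖lowering i Ψ‖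
          linarith
  calc (1 - δ) * ∑ α ∈ F, ((α.degree : ℝ) + N) * ‖(inner ℂ (lllLp α) Ψ : ℂ)‖ ^ 2
      = ∑ i, (1 - δ) * ∑ α ∈ F, ((α i : ℝ) + 1) * ‖(inner ℂ (lllLp α) Ψ : ℂ)‖ ^ 2 := by
        rw [← Finset.mul_sum, Finset.sum_comm]
        congr 1
        refine Finset.sum_congr rfl fun α _ => ?_
        rw [← Finset.sum_mul, Finset.sum_add_distrib, Finsupp.degree_eq_sum]
        simp
    _ ≤ ∑ i, (‖(memLp_coord_mul h i).toLp _‖ ^ 2 + ‖lowering i Ψ‖ ^ 2 / δ) :=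
        Finset.sum_le_sum fun i _ => key i
    _ = _ := by rw [Finset.sum_add_distrib, sum_norm_coord_mul_sq h, Finset.sum_div]

end LLL

/-- If finitely many functionals on a finite dimensional space have a common kernel spanned by a
unit vector `L`, they control the component orthogonal to `L`. -/
theorem exists_norm_sub_sq_le {H : Type*} [NormedAddCommGroup H] [InnerProductSpace ℂ H]
    (U : Submodule ℂ H) [FiniteDimensional ℂ U] {ι : Type*} [Fintype ι] (lam : ι → H) {L : H}
    (hLU : L ∈ U) (hL : ‖L‖ = 1) (hlamL : ∀ t, inner ℂ (lam t) L = 0)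
    (hker : ∀ u ∈ U, (∀ t, inner ℂ (lam t) u = 0) → ∃ c : ℂ, u = c • L) :
    ∃ C : ℝ, 0 ≤ C ∧ ∀ u ∈ U, ‖u - (inner ℂ L u : ℂ) • L‖ ^ 2 ≤
      C * ∑ t, ‖(inner ℂ (lam t) u : ℂ)‖ ^ 2 := by
  have hLL : inner ℂ L L = 1 := by rw [inner_self_eq_norm_sq_to_K, hL]; simp
  -- Adjoining the functional of `L` makes the family injective, hence bounded below on a finite
  -- dimensional space; this functional vanishes on the component orthogonal to `L`.
  let S : U →ₗ[ℂ] (ι → ℂ) × ℂ :=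
    (LinearMap.pi fun t => (innerSL ℂ (lam t)).toLinearMap ∘ₗ U.subtype).prod
      ((innerSL ℂ L).toLinearMap ∘ₗ U.subtype)
  have hS : ∀ u : U, S u = (fun t => inner ℂ (lam t) (u : H), inner ℂ L (u : H)) := fun u => rfl
  have hSk : LinearMap.ker S = ⊥ := by
    rw [LinearMap.ker_eq_bot']
    intro u hu
    rw [hS, Prod.mk_eq_zero] at hu
    obtain ⟨c, hc⟩ := hker u u.2 fun t => congrFun hu.1 t
    have h2 := hu.2
    rw [hc, inner_smul_right, hLL, mul_one] at h2
    exact Subtype.ext (by rw [hc, h2, zero_smul]; rfl)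
  obtain ⟨K, -, hK⟩ := S.exists_antilipschitzWith hSk
  refine ⟨(K : ℝ) ^ 2, by positivity, fun u hu => ?_⟩
  set u' : H := u - (inner ℂ L u : ℂ) • L with hu'
  have hu'U : u' ∈ U := U.sub_mem hu (U.smul_mem _ hLU)
  have h1 : inner ℂ L u' = 0 := by
    rw [hu', inner_sub_right, inner_smul_right, hLL, mul_one, sub_self]
  have h2 : ∀ t, inner ℂ (lam t) u' = inner ℂ (lam t) u := fun t => by
    rw [hu', inner_sub_right, inner_smul_right, hlamL, mul_zero, sub_zero]
  have h3 : ‖u'‖ ≤ K * ‖S ⟨u', hu'U⟩‖ := by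
    have := hK.le_mul_dist ⟨u', hu'U⟩ 0
    rwa [dist_zero_right, map_zero, dist_zero_right] at this
  have h4 : ‖S ⟨u', hu'U⟩‖ ≤ √(∑ t, ‖(inner ℂ (lam t) u : ℂ)‖ ^ 2) := by
    rw [hS]
    simp only [h1, h2]
    rw [Prod.norm_def, norm_zero, max_eq_left (norm_nonneg _),
      pi_norm_le_iff_of_nonneg (Real.sqrt_nonneg _)]
    intro t
    refine Real.le_sqrt_of_sq_le ?_
    exact Finset.single_le_sum (f := fun t => ‖(inner ℂ (lam t) u : ℂ)‖ ^ 2)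
      (fun _ _ => by positivity) (Finset.mem_univ t)
  calc ‖u'‖ ^ 2 ≤ (K * √(∑ t, ‖(inner ℂ (lam t) u : ℂ)‖ ^ 2)) ^ 2 := by
        gcongr
        exact h3.trans (by gcongr)
    _ = _ := by rw [mul_pow, Real.sq_sqrt (Finset.sum_nonneg fun _ _ => by positivity)]

/-! ### Truncation to bounded degree and the lower bound on the trap -/

section LowPart

variable {N : ℕ}

/-- The component in the lowest Landau level of total degree at most `d`. -/
def lowPart (d : ℕ) (Ψ : L2 N) : L2 N :=
  ∑ α ∈ (finite_degree_le (N := N) d).toFinset, (inner ℂ (lllLp α) Ψ : ℂ) • lllLp α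

theorem mem_degree_le {d : ℕ} {α : Fin N →₀ ℕ} :
    α ∈ (finite_degree_le (N := N) d).toFinset ↔ α.degree ≤ d := by
  rw [Set.Finite.mem_toFinset, Set.mem_ofPred_eq]

theorem lowPart_mem (d : ℕ) (Ψ : L2 N) : lowPart d Ψ ∈ lllSpan N d :=
  Submodule.sum_mem _ fun α hα =>
    Submodule.smul_mem _ _ (Submodule.subset_span ⟨α, mem_degree_le.1 hα, rfl⟩)

theorem inner_lllLp_lowPart {d : ℕ} (Ψ : L2 N) {α : Fin N →₀ ℕ} (hα : α.degree ≤ d) :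
    inner ℂ (lllLp α) (lowPart d Ψ) = inner ℂ (lllLp α) Ψ :=
  orthonormal_lllLp.inner_right_sum (fun α => (inner ℂ (lllLp α) Ψ : ℂ)) (mem_degree_le.2 hα)

theorem inner_orbitalLp_lowPart_of_ne {d : ℕ} (Ψ : L2 N) {ν : Fin N → ℕ × ℕ}
    (hν : ∀ α : Fin N →₀ ℕ, α.degree ≤ d → ν ≠ lllIndex α) :
    inner ℂ (orbitalLp ν) (lowPart d Ψ) = 0 := by
  rw [lowPart, inner_sum]
  refine Finset.sum_eq_zero fun α hα => ?_
  rw [inner_smul_right, lllLp, (orthonormal_orbitalLp N).2 (hν α (mem_degree_le.1 hα)), mul_zero]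

theorem inner_lowPart {d : ℕ} (Ψ : L2 N) {L : L2 N} (hL : L ∈ lllSpan N d) :
    inner ℂ L (lowPart d Ψ) = inner ℂ L Ψ := by
  induction hL using Submodule.span_induction with
  | mem L h =>
    obtain ⟨α, hα, rfl⟩ := h
    exact inner_lllLp_lowPart Ψ hα
  | zero => rw [inner_zero_left, inner_zero_left]
  | add u v _ _ h1 h2 => rw [inner_add_left, inner_add_left, h1, h2]
  | smul c u _ h => rw [inner_smul_left, inner_smul_left, h]

theorem norm_lowPart_sq (d : ℕ) (Ψ : L2 N) : ‖lowPart d Ψ‖ ^ 2 =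
    ∑ α ∈ (finite_degree_le (N := N) d).toFinset, ‖(inner ℂ (lllLp α) Ψ : ℂ)‖ ^ 2 := by
  have h1 := orthonormal_lllLp.inner_sum (fun α : Fin N →₀ ℕ => (inner ℂ (lllLp α) Ψ : ℂ))
    (fun α => (inner ℂ (lllLp α) Ψ : ℂ)) (finite_degree_le (N := N) d).toFinset
  have h2 : (inner ℂ (lowPart d Ψ) (lowPart d Ψ) : ℂ).re = ‖lowPart d Ψ‖ ^ 2 :=
    inner_self_eq_norm_sq (𝕜 := ℂ) _
  rw [← h2, lowPart, h1, Complex.re_sum]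
  refine Finset.sum_congr rfl fun α _ => ?_
  rw [mul_comm, Complex.mul_conj, Complex.normSq_eq_norm_sq, Complex.ofReal_re]

theorem norm_sub_inner_smul_sq {H : Type*} [NormedAddCommGroup H] [InnerProductSpace ℂ H] {L : H}
    (hL : ‖L‖ = 1) (u : H) :
    ‖u‖ ^ 2 = ‖(inner ℂ L u : ℂ)‖ ^ 2 + ‖u - (inner ℂ L u : ℂ) • L‖ ^ 2 := by
  have hLL : inner ℂ L L = 1 := by rw [inner_self_eq_norm_sq_to_K, hL]; simp
  have h0 : inner ℂ ((inner ℂ L u : ℂ) • L) (u - (inner ℂ L u : ℂ) • L) = 0 := by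
    rw [inner_smul_left, inner_sub_right, inner_smul_right, hLL, mul_one, sub_self, mul_zero]
  have h1 := norm_add_sq_eq_norm_sq_add_norm_sq_of_inner_eq_zero _ _ h0
  rw [add_sub_cancel, norm_smul, hL, mul_one, ← sq, ← sq, ← sq] at h1
  exact h1

/-- Since `L` lives in degree exactly `d`, components of lower degree belong entirely to the part
orthogonal to `L`, where a weight up to `d + 1` is affordable. In degree `d` the weight is one,
which is why `|⟨L, Ψ⟩|²` appears with coefficient one and a gap of size one remains. -/
theorem sum_defect_le {d : ℕ} {L : L2 N} (hLm : L ∈ lllSpan N d) (hL : ‖L‖ = 1)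
    (hLd : ∀ α : Fin N →₀ ℕ, α.degree ≠ d → inner ℂ (lllLp α) L = 0) (Ψ : L2 N) :
    ∑ α ∈ (finite_degree_le (N := N) d).toFinset,
      ((d : ℝ) + 1 - α.degree) * ‖(inner ℂ (lllLp α) Ψ : ℂ)‖ ^ 2 ≤
      ‖(inner ℂ L Ψ : ℂ)‖ ^ 2 +
        ((d : ℝ) + 1) * ‖lowPart d Ψ - (inner ℂ L Ψ : ℂ) • L‖ ^ 2 := by
  set A := (finite_degree_le (N := N) d).toFinset
  have hsplit := norm_sub_inner_smul_sq hL (lowPart d Ψ)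
  rw [inner_lowPart Ψ hLm] at hsplit
  set u' := lowPart d Ψ - (inner ℂ L Ψ : ℂ) • L with hu'
  have h1 : ∀ α ∈ A, ((d : ℝ) + 1 - α.degree) * ‖(inner ℂ (lllLp α) Ψ : ℂ)‖ ^ 2 ≤
      ‖(inner ℂ (lllLp α) Ψ : ℂ)‖ ^ 2 + d * ‖(inner ℂ (lllLp α) u' : ℂ)‖ ^ 2 := by
    intro α hα
    have hαd := mem_degree_le.1 hα
    rcases eq_or_ne α.degree d with he | hne
    · rw [he]
      have : 0 ≤ (d : ℝ) * ‖(inner ℂ (lllLp α) u' : ℂ)‖ ^ 2 := by positivity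
      linarith
    · have e : inner ℂ (lllLp α) u' = inner ℂ (lllLp α) Ψ := by
        rw [hu', inner_sub_right, inner_smul_right, hLd α hne, mul_zero, sub_zero,
          inner_lllLp_lowPart Ψ hαd]
      rw [e]
      have h2 : (0 : ℝ) ≤ α.degree := Nat.cast_nonneg _
      nlinarith [sq_nonneg ‖(inner ℂ (lllLp α) Ψ : ℂ)‖]
  have h2 : ∑ α ∈ A, ‖(inner ℂ (lllLp α) u' : ℂ)‖ ^ 2 ≤ ‖u'‖ ^ 2 :=
    orthonormal_lllLp.sum_inner_products_le u'
  calc _ ≤ ∑ α ∈ A, (‖(inner ℂ (lllLp α) Ψ : ℂ)‖ ^ 2 + d * ‖(inner ℂ (lllLp α) u' : ℂ)‖ ^ 2) :=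
        Finset.sum_le_sum h1
    _ = ‖lowPart d Ψ‖ ^ 2 + d * ∑ α ∈ A, ‖(inner ℂ (lllLp α) u' : ℂ)‖ ^ 2 := by
        rw [Finset.sum_add_distrib, ← Finset.mul_sum, norm_lowPart_sq]
    _ ≤ ‖lowPart d Ψ‖ ^ 2 + d * ‖u'‖ ^ 2 := by gcongr
    _ = _ := by rw [hsplit]; ring

/-- The trap weight of degree `k` is `d + N + 1` minus the defect `d + 1 - k`. Only the finitely
many degrees up to `d` have a positive defect. -/
theorem trap_lower_bound_lll {d : ℕ} {Ψ Θ η : L2 N}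
    (hsum : Ψ = Θ + η) (hη : ∀ α, inner ℂ (lllLp α) η = 0)
    (hΘ : ∀ ν : Fin N → ℕ × ℕ, (∃ i, (ν i).2 ≠ 0) → inner ℂ (orbitalLp ν) Θ = 0)
    (hΨ : ∀ i k, IsWeakMagMomentum i k Ψ (weakMagMomentum i k Ψ))
    (h : ∫⁻ x, ENNReal.ofReal (∑ i, ‖x i‖ ^ 2) * ‖Ψ x‖ₑ ^ 2 < ⊤) {δ : ℝ} (hδ : 0 < δ)
    (hδ1 : δ ≤ 1) :
    (1 - δ) * (((d : ℝ) + N + 1) * ‖Θ‖ ^ 2 - ∑ α ∈ (finite_degree_le (N := N) d).toFinset,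
      ((d : ℝ) + 1 - α.degree) * ‖(inner ℂ (lllLp α) Ψ : ℂ)‖ ^ 2) ≤
      (∫⁻ x, ENNReal.ofReal (∑ i, ‖x i‖ ^ 2) * ‖Ψ x‖ₑ ^ 2).toReal +
        (∑ i, ‖lowering i Ψ‖ ^ 2) / δ := by
  set A := (finite_degree_le (N := N) d).toFinset
  set D := ∑ α ∈ A, ((d : ℝ) + 1 - α.degree) * ‖(inner ℂ (lllLp α) Ψ : ℂ)‖ ^ 2
  have h1 : Tendsto (fun F : Finset (Fin N →₀ ℕ) => ∑ α ∈ F, ‖(inner ℂ (lllLp α) Θ : ℂ)‖ ^ 2)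
      atTop (𝓝 (‖Θ‖ ^ 2)) := hasSum_norm_inner_lllLp_sq hΘ
  -- For finite sets `F` containing all degrees up to `d`, the additional defects are nonpositive
  -- and can be discarded; the limit over `F` restores the full norm.
  refine le_of_tendsto (((h1.const_mul _).sub_const D).const_mul (1 - δ))
    (eventually_atTop.2 ⟨A, fun F hAF => ?_⟩)
  refine le_trans ?_ (sum_degree_mul_le hΨ h hδ hδ1 F)
  refine mul_le_mul_of_nonneg_left ?_ (by linarith)
  have hDF : ∑ α ∈ F, ((d : ℝ) + 1 - α.degree) * ‖(inner ℂ (lllLp α) Ψ : ℂ)‖ ^ 2 ≤ D := by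
    rw [← Finset.sum_sdiff hAF]
    have : ∑ α ∈ F \ A, ((d : ℝ) + 1 - α.degree) * ‖(inner ℂ (lllLp α) Ψ : ℂ)‖ ^ 2 ≤ 0 := by
      refine Finset.sum_nonpos fun α hα => ?_
      have h1 : ¬ α.degree ≤ d := fun hle => (Finset.mem_sdiff.1 hα).2 (mem_degree_le.2 hle)
      have h2 : (d : ℝ) + 1 ≤ α.degree := by exact_mod_cast (by omega : d + 1 ≤ α.degree)
      exact mul_nonpos_of_nonpos_of_nonneg (by linarith) (by positivity)
    linarith
  have e : ∀ α, inner ℂ (lllLp α) Θ = inner ℂ (lllLp α) Ψ := fun α => by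
    rw [hsum, inner_add_right, hη, add_zero]
  simp_rw [e]
  have e2 : ∑ α ∈ F, ((α.degree : ℝ) + N) * ‖(inner ℂ (lllLp α) Ψ : ℂ)‖ ^ 2 =
      ((d : ℝ) + N + 1) * (∑ α ∈ F, ‖(inner ℂ (lllLp α) Ψ : ℂ)‖ ^ 2) -
        ∑ α ∈ F, ((d : ℝ) + 1 - α.degree) * ‖(inner ℂ (lllLp α) Ψ : ℂ)‖ ^ 2 := by
    rw [Finset.mul_sum, ← Finset.sum_sub_distrib]
    exact Finset.sum_congr rfl fun α _ => by ring
  rw [e2]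
  linarith

theorem trap_arith {δ n X Θ η Ψ D K T : ℝ} (hδ1 : δ ≤ 1) (hδ : 0 < δ) (hn : 0 ≤ n)
    (hlim : (1 - δ) * (n * Θ - D) ≤ T + K / δ) (hpyth : Ψ = Θ + η) (hη : η ≤ K / 4) (hK : 0 ≤ K)
    (hD : D ≤ X) : (1 - δ) * (n * Ψ - X) ≤ T + (1 / δ + n) * K := by
  have h1 : n * η ≤ n * K := mul_le_mul_of_nonneg_left (by linarith) hn
  have h2 : n * Ψ - X ≤ n * Θ - D + n * K := by
    rw [hpyth]
    linarith
  have h3 := mul_le_mul_of_nonneg_left h2 (by linarith : 0 ≤ 1 - δ)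
  have h4 : (1 - δ) * (n * K) ≤ n * K := mul_le_of_le_one_left (by positivity) (by linarith)
  have e : (1 / δ + n) * K = K / δ + n * K := by ring
  rw [e]
  linarith

/-- Lower bound on the trapping energy. -/
theorem trap_lower_bound {d : ℕ} {L : L2 N} (hLm : L ∈ lllSpan N d) (hL : ‖L‖ = 1)
    (hLd : ∀ α : Fin N →₀ ℕ, α.degree ≠ d → inner ℂ (lllLp α) L = 0) {Ψ Θ η : L2 N}
    (hsum : Ψ = Θ + η) (hη : ∀ α, inner ℂ (lllLp α) η = 0)
    (hΘ : ∀ ν : Fin N → ℕ × ℕ, (∃ i, (ν i).2 ≠ 0) → inner ℂ (orbitalLp ν) Θ = 0)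
    (hpyth : ‖Ψ‖ ^ 2 = ‖Θ‖ ^ 2 + ‖η‖ ^ 2)
    (hΨ : ∀ i k, IsWeakMagMomentum i k Ψ (weakMagMomentum i k Ψ))
    (h : ∫⁻ x, ENNReal.ofReal (∑ i, ‖x i‖ ^ 2) * ‖Ψ x‖ₑ ^ 2 < ⊤) {δ : ℝ} (hδ : 0 < δ)
    (hδ1 : δ ≤ 1) :
    (1 - δ) * (((d : ℝ) + N + 1) * ‖Ψ‖ ^ 2 - (‖(inner ℂ L Ψ : ℂ)‖ ^ 2 +
        ((d : ℝ) + 1) * ‖lowPart d Ψ - (inner ℂ L Ψ : ℂ) • L‖ ^ 2)) ≤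
      (∫⁻ x, ENNReal.ofReal (∑ i, ‖x i‖ ^ 2) * ‖Ψ x‖ₑ ^ 2).toReal +
        (1 / δ + ((d : ℝ) + N + 1)) * ∑ i, ‖lowering i Ψ‖ ^ 2 :=
  trap_arith hδ1 hδ (by positivity) (trap_lower_bound_lll (d := d) hsum hη hΘ hΨ h hδ hδ1) hpyth
    (norm_sq_le_of_lll_orthogonal hsum hη hΘ hΨ) (Finset.sum_nonneg fun _ _ => by positivity)
    (sum_defect_le hLm hL hLd Ψ)

/-- A `detect` vector of degree at most `d` is orthogonal to every lowest Landau level orbital of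
larger degree, by homogeneity, so it does not notice the truncation. -/
theorem inner_detect_sub_lowPart {i j : Fin N} (hij : j ≠ i) {d : ℕ} {α : Fin N →₀ ℕ}
    (hα : α.degree ≤ d) {Ψ Θ η : L2 N} (hsum : Ψ = Θ + η) (hη : ∀ α, inner ℂ (lllLp α) η = 0)
    (hΘ : ∀ ν : Fin N → ℕ × ℕ, (∃ i, (ν i).2 ≠ 0) → inner ℂ (orbitalLp ν) Θ = 0) :
    inner ℂ (detect hij α) (lowPart d Ψ) = inner ℂ (detect hij α) Θ := by
  have h1 := (orbitalBasis N).hasSum_inner_mul_inner (detect hij α) (Θ - lowPart d Ψ)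
  have h2 : ∀ ν, inner ℂ (detect hij α) (orbitalBasis N ν) *
      inner ℂ (orbitalBasis N ν) (Θ - lowPart d Ψ) = 0 := by
    intro ν
    rw [orbitalBasis_apply, inner_sub_right]
    by_cases hν : ∃ i, (ν i).2 ≠ 0
    · rw [hΘ ν hν, inner_orbitalLp_lowPart_of_ne, sub_self, mul_zero]
      rintro β - rfl
      obtain ⟨i, hi⟩ := hν
      exact hi rfl
    · push Not at hν
      rw [eq_lllIndex hν]
      set β : Fin N →₀ ℕ := Finsupp.equivFunOnFinite.symm fun i => (ν i).1
      change inner ℂ (detect hij α) (lllLp β) *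
        (inner ℂ (lllLp β) Θ - inner ℂ (lllLp β) (lowPart d Ψ)) = 0
      rcases le_or_gt β.degree d with hβ | hβ
      · rw [inner_lllLp_lowPart Ψ hβ, hsum, inner_add_right, hη, add_zero, sub_self, mul_zero]
      · obtain ⟨c, -, hc⟩ := lllLp_eq β
        rw [hc, inner_smul_right, inner_detect_eq_zero_of_isHomogeneous hij
          (MvPolynomial.isHomogeneous_monomial (1 : ℂ) rfl) (by omega), mul_zero, zero_mul]
  simp_rw [h2] at h1
  have h3 := h1.unique hasSum_zero
  rw [inner_sub_right, sub_eq_zero] at h3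
  exact h3.symm

end LowPart

/-! ### The lower bound on the energy -/

/-- The size `s a` of the interaction energy of pairs with relative angular momentum `ℓ`. -/
structure IsScale (ℓ : ℕ) (s : ℝ → ℝ) : Prop where
  pos : ∀ᶠ a in 𝓝[>] (0 : ℝ), 0 < s a
  tendsto_zero : Tendsto s (𝓝[>] 0) (𝓝 0)
  -- The next two bounds say that both costs in the pair estimate, the interaction at distance `a`
  -- and the norm of the test function, are at most of order `1/s`. The last field makes the kinetic
  -- cost of the cut-off trial state negligible compared with `s`.
  pow_le : ∃ C : ℝ, ∀ᶠ a in 𝓝[>] (0 : ℝ), (a ^ 2)⁻¹ ^ ℓ ≤ C * (s a)⁻¹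
  lintegral_le : ∀ c : ℝ, 0 < c → ∃ C : ℝ, ∀ᶠ a in 𝓝[>] (0 : ℝ),
    ∫⁻ t in Set.Icc (c * a ^ 2 / 2) 2, ENNReal.ofReal (t ^ (ℓ + 1))⁻¹ ≤ ENNReal.ofReal (C * (s a)⁻¹)
  pow_div_tendsto_zero : Tendsto (fun a => a ^ (2 * ℓ + 2) / s a) (𝓝[>] 0) (𝓝 0)

/-- The interaction potential of all pairs. -/
def pairPot (N : ℕ) (v : ℝ → ℝ≥0∞) (a : ℝ) (x : Conf N) : ℝ≥0∞ :=
  ∑ i, ∑ j ∈ Finset.Ioi i, scaled v a ‖x i - x j‖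

/-- On `t ≤ 2` smaller powers are dominated by the largest one up to `2 ^ ℓ`, so the scale for
relative angular momentum `ℓ` covers all smaller ones. -/
theorem lintegral_inv_pow_le {c a : ℝ} (hc : 0 < c) (ha : 0 < a) {m ℓ : ℕ} (hm : m ≤ ℓ) {C : ℝ}
    (h : ∫⁻ t in Set.Icc (c * a ^ 2 / 2) 2, ENNReal.ofReal (t ^ (ℓ + 1))⁻¹ ≤ ENNReal.ofReal C) :
    ∫⁻ t in Set.Icc (c * a ^ 2 / 2) 2, ENNReal.ofReal (t ^ (m + 1))⁻¹ ≤
      ENNReal.ofReal (2 ^ ℓ * C) := by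
  calc ∫⁻ t in Set.Icc (c * a ^ 2 / 2) 2, ENNReal.ofReal (t ^ (m + 1))⁻¹
      ≤ ∫⁻ t in Set.Icc (c * a ^ 2 / 2) 2,
          ENNReal.ofReal (2 ^ ℓ) * ENNReal.ofReal (t ^ (ℓ + 1))⁻¹ := by
        refine setLIntegral_mono' measurableSet_Icc fun t ht => ?_
        rw [← ENNReal.ofReal_mul (by positivity)]
        apply ENNReal.ofReal_le_ofReal
        have ht0 : 0 < t := lt_of_lt_of_le (by positivity) ht.1
        have e : (t ^ (m + 1))⁻¹ = t ^ (ℓ - m) * (t ^ (ℓ + 1))⁻¹ := by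
          rw [show ℓ + 1 = (ℓ - m) + (m + 1) by omega, pow_add t (ℓ - m), mul_inv,
            mul_inv_cancel_left₀ (by positivity)]
        rw [e]
        gcongr
        calc t ^ (ℓ - m) ≤ 2 ^ (ℓ - m) := pow_le_pow_left₀ ht0.le ht.2 _
          _ ≤ 2 ^ ℓ := pow_le_pow_right₀ one_le_two (Nat.sub_le _ _)
    _ = ENNReal.ofReal (2 ^ ℓ) *
          ∫⁻ t in Set.Icc (c * a ^ 2 / 2) 2, ENNReal.ofReal (t ^ (ℓ + 1))⁻¹ :=
        lintegral_const_mul' _ _ ENNReal.ofReal_ne_top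
    _ ≤ ENNReal.ofReal (2 ^ ℓ * C) := by
        rw [ENNReal.ofReal_mul (by positivity)]
        gcongr

/-! ### Combining the pair bounds with the trap bound -/

section Master

variable {N : ℕ}

theorem inner_lllLp_polyLp_eq_zero {Q : MvPolynomial (Fin N) ℂ} {d : ℕ} (hQ : Q.IsHomogeneous d)
    {α : Fin N →₀ ℕ} (hα : α.degree ≠ d) : inner ℂ (lllLp α) (polyLp Q) = 0 := by
  rw [Q.as_sum, map_sum, inner_sum]
  refine Finset.sum_eq_zero fun β hβ => ?_
  obtain ⟨c, hc⟩ := polyLp_monomial_mem (α := β) (MvPolynomial.coeff β Q)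
  have hne : α ≠ β := by
    rintro rfl
    exact hα (by
      by_contra hcon
      exact (MvPolynomial.mem_support_iff.1 hβ) (hQ.coeff_eq_zero hcon))
  rw [hc, inner_smul_right, orthonormal_lllLp.2 hne, mul_zero]

theorem laughlin_eq_smul (N m : ℕ) :
    laughlin N m = (‖(memLp_laughlinFun N m).toLp‖⁻¹ : ℂ) • polyLp (jastrow N ^ m) := by
  rw [laughlin, toLp_laughlinFun]

theorem laughlin_mem_lllSpan (N m : ℕ) : laughlin N m ∈ lllSpan N (numPairs N * m) := by
  rw [laughlin_eq_smul]
  exact Submodule.smul_mem _ _ (polyLp_mem_lllSpan ((jastrow_isHomogeneous N).pow m).totalDegree_le)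

theorem inner_lllLp_laughlin (m : ℕ) {α : Fin N →₀ ℕ} (hα : α.degree ≠ numPairs N * m) :
    inner ℂ (lllLp α) (laughlin N m) = 0 := by
  rw [laughlin_eq_smul, inner_smul_right,
    inner_lllLp_polyLp_eq_zero ((jastrow_isHomogeneous N).pow m) hα, mul_zero]

theorem lintegral_scaled_le_pairPot (v : ℝ → ℝ≥0∞) (a : ℝ) (Ψ : L2 N) {i j : Fin N} (hij : i < j) :
    ∫⁻ x, scaled v a ‖x i - x j‖ * ‖Ψ x‖ₑ ^ 2 ≤ ∫⁻ x, pairPot N v a x * ‖Ψ x‖ₑ ^ 2 := by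
  refine lintegral_mono fun x => ?_
  gcongr
  refine le_trans ?_ (Finset.single_le_sum
    (f := fun i => ∑ j ∈ Finset.Ioi i, scaled v a ‖x i - x j‖) (fun _ _ => zero_le)
    (Finset.mem_univ i))
  exact Finset.single_le_sum (f := fun j => scaled v a ‖x i - x j‖) (fun _ _ => zero_le)
    (Finset.mem_Ioi.2 hij)

theorem finite_pair_index (N n d : ℕ) : Finite {t : (Fin N × Fin N) × (Fin N →₀ ℕ) //
    t.1.1 < t.1.2 ∧ t.2 t.1.1 < n ∧ t.2.degree ≤ d} :=
  ((Set.finite_univ (α := Fin N × Fin N)).prod (finite_degree_le (N := N) d)).subset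
    fun _ ht => ⟨Set.mem_univ _, ht.2.2⟩

theorem pair_arith {C Ci Cp r K Ki V Vij J M Λ : ℝ} (hC : 0 ≤ C) (hr : 0 ≤ r) (hK : 0 ≤ K)
    (hV : 0 ≤ V) (hKi0 : 0 ≤ Ki) (hVij0 : 0 ≤ Vij) (hKi : Ki ≤ K) (hVij : Vij ≤ V)
    (hJ : J ≤ |Ci| * r) (hM : M ≤ |Cp| * r) (h : Λ ≤ C * (J * Ki + M * Vij)) :
    Λ ≤ C * (|Ci| + |Cp|) * (r * (K + V)) := by
  have h1 : J * Ki ≤ |Ci| * r * K :=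
    (mul_le_mul_of_nonneg_right hJ hKi0).trans (mul_le_mul_of_nonneg_left hKi (by positivity))
  have h2 : M * Vij ≤ |Cp| * r * V :=
    (mul_le_mul_of_nonneg_right hM hVij0).trans (mul_le_mul_of_nonneg_left hVij (by positivity))
  have h3 : 0 ≤ |Ci| * r * V := by positivity
  have h4 : 0 ≤ |Cp| * r * K := by positivity
  calc Λ ≤ C * (J * Ki + M * Vij) := h
    _ ≤ C * ((|Ci| + |Cp|) * (r * (K + V))) := by
        refine mul_le_mul_of_nonneg_left ?_ hC
        linarith
    _ = _ := by ring

/-- On the finite dimensional space of polynomials of degree at most `D`, the `detect` functionals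
with relative degree at most `ℓ` vanish jointly only on multiples of the Laughlin function, so they
control the rest. Each of them is bounded on `Ψ` by kinetic and interaction energy; the part outside
the lowest Landau level is subtracted at the cost of kinetic energy alone. -/
theorem exists_norm_lowPart_sub_le {v : ℝ → ℝ≥0∞} (hv : Measurable v)
    (hne : ¬ ∀ᵐ x : ℂ, v ‖x‖ = 0) {ℓ : ℕ} {s : ℝ → ℝ} (hs : IsScale ℓ s) :
    ∃ C : ℝ, 0 < C ∧ ∀ᶠ a in 𝓝[>] (0 : ℝ), ∀ Ψ : L2 N,
      (∀ i k, IsWeakMagMomentum i k Ψ (weakMagMomentum i k Ψ)) →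
      ∫⁻ x, pairPot N v a x * ‖Ψ x‖ₑ ^ 2 < ⊤ →
      ‖lowPart (numPairs N * (ℓ + 1)) Ψ -
          (inner ℂ (laughlin N (ℓ + 1)) Ψ : ℂ) • laughlin N (ℓ + 1)‖ ^ 2 ≤
        C * ((s a)⁻¹ * (∑ i, ‖lowering i Ψ‖ ^ 2 +
          (∫⁻ x, pairPot N v a x * ‖Ψ x‖ₑ ^ 2).toReal)) := by
  obtain ⟨c, d, δ, U, hc, hcd, hδ, hU, hUs, hU0, hUv⟩ := exists_lower_bound_on_set hv hne
  obtain ⟨Cp, hCp⟩ := hs.pow_le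
  obtain ⟨Ci, hCi⟩ := hs.lintegral_le c hc
  set D := numPairs N * (ℓ + 1) with hD
  set L := laughlin N (ℓ + 1) with hL
  let ι := {t : (Fin N × Fin N) × (Fin N →₀ ℕ) //
    t.1.1 < t.1.2 ∧ t.2 t.1.1 < ℓ + 1 ∧ t.2.degree ≤ D}
  have := finite_pair_index N (ℓ + 1) D
  have hι : Fintype ι := Fintype.ofFinite ι
  let lam : ι → L2 N := fun t => detect t.2.1.ne' t.1.2
  obtain ⟨Cf, hCf0, hCf⟩ := exists_norm_sub_sq_le (lllSpan N D) lam (L := L)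
    (laughlin_mem_lllSpan N _) (norm_laughlin _)
    (fun t => by
      rw [hL, laughlin_eq_smul, inner_smul_right, inner_detect_jastrow_pow _ _ t.2.1 t.2.2.1,
        mul_zero])
    (fun u hu h => by
      obtain ⟨b, hb⟩ := exists_eq_smul_of_inner_detect_eq_zero hu fun i j hij α h1 h2 =>
        h ⟨((i, j), α), hij, h1, h2⟩
      refine ⟨b * ‖(memLp_laughlinFun N (ℓ + 1)).toLp‖, ?_⟩
      have hne0 : (‖(memLp_laughlinFun N (ℓ + 1)).toLp‖ : ℂ) ≠ 0 :=
        Complex.ofReal_ne_zero.2 (norm_laughlinFun_ne_zero _)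
      rw [hL, laughlin_eq_smul, smul_smul, mul_assoc, mul_inv_cancel₀ hne0, mul_one, hb])
  choose C hC0 hC using fun t : ι => exists_norm_inner_detect_sq_le (v := v) t.2.1.ne' t.1.2 hc hcd hδ
    hU hUs hU0 hUv
  -- The factor `2` comes from splitting `Ψ` and `η`. The term `‖lam t‖ ^ 2` covers `2 ‖lam t‖² ·
  -- K/4`, because `s a < 1`.
  set B : ι → ℝ := fun t => 2 * (C t * (|2 ^ ℓ * Ci| + |Cp|)) + ‖lam t‖ ^ 2 with hB
  have hB0 : ∀ t, 0 ≤ B t := fun t => by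
    have := hC0 t
    positivity
  have hBs : 0 ≤ ∑ t, B t := Finset.sum_nonneg fun t _ => hB0 t
  refine ⟨Cf * ∑ t, B t + 1, by positivity, ?_⟩
  have hsmall : ∀ᶠ a in 𝓝[>] (0 : ℝ), 2 * d * a ^ 2 ≤ 2 := by
    have h1 : Tendsto (fun a : ℝ => 2 * d * a ^ 2) (𝓝[>] 0) (𝓝 (2 * d * 0 ^ 2)) :=
      ((continuous_const.mul (continuous_pow 2)).tendsto 0).mono_left nhdsWithin_le_nhds
    exact (h1.eventually_lt_const (by norm_num)).mono fun a h => h.le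
  have hs1 : ∀ᶠ a in 𝓝[>] (0 : ℝ), s a < 1 := hs.tendsto_zero.eventually_lt_const one_pos
  filter_upwards [hCp, hCi, hs.pos, hsmall, hs1, Ioc_mem_nhdsGT (zero_lt_one' ℝ)] with
    a hpa hia hsa hda hsa1 ha Ψ hΨ hV
  obtain ⟨Θ, η, hsum, hη, hΘ, hpyth⟩ := exists_lll_decomposition Ψ
  have hηK := norm_sq_le_of_lll_orthogonal hsum hη hΘ hΨ
  set K := ∑ i, ‖lowering i Ψ‖ ^ 2 with hK
  set V := (∫⁻ x, pairPot N v a x * ‖Ψ x‖ₑ ^ 2).toReal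
  have hK0 : 0 ≤ K := Finset.sum_nonneg fun _ _ => by positivity
  have hV0 : 0 ≤ V := ENNReal.toReal_nonneg
  have hr : 1 ≤ (s a)⁻¹ := (one_le_inv₀ hsa).2 hsa1.le
  have hr0 : 0 ≤ (s a)⁻¹ := by positivity
  have h1 := hCf _ (lowPart_mem D Ψ)
  rw [inner_lowPart Ψ (laughlin_mem_lllSpan N _)] at h1
  have key : ∀ t : ι, ‖(inner ℂ (lam t) (lowPart D Ψ) : ℂ)‖ ^ 2 ≤ B t * ((s a)⁻¹ * (K + V)) := by
    rintro ⟨⟨⟨i, j⟩, α⟩, hij, hαi, hαd⟩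
    set t : ι := ⟨⟨⟨i, j⟩, α⟩, hij, hαi, hαd⟩ with ht
    have e : inner ℂ (lam t) (lowPart D Ψ) = inner ℂ (lam t) Ψ - inner ℂ (lam t) η := by
      have e1 : inner ℂ (lam t) (lowPart D Ψ) = inner ℂ (lam t) Θ :=
        inner_detect_sub_lowPart hij.ne' hαd hsum hη hΘ
      rw [e1, hsum, inner_add_right, add_sub_cancel_right]
    have hm : α i ≤ ℓ := Nat.lt_succ_iff.1 hαi
    have hia' : ∫⁻ t in Set.Icc (c * a ^ 2 / 2) 2, ENNReal.ofReal (t ^ (α i + 1))⁻¹ ≤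
        ENNReal.ofReal (|2 ^ ℓ * Ci| * (s a)⁻¹) := by
      refine (lintegral_inv_pow_le hc ha.1 hm hia).trans (ENNReal.ofReal_le_ofReal ?_)
      rw [← mul_assoc]
      gcongr
      exact le_abs_self _
    have hVij := lintegral_scaled_le_pairPot v a Ψ hij
    have h2 := hC t a ha.1 hda _ (by positivity) hia' Ψ (hΨ i) (hVij.trans_lt hV)
    have h3 : ‖(inner ℂ (lam t) Ψ : ℂ)‖ ^ 2 ≤ C t * (|2 ^ ℓ * Ci| + |Cp|) * ((s a)⁻¹ * (K + V)) := by
      refine pair_arith (hC0 t) hr0 hK0 hV0 (sq_nonneg _) ENNReal.toReal_nonneg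
        (Finset.single_le_sum (f := fun i => ‖lowering i Ψ‖ ^ 2) (fun _ _ => by positivity)
          (Finset.mem_univ i))
        (ENNReal.toReal_mono hV.ne hVij) le_rfl ?_ h2
      calc (a ^ 2)⁻¹ ^ α i ≤ (a ^ 2)⁻¹ ^ ℓ := by
            refine pow_le_pow_right₀ ?_ hm
            have : a ^ 2 ≤ 1 := pow_le_one₀ ha.1.le ha.2
            have ha2 : 0 < a ^ 2 := pow_pos ha.1 2
            exact (one_le_inv₀ ha2).2 this
        _ ≤ Cp * (s a)⁻¹ := hpa
        _ ≤ |Cp| * (s a)⁻¹ := by gcongr; exact le_abs_self _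
    have h4 : ‖(inner ℂ (lam t) η : ℂ)‖ ^ 2 ≤ ‖lam t‖ ^ 2 * (K / 4) := by
      calc ‖(inner ℂ (lam t) η : ℂ)‖ ^ 2 ≤ (‖lam t‖ * ‖η‖) ^ 2 := by
            gcongr
            exact norm_inner_le_norm _ _
        _ = ‖lam t‖ ^ 2 * ‖η‖ ^ 2 := mul_pow _ _ _
        _ ≤ _ := by gcongr
    have h5 : ‖(inner ℂ (lam t) Ψ : ℂ) - inner ℂ (lam t) η‖ ^ 2 ≤
        2 * ‖(inner ℂ (lam t) Ψ : ℂ)‖ ^ 2 + 2 * ‖(inner ℂ (lam t) η : ℂ)‖ ^ 2 := by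
      have h6 := norm_sub_le (inner ℂ (lam t) Ψ : ℂ) (inner ℂ (lam t) η)
      nlinarith [sq_nonneg (‖(inner ℂ (lam t) Ψ : ℂ)‖ - ‖(inner ℂ (lam t) η : ℂ)‖),
        norm_nonneg ((inner ℂ (lam t) Ψ : ℂ) - inner ℂ (lam t) η)]
    have h7 : K / 2 ≤ (s a)⁻¹ * (K + V) := by nlinarith
    have h8 := mul_le_mul_of_nonneg_left h7 (sq_nonneg ‖lam t‖)
    rw [e, hB]
    linarith
  refine h1.trans ?_
  calc Cf * ∑ t, ‖(inner ℂ (lam t) (lowPart D Ψ) : ℂ)‖ ^ 2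
      ≤ Cf * ∑ t, B t * ((s a)⁻¹ * (K + V)) := by
        exact mul_le_mul_of_nonneg_left (Finset.sum_le_sum fun t _ => key t) hCf0
    _ = Cf * (∑ t, B t) * ((s a)⁻¹ * (K + V)) := by rw [← Finset.sum_mul, mul_assoc]
    _ ≤ (Cf * ∑ t, B t + 1) * ((s a)⁻¹ * (K + V)) := by
        refine mul_le_mul_of_nonneg_right (by linarith) (mul_nonneg hr0 (add_nonneg hK0 hV0))

theorem measurable_pairPot {v : ℝ → ℝ≥0∞} (hv : Measurable v) (a : ℝ) :
    Measurable (pairPot N v a) := by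
  unfold pairPot scaled
  fun_prop

theorem measurable_potential {v : ℝ → ℝ≥0∞} (hv : Measurable v) (a κ : ℝ) :
    Measurable (potential N v a κ) := by
  unfold potential scaled
  fun_prop

theorem lintegral_potential {v : ℝ → ℝ≥0∞} (hv : Measurable v) (a : ℝ) {κ : ℝ} (hκ : 0 ≤ κ)
    (Ψ : L2 N) : ∫⁻ x, potential N v a κ x * ‖Ψ x‖ₑ ^ 2 =
      (∫⁻ x, pairPot N v a x * ‖Ψ x‖ₑ ^ 2) +
        ENNReal.ofReal κ * ∫⁻ x, ENNReal.ofReal (∑ i, ‖x i‖ ^ 2) * ‖Ψ x‖ₑ ^ 2 := by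
  rw [← lintegral_const_mul' _ _ ENNReal.ofReal_ne_top, ← lintegral_add_left']
  · refine lintegral_congr fun x => ?_
    rw [potential, pairPot, add_mul, ENNReal.ofReal_mul hκ, mul_assoc]
  · exact (measurable_pairPot hv a).aemeasurable.mul
      ((Lp.aestronglyMeasurable Ψ).enorm.pow_const 2)

theorem InFormDomain.lintegral_lt_top {v : ℝ → ℝ≥0∞} (hv : Measurable v) {a κ : ℝ} (hκ : 0 < κ)
    {Ψ : L2 N} (h : InFormDomain (potential N v a κ) Ψ) :
    ∫⁻ x, pairPot N v a x * ‖Ψ x‖ₑ ^ 2 < ⊤ ∧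
      ∫⁻ x, ENNReal.ofReal (∑ i, ‖x i‖ ^ 2) * ‖Ψ x‖ₑ ^ 2 < ⊤ := by
  have h1 := h.2
  rw [lintegral_potential hv a hκ.le, ENNReal.add_lt_top] at h1
  refine ⟨h1.1, ?_⟩
  by_contra hcon
  rw [not_lt_top_iff] at hcon
  rw [hcon, ENNReal.mul_top (ENNReal.ofReal_pos.2 hκ).ne'] at h1
  exact lt_irrefl _ h1.2

theorem InFormDomain.energy_potential {v : ℝ → ℝ≥0∞} (hv : Measurable v) {a κ : ℝ} (hκ : 0 < κ)
    {Ψ : L2 N} (h : InFormDomain (potential N v a κ) Ψ) :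
    energy (potential N v a κ) Ψ = ∑ i, ‖lowering i Ψ‖ ^ 2 +
      (∫⁻ x, pairPot N v a x * ‖Ψ x‖ₑ ^ 2).toReal +
      κ * (∫⁻ x, ENNReal.ofReal (∑ i, ‖x i‖ ^ 2) * ‖Ψ x‖ₑ ^ 2).toReal := by
  obtain ⟨h1, h2⟩ := h.lintegral_lt_top hv hκ
  rw [energy, lintegral_potential hv a hκ.le, ENNReal.toReal_add h1.ne
    (ENNReal.mul_ne_top ENNReal.ofReal_ne_top h2.ne), ENNReal.toReal_mul,
    ENNReal.toReal_ofReal hκ.le, add_assoc]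

/-- The available energy `K + V` is divided: half of it absorbs the deviation from the Laughlin
function, and another `K / 2` absorbs the kinetic error of the trap bound. The first needs `lam`
small, the second only `s` small. -/
theorem energy_arith {s lam δ n d C K V T U Ψ g : ℝ} (hs : 0 < s) (hlam : 0 < lam)
    (hδ : 0 < δ) (hK : 0 ≤ K) (hV : 0 ≤ V) (hU : 0 ≤ U)
    (hg : 0 ≤ g) (hd : 0 ≤ d) (hUC : U ≤ C * (s⁻¹ * (K + V)))
    (htrap : (1 - δ) * (n * Ψ - (g + d * U)) ≤ T + (1 / δ + n) * K)
    (hlamC : lam * d * C ≤ 1 / 2) (hsmall : s * (lam * (1 / δ + n)) ≤ 1 / 2) :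
    s * lam * (n * (1 - δ) * Ψ - g) ≤ K + V + s * lam * T := by
  have h1 : s * lam * d * U ≤ (K + V) / 2 := by
    calc s * lam * d * U ≤ s * lam * d * (C * (s⁻¹ * (K + V))) := by gcongr
      _ = lam * d * C * (K + V) := by field_simp
      _ ≤ 1 / 2 * (K + V) := by gcongr
      _ = _ := by ring
  have h2 : s * lam * ((1 / δ + n) * K) ≤ K / 2 := by
    calc s * lam * ((1 / δ + n) * K) = s * (lam * (1 / δ + n)) * K := by ring
      _ ≤ 1 / 2 * K := by gcongr
      _ = _ := by ring
  have h3 := mul_le_mul_of_nonneg_left htrap (by positivity : 0 ≤ s * lam)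
  have h4 : 0 ≤ s * lam * δ * (g + d * U) := by positivity
  nlinarith

/-- The energy is bounded below with a gap above the Laughlin state. -/
theorem exists_energy_lower_bound {v : ℝ → ℝ≥0∞} (hv : Measurable v)
    (hne : ¬ ∀ᵐ x : ℂ, v ‖x‖ = 0) {ℓ : ℕ} {s : ℝ → ℝ} (hs : IsScale ℓ s) :
    ∃ lam₀ : ℝ, 0 < lam₀ ∧ ∀ lam : ℝ, 0 < lam → lam < lam₀ → ∀ δ : ℝ, 0 < δ → δ ≤ 1 →
      ∀ᶠ a in 𝓝[>] (0 : ℝ), ∀ Ψ : L2 N, InFormDomain (potential N v a (s a * lam)) Ψ →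
        s a * lam * (((numPairs N * (ℓ + 1) : ℕ) + N + 1) * (1 - δ) * ‖Ψ‖ ^ 2 -
          ‖(inner ℂ (laughlin N (ℓ + 1)) Ψ : ℂ)‖ ^ 2) ≤ energy (potential N v a (s a * lam)) Ψ := by
  obtain ⟨C, hC, hlow⟩ := exists_norm_lowPart_sub_le (N := N) hv hne hs
  set D := numPairs N * (ℓ + 1) with hD
  -- This gives `lam * (D + 1) * C ≤ 1 / 2`. The threshold does not depend on `δ`; only the
  -- admissible range of `a` does.
  refine ⟨1 / (2 * ((D : ℝ) + 1) * C), by positivity, fun lam hlam hlam0 δ hδ hδ1 => ?_⟩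
  have hsmall : ∀ᶠ a in 𝓝[>] (0 : ℝ), s a * (lam * (1 / δ + ((D : ℝ) + N + 1))) < 1 / 2 := by
    have := hs.tendsto_zero.mul_const (lam * (1 / δ + ((D : ℝ) + N + 1)))
    rw [zero_mul] at this
    exact this.eventually_lt_const (by norm_num)
  filter_upwards [hlow, hs.pos, hsmall] with a hlowa hsa hsmalla Ψ hΨ
  obtain ⟨h1, h2⟩ := hΨ.lintegral_lt_top hv (mul_pos hsa hlam)
  rw [hΨ.energy_potential hv (mul_pos hsa hlam)]
  have hw : ∀ i k, IsWeakMagMomentum i k Ψ (weakMagMomentum i k Ψ) := fun i k => hΨ.isWeak i k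
  obtain ⟨Θ, η, hsum, hη, hΘ, hpyth⟩ := exists_lll_decomposition Ψ
  have htrap := trap_lower_bound (laughlin_mem_lllSpan N (ℓ + 1)) (norm_laughlin _)
    (fun α hα => inner_lllLp_laughlin _ hα) hsum hη hΘ hpyth hw h2 hδ hδ1
  refine energy_arith hsa hlam hδ (Finset.sum_nonneg fun _ _ => by positivity)
    ENNReal.toReal_nonneg (sq_nonneg _) (sq_nonneg _) (by positivity) (hlowa Ψ hw h1) htrap ?_
    hsmalla.le
  rw [lt_div_iff₀ (by positivity)] at hlam0
  linarith

end Master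

/-! ### Calculus of polynomials times the Gaussian -/

section PolyCalculus

open MvPolynomial

variable {N : ℕ}

theorem norm_pow_mul_gauss_le (m : ℕ) (z : ℂ) :
    ‖z ^ m * gauss z‖ ≤ (m.factorial * Real.exp 1) * Real.exp (-‖z‖ ^ 2 / 4) := by
  rw [norm_mul, norm_pow, norm_gauss]
  have h1 : ‖z‖ ^ m ≤ m.factorial * Real.exp ‖z‖ := by
    have := Real.pow_div_factorial_le_exp ‖z‖ (norm_nonneg z) m
    rwa [div_le_iff₀' (by positivity)] at this
  calc ‖z‖ ^ m * Real.exp (-‖z‖ ^ 2 / 2)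
      ≤ m.factorial * Real.exp ‖z‖ * Real.exp (-‖z‖ ^ 2 / 2) := by gcongr
    _ = m.factorial * Real.exp (‖z‖ + -‖z‖ ^ 2 / 2) := by rw [mul_assoc, ← Real.exp_add]
    _ ≤ m.factorial * Real.exp (1 + -‖z‖ ^ 2 / 4) := by
        refine mul_le_mul_of_nonneg_left (Real.exp_le_exp.2 ?_) (by positivity)
        nlinarith [sq_nonneg (‖z‖ - 2)]
    _ = _ := by rw [Real.exp_add, mul_assoc]

theorem exists_norm_polyFn_le (Q : MvPolynomial (Fin N) ℂ) :
    ∃ C : ℝ, 0 ≤ C ∧ ∀ x, ‖polyFn Q x‖ ≤ C * ∏ i, Real.exp (-‖x i‖ ^ 2 / 4) := by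
  induction Q using MvPolynomial.induction_on' with
  | monomial α c =>
    refine ⟨‖c‖ * ∏ i, ((α i).factorial * Real.exp 1), by positivity, fun x => ?_⟩
    have h : polyFn (monomial α c) x = c * ∏ i, (x i ^ α i * gauss (x i)) := by
      rw [polyFn, eval_monomial, Finsupp.prod_fintype _ _ fun _ => pow_zero _, gaussProd,
        Finset.prod_mul_distrib, mul_assoc]
    rw [h, norm_mul, norm_prod, mul_assoc, ← Finset.prod_mul_distrib]
    gcongr with i
    exact norm_pow_mul_gauss_le _ _
  | add P Q hP hQ =>
    obtain ⟨C, hC, h⟩ := hP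
    obtain ⟨C', hC', h'⟩ := hQ
    refine ⟨C + C', by positivity, fun x => ?_⟩
    have e : polyFn (P + Q) x = polyFn P x + polyFn Q x := by simp [polyFn, add_mul]
    rw [e, add_mul]
    exact (norm_add_le _ _).trans (add_le_add (h x) (h' x))

theorem hasFDerivAt_eval_single (Q : MvPolynomial (Fin N) ℂ) (x : Conf N) :
    ∃ D : Conf N →L[ℝ] ℂ, HasFDerivAt (fun y : Conf N => eval y Q) D x ∧
      ∀ i w, D (Pi.single i w) = w * eval x (pderiv i Q) := by
  induction Q using MvPolynomial.induction_on with
  | C c => exact ⟨0, by simpa using hasFDerivAt_const c x, by simp⟩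
  | add P Q hP hQ =>
    obtain ⟨D, h, hD⟩ := hP
    obtain ⟨D', h', hD'⟩ := hQ
    refine ⟨D + D', (h.add h').congr_of_eventuallyEq (.of_forall fun y => map_add (eval y) P Q),
      fun i w => ?_⟩
    simp [hD, hD', mul_add]
  | mul_X P k hP =>
    obtain ⟨D, h, hD⟩ := hP
    have hk : HasFDerivAt (fun y : Conf N => y k)
        (ContinuousLinearMap.proj (R := ℝ) (φ := fun _ : Fin N => ℂ) k) x :=
      (ContinuousLinearMap.proj (R := ℝ) (φ := fun _ : Fin N => ℂ) k).hasFDerivAt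
    refine ⟨_, (h.mul hk).congr_of_eventuallyEq (.of_forall fun y => by simp), fun i w => ?_⟩
    rcases eq_or_ne k i with rfl | hki
    · simp [hD, Derivation.leibniz]
      ring
    · simp [hD, Derivation.leibniz, hki]
      ring

theorem fderiv_gaussProd (i : Fin N) (x : Conf N) (w : ℂ) :
    fderiv ℝ (gaussProd (N := N)) x (Pi.single i w) =
      -(1 / 2) * (conj (x i) * w + x i * conj w) * gaussProd x := by
  have h1 := fderiv_prod_single (i := i) (x := x) (f := fun _ => gauss)
    (fun k => contDiff_gauss.differentiable (by simp) _) w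
  rw [(hasFDerivAt_gauss (x i)).fderiv, wirtinger_apply] at h1
  change fderiv ℝ (fun x : Conf N => ∏ k, gauss (x k)) x (Pi.single i w) = _
  rw [h1, gaussProd, ← Finset.mul_prod_erase Finset.univ _ (Finset.mem_univ i)]
  ring

theorem contDiff_polyFn (Q : MvPolynomial (Fin N) ℂ) : ContDiff ℝ ∞ (polyFn Q) := by
  refine ContDiff.mul ?_ contDiff_gaussProd
  induction Q using MvPolynomial.induction_on with
  | C c => simpa using contDiff_const
  | add P Q hP hQ => simpa using hP.add hQ
  | mul_X P k hP => simpa using hP.mul (contDiff_apply ℝ ℂ k)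

theorem fderiv_polyFn (Q : MvPolynomial (Fin N) ℂ) (i : Fin N) (x : Conf N) (w : ℂ) :
    fderiv ℝ (polyFn Q) x (Pi.single i w) = w * polyFn (pderiv i Q) x
      - (1 / 2) * (conj (x i) * w + x i * conj w) * polyFn Q x := by
  obtain ⟨D, hD, hDi⟩ := hasFDerivAt_eval_single Q x
  have hG : HasFDerivAt (gaussProd (N := N)) (fderiv ℝ gaussProd x) x :=
    (contDiff_gaussProd.differentiable (by simp) x).hasFDerivAt
  have h := (hD.mul hG).fderiv
  change fderiv ℝ ((fun y => eval y Q) * gaussProd) x _ = _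
  rw [h]
  simp only [_root_.add_apply, _root_.smul_apply, hDi, fderiv_gaussProd, smul_eq_mul, polyFn]
  ring

theorem magMomentum_polyFn_one (Q : MvPolynomial (Fin N) ℂ) (i : Fin N) (x : Conf N) :
    magMomentum i 1 (polyFn Q) x = polyFn (pderiv i Q) x - conj (x i) * polyFn Q x := by
  have e1 : x i = (x i).re + (x i).im * Complex.I := (Complex.re_add_im _).symm
  have e2 : conj (x i) = (x i).re - (x i).im * Complex.I := by
    rw [← Complex.re_add_im (conj (x i)), Complex.conj_re, Complex.conj_im]
    push_cast
    ring
  simp only [magMomentum, fderiv_polyFn, dir, vecPot, Matrix.cons_val_one, Matrix.cons_val_fin_one,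
    Complex.conj_I]
  rw [e2]
  linear_combination (-polyFn (pderiv i Q) x + polyFn Q x * (x i).re * (1 / 2)
    - polyFn Q x * x i * (1 / 2) - polyFn Q x * (x i).im * Complex.I * (1 / 2)) * Complex.I_mul_I
    + polyFn Q x * (1 / 2) * e1

/-- This is the lowest Landau level condition: `P₀ + iP₁` annihilates a holomorphic polynomial times
the Gaussian. -/
theorem magMomentum_polyFn_zero (Q : MvPolynomial (Fin N) ℂ) (i : Fin N) (x : Conf N) :
    magMomentum i 0 (polyFn Q) x = -Complex.I * magMomentum i 1 (polyFn Q) x := by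
  have e1 : x i = (x i).re + (x i).im * Complex.I := (Complex.re_add_im _).symm
  have e2 : conj (x i) = (x i).re - (x i).im * Complex.I := by
    rw [← Complex.re_add_im (conj (x i)), Complex.conj_re, Complex.conj_im]
    push_cast
    ring
  rw [magMomentum_polyFn_one]
  simp only [magMomentum, fderiv_polyFn, dir, vecPot, Matrix.cons_val_zero, map_one,
    Complex.ofReal_neg]
  rw [e2]
  linear_combination (polyFn Q x * (x i).im) * Complex.I_mul_I
    + polyFn Q x * (1 / 2) * Complex.I * e1

theorem memLp_magMomentum_polyFn (Q : MvPolynomial (Fin N) ℂ) (i : Fin N) (k : Fin 2) :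
    MemLp (magMomentum i k (polyFn Q)) 2 volume := by
  have hc : ∀ k, Continuous (magMomentum i k (polyFn Q)) := fun k =>
    continuous_magMomentum i k ((contDiff_polyFn Q).of_le (by simp))
  have h1 : MemLp (magMomentum i 1 (polyFn Q)) 2 volume := by
    have h2 : MemLp (fun x => conj (x i) * polyFn Q x) 2 volume := by
      refine (memLp_polyFn (X i * Q)).mono
        ((Complex.continuous_conj.comp (continuous_apply i)).mul
          (contDiff_polyFn Q).continuous).aestronglyMeasurable (ae_of_all _ fun x => ?_)
      simp [polyFn, mul_assoc]
    exact ((memLp_polyFn (pderiv i Q)).sub h2).ae_eq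
      (ae_of_all _ fun x => (magMomentum_polyFn_one Q i x).symm)
  fin_cases k
  · exact (h1.const_mul (-Complex.I)).ae_eq
      (ae_of_all _ fun x => (magMomentum_polyFn_zero Q i x).symm)
  · exact h1

theorem norm_polyLp_monomial_sq (α : Fin N →₀ ℕ) :
    ‖polyLp (monomial α (1 : ℂ))‖ ^ 2 = ∏ i, (Real.pi * (α i).factorial) := by
  rw [polyLp_apply, norm_toLp_sq_eq_integral]
  have h : ∀ x : Conf N, ‖polyFn (monomial α (1 : ℂ)) x‖ ^ 2 =
      ∏ i, ((‖x i‖ ^ 2) ^ α i * Real.exp (-1 * ‖x i‖ ^ 2)) := fun x => by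
    rw [polyFn, eval_monomial_one, gaussProd, ← Finset.prod_mul_distrib, norm_prod,
      ← Finset.prod_pow]
    refine Finset.prod_congr rfl fun i _ => ?_
    rw [norm_mul, norm_pow, norm_gauss, mul_pow, ← Real.exp_nat_mul, ← pow_mul, ← pow_mul,
      mul_comm (α i)]
    congr 2
    push_cast
    ring
  simp_rw [h]
  rw [integral_fintype_prod_volume_eq_prod
    fun (i : Fin N) (z : ℂ) => (‖z‖ ^ 2) ^ α i * Real.exp (-1 * ‖z‖ ^ 2)]
  refine Finset.prod_congr rfl fun i _ => ?_
  rw [integral_norm_pow_mul_exp _ one_pos]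
  simp

/-- Multiplying a monomial by one coordinate increases a single factorial. Since monomials stay
orthogonal under this shift, the trap energy of a polynomial can be computed coefficientwise. -/
theorem norm_polyLp_monomial_add_single_sq (α : Fin N →₀ ℕ) (i : Fin N) :
    ‖polyLp (monomial (α + Finsupp.single i 1) (1 : ℂ))‖ ^ 2 =
      (α i + 1) * ‖polyLp (monomial α (1 : ℂ))‖ ^ 2 := by
  rw [norm_polyLp_monomial_sq, norm_polyLp_monomial_sq,
    ← Finset.mul_prod_erase Finset.univ _ (Finset.mem_univ i),
    ← Finset.mul_prod_erase Finset.univ (fun i => Real.pi * (α i).factorial) (Finset.mem_univ i)]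
  have h : ∏ k ∈ Finset.univ.erase i, (Real.pi * ((α + Finsupp.single i 1 : Fin N →₀ ℕ) k).factorial) =
      ∏ k ∈ Finset.univ.erase i, (Real.pi * (α k).factorial) :=
    Finset.prod_congr rfl fun k hk => by
      simp [Finsupp.single_eq_of_ne (Finset.ne_of_mem_erase hk)]
  rw [h]
  simp [Nat.factorial_succ]
  ring

theorem inner_polyLp_monomial {α β : Fin N →₀ ℕ} (h : α ≠ β) :
    (inner ℂ (polyLp (monomial α (1 : ℂ))) (polyLp (monomial β (1 : ℂ))) : ℂ) = 0 := by
  obtain ⟨c, hc⟩ := polyLp_monomial_mem (α := α) 1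
  obtain ⟨c', hc'⟩ := polyLp_monomial_mem (α := β) 1
  rw [hc, hc', inner_smul_left, inner_smul_right, orthonormal_lllLp.2 h, mul_zero, mul_zero]

theorem norm_sum_polyLp_monomial_sq (s : Finset (Fin N →₀ ℕ)) (c : (Fin N →₀ ℕ) → ℂ)
    {f : (Fin N →₀ ℕ) → (Fin N →₀ ℕ)} (hf : Function.Injective f) :
    ‖∑ α ∈ s, c α • polyLp (monomial (f α) (1 : ℂ))‖ ^ 2 =
      ∑ α ∈ s, ‖c α‖ ^ 2 * ‖polyLp (monomial (f α) (1 : ℂ))‖ ^ 2 := by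
  have h : (((‖∑ α ∈ s, c α • polyLp (monomial (f α) (1 : ℂ))‖ ^ 2 : ℝ)) : ℂ) =
      ((∑ α ∈ s, ‖c α‖ ^ 2 * ‖polyLp (monomial (f α) (1 : ℂ))‖ ^ 2 : ℝ) : ℂ) := by
    push_cast
    refine (inner_self_eq_norm_sq_to_K (𝕜 := ℂ)
      (∑ α ∈ s, c α • polyLp (monomial (f α) (1 : ℂ)))).symm.trans ?_
    rw [sum_inner]
    refine Finset.sum_congr rfl fun α hα => ?_
    rw [inner_sum, Finset.sum_eq_single_of_mem α hα fun β _ hβ => by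
      rw [inner_smul_left, inner_smul_right, inner_polyLp_monomial (hf.ne hβ.symm), mul_zero,
        mul_zero]]
    rw [inner_smul_left, inner_smul_right, inner_self_eq_norm_sq_to_K, ← mul_assoc,
      Complex.conj_mul']
    rfl
  exact_mod_cast h

/-- The trap energy of a homogeneous polynomial in the lowest Landau level. -/
theorem sum_norm_polyLp_X_mul_sq {Q : MvPolynomial (Fin N) ℂ} {d : ℕ} (hQ : Q.IsHomogeneous d) :
    ∑ i, ‖polyLp (X i * Q)‖ ^ 2 = (d + N) * ‖polyLp Q‖ ^ 2 := by
  have e0 : polyLp Q = ∑ α ∈ Q.support, coeff α Q • polyLp (monomial α (1 : ℂ)) := by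
    conv_lhs => rw [Q.as_sum, map_sum]
    refine Finset.sum_congr rfl fun α _ => ?_
    rw [← map_smul, smul_monomial, smul_eq_mul, mul_one]
  have e1 : ∀ i, polyLp (X i * Q) =
      ∑ α ∈ Q.support, coeff α Q • polyLp (monomial (α + Finsupp.single i 1) (1 : ℂ)) := fun i => by
    conv_lhs => rw [Q.as_sum, Finset.mul_sum, map_sum]
    refine Finset.sum_congr rfl fun α _ => ?_
    rw [← map_smul, smul_monomial, smul_eq_mul, mul_one, X, monomial_mul, one_mul,
      add_comm]
  have h0 := norm_sum_polyLp_monomial_sq Q.support (fun α => coeff α Q) Function.injective_id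
  simp only [id] at h0
  have h1 := fun i => norm_sum_polyLp_monomial_sq Q.support (fun α => coeff α Q)
    (f := fun α => α + Finsupp.single i 1) (add_left_injective _)
  simp_rw [e1, h1]
  rw [e0, h0, Finset.sum_comm, Finset.mul_sum]
  refine Finset.sum_congr rfl fun α hα => ?_
  simp_rw [norm_polyLp_monomial_add_single_sq]
  have hd : ∑ i, ((α i : ℝ) + 1) = d + N := by
    have : α.degree = d := by
      rw [Finsupp.degree_eq_weight_one]
      exact hQ (mem_support_iff.1 hα)
    rw [Finset.sum_add_distrib, ← this, Finsupp.degree_eq_sum]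
    simp
  rw [← Finset.mul_sum, ← Finset.sum_mul, hd]
  ring

theorem lintegral_trap_polyFn {Q : MvPolynomial (Fin N) ℂ} {d : ℕ} (hQ : Q.IsHomogeneous d) :
    ∫⁻ x, ENNReal.ofReal (∑ i, ‖x i‖ ^ 2) * ‖polyFn Q x‖ₑ ^ 2 =
      ENNReal.ofReal ((d + N) * ‖polyLp Q‖ ^ 2) := by
  rw [← sum_norm_polyLp_X_mul_sq hQ, ENNReal.ofReal_sum_of_nonneg fun i _ => by positivity]
  have h : ∀ i, ENNReal.ofReal (‖polyLp (X i * Q)‖ ^ 2) = ∫⁻ x, ‖polyFn (X i * Q) x‖ₑ ^ 2 :=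
    fun i => by
      rw [polyLp_apply, norm_toLp_sq, ENNReal.ofReal_toReal
        ((memLp_two_iff_lintegral (memLp_polyFn _).1).1 (memLp_polyFn _)).ne]
  simp_rw [h]
  rw [← lintegral_finsetSum' _ fun i _ => (memLp_polyFn _).1.enorm.pow_const 2]
  refine lintegral_congr fun x => ?_
  rw [ENNReal.ofReal_sum_of_nonneg fun i _ => by positivity, Finset.sum_mul]
  refine Finset.sum_congr rfl fun i _ => ?_
  have e : polyFn (X i * Q) x = x i * polyFn Q x := by simp [polyFn, mul_assoc]
  rw [e, enorm_mul, mul_pow, ENNReal.ofReal_pow (norm_nonneg _), ofReal_norm]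

end PolyCalculus

/-! ### Trial states -/

/-- A smooth function vanishing on the disk of radius `R` and equal to one outside the disk of
radius `2R`, with derivative bounded by `M`. -/
structure IsCutoff (R M : ℝ) (ψ : ℂ → ℂ) : Prop where
  contDiff : ContDiff ℝ ∞ ψ
  norm_le : ∀ z, ‖ψ z‖ ≤ 1
  eq_zero : ∀ z, ‖z‖ ≤ R → ψ z = 0
  eq_one : ∀ z, 2 * R ≤ ‖z‖ → ψ z = 1
  fderiv_le : ∀ z, ‖fderiv ℝ ψ z‖ ≤ M
  fderiv_eq_zero : ∀ z, 2 * R < ‖z‖ → fderiv ℝ ψ z = 0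

theorem exists_isCutoff {R : ℝ} (hR : 0 < R) : ∃ M ψ, IsCutoff R M ψ := by
  let b : ContDiffBump (0 : ℂ) := ⟨R, 2 * R, hR, by linarith⟩
  have hu : ContDiff ℝ ∞ fun z => ((b z : ℝ) : ℂ) := Complex.ofRealCLM.contDiff.comp b.contDiff
  have hus : HasCompactSupport fun z => ((b z : ℝ) : ℂ) :=
    b.hasCompactSupport.comp_left (g := fun t : ℝ => (t : ℂ)) Complex.ofReal_zero
  obtain ⟨M, hM⟩ := (hus.fderiv (𝕜 := ℝ)).exists_bound_of_continuous
    (hu.continuous_fderiv (by simp))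
  have h1 : ∀ z, 2 * R ≤ ‖z‖ → 1 - ((b z : ℝ) : ℂ) = 1 := fun z hz => by
    rw [b.zero_of_le_dist (by simpa [b] using hz)]
    simp
  refine ⟨M, fun z => 1 - ((b z : ℝ) : ℂ), contDiff_const.sub hu, fun z => ?_, fun z hz => ?_, h1,
    fun z => ?_, fun z hz => ?_⟩
  · rw [← Complex.ofReal_one, ← Complex.ofReal_sub, Complex.norm_real, Real.norm_eq_abs, abs_le]
    have := b.nonneg (x := z)
    have := b.le_one (x := z)
    constructor <;> linarith
  · rw [b.one_of_mem_closedBall (by simpa [b] using hz)]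
    simp
  · rw [fderiv_const_sub, norm_neg]
    exact hM z
  · have h2 : (fun z => 1 - ((b z : ℝ) : ℂ)) =ᶠ[𝓝 z] fun _ => 1 := by
      filter_upwards [(isOpen_lt continuous_const continuous_norm).mem_nhds hz] with y hy
      exact h1 y (le_of_lt hy)
    rw [h2.fderiv_eq, fderiv_const_apply]

section Trial

open MvPolynomial

variable {N : ℕ}

/-- The pairs of particles. -/
def pairs (N : ℕ) : Finset (Fin N × Fin N) := Finset.univ.filter fun p => p.1 < p.2

theorem mem_pairs {p : Fin N × Fin N} : p ∈ pairs N ↔ p.1 < p.2 := by simp [pairs]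

/-- The product of the cutoffs of all pairs at the length scale `a`. -/
def pairCutoff (ψ : ℂ → ℂ) (a : ℝ) (x : Conf N) : ℂ :=
  ∏ p ∈ pairs N, ψ (a⁻¹ • (x p.1 - x p.2))

theorem norm_pairCutoff_le {R M : ℝ} {ψ : ℂ → ℂ} (hψ : IsCutoff R M ψ) (a : ℝ) (x : Conf N) :
    ‖pairCutoff ψ a x‖ ≤ 1 := by
  rw [pairCutoff, norm_prod]
  exact Finset.prod_le_one (fun _ _ => norm_nonneg _) fun _ _ => hψ.norm_le _

theorem contDiff_pairCutoff {R M : ℝ} {ψ : ℂ → ℂ} (hψ : IsCutoff R M ψ) (a : ℝ) :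
    ContDiff ℝ ∞ (pairCutoff (N := N) ψ a) :=
  contDiff_prod fun p _ => hψ.contDiff.comp
    (((contDiff_apply ℝ ℂ p.1).sub (contDiff_apply ℝ ℂ p.2)).const_smul a⁻¹)

/-- Each factor varies only where its pair is within `2Ra`, with gradient of order `1/a`; all other
factors are at most one. -/
theorem norm_fderiv_pairCutoff_le {R M : ℝ} {ψ : ℂ → ℂ} (hψ : IsCutoff R M ψ) {a : ℝ} (ha : 0 < a)
    (x : Conf N) (i : Fin N) (w : ℂ) :
    ‖fderiv ℝ (pairCutoff ψ a) x (Pi.single i w)‖ ≤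
      ∑ p ∈ pairs N, if ‖x p.1 - x p.2‖ ≤ 2 * R * a then M * (a⁻¹ * (2 * ‖w‖)) else 0 := by
  have hM : 0 ≤ M := (norm_nonneg _).trans (hψ.fderiv_le 0)
  let A : Fin N × Fin N → Conf N →L[ℝ] ℂ := fun p =>
    a⁻¹ • (ContinuousLinearMap.proj (R := ℝ) (φ := fun _ : Fin N => ℂ) p.1 -
      ContinuousLinearMap.proj (R := ℝ) (φ := fun _ : Fin N => ℂ) p.2)
  have hA : ∀ p y, A p y = a⁻¹ • (y p.1 - y p.2) := fun p y => rfl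
  have hg : ∀ p, HasFDerivAt (fun y : Conf N => ψ (a⁻¹ • (y p.1 - y p.2)))
      ((fderiv ℝ ψ (A p x)).comp (A p)) x := fun p =>
    ((hψ.contDiff.differentiable (by simp) (A p x)).hasFDerivAt).comp x (A p).hasFDerivAt
  have h := HasFDerivAt.finsetProd (u := pairs N) fun p _ => hg p
  have e : fderiv ℝ (pairCutoff ψ a) x = _ := h.fderiv
  rw [e, _root_.sum_apply]
  refine (norm_sum_le _ _).trans (Finset.sum_le_sum fun p _ => ?_)
  rw [_root_.smul_apply, norm_smul, norm_prod]
  have h1 : ∏ q ∈ (pairs N).erase p, ‖ψ (a⁻¹ • (x q.1 - x q.2))‖ ≤ 1 :=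
    Finset.prod_le_one (fun _ _ => norm_nonneg _) fun _ _ => hψ.norm_le _
  refine (mul_le_mul_of_nonneg_right h1 (norm_nonneg _)).trans ?_
  rw [one_mul, ContinuousLinearMap.comp_apply]
  split_ifs with hx
  · refine (ContinuousLinearMap.le_opNorm _ _).trans (mul_le_mul (hψ.fderiv_le _) ?_
      (norm_nonneg _) hM)
    rw [hA, norm_smul, Real.norm_of_nonneg (by positivity)]
    refine mul_le_mul_of_nonneg_left ((norm_sub_le _ _).trans ?_) (by positivity)
    have h2 : ∀ k, ‖(Pi.single i w : Conf N) k‖ ≤ ‖w‖ := fun k => by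
      rw [← Pi.norm_single (ι := Fin N) (G := fun _ => ℂ) (i := i) w]
      exact norm_le_pi_norm (Pi.single i w : Conf N) k
    linarith [h2 p.1, h2 p.2]
  · rw [hψ.fderiv_eq_zero (A p x)]
    · simp
    · rw [hA, norm_smul, Real.norm_of_nonneg (by positivity)]
      push Not at hx
      rwa [← div_eq_inv_mul, lt_div_iff₀ ha]

/-- A Gaussian restricted to the configurations where two particles are close. -/
def collisionWeight (i j : Fin N) (ρ : ℝ) (x : Conf N) : ℝ :=
  if ‖x i - x j‖ ≤ ρ then ∏ k, Real.exp (-‖x k‖ ^ 2 / 2) else 0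

/-- In relative coordinates the condition is a disk of area `πρ²`. The Gaussian of particle `i` is
bounded by one and the other coordinates integrate to a constant. -/
theorem integrable_collisionWeight (N : ℕ) : ∃ K : ℝ, 0 ≤ K ∧ ∀ i j : Fin N, j ≠ i → ∀ ρ, 0 ≤ ρ →
    Integrable (collisionWeight i j ρ) ∧ ∫ x, collisionWeight i j ρ x ≤ K * ρ ^ 2 := by
  refine ⟨Real.pi * (∫ z : ℂ, Real.exp (-‖z‖ ^ 2 / 2)) ^ (N - 1),
    mul_nonneg Real.pi_pos.le (pow_nonneg (integral_nonneg fun z => (Real.exp_pos _).le) _),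
    fun i j hij ρ hρ => ?_⟩
  let B : ℂ → ℝ := (Metric.closedBall (0 : ℂ) ρ).indicator fun _ => 1
  let H : Fin N → ℂ → ℝ := Function.update (fun _ z => Real.exp (-‖z‖ ^ 2 / 2)) i B
  have hB : Integrable B := (integrable_indicator_iff Metric.isClosed_closedBall.measurableSet).2
    (integrableOn_const (by exact measure_closedBall_lt_top.ne))
  have hHi : H i = B := Function.update_self ..
  have hHk : ∀ k, k ≠ i → H k = fun z => Real.exp (-‖z‖ ^ 2 / 2) := fun k hk =>
    Function.update_of_ne hk ..
  have hH : ∀ k, Integrable (H k) := fun k => by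
    rcases eq_or_ne k i with rfl | hk
    · rwa [hHi]
    · rw [hHk k hk]
      exact integrable_exp_neg_norm_sq
  have hH0 : ∀ k z, 0 ≤ H k z := fun k z => by
    rcases eq_or_ne k i with rfl | hk
    · rw [hHi]
      exact Set.indicator_nonneg (fun _ _ => zero_le_one) z
    · rw [hHk k hk]
      exact (Real.exp_pos _).le
  have h1 : Integrable fun y : Conf N => ∏ k, H k (y k) := Integrable.fintype_prod hH
  have h2 : Integrable fun x : Conf N => ∏ k, H k (shearHomeo hij x k) :=
    (measurePreserving_shearHomeo hij).integrable_comp_of_integrable h1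
  have h0 : ∀ x, 0 ≤ collisionWeight i j ρ x := fun x => by
    unfold collisionWeight
    split_ifs
    · positivity
    · exact le_rfl
  have hle : ∀ x, collisionWeight i j ρ x ≤ ∏ k, H k (shearHomeo hij x k) := fun x => by
    unfold collisionWeight
    split_ifs with hx
    · refine Finset.prod_le_prod (fun _ _ => (Real.exp_pos _).le) fun k _ => ?_
      rw [shearHomeo_apply]
      rcases eq_or_ne k i with rfl | hk
      · rw [hHi, Function.update_self, show B (x k - x j) = 1 from
          Set.indicator_of_mem (by simpa using hx) _]
        exact Real.exp_le_one_iff.2 (by nlinarith [sq_nonneg ‖x k‖])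
      · rw [hHk k hk, Function.update_of_ne hk]
    · exact Finset.prod_nonneg fun k _ => hH0 k _
  have hm : Measurable (collisionWeight i j ρ) := by
    unfold collisionWeight
    refine Measurable.ite (measurableSet_le (by fun_prop) measurable_const) (by fun_prop)
      measurable_const
  have h3 : Integrable (collisionWeight i j ρ) :=
    h2.mono' hm.aestronglyMeasurable (ae_of_all _ fun x => by
      rw [Real.norm_of_nonneg (h0 x)]
      exact hle x)
  refine ⟨h3, (integral_mono h3 h2 hle).trans_eq ?_⟩
  rw [(measurePreserving_shearHomeo hij).integral_comp (shearHomeo hij).measurableEmbedding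
    (fun y : Conf N => ∏ k, H k (y k)), integral_fintype_prod_volume_eq_prod H,
    ← Finset.mul_prod_erase Finset.univ _ (Finset.mem_univ i), hHi]
  have e1 : ∏ k ∈ Finset.univ.erase i, ∫ z, H k z =
      (∫ z : ℂ, Real.exp (-‖z‖ ^ 2 / 2)) ^ (N - 1) := by
    rw [Finset.prod_congr rfl fun k hk => by rw [hHk k (Finset.ne_of_mem_erase hk)],
      Finset.prod_const, Finset.card_erase_of_mem (Finset.mem_univ i), Finset.card_univ,
      Fintype.card_fin]
  have e2 : ∫ z, B z = Real.pi * ρ ^ 2 := by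
    rw [integral_indicator_const _ Metric.isClosed_closedBall.measurableSet, Measure.real,
      Complex.volume_closedBall, smul_eq_mul, mul_one, ENNReal.toReal_mul, ENNReal.toReal_pow,
      ENNReal.toReal_ofReal hρ]
    rw [mul_comm]
    rfl
  rw [e1, e2]
  ring

/-- Laughlin functions vanish to order `m` at particle collisions. -/
theorem exists_norm_polyFn_jastrow_sq_le (N m : ℕ) : ∃ C : ℝ, 0 ≤ C ∧ ∀ p ∈ pairs N, ∀ x : Conf N,
    ‖polyFn (jastrow N ^ m) x‖ ^ 2 ≤
      C * (‖x p.1 - x p.2‖ ^ 2) ^ m * ∏ k, Real.exp (-‖x k‖ ^ 2 / 2) := by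
  have key : ∀ p : pairs N, ∃ C : ℝ, 0 ≤ C ∧ ∀ x : Conf N, ‖polyFn (jastrow N ^ m) x‖ ^ 2 ≤
      C * (‖x p.1.1 - x p.1.2‖ ^ 2) ^ m * ∏ k, Real.exp (-‖x k‖ ^ 2 / 2) := by
    rintro ⟨⟨i, j⟩, hp⟩
    have hij : i < j := mem_pairs.1 hp
    have hd : (X i - X j : MvPolynomial (Fin N) ℂ) ∣ jastrow N :=
      (Finset.dvd_prod_of_mem (fun j => (X i - X j : MvPolynomial (Fin N) ℂ))
        (Finset.mem_Ioi.2 hij)).trans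
        (Finset.dvd_prod_of_mem (fun i => ∏ j ∈ Finset.Ioi i, (X i - X j : MvPolynomial (Fin N) ℂ))
          (Finset.mem_univ i))
    obtain ⟨Q, hQ⟩ := pow_dvd_pow_of_dvd hd m
    obtain ⟨C, hC, hCx⟩ := exists_norm_polyFn_le Q
    refine ⟨C ^ 2, by positivity, fun x => ?_⟩
    have e : polyFn (jastrow N ^ m) x = (x i - x j) ^ m * polyFn Q x := by
      simp [polyFn, hQ, mul_assoc]
    rw [e, norm_mul, norm_pow, mul_pow, ← pow_mul, mul_comm m 2, pow_mul]
    calc (‖x i - x j‖ ^ 2) ^ m * ‖polyFn Q x‖ ^ 2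
        ≤ (‖x i - x j‖ ^ 2) ^ m * (C * ∏ k, Real.exp (-‖x k‖ ^ 2 / 4)) ^ 2 := by
          gcongr
          exact hCx x
      _ = C ^ 2 * (‖x i - x j‖ ^ 2) ^ m * ∏ k, Real.exp (-‖x k‖ ^ 2 / 2) := by
          rw [mul_pow, ← Finset.prod_pow]
          have : ∀ k, Real.exp (-‖x k‖ ^ 2 / 4) ^ 2 = Real.exp (-‖x k‖ ^ 2 / 2) := fun k => by
            rw [← Real.exp_nat_mul]
            congr 1
            push_cast
            ring
          simp_rw [this]
          ring
  choose C hC0 hC using key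
  refine ⟨∑ p, C p, Finset.sum_nonneg fun p _ => hC0 p, fun p hp x => (hC ⟨p, hp⟩ x).trans ?_⟩
  have : C ⟨p, hp⟩ ≤ ∑ p, C p :=
    Finset.single_le_sum (fun p _ => hC0 p) (Finset.mem_univ (⟨p, hp⟩ : pairs N))
  gcongr

/-- A lowest Landau level function cut off at particle collisions. -/
def trial (ψ : ℂ → ℂ) (Q : MvPolynomial (Fin N) ℂ) (a : ℝ) (x : Conf N) : ℂ :=
  pairCutoff ψ a x * polyFn Q x

section

variable {R M : ℝ} {ψ : ℂ → ℂ}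

theorem norm_trial_le (hψ : IsCutoff R M ψ) (Q : MvPolynomial (Fin N) ℂ)
    (a : ℝ) (x : Conf N) : ‖trial ψ Q a x‖ ≤ ‖polyFn Q x‖ := by
  rw [trial, norm_mul]
  exact mul_le_of_le_one_left (norm_nonneg _) (norm_pairCutoff_le hψ a x)

theorem contDiff_trial (hψ : IsCutoff R M ψ) (Q : MvPolynomial (Fin N) ℂ)
    (a : ℝ) : ContDiff ℝ ∞ (trial ψ Q a) :=
  (contDiff_pairCutoff hψ a).mul (contDiff_polyFn Q)

theorem memLp_trial (hψ : IsCutoff R M ψ) (Q : MvPolynomial (Fin N) ℂ)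
    (a : ℝ) : MemLp (trial ψ Q a) 2 volume :=
  (memLp_polyFn Q).mono (contDiff_trial hψ Q a).continuous.aestronglyMeasurable
    (ae_of_all _ fun x => norm_trial_le hψ Q a x)

theorem magMomentum_trial (hψ : IsCutoff R M ψ) (Q : MvPolynomial (Fin N) ℂ)
    (i : Fin N) (k : Fin 2) (a : ℝ) (x : Conf N) :
    magMomentum i k (trial ψ Q a) x = pairCutoff ψ a x * magMomentum i k (polyFn Q) x -
      Complex.I * fderiv ℝ (pairCutoff ψ a) x (Pi.single i (dir k)) * polyFn Q x :=
  magMomentum_mul i k ((contDiff_pairCutoff hψ a).differentiable (by simp) x)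
    ((contDiff_polyFn Q).differentiable (by simp) x)

theorem memLp_magMomentum_trial (hψ : IsCutoff R M ψ) (Q : MvPolynomial (Fin N) ℂ)
    (i : Fin N) (k : Fin 2) {a : ℝ} (ha : 0 < a) :
    MemLp (magMomentum i k (trial ψ Q a)) 2 volume := by
  have hM : 0 ≤ M := (norm_nonneg _).trans (hψ.fderiv_le 0)
  have hc1 := (contDiff_pairCutoff (N := N) hψ a).continuous
  have hc2 := (contDiff_pairCutoff (N := N) hψ a).continuous_fderiv (by simp)
  have hc3 := continuous_magMomentum i k ((contDiff_polyFn Q).of_le (by simp))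
  have h1 : MemLp (fun x => pairCutoff ψ a x * magMomentum i k (polyFn Q) x) 2 volume := by
    refine (memLp_magMomentum_polyFn Q i k).mono (hc1.mul hc3).aestronglyMeasurable
      (ae_of_all _ fun x => ?_)
    rw [norm_mul]
    exact mul_le_of_le_one_left (norm_nonneg _) (norm_pairCutoff_le hψ a x)
  have h2 : MemLp (fun x => Complex.I * fderiv ℝ (pairCutoff ψ a) x (Pi.single i (dir k)) *
      polyFn Q x) 2 volume := by
    refine (memLp_polyFn Q).of_le_mul (c := ∑ _p ∈ pairs N, M * (a⁻¹ * (2 * ‖dir k‖)))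
      ((continuous_const.mul (hc2.clm_apply continuous_const)).mul
        (contDiff_polyFn Q).continuous).aestronglyMeasurable (ae_of_all _ fun x => ?_)
    rw [norm_mul, norm_mul, Complex.norm_I, one_mul]
    refine mul_le_mul_of_nonneg_right ((norm_fderiv_pairCutoff_le hψ ha x i _).trans
      (Finset.sum_le_sum fun p _ => ?_)) (norm_nonneg _)
    split_ifs
    · exact le_rfl
    · positivity
  exact (h1.sub h2).ae_eq (ae_of_all _ fun x => (magMomentum_trial hψ Q i k a x).symm)

theorem isWeakMagMomentum_trial (hψ : IsCutoff R M ψ) (Q : MvPolynomial (Fin N) ℂ)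
    (i : Fin N) (k : Fin 2) {a : ℝ} (ha : 0 < a) :
    IsWeakMagMomentum i k (memLp_trial hψ Q a).toLp (memLp_magMomentum_trial hψ Q i k ha).toLp :=
  isWeakMagMomentum_toLp i k ((contDiff_trial hψ Q a).of_le (by simp)) _ _

/-- The lowering operator annihilates the polynomial factor, so only derivatives of the cutoff
remain, and they live near collisions. -/
theorem norm_magMomentum_trial_le (hψ : IsCutoff R M ψ) (Q : MvPolynomial (Fin N) ℂ)
    (i : Fin N) {a : ℝ} (ha : 0 < a) (x : Conf N) :
    ‖magMomentum i 0 (trial ψ Q a) x + Complex.I * magMomentum i 1 (trial ψ Q a) x‖ ^ 2 ≤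
      (pairs N).card * ∑ p ∈ pairs N, if ‖x p.1 - x p.2‖ ≤ 2 * R * a then
        (4 * M * a⁻¹) ^ 2 * ‖polyFn Q x‖ ^ 2 else 0 := by
  have hd : ∀ k, ‖dir k‖ = 1 := fun k => by fin_cases k <;> simp [dir]
  have e : magMomentum i 0 (trial ψ Q a) x + Complex.I * magMomentum i 1 (trial ψ Q a) x =
      -Complex.I * (fderiv ℝ (pairCutoff ψ a) x (Pi.single i (dir 0)) +
        Complex.I * fderiv ℝ (pairCutoff ψ a) x (Pi.single i (dir 1))) * polyFn Q x := by
    rw [magMomentum_trial hψ, magMomentum_trial hψ, magMomentum_polyFn_zero]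
    ring
  have h : ‖magMomentum i 0 (trial ψ Q a) x + Complex.I * magMomentum i 1 (trial ψ Q a) x‖ ≤
      ∑ p ∈ pairs N, if ‖x p.1 - x p.2‖ ≤ 2 * R * a then 4 * M * a⁻¹ * ‖polyFn Q x‖ else 0 := by
    rw [e, norm_mul, norm_mul, norm_neg, Complex.norm_I, one_mul]
    have h1 := norm_fderiv_pairCutoff_le hψ ha x i (dir 0)
    have h2 := norm_fderiv_pairCutoff_le hψ ha x i (dir 1)
    rw [hd] at h1 h2
    have h3 := norm_add_le (fderiv ℝ (pairCutoff ψ a) x (Pi.single i (dir 0)))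
      (Complex.I * fderiv ℝ (pairCutoff ψ a) x (Pi.single i (dir 1)))
    rw [norm_mul, Complex.norm_I, one_mul] at h3
    refine (mul_le_mul_of_nonneg_right (h3.trans (add_le_add h1 h2)) (norm_nonneg _)).trans_eq ?_
    rw [← Finset.sum_add_distrib, Finset.sum_mul]
    refine Finset.sum_congr rfl fun p _ => ?_
    split_ifs <;> ring
  refine (pow_le_pow_left₀ (norm_nonneg _) h 2).trans (sq_sum_le_card_mul_sum_sq.trans_eq ?_)
  congr 1
  refine Finset.sum_congr rfl fun p _ => ?_
  split_ifs <;> ring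

end

/-- Near a collision the squared gradient is of order `a⁻²`, the squared Laughlin function of order
`a^{2m}`, and the region has area of order `a²`. The product is of order `a^{2m}`. -/
theorem exists_norm_lowering_trial_sq_le {R M : ℝ} (hR : 0 ≤ R) {ψ : ℂ → ℂ} (hψ : IsCutoff R M ψ)
    (m : ℕ) : ∃ C : ℝ, ∀ a : ℝ, 0 < a → ∀ i : Fin N,
      ‖lowering i (memLp_trial hψ (jastrow N ^ m) a).toLp‖ ^ 2 ≤ C * (a ^ 2) ^ m := by
  obtain ⟨K, hK, hKi⟩ := integrable_collisionWeight N
  obtain ⟨C, hC, hCx⟩ := exists_norm_polyFn_jastrow_sq_le N m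
  set n : ℝ := ((pairs N).card : ℝ) with hn
  refine ⟨n * (n * ((4 * M) ^ 2 * (C * (4 * R ^ 2) ^ m) * (K * (4 * R ^ 2)))), fun a ha i => ?_⟩
  set Q := jastrow N ^ m with hQ
  have e : lowering i (memLp_trial hψ Q a).toLp =
      ((memLp_magMomentum_trial hψ Q i 0 ha).add
        ((memLp_magMomentum_trial hψ Q i 1 ha).const_smul Complex.I)).toLp := by
    rw [lowering, (isWeakMagMomentum_trial hψ Q i 0 ha).weakMagMomentum_eq,
      (isWeakMagMomentum_trial hψ Q i 1 ha).weakMagMomentum_eq, ← MemLp.toLp_const_smul,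
      ← MemLp.toLp_add]
  rw [e, norm_toLp_sq_eq_integral]
  set c : ℝ := (4 * M * a⁻¹) ^ 2 * (C * ((2 * R * a) ^ 2) ^ m) with hc
  have hc0 : 0 ≤ c := by positivity
  have hint : ∀ p ∈ pairs N, Integrable fun x => c * collisionWeight p.1 p.2 (2 * R * a) x :=
    fun p hp => (hKi p.1 p.2 (mem_pairs.1 hp).ne' _ (by positivity)).1.const_mul c
  have hpt : ∀ x : Conf N, ‖(magMomentum i 0 (trial ψ Q a) +
      Complex.I • magMomentum i 1 (trial ψ Q a)) x‖ ^ 2 ≤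
        n * ∑ p ∈ pairs N, c * collisionWeight p.1 p.2 (2 * R * a) x := fun x => by
    refine (norm_magMomentum_trial_le hψ Q i ha x).trans
      (mul_le_mul_of_nonneg_left (Finset.sum_le_sum fun p hp => ?_) (by positivity))
    unfold collisionWeight
    split_ifs with hx
    · rw [hc, mul_assoc ((4 * M * a⁻¹) ^ 2)]
      refine mul_le_mul_of_nonneg_left ((hCx p hp x).trans ?_) (by positivity)
      gcongr
    · simp
  calc ∫ x, ‖(magMomentum i 0 (trial ψ Q a) + Complex.I • magMomentum i 1 (trial ψ Q a)) x‖ ^ 2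
      ≤ ∫ x, n * ∑ p ∈ pairs N, c * collisionWeight p.1 p.2 (2 * R * a) x :=
        integral_mono_of_nonneg (ae_of_all _ fun x => by positivity)
          ((integrable_finsetSum _ hint).const_mul n) (ae_of_all _ hpt)
    _ = n * ∑ p ∈ pairs N, c * ∫ x, collisionWeight p.1 p.2 (2 * R * a) x := by
        rw [integral_const_mul, integral_finsetSum _ hint]
        simp_rw [integral_const_mul]
    _ ≤ n * ∑ _p ∈ pairs N, c * (K * (2 * R * a) ^ 2) := by
        refine mul_le_mul_of_nonneg_left (Finset.sum_le_sum fun p hp =>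
          mul_le_mul_of_nonneg_left ?_ hc0) (by positivity)
        exact (hKi p.1 p.2 (mem_pairs.1 hp).ne' _ (by positivity)).2
    _ = _ := by
        rw [Finset.sum_const, nsmul_eq_mul, ← hn, hc,
          show (2 * R * a) ^ 2 = 4 * R ^ 2 * a ^ 2 by ring, mul_pow (4 * R ^ 2)]
        field_simp

end Trial

/-! ### Energy and norm of the trial states -/

section TrialEnergy

open MvPolynomial

variable {N : ℕ} {R M : ℝ} {ψ : ℂ → ℂ}

theorem trial_eq_zero (hψ : IsCutoff R M ψ) (Q : MvPolynomial (Fin N) ℂ) {a : ℝ} (ha : 0 < a)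
    {x : Conf N} {i j : Fin N} (hij : i < j) (h : ‖x i - x j‖ ≤ R * a) : trial ψ Q a x = 0 := by
  rw [trial, pairCutoff, Finset.prod_eq_zero (i := (i, j)) (mem_pairs.2 hij), zero_mul]
  refine hψ.eq_zero _ ?_
  rw [norm_smul, Real.norm_of_nonneg (by positivity), ← div_eq_inv_mul, div_le_iff₀ ha]
  exact h

/-- The cutoff vanishes on the whole range of the scaled potential, so the trial state is admissible
with zero interaction energy even for a hard core. -/
theorem pairPot_mul_trial (hψ : IsCutoff R M ψ) (Q : MvPolynomial (Fin N) ℂ) {v : ℝ → ℝ≥0∞}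
    (hv : ∀ r, R < r → v r = 0) {a : ℝ} (ha : 0 < a) (x : Conf N) :
    pairPot N v a x * ‖trial ψ Q a x‖ₑ ^ 2 = 0 := by
  rw [pairPot, Finset.sum_mul]
  refine Finset.sum_eq_zero fun i _ => ?_
  rw [Finset.sum_mul]
  refine Finset.sum_eq_zero fun j hj => ?_
  rcases le_or_gt ‖x i - x j‖ (R * a) with h | h
  · rw [trial_eq_zero hψ Q ha (Finset.mem_Ioi.1 hj) h]
    simp
  · rw [scaled, hv _ ((lt_div_iff₀ ha).2 h), mul_zero, zero_mul]

theorem eventually_trial_eq (hψ : IsCutoff R M ψ) {m : ℕ} (hm : m ≠ 0) (x : Conf N) :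
    ∀ᶠ a in 𝓝[>] (0 : ℝ), trial ψ (jastrow N ^ m) a x = polyFn (jastrow N ^ m) x := by
  -- At a collision both sides vanish since `m ≠ 0`; elsewhere all pair distances eventually exceed
  -- `2Ra`.
  by_cases hx : ∃ p ∈ pairs N, x p.1 = x p.2
  · obtain ⟨p, hp, hxp⟩ := hx
    refine .of_forall fun a => ?_
    obtain ⟨C, hC, hCx⟩ := exists_norm_polyFn_jastrow_sq_le N m
    have h := hCx p hp x
    rw [hxp, sub_self, norm_zero, zero_pow two_ne_zero, zero_pow hm, mul_zero, zero_mul] at h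
    have h0 : polyFn (jastrow N ^ m) x = 0 := by
      rw [← norm_eq_zero, ← sq_eq_zero_iff]
      exact le_antisymm h (sq_nonneg _)
    rw [trial, h0, mul_zero]
  · push Not at hx
    have h : ∀ p ∈ pairs N, ∀ᶠ a in 𝓝[>] (0 : ℝ), ψ (a⁻¹ • (x p.1 - x p.2)) = 1 := fun p hp => by
      have hpos : 0 < ‖x p.1 - x p.2‖ := norm_pos_iff.2 (sub_ne_zero.2 (hx p hp))
      have ht : Tendsto (fun a : ℝ => 2 * R * a) (𝓝[>] 0) (𝓝 (2 * R * 0)) :=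
        ((continuous_const.mul continuous_id).tendsto 0).mono_left nhdsWithin_le_nhds
      rw [mul_zero] at ht
      filter_upwards [ht.eventually_lt_const hpos, self_mem_nhdsWithin] with a h1 ha
      have ha' : (0 : ℝ) < a := ha
      refine hψ.eq_one _ ?_
      rw [norm_smul, Real.norm_of_nonneg (by positivity), ← div_eq_inv_mul, le_div_iff₀ ha']
      exact h1.le
    filter_upwards [(Finset.eventually_all _).2 h] with a ha
    rw [trial, pairCutoff, Finset.prod_eq_one ha, one_mul]

theorem tendsto_norm_trial_sq (hψ : IsCutoff R M ψ) {m : ℕ} (hm : m ≠ 0) :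
    Tendsto (fun a => ‖(memLp_trial hψ (jastrow N ^ m) a).toLp‖ ^ 2) (𝓝[>] (0 : ℝ))
      (𝓝 (‖polyLp (jastrow N ^ m)‖ ^ 2)) := by
  simp_rw [polyLp_apply, norm_toLp_sq_eq_integral]
  refine tendsto_integral_filter_of_dominated_convergence
    (fun x => ‖polyFn (jastrow N ^ m) x‖ ^ 2) (.of_forall fun a =>
      ((contDiff_trial hψ _ a).continuous.norm.pow 2).aestronglyMeasurable)
    (.of_forall fun a => ae_of_all _ fun x => ?_)
    ((memLp_two_iff_integrable_sq_norm (memLp_polyFn _).1).1 (memLp_polyFn _))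
    (ae_of_all _ fun x => ?_)
  · rw [Real.norm_of_nonneg (by positivity)]
    exact pow_le_pow_left₀ (norm_nonneg _) (norm_trial_le hψ _ a x) 2
  · exact tendsto_const_nhds.congr' ((eventually_trial_eq hψ hm x).mono fun a h => by simp only [h])

theorem lintegral_mul_toLp {f : Conf N → ℂ} (hf : MemLp f 2 volume) (W : Conf N → ℝ≥0∞) :
    ∫⁻ x, W x * ‖hf.toLp f x‖ₑ ^ 2 = ∫⁻ x, W x * ‖f x‖ₑ ^ 2 :=
  lintegral_congr_ae (hf.coeFn_toLp.mono fun x h => by simp only [h])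

theorem energy_trial_le (hψ : IsCutoff R M ψ) {Q : MvPolynomial (Fin N) ℂ} {d : ℕ}
    (hQ : Q.IsHomogeneous d) {v : ℝ → ℝ≥0∞} (hvm : Measurable v) (hv : ∀ r, R < r → v r = 0)
    {a κ : ℝ} (ha : 0 < a) (hκ : 0 < κ) :
    InFormDomain (potential N v a κ) (memLp_trial hψ Q a).toLp ∧
      energy (potential N v a κ) (memLp_trial hψ Q a).toLp ≤
        ∑ i, ‖lowering i (memLp_trial hψ Q a).toLp‖ ^ 2 + κ * ((d + N) * ‖polyLp Q‖ ^ 2) := by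
  have hpair : ∫⁻ x, pairPot N v a x * ‖(memLp_trial hψ Q a).toLp (trial ψ Q a) x‖ₑ ^ 2 = 0 := by
    rw [lintegral_mul_toLp]
    simp_rw [pairPot_mul_trial hψ Q hv ha]
    exact lintegral_zero
  have htrap : ∫⁻ x, ENNReal.ofReal (∑ i, ‖x i‖ ^ 2) *
      ‖(memLp_trial hψ Q a).toLp (trial ψ Q a) x‖ₑ ^ 2 ≤
        ENNReal.ofReal ((d + N) * ‖polyLp Q‖ ^ 2) := by
    rw [lintegral_mul_toLp _ fun x => ENNReal.ofReal (∑ i, ‖x i‖ ^ 2), ← lintegral_trap_polyFn hQ]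
    refine lintegral_mono fun x => ?_
    gcongr
    exact enorm_le_iff_norm_le.2 (norm_trial_le hψ Q a x)
  have hdom : InFormDomain (potential N v a κ) (memLp_trial hψ Q a).toLp := by
    refine ⟨fun i k => ⟨_, isWeakMagMomentum_trial hψ Q i k ha⟩, ?_⟩
    rw [lintegral_potential hvm a hκ.le, hpair, zero_add]
    exact ENNReal.mul_lt_top ENNReal.ofReal_lt_top (htrap.trans_lt ENNReal.ofReal_lt_top)
  refine ⟨hdom, ?_⟩
  rw [hdom.energy_potential hvm hκ, hpair, ENNReal.toReal_zero, add_zero]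
  have := ENNReal.toReal_mono ENNReal.ofReal_ne_top htrap
  rw [ENNReal.toReal_ofReal (by positivity)] at this
  gcongr

/-- The kinetic energy of order `a^{2ℓ+2}` is small compared with `s`. The trap energy is at most
that of the uncut Laughlin function, and the norm converges to that of the Laughlin function. The
slack `ε` absorbs both errors. -/
theorem exists_trial (N : ℕ) {v : ℝ → ℝ≥0∞} (hvm : Measurable v)
    (hv : ∃ R₀ : ℝ, ∀ r, R₀ < r → v r = 0) {ℓ : ℕ} {s : ℝ → ℝ} (hs : IsScale ℓ s) {lam : ℝ}
    (hlam : 0 < lam) {ε : ℝ} (hε : 0 < ε) :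
    ∀ᶠ a in 𝓝[>] (0 : ℝ), ∃ T : L2 N, InFormDomain (potential N v a (s a * lam)) T ∧
      energy (potential N v a (s a * lam)) T <
        s a * lam * (((numPairs N * (ℓ + 1) : ℕ) + N + ε) * ‖T‖ ^ 2) := by
  obtain ⟨R₀, hR₀⟩ := hv
  set R := max R₀ 1 with hR
  have hR0 : 0 < R := lt_max_of_lt_right one_pos
  have hvR : ∀ r, R < r → v r = 0 := fun r hr => hR₀ r ((le_max_left _ _).trans_lt hr)
  obtain ⟨M, ψ, hψ⟩ := exists_isCutoff hR0
  obtain ⟨C, hC⟩ := exists_norm_lowering_trial_sq_le (N := N) hR0.le hψ (ℓ + 1)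
  set Q := jastrow N ^ (ℓ + 1) with hQ
  have hQh : Q.IsHomogeneous (numPairs N * (ℓ + 1)) := (jastrow_isHomogeneous N).pow (ℓ + 1)
  set n : ℝ := (numPairs N * (ℓ + 1) : ℕ) + N with hn
  have hn0 : 0 ≤ n := by positivity
  set q := ‖polyLp Q‖ ^ 2 with hq
  have hq0 : 0 < q := by
    have := norm_laughlinFun_ne_zero (N := N) (ℓ + 1)
    rw [toLp_laughlinFun] at this
    positivity
  have hT := tendsto_norm_trial_sq (N := N) hψ (ℓ.succ_ne_zero)
  have h1 : Tendsto (fun a => N * C * (a ^ (2 * ℓ + 2) / s a) + lam * (n * q)) (𝓝[>] (0 : ℝ))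
      (𝓝 (N * C * 0 + lam * (n * q))) :=
    (hs.pow_div_tendsto_zero.const_mul _).add_const _
  have h2 : Tendsto (fun a => lam * ((n + ε) * ‖(memLp_trial hψ Q a).toLp‖ ^ 2)) (𝓝[>] (0 : ℝ))
      (𝓝 (lam * ((n + ε) * q))) := (hT.const_mul _).const_mul _
  have h3 : N * C * 0 + lam * (n * q) < lam * ((n + ε) * q) := by
    have : 0 < lam * (ε * q) := by positivity
    linarith
  filter_upwards [h1.eventually_lt h2 h3, hs.pos, self_mem_nhdsWithin] with a hlt hsa ha
  obtain ⟨hdom, hen⟩ := energy_trial_le hψ hQh hvm hvR (a := a) (κ := s a * lam) ha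
    (mul_pos hsa hlam)
  refine ⟨_, hdom, hen.trans_lt ?_⟩
  have h4 : ∑ i, ‖lowering i (memLp_trial hψ Q a).toLp‖ ^ 2 ≤ N * (C * (a ^ 2) ^ (ℓ + 1)) := by
    refine (Finset.sum_le_sum fun i _ => hC a ha i).trans_eq ?_
    simp
  calc ∑ i, ‖lowering i (memLp_trial hψ Q a).toLp‖ ^ 2 + s a * lam * (n * q)
      ≤ N * (C * (a ^ 2) ^ (ℓ + 1)) + s a * lam * (n * q) := by gcongr
    _ = s a * (N * C * (a ^ (2 * ℓ + 2) / s a) + lam * (n * q)) := by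
        rw [← pow_mul, show 2 * (ℓ + 1) = 2 * ℓ + 2 by ring]
        field_simp
    _ < s a * (lam * ((n + ε) * ‖(memLp_trial hψ Q a).toLp‖ ^ 2)) :=
        mul_lt_mul_of_pos_left hlt hsa
    _ = _ := by ring

end TrialEnergy

/-! ### Convergence of the ground states -/

section Convergence

variable {N : ℕ}

theorem IsGroundState.smul {W : Conf N → ℝ≥0∞} (hW : Measurable W) {Ψ : L2 N}
    (h : IsGroundState W Ψ) {c : ℂ} (hc : ‖c‖ = 1) : IsGroundState W (c • Ψ) := by
  obtain ⟨h1, E, ⟨hd, _, hf⟩, hE⟩ := h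
  have hcd : c • Ψ ∈ formDomain hW := (formDomain hW).smul_mem c hd
  refine ⟨by rw [norm_smul, hc, h1, one_mul], E,
    ⟨hcd, subset_closure ((formDomain hW).smul_mem _ hcd), fun Φ hΦ => ?_⟩, hE⟩
  have e1 := form_eq_inner hW ⟨Φ, hΦ⟩ ⟨c • Ψ, hcd⟩
  have e2 := form_eq_inner hW ⟨Φ, hΦ⟩ ⟨Ψ, hd⟩
  have e3 : rootForm hW ⟨c • Ψ, hcd⟩ = c • rootForm hW ⟨Ψ, hd⟩ :=
    (rootForm hW).map_smul c ⟨Ψ, hd⟩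
  rw [e3, inner_smul_right, ← e2] at e1
  rw [smul_comm, inner_smul_right, ← hf Φ hΦ]
  exact e1

/-- For a real nonnegative overlap `t ≤ 1` the squared distance is `2(1 - t)`, and `t² ≤ t`. -/
theorem norm_sub_sq_le_of_inner {H : Type*} [NormedAddCommGroup H] [InnerProductSpace ℂ H]
    {L Ψ : H} (hL : ‖L‖ = 1) (hΨ : ‖Ψ‖ = 1) (h : (inner ℂ L Ψ : ℂ) = (‖(inner ℂ L Ψ : ℂ)‖ : ℂ)) :
    ‖Ψ - L‖ ^ 2 ≤ 2 * (1 - ‖(inner ℂ L Ψ : ℂ)‖ ^ 2) := by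
  have h1 := @norm_sub_sq ℂ H _ _ _ L Ψ
  have h2 : RCLike.re (inner ℂ L Ψ : ℂ) = ‖(inner ℂ L Ψ : ℂ)‖ := by
    conv_lhs => rw [h]
    exact Complex.ofReal_re _
  have h3 : ‖(inner ℂ L Ψ : ℂ)‖ ≤ 1 := by
    have := norm_inner_le_norm (𝕜 := ℂ) L Ψ
    rwa [hL, hΨ, one_mul] at this
  rw [norm_sub_rev, h1, h2, hL, hΨ]
  nlinarith [norm_nonneg (inner ℂ L Ψ : ℂ)]

theorem exists_norm_eq_one_mul_eq_norm (z : ℂ) : ∃ c : ℂ, ‖c‖ = 1 ∧ c * z = (‖z‖ : ℂ) := by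
  rcases eq_or_ne z 0 with rfl | hz
  · exact ⟨1, norm_one, by simp⟩
  · have hn : (‖z‖ : ℂ) ≠ 0 := Complex.ofReal_ne_zero.2 (norm_ne_zero_iff.2 hz)
    refine ⟨(‖z‖ : ℂ) / z, ?_, div_mul_cancel₀ _ hz⟩
    rw [norm_div, Complex.norm_real, norm_norm, div_self (norm_ne_zero_iff.2 hz)]

/-- The lower bound at the minimizer is at most its energy, which is less than `κ(n + η)`. Hence `n
+ 1 - η - b < n + η`. -/
theorem overlap_arith {κ n η E b t : ℝ} (hκ : 0 < κ) (ht : 0 < t)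
    (hlow : κ * (n + 1 - η - b) ≤ E) (hE : E * t < κ * ((n + η) * t)) : 1 - 2 * η < b := by
  have h1 : E < κ * (n + η) := by
    rw [← mul_assoc] at hE
    exact lt_of_mul_lt_mul_right hE ht.le
  have h2 := lt_of_mul_lt_mul_left (hlow.trans_lt h1) hκ.le
  linarith

theorem exists_isGroundState_overlap {W : Conf N → ℝ≥0∞} (hW : Measurable W) (L : L2 N)
    {κ n η : ℝ} (hκ : 0 < κ) (hη : η ≤ 1 / 2)
    (hgap : ∀ Ψ, InFormDomain W Ψ →
      κ * ((n + 1 - η) * ‖Ψ‖ ^ 2 - ‖(inner ℂ L Ψ : ℂ)‖ ^ 2) ≤ energy W Ψ)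
    {T : L2 N} (hTd : InFormDomain W T) (hT : energy W T < κ * ((n + η) * ‖T‖ ^ 2)) :
    ∃ Ψ, IsGroundState W Ψ ∧ (∀ Φ, IsGroundState W Φ → ∃ c : ℂ, ‖c‖ = 1 ∧ Φ = c • Ψ) ∧
      1 - 2 * η < ‖(inner ℂ L Ψ : ℂ)‖ ^ 2 := by
  have hgap' : ∀ Ψ : L2 N, InFormDomain W Ψ →
      κ * (n + 1 - η) * ‖Ψ‖ ^ 2 - κ * ‖(inner ℂ L Ψ : ℂ)‖ ^ 2 ≤ energy W Ψ := fun Ψ hΨ =>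
    le_of_eq_of_le (by ring) (hgap Ψ hΨ)
  have ht : 0 < ‖T‖ ^ 2 := by
    refine lt_of_le_of_ne (sq_nonneg _) fun h0 => ?_
    rw [← h0, mul_zero, mul_zero] at hT
    exact hT.not_ge (add_nonneg (Finset.sum_nonneg fun _ _ => sq_nonneg _) ENNReal.toReal_nonneg)
  -- The condition `η ≤ 1/2` places the trial energy `n + η` below the gap level `n + 1 - η`.
  have hT' : energy W T < κ * (n + 1 - η) * ‖T‖ ^ 2 := by
    refine hT.trans_le ?_
    rw [mul_assoc]
    exact mul_le_mul_of_nonneg_left (mul_le_mul_of_nonneg_right (by linarith) ht.le) hκ.le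
  obtain ⟨Ψ, hΨd, hΨg, hmin, huniq⟩ := exists_isGroundState_of_gap hW _ hgap' hTd hT'
  refine ⟨Ψ, hΨg, huniq, overlap_arith hκ ht ?_ ((hmin T hTd).trans_lt hT)⟩
  have h := hgap Ψ hΨd
  rwa [hΨg.1, one_pow, mul_one] at h

/-- The ground state exists, is unique up to a phase, and has overlap with the Laughlin function
arbitrarily close to one. -/
theorem exists_groundState_overlap (N : ℕ) {v : ℝ → ℝ≥0∞} (hvm : Measurable v)
    (hv : ∃ R₀ : ℝ, ∀ r, R₀ < r → v r = 0) (hne : ¬ ∀ᵐ x : ℂ, v ‖x‖ = 0) {ℓ : ℕ} {s : ℝ → ℝ}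
    (hs : IsScale ℓ s) : ∃ lam₀ : ℝ, 0 < lam₀ ∧ ∀ lam : ℝ, 0 < lam → lam < lam₀ →
      ∀ η : ℝ, 0 < η → η ≤ 1 / 2 → ∀ᶠ a in 𝓝[>] (0 : ℝ), ∃ Ψ : L2 N,
        IsGroundState (potential N v a (s a * lam)) Ψ ∧
        (∀ Φ, IsGroundState (potential N v a (s a * lam)) Φ → ∃ c : ℂ, ‖c‖ = 1 ∧ Φ = c • Ψ) ∧
        1 - 2 * η < ‖(inner ℂ (laughlin N (ℓ + 1)) Ψ : ℂ)‖ ^ 2 := by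
  obtain ⟨lam₀, hlam₀, hlow⟩ := exists_energy_lower_bound (N := N) hvm hne hs
  refine ⟨lam₀, hlam₀, fun lam hlam hlam1 η hη hη1 => ?_⟩
  set n : ℝ := (numPairs N * (ℓ + 1) : ℕ) + N with hn
  have hn0 : 0 ≤ n := by positivity
  -- The value `δ = η/(n + 1)` turns the level `(n + 1)(1 - δ)` into `n + 1 - η`.
  have hδ : η / (n + 1) ≤ 1 := by
    rw [div_le_one (by positivity)]
    linarith
  filter_upwards [hlow lam hlam hlam1 (η / (n + 1)) (by positivity) hδ,
    exists_trial N hvm hv hs hlam hη, hs.pos] with a hlowa ⟨T, hTd, hT⟩ hsa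
  have e : (n + 1) * (1 - η / (n + 1)) = n + 1 - η := by field_simp
  refine exists_isGroundState_overlap (measurable_potential hvm a (s a * lam)) _
    (mul_pos hsa hlam) hη1 (fun Ψ hΨ => ?_) hTd hT
  have h := hlowa Ψ hΨ
  rwa [e] at h

theorem exists_groundStateTendsto (N : ℕ) {v : ℝ → ℝ≥0∞} (hvm : Measurable v)
    (hv : ∃ R₀ : ℝ, ∀ r, R₀ < r → v r = 0) (hne : ¬ ∀ᵐ x : ℂ, v ‖x‖ = 0) {ℓ : ℕ} {s : ℝ → ℝ}
    (hs : IsScale ℓ s) : ∃ lam₀ : ℝ, 0 < lam₀ ∧ ∀ lam : ℝ, 0 < lam → lam < lam₀ →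
      GroundStateTendsto v (fun a => s a * lam) (laughlin N (ℓ + 1)) := by
  obtain ⟨lam₀, hlam₀, hov⟩ := exists_groundState_overlap N hvm hv hne hs
  refine ⟨lam₀, hlam₀, fun lam hlam hlam1 => ?_⟩
  have hov := hov lam hlam hlam1
  set L := laughlin N (ℓ + 1) with hL
  -- The phase is fixed by a real nonnegative overlap with the Laughlin function. The family is
  -- chosen before `η`, so that one family serves all accuracies.
  let P : ℝ → L2 N → Prop := fun a Ψ => IsGroundState (potential N v a (s a * lam)) Ψ ∧
    (inner ℂ L Ψ : ℂ) = (‖(inner ℂ L Ψ : ℂ)‖ : ℂ)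
  have hchoice : ∃ Ψ : ℝ → L2 N, ∀ a, (∃ Φ, P a Φ) → P a (Ψ a) := by
    classical
    exact ⟨fun a => if h : ∃ Φ, P a Φ then h.choose else 0, fun a h => by
      simp only [dif_pos h]
      exact h.choose_spec⟩
  obtain ⟨Ψ, hΨ⟩ := hchoice
  have key : ∀ η : ℝ, 0 < η → η ≤ 1 / 2 → ∀ᶠ a in 𝓝[>] (0 : ℝ), P a (Ψ a) ∧
      (∀ Φ, IsGroundState (potential N v a (s a * lam)) Φ → ∃ c : ℂ, ‖c‖ = 1 ∧ Φ = c • Ψ a) ∧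
      1 - 2 * η < ‖(inner ℂ L (Ψ a) : ℂ)‖ ^ 2 := fun η hη hη1 => by
    filter_upwards [hov η hη hη1] with a ⟨Φ, hΦ, huniq, hΦL⟩
    obtain ⟨c, hc, hcz⟩ := exists_norm_eq_one_mul_eq_norm (inner ℂ L Φ : ℂ)
    have hP : P a (Ψ a) := hΨ a ⟨c • Φ, hΦ.smul (measurable_potential hvm a _) hc, by
      rw [inner_smul_right, hcz, Complex.norm_real, norm_norm]⟩
    obtain ⟨b, hb, hbΦ⟩ := huniq _ hP.1
    have hb0 : b ≠ 0 := norm_ne_zero_iff.1 (by rw [hb]; exact one_ne_zero)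
    refine ⟨hP, fun Φ' hΦ' => ?_, ?_⟩
    · obtain ⟨b', hb', hbΦ'⟩ := huniq _ hΦ'
      refine ⟨b' * b⁻¹, by rw [norm_mul, norm_inv, hb, hb', inv_one, one_mul], ?_⟩
      rw [hbΦ, smul_smul, mul_assoc, inv_mul_cancel₀ hb0, mul_one, hbΦ']
    · rwa [hbΦ, inner_smul_right, norm_mul, hb, one_mul]
  refine ⟨Ψ, (key (1 / 2) (by norm_num) le_rfl).mono fun a h => ⟨h.1.1, h.2.1⟩, ?_⟩
  rw [Metric.tendsto_nhds]
  intro ε hε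
  -- The squared distance is less than `4η`, and `4 · ε²/8 = ε²/2 < ε²`.
  filter_upwards [key (min (ε ^ 2 / 8) (1 / 2)) (by positivity) (min_le_right _ _)] with a h
  have h1 := norm_sub_sq_le_of_inner (norm_laughlin (N := N) (ℓ + 1)) h.1.1.1 h.1.2
  have h2 : min (ε ^ 2 / 8) (1 / 2 : ℝ) ≤ ε ^ 2 / 8 := min_le_left _ _
  rw [dist_eq_norm]
  refine lt_of_pow_lt_pow_left₀ 2 hε.le ?_
  nlinarith [h.2.2]

end Convergence

/-! ### The scales of the trap -/

theorem tendsto_pow_nhdsGT_zero {n : ℕ} (hn : n ≠ 0) :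
    Tendsto (fun a : ℝ => a ^ n) (𝓝[>] 0) (𝓝 0) := by
  have : Tendsto (fun a : ℝ => a ^ n) (𝓝[>] 0) (𝓝 (0 ^ n)) :=
    ((continuous_pow n).tendsto 0).mono_left nhdsWithin_le_nhds
  rwa [zero_pow hn] at this

theorem lintegral_Icc_inv_pow_le {ℓ : ℕ} (hℓ : 1 ≤ ℓ) {A : ℝ} (hA : 0 < A) :
    ∫⁻ t in Set.Icc A 2, ENNReal.ofReal (t ^ (ℓ + 1))⁻¹ ≤ ENNReal.ofReal (A ^ ℓ)⁻¹ := by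
  have hexp : -((ℓ : ℝ) + 1) < -1 := by
    have : (1 : ℝ) ≤ ℓ := by exact_mod_cast hℓ
    linarith
  have hpow : ∀ t ∈ Set.Ioi A, (t ^ (ℓ + 1))⁻¹ = t ^ (-((ℓ : ℝ) + 1)) := fun t ht => by
    rw [Real.rpow_neg (hA.trans ht).le]
    congr 1
    exact_mod_cast (Real.rpow_natCast t (ℓ + 1)).symm
  have hint := integrableOn_Ioi_rpow_of_lt hexp hA
  have h1 : ∫⁻ t in Set.Icc A 2, ENNReal.ofReal (t ^ (ℓ + 1))⁻¹ ≤
      ∫⁻ t in Set.Ioi A, ENNReal.ofReal (t ^ (-((ℓ : ℝ) + 1))) := by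
    rw [← setLIntegral_congr Ioc_ae_eq_Icc]
    refine (lintegral_mono_set Set.Ioc_subset_Ioi_self).trans_eq ?_
    exact setLIntegral_congr_fun measurableSet_Ioi fun t ht => by rw [hpow t ht]
  refine h1.trans ?_
  rw [← ofReal_integral_eq_lintegral_ofReal hint ((ae_restrict_iff' measurableSet_Ioi).2
    (ae_of_all _ fun t ht => Real.rpow_nonneg (hA.trans ht).le _)), integral_Ioi_rpow_of_lt hexp hA]
  refine ENNReal.ofReal_le_ofReal ?_
  rw [show -((ℓ : ℝ) + 1) + 1 = -(ℓ : ℝ) by ring, Real.rpow_neg hA.le, Real.rpow_natCast,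
    neg_div_neg_eq]
  exact div_le_self (by positivity) (by exact_mod_cast hℓ)

theorem lintegral_Icc_inv_le {A : ℝ} (hA : 0 < A) (hA2 : A ≤ 2) :
    ∫⁻ t in Set.Icc A 2, ENNReal.ofReal (t ^ (0 + 1))⁻¹ = ENNReal.ofReal (Real.log (2 / A)) := by
  have hint : IntegrableOn (fun t : ℝ => t⁻¹) (Set.Icc A 2) :=
    ContinuousOn.integrableOn_Icc (continuousOn_inv₀.mono fun t ht => (hA.trans_le ht.1).ne')
  simp_rw [zero_add, pow_one]
  rw [← ofReal_integral_eq_lintegral_ofReal hint ((ae_restrict_iff' measurableSet_Icc).2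
    (ae_of_all _ fun t ht => inv_nonneg.2 (hA.trans_le ht.1).le)), integral_Icc_eq_integral_Ioc,
    ← intervalIntegral.integral_of_le hA2, integral_inv_of_pos hA two_pos]

/-- For `ℓ ≥ 1` the integral of `t^{-ℓ-1}` is dominated by its lower end, of order `a²`, and is of
order `a^{-2ℓ}`. -/
theorem isScale_pow {ℓ : ℕ} (hℓ : 1 ≤ ℓ) : IsScale ℓ fun a => a ^ (2 * ℓ) where
  pos := eventually_mem_nhdsWithin.mono fun a ha => pow_pos ha _
  tendsto_zero := tendsto_pow_nhdsGT_zero (by positivity)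
  pow_le := ⟨1, .of_forall fun a => by rw [one_mul, pow_mul, inv_pow]⟩
  lintegral_le c hc := by
    refine ⟨((c / 2) ^ ℓ)⁻¹, eventually_mem_nhdsWithin.mono fun a ha => ?_⟩
    have ha' : (0 : ℝ) < a := ha
    refine (lintegral_Icc_inv_pow_le hℓ (by positivity)).trans_eq ?_
    rw [show c * a ^ 2 / 2 = c / 2 * a ^ 2 by ring, mul_pow, mul_inv, ← pow_mul]
  pow_div_tendsto_zero := by
    refine (tendsto_pow_nhdsGT_zero two_ne_zero).congr'
      (eventually_mem_nhdsWithin.mono fun a ha => ?_)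
    have ha' : (0 : ℝ) < a := ha
    simp only [pow_add]
    rw [mul_div_cancel_left₀ _ (by positivity)]

theorem tendsto_log_inv_sq :
    Tendsto (fun a : ℝ => Real.log (1 / a ^ 2)) (𝓝[>] 0) atTop := by
  have h : Tendsto (fun a : ℝ => a ^ 2) (𝓝[>] 0) (𝓝[>] 0) :=
    tendsto_nhdsWithin_iff.2 ⟨tendsto_pow_nhdsGT_zero two_ne_zero,
      eventually_mem_nhdsWithin.mono fun a ha => Set.mem_Ioi.2 (pow_pos ha 2)⟩
  simp_rw [one_div]
  exact Real.tendsto_log_atTop.comp (tendsto_inv_nhdsGT_zero.comp h)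

/-- For relative angular momentum zero the integral of `1/t` from order `a²` to order one is
logarithmic, which is the origin of the logarithm in the trap strength. -/
theorem isScale_log : IsScale 0 fun a => (Real.log (1 / a ^ 2))⁻¹ where
  pos := (tendsto_log_inv_sq.eventually_gt_atTop 0).mono fun a h => inv_pos.2 h
  tendsto_zero := tendsto_inv_atTop_zero.comp tendsto_log_inv_sq
  pow_le := ⟨1, (tendsto_log_inv_sq.eventually_ge_atTop 1).mono fun a h => by
    rwa [pow_zero, one_mul, inv_inv]⟩
  lintegral_le c hc := by
    -- The integral is `log (4/c) + log (1/a²)`; once `log (1/a²) ≥ 1`, the constant term is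
    -- absorbed into a multiple of the logarithm.
    refine ⟨|Real.log (4 / c)| + 1, ?_⟩
    have hsmall : ∀ᶠ a in 𝓝[>] (0 : ℝ), c * a ^ 2 < 4 := by
      have := (tendsto_pow_nhdsGT_zero two_ne_zero).const_mul c
      rw [mul_zero] at this
      exact this.eventually_lt_const (by norm_num)
    filter_upwards [tendsto_log_inv_sq.eventually_ge_atTop 1, hsmall, self_mem_nhdsWithin] with
      a h1 h2 ha
    have ha' : (0 : ℝ) < a := ha
    rw [lintegral_Icc_inv_le (by positivity) (by linarith)]
    refine ENNReal.ofReal_le_ofReal ?_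
    rw [inv_inv, show 2 / (c * a ^ 2 / 2) = 4 / c * (1 / a ^ 2) by field_simp; norm_num,
      Real.log_mul (by positivity) (by positivity)]
    have h3 := le_abs_self (Real.log (4 / c))
    nlinarith [abs_nonneg (Real.log (4 / c))]
  pow_div_tendsto_zero := by
    have h1 := (tendsto_log_mul_rpow_nhdsGT_zero (r := 2) two_pos).const_mul (-2)
    rw [mul_zero] at h1
    refine h1.congr' (eventually_mem_nhdsWithin.mono fun a ha => ?_)
    simp only [div_inv_eq_mul, one_div, Real.log_inv, Real.log_pow, Real.rpow_two]
    push_cast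
    ring

end Haldane

end

theorem corollary1 (N : ℕ) (hN : 2 ≤ N) (v : ℝ → ENNReal) (hv_meas : Measurable v)
    (hv_supp : ∃ R₀ : ℝ, ∀ r, R₀ < r → v r = 0)
    (hv_ne : ¬ ∀ᵐ x : ℂ, v ‖x‖ = 0) :
    (∀ ℓ : ℕ, 1 ≤ ℓ → ∃ lam₀ : ℝ, 0 < lam₀ ∧ ∀ lam : ℝ, 0 < lam → lam < lam₀ →
      Haldane.GroundStateTendsto v (fun a => a ^ (2 * ℓ) * lam) (Haldane.laughlin N (ℓ + 1))) ∧
    (∃ lam₀ : ℝ, 0 < lam₀ ∧ ∀ lam : ℝ, 0 < lam → lam < lam₀ →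
      Haldane.GroundStateTendsto v (fun a => (Real.log (1 / a ^ 2))⁻¹ * lam)
        (Haldane.laughlin N 1)) := by
  refine ⟨fun ℓ hℓ => ?_, ?_⟩
  · exact Haldane.exists_groundStateTendsto N hv_meas hv_supp hv_ne (Haldane.isScale_pow hℓ)
  · exact Haldane.exists_groundStateTendsto N hv_meas hv_supp hv_ne Haldane.isScale_log
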